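/- **Conventions.** Let $k$ be a field of characteristic zero. A DGLA is a $\mathbb Z$-graded vector space $\mathfrak g=\bigoplus_i\mathfrak g^i$ over $k$ with a graded Lie bracket $[\cdot,\cdot]$ of degree $0$ and a differential $\delta$ of degree $1$ which is a derivation of the bracket; it is *nilpotent* if its lower central series reaches $0$. Put $\mathrm{MC}(\mathfrak g)=\{\gamma\in\mathfrak g^1\mid \delta\gamma+\tfrac12[\gamma,\gamma]=0\}$. Let $\Omega_n$ be the commutative differential graded algebra of polynomial differential forms on the simplex $\Delta^n$, with generators $t_0,\dots,t_n,dt_0,\dots,dt_n$ and relations $\sum t_i=1$, $\sum dt_i=0$. The DGLA $\Omega_n\otimes\mathfrak g$ has the differential $\omega\otimes x\mapsto d\omega\otimes x+(-1)^{|\omega|}\omega\otimes\delta x$ and the bracket $[\omega\otimes x,\eta\otimes y]=(-1)^{|x||\eta|}\omega\eta\otimes[x,y]$. The simplicial set $\Sigma(\mathfrak g)$ is given by $\Sigma_n(\mathfrak g)=\mathrm{MC}(\Omega_n\otimes\mathfrak g)$. Let $\mathfrak g$ be a nilpotent DGLA with $\mathfrak g^i=0$ for $i\le-2$. The Deligne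 $2$-groupoid $\mathrm{MC}^2(\mathfrak g)$ has as objects the elements of $\mathrm{MC}(\mathfrak g)$; as $1$-morphisms $\gamma\to\gamma'$ the elements $\exp X\in\exp\mathfrak g^0$ with $\gamma'=\gamma-\sum_{i\ge0}\frac{(\operatorname{ad}X)^i}{(i+1)!}(\delta X+[\gamma,X])$; and as $2$-morphisms $\exp X\to\exp Y$ between $1$-morphisms with target $\gamma$ the elements $\exp_\gamma t$, $t\in\mathfrak g^{-1}$, of the unipotent group of the Lie algebra $\mathfrak g^{-1}$ with bracket $[a,b]_\gamma=[a,\delta b+[\gamma,b]]$ that satisfy $\exp(\delta t+[\gamma,t])\exp X=\exp Y$. An $n$-simplex of its simplicial nerve $\mathfrak N\mathrm{MC}^2(\mathfrak g)$ consists of objects $\mu_i$ ($0\le i\le n$), $1$-morphisms $g_{ij}\colon\mu_j\to\mu_i$ ($i<j$) and $2$-morphisms $c_{ijl}\colon g_{ij}g_{jl}\to g_{il}$ ($i<j<l$) with $c_{ijm}c_{jlm}=c_{ilm}c_{ijl}$ as $2$-morphisms $g_{ij}g_{jl}g_{lm}\to g_{im}$; structure maps are given by re-indexing (with identities for repeated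 indices). Here the product of $2$-morphisms is vertical composition, i.e. the product in $\exp_{\mu_i}\mathfrak g^{-1}$, and $c_{jlm}$ is whiskered by $g_{ij}=\exp X$, which replaces $c_{jlm}=\exp_{\mu_j}t$ by $\exp_{\mu_i}(e^{\operatorname{ad}X}t)$. **Holonomy.** For $u=\exp z$ let $(\partial u)u^{-1}=\frac{e^{\operatorname{ad}z}-1}{\operatorname{ad}z}(\partial z)$. For $\mu\in\Sigma_1(\mathfrak g)$ with one-form part $A\,dx$ ($x=t_1$) the holonomy is $P(\mu)=u(1)^{-1}$, where $u$ is the solution of $(\partial_x u)u^{-1}+A=0$, $u(0)=1$ in $\exp\mathfrak g^0$. For $\mu\in\Sigma_2(\mathfrak g)$ with value $\gamma$ at the vertex $0$, pull $\mu$ back to the square by $t_1=x_1(1-x_2)$, $t_2=x_1x_2$, and let $A_1$ be the coefficient of $dx_1$ and $\beta_{12}$ that of $dx_1dx_2$. Let $\exp z$ solve $(\partial_1\exp z)(\exp z)^{-1}+A_1=0$, $\exp z=1$ at $x_1=0$; let $Y=\int_0^{x_1}e^{-\operatorname{ad}z}\beta_{12}\,dx_1$; and let $u$ solve $(\partial_2u)u^{-1}=Y$,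 $u=1$ at $x_2=0$, in $\exp_\gamma\mathfrak g^{-1}$. The two-dimensional holonomy is $P_2(\mu)=u(1,1)$. All of these problems have to be solved in polynomials. **Integration.** For a complex $\mathfrak a$, $K(\mathfrak a[1])_n$ is the group of degree-one cocycles of the total complex of normalized cochains on $\Delta^n$ with values in $\mathfrak a$ (families $c(\sigma)\in\mathfrak a^{1-p}$, $\sigma\colon[p]\to[n]$, vanishing on non-injective $\sigma$; total differential $\sum_j(-1)^j\partial_j^*+(-1)^p\delta$). The integration map sends a closed element $\alpha\in(\Omega_n\otimes\mathfrak a)^1$ to $\sigma\mapsto\int_{\Delta^p}\sigma^*\alpha$. **Theorem.** For every field $k$ of characteristic zero the following hold. For every nilpotent DGLA $\mathfrak g$ over $k$ with $\mathfrak g^i=0$ for $i\le-2$ and all $n$, the holonomies below exist and are unique, and the maps $$\mathbb I_n\colon\Sigma_n(\mathfrak g)\to\mathfrak N_n\mathrm{MC}^2(\mathfrak g),\qquad \mu\mapsto\bigl((\mu_i)_i,\ (P(\mu_{ij}))_{i<j},\ (P_2(\mu_{ijl}))_{i<j<l}\bigr)$$ are well defined, where $\mu_i$ is the value of $\mu$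 at the vertex $i$, and $\mu_{ij}$, $\mu_{ijl}$ are the restrictions of $\mu$ to the edges and two-dimensional faces. They form a morphism of simplicial sets $\mathbb I\colon\Sigma(\mathfrak g)\to\mathfrak N\mathrm{MC}^2(\mathfrak g)$, natural in $\mathfrak g$, such that: 1. $\mathbb I_0$ is the identity under $\Sigma_0(\mathfrak g)=\mathrm{MC}(\mathfrak g)=\mathfrak N_0\mathrm{MC}^2(\mathfrak g)$. 2. For abelian $\mathfrak a$, $\Sigma_n(\mathfrak a)$ is the group of closed elements of $(\Omega_n\otimes\mathfrak a)^1$, $\mathfrak N\mathrm{MC}^2(\mathfrak a)$ is identified with $K(\mathfrak a[1])$ by $\mu_i=c(i)$, $g_{ij}=\exp c(ij)$, $c_{ijl}=\exp c(ijl)$, and $\mathbb I$ coincides with the integration map $\int\colon\Sigma(\mathfrak a)\to K(\mathfrak a[1])$, which is a morphism of simplicial groups, natural in $\mathfrak a$. 3. Let $\mathfrak a\hookrightarrow\mathfrak g$ be a central DG Lie subalgebra with quotient $\mathfrak g\to\mathfrak g/\mathfrak a$, and let $\Sigma(\mathfrak g/\mathfrak a)_0$, $\mathfrak N\mathrm{MC}^2(\mathfrak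 g/\mathfrak a)_0$ be the images of $\Sigma(\mathfrak g)$ and $\mathfrak N\mathrm{MC}^2(\mathfrak g)$. The simplicial group $\Sigma(\mathfrak a)$ acts on $\Sigma(\mathfrak g)$ by addition and $K(\mathfrak a[1])$ acts on $\mathfrak N\mathrm{MC}^2(\mathfrak g)$ by adding its values to $\mu_i$, $\log g_{ij}$, $\log c_{ijl}$. With these actions $\Sigma(\mathfrak g)\to\Sigma(\mathfrak g/\mathfrak a)_0$ and $\mathfrak N\mathrm{MC}^2(\mathfrak g)\to\mathfrak N\mathrm{MC}^2(\mathfrak g/\mathfrak a)_0$ are principal fibrations (the action is free, its orbits are the fibres, and the map is surjective in each degree), $\mathbb I(\mathfrak g/\mathfrak a)$ restricts to a map of these images, the resulting square with $\mathbb I(\mathfrak g)$ commutes, and $\mathbb I(\mathfrak g)$ is equivariant with respect to $\int\colon\Sigma(\mathfrak a)\to K(\mathfrak a[1])$; that is, the square is a morphism of principal fibrations relative to the integration map. -/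

import Mathlib

open CategoryTheory TensorProduct

universe u

set_option linter.unusedVariables false
set_option linter.unusedSectionVars false

noncomputable section

/-! ## Polynomial differential forms -/

/-- Polynomial functions on affine `m`-space. -/
abbrev AffPoly (k : Type u) [Field k] (m : ℕ) : Type u := MvPolynomial (Fin m) k

/-- Polynomial differential forms on affine `m`-space: the graded commutative algebra
`k[x₁, …, xₘ] ⊗ Λ(dx₁, …, dxₘ)`. -/
abbrev PolyForm (k : Type u) [Field k] (m : ℕ) : Type u :=
  AffPoly k m ⊗[k] ExteriorAlgebra k (Fin m → k)

namespace PolyForm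

variable {k : Type u} [Field k] {m n p : ℕ}

/-- The generator `dxⱼ` of the exterior algebra. -/
def dx (j : Fin m) : ExteriorAlgebra k (Fin m → k) := ExteriorAlgebra.ι k (Pi.single j 1)

/-- A function as a form of degree zero. -/
def ofFun (k : Type u) [Field k] (m : ℕ) : AffPoly k m →ₐ[k] PolyForm k m := Algebra.TensorProduct.includeLeft

/-- A constant coefficient form as a polynomial form. -/
def ofExt (k : Type u) [Field k] (m : ℕ) : ExteriorAlgebra k (Fin m → k) →ₐ[k] PolyForm k m :=
  Algebra.TensorProduct.includeRight

/-- The de Rham differential `d(f w) = ∑ⱼ (∂f/∂xⱼ) dxⱼ w`. -/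
def d : PolyForm k m →ₗ[k] PolyForm k m :=
  ∑ j, TensorProduct.map (MvPolynomial.pderiv j).toLinearMap (LinearMap.mulLeft k (dx j))

/-- The sign involution `ω ↦ (-1)^{|ω|} ω`. -/
def invol (k : Type u) [Field k] (m : ℕ) : PolyForm k m →ₐ[k] PolyForm k m :=
  Algebra.TensorProduct.map (AlgHom.id k _) CliffordAlgebra.involute

/-- The forms of degree `q`. -/
def ofDegree (k : Type u) [Field k] (m q : ℕ) : Submodule k (PolyForm k m) :=
  LinearMap.range (TensorProduct.map (LinearMap.id : AffPoly k m →ₗ[k] AffPoly k m)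
    (⋀[k]^q (Fin m → k)).subtype)

theorem tmul_eq (f : AffPoly k m) (w : ExteriorAlgebra k (Fin m → k)) :
    f ⊗ₜ[k] w = ofFun k _ f * ofExt k _ w := by
  simp [ofFun, ofExt]

theorem d_tmul (f : AffPoly k m) (w : ExteriorAlgebra k (Fin m → k)) :
    d (f ⊗ₜ[k] w) = ∑ j, (MvPolynomial.pderiv j f) ⊗ₜ[k] (dx j * w) := by
  simp [d, LinearMap.sum_apply]

theorem d_ofFun (f : AffPoly k m) :
    d (ofFun k _ f) = ∑ j, (MvPolynomial.pderiv j f) ⊗ₜ[k] (dx j) := by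
  simp [ofFun, d_tmul]

theorem ofFun_comm (f : AffPoly k m) (ω : PolyForm k m) : ofFun k _ f * ω = ω * ofFun k _ f := by
  induction ω using TensorProduct.induction_on with
  | zero => simp
  | tmul g w => simp [ofFun, mul_comm]
  | add x y hx hy => rw [mul_add, add_mul, hx, hy]

theorem d_ofFun_mul (f : AffPoly k m) (ω : PolyForm k m) :
    d (ofFun k _ f * ω) = d (ofFun k _ f) * ω + ofFun k _ f * d ω := by
  induction ω using TensorProduct.induction_on with
  | zero => simp
  | tmul g w =>
    rw [d_ofFun, d_tmul]
    simp only [ofFun, Algebra.TensorProduct.includeLeft_apply, Algebra.TensorProduct.tmul_mul_tmul,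
      one_mul, d_tmul, Finset.mul_sum, Finset.sum_mul, ← Finset.sum_add_distrib]
    refine Finset.sum_congr rfl fun j _ => ?_
    rw [Derivation.leibniz, TensorProduct.add_tmul, smul_eq_mul, smul_eq_mul, add_comm,
      mul_comm g]
  | add x y hx hy => rw [mul_add, map_add, hx, hy, map_add, mul_add, mul_add]; abel

theorem dx_anticomm (i j : Fin m) : (dx i * dx j : ExteriorAlgebra k (Fin m → k)) = -(dx j * dx i) :=
  eq_neg_of_add_eq_zero_left (ExteriorAlgebra.ι_add_mul_swap _ _)

theorem sum_symm_eq_zero (c : Fin m → Fin m → AffPoly k m) (hc : ∀ i j, c i j = c j i)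
    (w : ExteriorAlgebra k (Fin m → k)) :
    ∑ i, ∑ j, c i j ⊗ₜ[k] (dx i * (dx j * w)) = 0 := by
  rw [← Finset.sum_product', Finset.univ_product_univ]
  refine Finset.sum_involution (fun x _ => (x.2, x.1)) ?_ ?_ (fun _ _ => Finset.mem_univ _)
    (fun _ _ => rfl)
  · rintro ⟨i, j⟩ -
    simp only
    rw [hc j i, ← TensorProduct.tmul_add, ← mul_assoc, ← mul_assoc, ← add_mul, dx_anticomm i j,
      neg_add_cancel, zero_mul, TensorProduct.tmul_zero]
  · rintro ⟨i, j⟩ - h1 h2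
    simp only [Prod.mk.injEq] at h2
    apply h1
    obtain ⟨rfl, -⟩ := h2
    simp only
    rw [← mul_assoc, dx, ExteriorAlgebra.ι_sq_zero, zero_mul, TensorProduct.tmul_zero]

theorem pderiv_comm (i j : Fin m) (f : AffPoly k m) :
    MvPolynomial.pderiv i (MvPolynomial.pderiv j f)
      = MvPolynomial.pderiv j (MvPolynomial.pderiv i f) := by
  induction f using MvPolynomial.induction_on with
  | C a => simp
  | add p q hp hq => simp [hp, hq]
  | mul_X p l hp =>
    simp only [MvPolynomial.pderiv_mul, map_add, hp, MvPolynomial.pderiv_X]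
    rcases eq_or_ne l i with rfl | hi <;> rcases eq_or_ne l j with rfl | hj <;>
      simp_all

theorem d_d_ofFun_mul (f : AffPoly k m) (ω : PolyForm k m) :
    d (d (ofFun k _ f) * ω) = -(d (ofFun k _ f) * d ω) := by
  induction ω using TensorProduct.induction_on with
  | zero => simp
  | tmul g w =>
    have key := sum_symm_eq_zero
      (fun i j => MvPolynomial.pderiv i (MvPolynomial.pderiv j f) * g)
      (fun i j => by rw [pderiv_comm]) w
    rw [d_ofFun, d_tmul, Finset.sum_mul, map_sum]
    simp only [Algebra.TensorProduct.tmul_mul_tmul, d_tmul, Finset.sum_mul, Finset.mul_sum,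
      MvPolynomial.pderiv_mul, TensorProduct.add_tmul, Finset.sum_add_distrib]
    rw [Finset.sum_comm, key, zero_add, Finset.sum_comm, ← Finset.sum_neg_distrib]
    refine Finset.sum_congr rfl fun j _ => ?_
    rw [← Finset.sum_neg_distrib]
    refine Finset.sum_congr rfl fun i _ => ?_
    rw [← mul_assoc, ← mul_assoc, dx_anticomm j i, neg_mul, TensorProduct.tmul_neg]
  | add x y hx hy => rw [mul_add, map_add, hx, hy, map_add, mul_add]; abel

/-- The square of an exact one-form vanishes. -/
theorem d_ofFun_sq (f : AffPoly k m) : d (ofFun k _ f) * d (ofFun k _ f) = 0 := by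
  have key := sum_symm_eq_zero
    (fun i j => MvPolynomial.pderiv i f * MvPolynomial.pderiv j f) (fun i j => mul_comm _ _) 1
  rw [d_ofFun, Finset.sum_mul]
  simpa [Finset.mul_sum] using key

/-- The pullback of polynomial forms along the polynomial map `(φ₁, …, φₙ)`: the algebra map
with `xᵢ ↦ φᵢ` and `dxᵢ ↦ dφᵢ`. -/
def pull (φ : Fin n → AffPoly k m) : PolyForm k n →ₐ[k] PolyForm k m :=
  Algebra.TensorProduct.lift ((ofFun k m).comp (MvPolynomial.aeval φ))
    (ExteriorAlgebra.lift k
      ⟨∑ i, (LinearMap.proj i : (Fin n → k) →ₗ[k] k).smulRight (d (ofFun k _ (φ i))), fun v => by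
        have h : (∑ i, (LinearMap.proj i : (Fin n → k) →ₗ[k] k).smulRight (d (ofFun k _ (φ i)))) v
            = d (ofFun k _ (∑ i, v i • φ i)) := by
          simp [LinearMap.sum_apply]
        rw [h, d_ofFun_sq]⟩)
    (fun x y => ofFun_comm _ _)

theorem pull_ofFun (φ : Fin n → AffPoly k m) (f : AffPoly k n) :
    pull φ (ofFun k _ f) = ofFun k _ (MvPolynomial.aeval φ f) := by
  simp [pull, ofFun]

theorem pull_ofExt_dx (φ : Fin n → AffPoly k m) (i : Fin n) :
    pull φ (ofExt k _ (dx i)) = d (ofFun k _ (φ i)) := by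
  simp [pull, ofExt, dx, LinearMap.sum_apply, Pi.single_apply]

theorem pull_ofExt_ι (φ : Fin n → AffPoly k m) (v : Fin n → k) :
    pull φ (ofExt k _ (ExteriorAlgebra.ι k v)) = d (ofFun k _ (∑ i, v i • φ i)) := by
  simp [pull, ofExt, LinearMap.sum_apply]

theorem pull_d_ofFun (φ : Fin n → AffPoly k m) (f : AffPoly k n) :
    pull φ (d (ofFun k _ f)) = d (ofFun k _ (MvPolynomial.aeval φ f)) := by
  induction f using MvPolynomial.induction_on with
  | C a =>
    rw [d_ofFun]
    simp [ofFun, d_tmul, MvPolynomial.algebraMap_eq]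
  | add p q hp hq => simp only [map_add, hp, hq]
  | mul_X p l hp =>
    have hX : pull φ (d (ofFun k _ (MvPolynomial.X l))) = d (ofFun k _ (φ l)) := by
      rw [d_ofFun, Finset.sum_eq_single l]
      · have : (1 : AffPoly k n) ⊗ₜ[k] (dx l : ExteriorAlgebra k (Fin n → k)) = ofExt k _ (dx l) := rfl
        rw [MvPolynomial.pderiv_X_self, this, pull_ofExt_dx]
      · intro b _ hb
        rw [MvPolynomial.pderiv_X_of_ne hb.symm, TensorProduct.zero_tmul]
      · simp
    rw [map_mul, d_ofFun_mul, map_add, map_mul, map_mul, hp, hX, pull_ofFun, pull_ofFun,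
      map_mul, map_mul, d_ofFun_mul, MvPolynomial.aeval_X]

theorem d_pull_ofExt (φ : Fin n → AffPoly k m) (w : ExteriorAlgebra k (Fin n → k)) :
    d (pull φ (ofExt k _ w)) = 0 := by
  induction w using CliffordAlgebra.left_induction with
  | algebraMap r =>
    rw [AlgHom.commutes, AlgHom.commutes, ← AlgHom.commutes (ofFun k m), d_ofFun]
    simp [MvPolynomial.algebraMap_eq]
  | add x y hx hy => rw [map_add, map_add, map_add, hx, hy, add_zero]
  | ι_mul x v hx =>
    have h := pull_ofExt_ι φ v
    rw [map_mul, map_mul]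
    erw [h]
    rw [d_d_ofFun_mul, hx, mul_zero, neg_zero]

theorem pull_d (φ : Fin n → AffPoly k m) (ω : PolyForm k n) : pull φ (d ω) = d (pull φ ω) := by
  induction ω using TensorProduct.induction_on with
  | zero => simp
  | tmul f w =>
    have h : d (ofExt k _ w : PolyForm k n) = 0 := by
      simp [ofExt, d_tmul]
    rw [tmul_eq, d_ofFun_mul, h, mul_zero, add_zero, map_mul, map_mul, pull_ofFun, d_ofFun_mul,
      d_pull_ofExt, mul_zero, add_zero, pull_d_ofFun]
  | add x y hx hy => simp only [map_add, hx, hy]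

theorem algHom_ext {A : Type u} [Semiring A] [Algebra k A] {F G : PolyForm k n →ₐ[k] A}
    (h : ∀ i, F (ofFun k _ (MvPolynomial.X i)) = G (ofFun k _ (MvPolynomial.X i)))
    (h' : ∀ i, F (ofExt k _ (dx i)) = G (ofExt k _ (dx i))) : F = G := by
  refine Algebra.TensorProduct.ext (MvPolynomial.algHom_ext fun i => h i) ?_
  refine ExteriorAlgebra.hom_ext (LinearMap.pi_ext' fun i => LinearMap.ext_ring ?_)
  exact h' i

theorem d_ofFun_X (i : Fin n) : d (ofFun k _ (MvPolynomial.X i : AffPoly k n)) = ofExt k _ (dx i) := by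
  rw [d_ofFun, Finset.sum_eq_single i]
  · rw [MvPolynomial.pderiv_X_self]; rfl
  · intro b _ hb
    rw [MvPolynomial.pderiv_X_of_ne hb.symm, TensorProduct.zero_tmul]
  · simp

theorem pull_X : pull (fun i => (MvPolynomial.X i : AffPoly k n)) = AlgHom.id k _ := by
  refine algHom_ext (fun i => ?_) (fun i => ?_)
  · rw [pull_ofFun]; simp
  · rw [pull_ofExt_dx, d_ofFun_X]; rfl

theorem pull_comp (ψ : Fin n → AffPoly k m) (φ : Fin p → AffPoly k n) :
    (pull ψ).comp (pull φ) = pull (fun i => MvPolynomial.aeval ψ (φ i)) := by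
  refine algHom_ext (fun i => ?_) (fun i => ?_)
  · simp only [AlgHom.comp_apply, pull_ofFun, MvPolynomial.aeval_X]
  · simp only [AlgHom.comp_apply, pull_ofExt_dx, pull_d_ofFun]

theorem invol_d_ofFun (f : AffPoly k n) : invol k _ (d (ofFun k _ f)) = -d (ofFun k _ f) := by
  rw [d_ofFun, map_sum, ← Finset.sum_neg_distrib]
  refine Finset.sum_congr rfl fun j _ => ?_
  simp [invol, dx, CliffordAlgebra.involute_ι, TensorProduct.tmul_neg, ExteriorAlgebra.ι]

theorem invol_ofFun (f : AffPoly k n) : invol k _ (ofFun k _ f) = ofFun k _ f := by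
  simp [invol, ofFun]

theorem pull_invol (φ : Fin n → AffPoly k m) (ω : PolyForm k n) :
    pull φ (invol k _ ω) = invol k _ (pull φ ω) := by
  have : (pull φ).comp (invol k n) = (invol k m).comp (pull φ) := by
    refine algHom_ext (fun i => ?_) (fun i => ?_)
    · simp only [AlgHom.comp_apply, invol_ofFun, pull_ofFun]
    · rw [AlgHom.comp_apply, AlgHom.comp_apply, pull_ofExt_dx, ← d_ofFun_X, invol_d_ofFun, map_neg,
        pull_d_ofFun, MvPolynomial.aeval_X, invol_d_ofFun]
  exact DFunLike.congr_fun this ω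

theorem ofFun_mul_mem {q : ℕ} (f : AffPoly k m) {ω : PolyForm k m} (hω : ω ∈ ofDegree k m q) :
    ofFun k _ f * ω ∈ ofDegree k m q := by
  obtain ⟨t, rfl⟩ := hω
  induction t using TensorProduct.induction_on with
  | zero => simp
  | tmul g w => exact ⟨(f * g) ⊗ₜ w, by simp [ofFun]⟩
  | add x y hx hy => rw [map_add, mul_add]; exact add_mem hx hy

theorem d_ofFun_mul_mem {q : ℕ} (f : AffPoly k m) {ω : PolyForm k m} (hω : ω ∈ ofDegree k m q) :
    d (ofFun k _ f) * ω ∈ ofDegree k m (q + 1) := by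
  obtain ⟨t, rfl⟩ := hω
  induction t using TensorProduct.induction_on with
  | zero => simp
  | tmul g w =>
    rw [d_ofFun, Finset.sum_mul]
    refine sum_mem fun j _ => ⟨(MvPolynomial.pderiv j f * g) ⊗ₜ ⟨dx j * (w : ExteriorAlgebra k (Fin m → k)), ?_⟩,
      by simp⟩
    rw [ExteriorAlgebra.exteriorPower, pow_succ']
    exact Submodule.mul_mem_mul (LinearMap.mem_range_self _ _) w.2
  | add x y hx hy => rw [map_add, mul_add]; exact add_mem hx hy

theorem pull_ofExt_mem (φ : Fin n → AffPoly k m) {q : ℕ} {w : ExteriorAlgebra k (Fin n → k)}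
    (hw : w ∈ ⋀[k]^q (Fin n → k)) : pull φ (ofExt k _ w) ∈ ofDegree k m q := by
  induction q generalizing w with
  | zero =>
    rw [ExteriorAlgebra.exteriorPower, pow_zero, Submodule.mem_one] at hw
    obtain ⟨r, rfl⟩ := hw
    rw [AlgHom.commutes, AlgHom.commutes]
    exact ⟨(algebraMap k _ r) ⊗ₜ ⟨1, by rw [ExteriorAlgebra.exteriorPower, pow_zero]; exact Submodule.one_le.mp le_rfl⟩,
      by simp [Algebra.TensorProduct.algebraMap_apply]⟩
  | succ q ih =>
    rw [ExteriorAlgebra.exteriorPower, pow_succ'] at hw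
    induction hw using Submodule.mul_induction_on' with
    | mem_mul_mem x hx y hy =>
      obtain ⟨v, rfl⟩ := hx
      rw [map_mul, map_mul, pull_ofExt_ι]
      exact d_ofFun_mul_mem _ (ih hy)
    | add x _ y _ hx hy => rw [map_add, map_add]; exact add_mem hx hy

theorem pull_mem (φ : Fin n → AffPoly k m) {q : ℕ} {ω : PolyForm k n}
    (hω : ω ∈ ofDegree k n q) : pull φ ω ∈ ofDegree k m q := by
  obtain ⟨t, rfl⟩ := hω
  induction t using TensorProduct.induction_on with
  | zero => simp
  | tmul g w =>
    rw [TensorProduct.map_tmul, tmul_eq, map_mul, pull_ofFun]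
    exact ofFun_mul_mem _ (pull_ofExt_mem φ w.2)
  | add x y hx hy => rw [map_add, map_add]; exact add_mem hx hy

/-! ### Coefficients and integration -/

/-- The degree zero part of a form, as a function. -/
def funPart : PolyForm k m →ₗ[k] AffPoly k m :=
  (TensorProduct.rid k (AffPoly k m)).toLinearMap ∘ₗ
    TensorProduct.map LinearMap.id ExteriorAlgebra.algebraMapInv.toLinearMap

/-- Contraction of a form with the vector field `∂/∂xⱼ`. -/
def contract (j : Fin m) : PolyForm k m →ₗ[k] PolyForm k m :=
  TensorProduct.map LinearMap.id
    (CliffordAlgebra.contractLeft (Q := (0 : QuadraticForm k (Fin m → k)))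
      (LinearMap.proj j : (Fin m → k) →ₗ[k] k))

/-- The coefficient of `dxⱼ`. -/
def coeff₁ (j : Fin m) : PolyForm k m →ₗ[k] AffPoly k m := funPart ∘ₗ contract j

/-- The value on `(∂/∂xᵢ, ∂/∂xⱼ)` of the degree two part, i.e. the coefficient of `dxᵢ dxⱼ`
for `i < j`. -/
def coeff₂ (i j : Fin m) : PolyForm k m →ₗ[k] AffPoly k m := funPart ∘ₗ contract j ∘ₗ contract i

/-- The coefficient of the volume form `dx₁ ⋯ dxₘ`. -/
def coeffTop (m : ℕ) : PolyForm k m →ₗ[k] AffPoly k m :=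
  funPart ∘ₗ (List.finRange m).foldl (fun T j => contract j ∘ₗ T) LinearMap.id

/-- The integral of a polynomial over the standard simplex
`{x₁, …, xₘ ≥ 0, x₁ + ⋯ + xₘ ≤ 1}` with respect to `dx₁ ⋯ dxₘ`, determined by the formula
`∫ x₁^{a₁} ⋯ xₘ^{aₘ} = a₁! ⋯ aₘ! / (m + a₁ + ⋯ + aₘ)!`. -/
def simplexIntegral (m : ℕ) : AffPoly k m →ₗ[k] k :=
  (MvPolynomial.basisMonomials (Fin m) k).constr k fun a =>
    (∏ i, ((a i).factorial : k)) / ((m + ∑ i, a i).factorial : k)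

/-! ### The simplicial structure -/

/-- The barycentric coordinates `t₀ = 1 - (x₁ + ⋯ + xₘ)` and `tᵢ = xᵢ` on the `m`-simplex. -/
def bary (k : Type u) [Field k] (m : ℕ) : Fin (m + 1) → AffPoly k m :=
  Fin.cons (1 - ∑ i, MvPolynomial.X i) MvPolynomial.X

/-- The coordinates of the affine map of simplices induced by `f : [m] → [n]`, namely
`tᵢ ↦ ∑_{f j = i} tⱼ` for `i = 1, …, n`. -/
def simplexMap (k : Type u) [Field k] (f : Fin (m + 1) → Fin (n + 1)) (i : Fin n) : AffPoly k m :=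
  ∑ j with f j = i.succ, bary k m j

theorem sum_bary : ∑ i, bary k m i = 1 := by
  rw [Fin.sum_univ_succ]; simp [bary]

theorem aeval_bary (f : Fin (m + 1) → Fin (n + 1)) (i : Fin (n + 1)) :
    MvPolynomial.aeval (simplexMap k f) (bary k n i) = ∑ j with f j = i, bary k m j := by
  refine Fin.cases ?_ (fun i => ?_) i
  · have h : ∑ i : Fin (n + 1), ∑ j with f j = i, bary k m j = 1 := by
      rw [Finset.sum_fiberwise, sum_bary]
    rw [Fin.sum_univ_succ] at h
    simp only [bary, Fin.cons_zero, map_sub, map_one, map_sum, MvPolynomial.aeval_X]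
    rw [sub_eq_iff_eq_add]
    exact h.symm
  · simp [bary, simplexMap]

theorem simplexMap_id : simplexMap k (id : Fin (m + 1) → Fin (m + 1)) = MvPolynomial.X := by
  funext i
  simp [simplexMap, bary, Finset.filter_eq']

theorem simplexMap_comp (f : Fin (m + 1) → Fin (n + 1)) (g : Fin (n + 1) → Fin (p + 1)) :
    (fun i => MvPolynomial.aeval (simplexMap k f) (simplexMap k g i)) = simplexMap k (g ∘ f) := by
  funext i
  rw [simplexMap, map_sum]
  simp_rw [aeval_bary]
  rw [simplexMap, ← Finset.sum_fiberwise_of_maps_to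
    (s := Finset.univ.filter fun j => (g ∘ f) j = i.succ)
    (t := Finset.univ.filter fun j => g j = i.succ) (g := f) (by simp)]
  refine Finset.sum_congr rfl fun j hj => Finset.sum_congr ?_ fun _ _ => rfl
  ext l
  simp only [Finset.mem_filter, Finset.mem_univ, true_and, Function.comp] at hj ⊢
  exact ⟨fun h => ⟨by rw [h, hj], h⟩, fun h => h.2⟩

end PolyForm

/-! ## Exponentials and the Baker–Campbell–Hausdorff product -/

section Series

variable {k : Type u} [Field k] {V W : Type u} [AddCommGroup V] [Module k V]
  [AddCommGroup W] [Module k W]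

/-- `exp(ad x)(v) = ∑ᵢ (ad x)ⁱ(v) / i!`, where `ad x = br x`. -/
def expAd (br : V →ₗ[k] V →ₗ[k] V) (x v : V) : V :=
  ∑ᶠ i : ℕ, ((i.factorial : k)⁻¹) • ((br x) ^ i) v

/-- `((exp(ad x) - 1) / ad x)(v) = ∑ᵢ (ad x)ⁱ(v) / (i + 1)!`, where `ad x = br x`. -/
def phiAd (br : V →ₗ[k] V →ₗ[k] V) (x v : V) : V :=
  ∑ᶠ i : ℕ, (((i + 1).factorial : k)⁻¹) • ((br x) ^ i) v

/-- The right nested bracket `[x₁, [x₂, … [x_{n-1}, xₙ] … ]]`. -/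
def nestedBracket (br : V →ₗ[k] V →ₗ[k] V) : List V → V
  | [] => 0
  | [x] => x
  | x :: y :: l => br x (nestedBracket br (y :: l))

/-- The word `x^{r₁} y^{s₁} ⋯ x^{rₙ} y^{sₙ}` attached to `((r₁, s₁), …, (rₙ, sₙ))`. -/
def bchWord (x y : V) (l : List (ℕ × ℕ)) : List V :=
  l.flatMap fun p => List.replicate p.1 x ++ List.replicate p.2 y

open Classical in
/-- The term of the Baker–Campbell–Hausdorff series in Dynkin's form with index
`((r₁, s₁), …, (rₙ, sₙ))`, `n ≥ 1`, `rᵢ + sᵢ > 0`. -/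
def bchTerm (br : V →ₗ[k] V →ₗ[k] V) (x y : V) (l : List (ℕ × ℕ)) : V :=
  if l ≠ [] ∧ ∀ p ∈ l, 0 < p.1 + p.2 then
    (((-1 : k) ^ (l.length - 1) / (l.length : k)) *
      (((l.map fun p => p.1 + p.2).sum : ℕ) : k)⁻¹ *
      ((l.map fun p => ((p.1.factorial : k) * (p.2.factorial : k))⁻¹).prod)) •
      nestedBracket br (bchWord x y l)
  else 0

/-- The Baker–Campbell–Hausdorff product `log(exp x · exp y)` for the Lie bracket `br`, by Dynkin's
formula. The sum is finite when `br` is nilpotent. -/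
def bch (br : V →ₗ[k] V →ₗ[k] V) (x y : V) : V := ∑ᶠ l : List (ℕ × ℕ), bchTerm br x y l

/-- A bilinear operation all of whose nested brackets with `N + 1` or more entries vanish. -/
def NilpBracket (br : V →ₗ[k] V →ₗ[k] V) (N : ℕ) : Prop :=
  ∃ F : ℕ → Submodule k V, (∀ x i, ∀ y ∈ F i, br x y ∈ F (i + 1)) ∧ F 0 = ⊤ ∧ F N = ⊥

theorem NilpBracket.pow_eq_zero {br : V →ₗ[k] V →ₗ[k] V} {N : ℕ} (h : NilpBracket br N) (x v : V)
    {i : ℕ} (hi : N ≤ i) : ((br x) ^ i) v = 0 := by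
  obtain ⟨F, hF, h0, hN⟩ := h
  have key : ∀ (i : ℕ) (v : V), ((br x) ^ i) v ∈ F i := by
    intro i
    induction i with
    | zero => intro v; rw [h0]; trivial
    | succ i ih => intro v; rw [pow_succ']; exact hF _ _ _ (ih v)
  obtain ⟨j, rfl⟩ := Nat.exists_eq_add_of_le hi
  rw [pow_add]
  have := key N (((br x) ^ j) v)
  rw [hN] at this
  exact this

theorem NilpBracket.nested_eq_zero {br : V →ₗ[k] V →ₗ[k] V} {N : ℕ} (h : NilpBracket br N)
    (w : List V) (hw : N < w.length) : nestedBracket br w = 0 := by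
  obtain ⟨F, hF, h0, hN⟩ := h
  have key : ∀ (i : ℕ) (w : List V), i < w.length → nestedBracket br w ∈ F i := by
    intro i
    induction i with
    | zero => intro w _; rw [h0]; trivial
    | succ i ih =>
      intro w hw
      match w, hw with
      | x :: y :: l, hw =>
        exact hF _ _ _ (ih (y :: l) (by simpa using hw))
  have := key N w hw
  rw [hN] at this
  exact this

theorem length_bchWord (x y : V) (l : List (ℕ × ℕ)) :
    (bchWord x y l).length = (l.map fun p => p.1 + p.2).sum := by
  induction l with
  | nil => rfl
  | cons p l ih =>
    have : bchWord x y (p :: l)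
        = (List.replicate p.1 x ++ List.replicate p.2 y) ++ bchWord x y l := rfl
    rw [this, List.length_append, ih]
    simp

theorem bchIndex_finite (N : ℕ) :
    {l : List (ℕ × ℕ) | (∀ p ∈ l, 0 < p.1 + p.2) ∧ (l.map fun p => p.1 + p.2).sum ≤ N}.Finite := by
  refine ((List.finite_length_le (Fin (N + 1) × Fin (N + 1)) N).image
    (List.map fun p => ((p.1 : ℕ), (p.2 : ℕ)))).subset ?_
  rintro l ⟨hpos, hsum⟩
  have hle : ∀ p ∈ l, p.1 + p.2 ≤ N := fun p hp =>
    (List.single_le_sum (by simp) _ (List.mem_map_of_mem hp)).trans hsum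
  have hlen : l.length ≤ N := by
    refine le_trans ?_ hsum
    have := List.length_le_sum_of_one_le (l.map fun p => p.1 + p.2) (by
      intro i hi
      obtain ⟨p, hp, rfl⟩ := List.mem_map.1 hi
      exact hpos p hp)
    simpa using this
  refine ⟨l.map fun p => (Fin.ofNat (N + 1) p.1, Fin.ofNat (N + 1) p.2), by simpa using hlen, ?_⟩
  rw [List.map_map]
  conv_rhs => rw [← List.map_id l]
  refine List.map_congr_left fun p hp => ?_
  have := hle p hp
  ext
  · simp [Nat.mod_eq_of_lt (show p.1 < N + 1 by omega)]
  · simp [Nat.mod_eq_of_lt (show p.2 < N + 1 by omega)]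

theorem NilpBracket.bchTerm_finite {br : V →ₗ[k] V →ₗ[k] V} {N : ℕ} (h : NilpBracket br N)
    (x y : V) : (Function.support (bchTerm br x y)).Finite := by
  refine (bchIndex_finite N).subset fun l hl => ?_
  rw [Function.mem_support, bchTerm] at hl
  split_ifs at hl with hc
  · refine ⟨hc.2, ?_⟩
    by_contra hlt
    rw [not_le, ← length_bchWord x y] at hlt
    exact hl (by rw [h.nested_eq_zero _ hlt, smul_zero])
  · exact absurd rfl hl

variable {br : V →ₗ[k] V →ₗ[k] V} {br' : W →ₗ[k] W →ₗ[k] W} (f : V →ₗ[k] W)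

theorem map_pow_ad (hf : ∀ x y, f (br x y) = br' (f x) (f y)) (x v : V) (i : ℕ) :
    f (((br x) ^ i) v) = ((br' (f x)) ^ i) (f v) := by
  induction i generalizing v with
  | zero => rfl
  | succ i ih => rw [pow_succ, pow_succ, Module.End.mul_apply, Module.End.mul_apply, ih, hf]

theorem NilpBracket.map_expAd {N : ℕ} (h : NilpBracket br N)
    (hf : ∀ x y, f (br x y) = br' (f x) (f y)) (x v : V) :
    f (expAd br x v) = expAd br' (f x) (f v) := by
  rw [expAd, map_finsum]
  · simp_rw [map_smul, map_pow_ad f hf]; rfl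
  · refine (Finset.finite_toSet (Finset.range N)).subset fun i hi => ?_
    by_contra hlt
    simp only [Finset.coe_range, Set.mem_Iio, not_lt] at hlt
    exact hi (by simp only [h.pow_eq_zero x v hlt, smul_zero])

theorem NilpBracket.map_phiAd {N : ℕ} (h : NilpBracket br N)
    (hf : ∀ x y, f (br x y) = br' (f x) (f y)) (x v : V) :
    f (phiAd br x v) = phiAd br' (f x) (f v) := by
  rw [phiAd, map_finsum]
  · simp_rw [map_smul, map_pow_ad f hf]; rfl
  · refine (Finset.finite_toSet (Finset.range N)).subset fun i hi => ?_
    by_contra hlt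
    simp only [Finset.coe_range, Set.mem_Iio, not_lt] at hlt
    exact hi (by simp only [h.pow_eq_zero x v hlt, smul_zero])

theorem map_nestedBracket (hf : ∀ x y, f (br x y) = br' (f x) (f y)) (w : List V) :
    f (nestedBracket br w) = nestedBracket br' (w.map f) := by
  match w with
  | [] => exact map_zero f
  | [_] => rfl
  | x :: y :: l =>
    have := map_nestedBracket hf (y :: l)
    simp only [nestedBracket, List.map_cons, hf] at this ⊢
    rw [this]

theorem map_bchWord (x y : V) (l : List (ℕ × ℕ)) :
    (bchWord x y l).map f = bchWord (f x) (f y) l := by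
  simp [bchWord, List.map_flatMap]

theorem NilpBracket.map_bch {N : ℕ} (h : NilpBracket br N)
    (hf : ∀ x y, f (br x y) = br' (f x) (f y)) (x y : V) :
    f (bch br x y) = bch br' (f x) (f y) := by
  rw [bch, map_finsum f (h.bchTerm_finite x y), bch]
  refine finsum_congr fun l => ?_
  rw [bchTerm, bchTerm]
  split_ifs
  · rw [map_smul, map_nestedBracket f hf, map_bchWord]
  · exact map_zero f

end Series

/-! ## Differential graded Lie algebras -/

/-- A differential graded Lie algebra over `k`, with cohomological grading: the underlying vector
space is the internal direct sum of the subspaces `deg i`, `i ∈ ℤ`. -/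
structure DGLA (k : Type u) [Field k] where
  /-- The underlying vector space. -/
  carrier : Type u
  [addCommGroup : AddCommGroup carrier]
  [module : Module k carrier]
  /-- The homogeneous component of degree `i`. -/
  deg : ℤ → Submodule k carrier
  isInternal : DirectSum.IsInternal deg
  /-- The graded Lie bracket. -/
  bracket : carrier →ₗ[k] carrier →ₗ[k] carrier
  /-- The differential. -/
  diff : carrier →ₗ[k] carrier
  bracket_mem : ∀ {i j : ℤ} {x y : carrier}, x ∈ deg i → y ∈ deg j → bracket x y ∈ deg (i + j)
  diff_mem : ∀ {i : ℤ} {x : carrier}, x ∈ deg i → diff x ∈ deg (i + 1)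
  skew : ∀ {i j : ℤ} {x y : carrier}, x ∈ deg i → y ∈ deg j →
    bracket x y = -((i * j).negOnePow • bracket y x)
  jacobi : ∀ {i j : ℤ} {x y : carrier} (z : carrier), x ∈ deg i → y ∈ deg j →
    bracket x (bracket y z) = bracket (bracket x y) z + (i * j).negOnePow • bracket y (bracket x z)
  leibniz : ∀ {i : ℤ} {x : carrier} (y : carrier), x ∈ deg i →
    diff (bracket x y) = bracket (diff x) y + i.negOnePow • bracket x (diff y)
  diff_diff : ∀ x, diff (diff x) = 0

/-- `x` is a Maurer–Cartan element: it lies in the degree one part `V₁` and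
`D x + ½ [x, x] = 0`. -/
def IsMaurerCartan {k : Type u} [Field k] {V : Type u} [AddCommGroup V] [Module k V]
    (V₁ : Submodule k V) (D : V →ₗ[k] V) (br : V →ₗ[k] V →ₗ[k] V) (x : V) : Prop :=
  x ∈ V₁ ∧ D x + (2 : k)⁻¹ • br x x = 0

namespace DGLA

variable {k : Type u} [Field k]

instance (G : DGLA k) : AddCommGroup G.carrier := G.addCommGroup
instance (G : DGLA k) : Module k G.carrier := G.module

variable (G : DGLA k)

/-- The projection to the sum of the components of even degree. -/
def evenPart : G.carrier →ₗ[k] G.carrier :=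
  DirectSum.toModule k ℤ G.carrier (fun i => if Even i then (G.deg i).subtype else 0) ∘ₗ
    (LinearEquiv.ofBijective (DirectSum.coeLinearMap G.deg) G.isInternal).symm.toLinearMap

/-- The projection to the sum of the components of odd degree. -/
def oddPart : G.carrier →ₗ[k] G.carrier := LinearMap.id - G.evenPart

variable {G} in
theorem evenPart_of_mem {i : ℤ} {x : G.carrier} (hx : x ∈ G.deg i) :
    G.evenPart x = if Even i then x else 0 := by
  have h : (LinearEquiv.ofBijective (DirectSum.coeLinearMap G.deg) G.isInternal).symm x
      = DirectSum.lof k ℤ (fun i => G.deg i) i ⟨x, hx⟩ := by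
    rw [LinearEquiv.symm_apply_eq]
    exact (DirectSum.coeLinearMap_lof G.deg i ⟨x, hx⟩).symm
  simp only [evenPart, LinearMap.comp_apply, LinearEquiv.coe_coe, h, DirectSum.toModule_lof]
  split_ifs <;> rfl

variable {G} in
theorem hom_induction {P : G.carrier → Prop} (x : G.carrier) (h0 : P 0)
    (hadd : ∀ x y, P x → P y → P (x + y)) (hmem : ∀ i, ∀ x ∈ G.deg i, P x) : P x := by
  have hx : x ∈ ⨆ i, G.deg i := by
    rw [G.isInternal.submodule_iSup_eq_top]; trivial
  exact Submodule.iSup_induction G.deg (motive := P) hx hmem h0 hadd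

/-- The lower central series: `C⁰ = 𝔤` and `Cⁱ⁺¹ = [𝔤, Cⁱ]`. -/
def lowerCentral : ℕ → Submodule k G.carrier
  | 0 => ⊤
  | i + 1 => Submodule.map₂ G.bracket ⊤ (lowerCentral i)

/-- A DGLA is nilpotent if its lower central series reaches zero. -/
def IsNilpotent : Prop := ∃ N, G.lowerCentral N = ⊥

/-- The Maurer–Cartan elements of a DGLA. -/
def IsMC (γ : G.carrier) : Prop := IsMaurerCartan (G.deg 1) G.diff G.bracket γ

/-! ### The Deligne 2-groupoid -/

/-- The gauge action `(exp X) · γ = γ - ∑ᵢ (ad X)ⁱ (δX + [γ, X]) / (i + 1)!`. -/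
def gauge (X γ : G.carrier) : G.carrier :=
  γ - phiAd G.bracket X (G.diff X + G.bracket γ X)

/-- The bracket `[a, b]_γ = [a, δb + [γ, b]]`, a Lie bracket on the component of degree `-1`. -/
def twistedBracket (γ : G.carrier) : G.carrier →ₗ[k] G.carrier →ₗ[k] G.carrier :=
  G.bracket.compl₂ (G.diff + G.bracket γ)

/-- `exp X`, for `X` of degree zero, is a 1-morphism `γ → γ'`. Composition of 1-morphisms is the
Baker–Campbell–Hausdorff product `bch G.bracket`. -/
def IsOneMor (X γ γ' : G.carrier) : Prop := X ∈ G.deg 0 ∧ G.gauge X γ = γ'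

/-- `exp_γ t`, for `t` of degree `-1`, is a 2-morphism from `exp X` to `exp Y`, where `exp X` and
`exp Y` have target `γ`: one has `exp(δt + [γ, t]) exp X = exp Y`. Vertical composition of
2-morphisms is the Baker–Campbell–Hausdorff product of the bracket `[·, ·]_γ`. -/
def IsTwoMor (γ t X Y : G.carrier) : Prop :=
  t ∈ G.deg (-1) ∧ bch G.bracket (G.diff t + G.bracket γ t) X = Y

/-! ### Tensor product with polynomial forms -/

/-- The vector space `Ω ⊗ 𝔤` of `𝔤`-valued polynomial forms on affine `m`-space. -/
abbrev Forms (m : ℕ) : Type u := PolyForm k m ⊗[k] G.carrier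

/-- The differential of `Ω ⊗ 𝔤`: `ω ⊗ x ↦ dω ⊗ x + (-1)^{|ω|} ω ⊗ δx`. -/
def formsDiff (m : ℕ) : G.Forms m →ₗ[k] G.Forms m :=
  TensorProduct.map PolyForm.d LinearMap.id +
    TensorProduct.map (PolyForm.invol k m).toLinearMap G.diff

/-- The bracket of `Ω ⊗ 𝔤`: `[ω ⊗ x, η ⊗ y] = (-1)^{|x| |η|} ω η ⊗ [x, y]`. -/
def formsBracket (m : ℕ) : G.Forms m →ₗ[k] G.Forms m →ₗ[k] G.Forms m :=
  TensorProduct.map₂ (LinearMap.mul k (PolyForm k m)) (G.bracket ∘ₗ G.evenPart) +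
    TensorProduct.map₂ ((LinearMap.mul k (PolyForm k m)).compl₂ (PolyForm.invol k m).toLinearMap)
      (G.bracket ∘ₗ G.oddPart)

/-- The degree one part of `Ω ⊗ 𝔤`, the sum of the `Ω^q ⊗ 𝔤^{1-q}`. -/
def formsDegOne (m : ℕ) : Submodule k (G.Forms m) :=
  ⨆ q : ℕ, LinearMap.range
    (TensorProduct.map (PolyForm.ofDegree k m q).subtype (G.deg (1 - q)).subtype)

/-- The Maurer–Cartan elements of `Ω ⊗ 𝔤`. -/
def IsFormsMC {m : ℕ} (μ : G.Forms m) : Prop :=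
  IsMaurerCartan (G.formsDegOne m) (G.formsDiff m) (G.formsBracket m) μ

/-- The closed elements of degree one of the complex `Ω ⊗ 𝔤` (the bracket plays no role). -/
def formsCocycles (m : ℕ) : AddSubgroup (G.Forms m) where
  carrier := {μ | μ ∈ G.formsDegOne m ∧ G.formsDiff m μ = 0}
  add_mem' h h' := ⟨add_mem h.1 h'.1, by rw [map_add, h.2, h'.2, add_zero]⟩
  zero_mem' := ⟨zero_mem _, map_zero _⟩
  neg_mem' h := ⟨by
    rw [← neg_one_smul k]
    exact Submodule.smul_mem _ _ h.1, by rw [← neg_one_smul k, map_smul, h.2, smul_zero]⟩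

/-- Pullback of `𝔤`-valued forms along a polynomial map. -/
def pullForms {m n : ℕ} (φ : Fin n → AffPoly k m) : G.Forms n →ₗ[k] G.Forms m :=
  TensorProduct.map (PolyForm.pull φ).toLinearMap LinearMap.id

/-- The simplicial structure map `Ω(Δⁿ) ⊗ 𝔤 → Ω(Δᵐ) ⊗ 𝔤` of `f : [m] → [n]`. -/
def simpForms {a b : SimplexCategory} (f : a ⟶ b) : G.Forms b.len →ₗ[k] G.Forms a.len :=
  G.pullForms (PolyForm.simplexMap k f.toOrderHom)

/-- The value of a `𝔤`-valued form on the zero-simplex. -/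
def value : G.Forms 0 →ₗ[k] G.carrier :=
  (TensorProduct.lid k G.carrier).toLinearMap ∘ₗ TensorProduct.map
    ((MvPolynomial.aeval (Fin.elim0 : Fin 0 → k)).toLinearMap ∘ₗ PolyForm.funPart) LinearMap.id

variable {G}

theorem formsDiff_pull {m n : ℕ} (φ : Fin n → AffPoly k m) (μ : G.Forms n) :
    G.formsDiff m (G.pullForms φ μ) = G.pullForms φ (G.formsDiff n μ) := by
  induction μ using TensorProduct.induction_on with
  | zero => simp
  | tmul ω x =>
    simp [formsDiff, pullForms, PolyForm.pull_d, PolyForm.pull_invol]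
  | add x y hx hy => simp only [map_add, hx, hy]

theorem formsBracket_pull {m n : ℕ} (φ : Fin n → AffPoly k m) (μ ν : G.Forms n) :
    G.formsBracket m (G.pullForms φ μ) (G.pullForms φ ν)
      = G.pullForms φ (G.formsBracket n μ ν) := by
  induction μ using TensorProduct.induction_on with
  | zero => simp
  | tmul ω x =>
    induction ν using TensorProduct.induction_on with
    | zero => simp
    | tmul η y => simp [formsBracket, pullForms, PolyForm.pull_invol]
    | add x y hx hy => simp only [map_add, hx, hy]
  | add x y hx hy => simp only [map_add, LinearMap.add_apply, hx, hy]

theorem pull_mem_degOne {m n : ℕ} (φ : Fin n → AffPoly k m) {μ : G.Forms n}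
    (hμ : μ ∈ G.formsDegOne n) : G.pullForms φ μ ∈ G.formsDegOne m := by
  refine Submodule.iSup_induction _ (motive := fun μ => G.pullForms φ μ ∈ G.formsDegOne m) hμ
    ?_ (by simp) (fun x y hx hy => by rw [map_add]; exact add_mem hx hy)
  rintro q _ ⟨t, rfl⟩
  refine Submodule.mem_iSup_of_mem q ?_
  induction t using TensorProduct.induction_on with
  | zero => simp
  | tmul ω x =>
    exact ⟨(⟨_, PolyForm.pull_mem φ ω.2⟩ : PolyForm.ofDegree k m q) ⊗ₜ x, by simp [pullForms]⟩
  | add x y hx hy => rw [map_add, map_add]; exact add_mem hx hy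

theorem IsFormsMC.pull {m n : ℕ} (φ : Fin n → AffPoly k m) {μ : G.Forms n} (h : G.IsFormsMC μ) :
    G.IsFormsMC (G.pullForms φ μ) :=
  ⟨pull_mem_degOne φ h.1, by
    rw [formsDiff_pull, formsBracket_pull, ← map_smul, ← map_add, h.2, map_zero]⟩

theorem formsCocycles_pull {m n : ℕ} (φ : Fin n → AffPoly k m) {μ : G.Forms n}
    (h : μ ∈ G.formsCocycles n) : G.pullForms φ μ ∈ G.formsCocycles m :=
  ⟨pull_mem_degOne φ h.1, by rw [formsDiff_pull, h.2, map_zero]⟩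

theorem simpForms_id (a : SimplexCategory) (μ : G.Forms a.len) : G.simpForms (𝟙 a) μ = μ := by
  have h : PolyForm.simplexMap k (SimplexCategory.Hom.toOrderHom (𝟙 a)) = MvPolynomial.X :=
    PolyForm.simplexMap_id
  rw [simpForms, h, pullForms]
  erw [PolyForm.pull_X]
  exact DFunLike.congr_fun (TensorProduct.map_id (R := k)) μ

theorem simpForms_comp {a b c : SimplexCategory} (f : a ⟶ b) (g : b ⟶ c) (μ : G.Forms c.len) :
    G.simpForms (f ≫ g) μ = G.simpForms f (G.simpForms g μ) := by
  have h : PolyForm.simplexMap k (SimplexCategory.Hom.toOrderHom (f ≫ g))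
      = fun i => MvPolynomial.aeval (PolyForm.simplexMap k f.toOrderHom)
        (PolyForm.simplexMap k g.toOrderHom i) :=
    (PolyForm.simplexMap_comp f.toOrderHom g.toOrderHom).symm
  rw [simpForms, simpForms, simpForms, h, pullForms, ← PolyForm.pull_comp]
  induction μ using TensorProduct.induction_on with
  | zero => simp
  | tmul ω x => simp [pullForms]
  | add x y hx hy => simp only [map_add, hx, hy]

/-! ### Morphisms -/

/-- Morphisms of DGLAs: linear maps which preserve degrees, brackets and differentials. -/
@[ext]
structure Hom (G H : DGLA k) where
  /-- The underlying linear map. -/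
  toLin : G.carrier →ₗ[k] H.carrier
  map_deg : ∀ i, ∀ x ∈ G.deg i, toLin x ∈ H.deg i
  map_bracket : ∀ x y, toLin (G.bracket x y) = H.bracket (toLin x) (toLin y)
  map_diff : ∀ x, toLin (G.diff x) = H.diff (toLin x)

variable {H : DGLA k}

/-- The map on `𝔤`-valued forms induced by a morphism of DGLAs. -/
def Hom.forms (f : Hom G H) (m : ℕ) : G.Forms m →ₗ[k] H.Forms m :=
  TensorProduct.map LinearMap.id f.toLin

theorem Hom.map_evenPart (f : Hom G H) (x : G.carrier) :
    f.toLin (G.evenPart x) = H.evenPart (f.toLin x) := by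
  refine hom_induction (P := fun x => f.toLin (G.evenPart x) = H.evenPart (f.toLin x)) x ?_ ?_ ?_
  · simp
  · intro x y hx hy; simp only [map_add, hx, hy]
  · intro i x hx
    rw [evenPart_of_mem hx, evenPart_of_mem (f.map_deg i x hx)]
    split_ifs <;> simp

theorem Hom.map_oddPart (f : Hom G H) (x : G.carrier) :
    f.toLin (G.oddPart x) = H.oddPart (f.toLin x) := by
  simp [oddPart, f.map_evenPart]

theorem Hom.formsDiff (f : Hom G H) (m : ℕ) (μ : G.Forms m) :
    f.forms m (G.formsDiff m μ) = H.formsDiff m (f.forms m μ) := by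
  induction μ using TensorProduct.induction_on with
  | zero => simp
  | tmul ω x => simp [DGLA.formsDiff, forms, f.map_diff]
  | add x y hx hy => simp only [map_add, hx, hy]

theorem Hom.formsBracket (f : Hom G H) (m : ℕ) (μ ν : G.Forms m) :
    f.forms m (G.formsBracket m μ ν) = H.formsBracket m (f.forms m μ) (f.forms m ν) := by
  induction μ using TensorProduct.induction_on with
  | zero => simp
  | tmul ω x =>
    induction ν using TensorProduct.induction_on with
    | zero => simp
    | tmul η y => simp [DGLA.formsBracket, forms, f.map_bracket, f.map_evenPart, f.map_oddPart]
    | add x y hx hy => simp only [map_add, hx, hy]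
  | add x y hx hy => simp only [map_add, LinearMap.add_apply, hx, hy]

theorem Hom.mem_degOne (f : Hom G H) {m : ℕ} {μ : G.Forms m} (hμ : μ ∈ G.formsDegOne m) :
    f.forms m μ ∈ H.formsDegOne m := by
  refine Submodule.iSup_induction _ (motive := fun μ => f.forms m μ ∈ H.formsDegOne m) hμ
    ?_ (by simp) (fun x y hx hy => by rw [map_add]; exact add_mem hx hy)
  rintro q _ ⟨t, rfl⟩
  refine Submodule.mem_iSup_of_mem q ?_
  induction t using TensorProduct.induction_on with
  | zero => simp
  | tmul ω x =>
    exact ⟨ω ⊗ₜ (⟨_, f.map_deg _ _ x.2⟩ : H.deg (1 - q)), by simp [forms]⟩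
  | add x y hx hy => rw [map_add, map_add]; exact add_mem hx hy

theorem Hom.isFormsMC (f : Hom G H) {m : ℕ} {μ : G.Forms m} (h : G.IsFormsMC μ) :
    H.IsFormsMC (f.forms m μ) :=
  ⟨f.mem_degOne h.1, by
    rw [← f.formsDiff, ← f.formsBracket, ← map_smul, ← map_add, h.2, map_zero]⟩

theorem Hom.mem_formsCocycles (f : Hom G H) {m : ℕ} {μ : G.Forms m} (h : μ ∈ G.formsCocycles m) :
    f.forms m μ ∈ H.formsCocycles m :=
  ⟨f.mem_degOne h.1, by rw [← f.formsDiff, h.2, map_zero]⟩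

theorem Hom.forms_simp (f : Hom G H) {a b : SimplexCategory} (s : a ⟶ b) (μ : G.Forms b.len) :
    f.forms _ (G.simpForms s μ) = H.simpForms s (f.forms _ μ) := by
  induction μ using TensorProduct.induction_on with
  | zero => simp
  | tmul ω x => simp [simpForms, pullForms, forms]
  | add x y hx hy => simp only [map_add, hx, hy]

theorem Hom.forms_comp {K : DGLA k} (f : Hom G H) (g : Hom H K) {h : Hom G K}
    (hh : h.toLin = g.toLin ∘ₗ f.toLin) (m : ℕ) (μ : G.Forms m) :
    h.forms m μ = g.forms m (f.forms m μ) := by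
  induction μ using TensorProduct.induction_on with
  | zero => simp
  | tmul ω x => simp [forms, hh]
  | add x y hx hy => simp only [map_add, hx, hy]

theorem Hom.isMC (f : Hom G H) {γ : G.carrier} (h : G.IsMC γ) : H.IsMC (f.toLin γ) :=
  ⟨f.map_deg _ _ h.1, by
    rw [← f.map_diff, ← f.map_bracket, ← map_smul, ← map_add, h.2, map_zero]⟩

theorem Hom.map_twisted (f : Hom G H) (γ x y : G.carrier) :
    f.toLin (G.twistedBracket γ x y) = H.twistedBracket (f.toLin γ) (f.toLin x) (f.toLin y) := by
  simp [twistedBracket, f.map_bracket, f.map_diff]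

/-! ### Nilpotency -/

theorem nilpBracket {N : ℕ} (hN : G.lowerCentral N = ⊥) : NilpBracket G.bracket N :=
  ⟨G.lowerCentral, fun x _ _ hy => Submodule.apply_mem_map₂ _ (Submodule.mem_top (x := x)) hy,
    rfl, hN⟩

theorem diff_bracket (x y : G.carrier) :
    G.diff (G.bracket x y) = G.bracket (G.diff x) y + G.bracket (G.evenPart x - G.oddPart x)
      (G.diff y) := by
  refine hom_induction (P := fun x => G.diff (G.bracket x y) = G.bracket (G.diff x) y +
    G.bracket (G.evenPart x - G.oddPart x) (G.diff y)) x ?_ ?_ ?_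
  · simp
  · intro x z hx hz
    simp only [map_add, LinearMap.add_apply, hx, hz, map_sub, LinearMap.sub_apply]; abel
  · intro i x hx
    rw [G.leibniz y hx, oddPart, LinearMap.sub_apply, LinearMap.id_apply, evenPart_of_mem hx]
    split_ifs with h
    · simp [Int.negOnePow_even _ h]
    · simp [Int.negOnePow_odd _ (Int.not_even_iff_odd.1 h)]

theorem diff_mem_lowerCentral (i : ℕ) {x : G.carrier} (hx : x ∈ G.lowerCentral i) :
    G.diff x ∈ G.lowerCentral i := by
  induction i generalizing x with
  | zero => exact Submodule.mem_top
  | succ i ih =>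
    have h : Submodule.map₂ G.bracket ⊤ (G.lowerCentral i)
        ≤ (G.lowerCentral (i + 1)).comap G.diff := by
      refine Submodule.map₂_le.2 fun x _ y hy => ?_
      rw [Submodule.mem_comap, diff_bracket]
      exact add_mem (Submodule.apply_mem_map₂ _ Submodule.mem_top hy)
        (Submodule.apply_mem_map₂ _ Submodule.mem_top (ih hy))
    exact h hx

theorem lowerCentral_succ_le (i : ℕ) : G.lowerCentral (i + 1) ≤ G.lowerCentral i := by
  induction i with
  | zero => exact le_top
  | succ i ih => exact Submodule.map₂_le_map₂_right ih

theorem nilpBracket_twisted {N : ℕ} (hN : G.lowerCentral N = ⊥) (γ : G.carrier) :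
    NilpBracket (G.twistedBracket γ) N :=
  ⟨G.lowerCentral, fun x i _ hy => Submodule.apply_mem_map₂ _ (Submodule.mem_top (x := x))
    (add_mem (diff_mem_lowerCentral i hy)
      (lowerCentral_succ_le i (Submodule.apply_mem_map₂ _ Submodule.mem_top hy))), rfl, hN⟩

end DGLA

/-! ## Holonomy -/

namespace DGLA

variable {k : Type u} [Field k] (G : DGLA k)

/-- `𝔤`-valued polynomials on affine `m`-space. -/
abbrev Polys (m : ℕ) : Type u := AffPoly k m ⊗[k] G.carrier

variable {G}

/-- The extension of a bilinear operation on `𝔤` to `𝔤`-valued polynomials. -/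
def polyBracket (br : G.carrier →ₗ[k] G.carrier →ₗ[k] G.carrier) (m : ℕ) :
    G.Polys m →ₗ[k] G.Polys m →ₗ[k] G.Polys m :=
  TensorProduct.map₂ (LinearMap.mul k (AffPoly k m)) br

/-- The partial derivative `∂/∂xⱼ`. -/
def partialDeriv {m : ℕ} (j : Fin m) : G.Polys m →ₗ[k] G.Polys m :=
  TensorProduct.map (MvPolynomial.pderiv j).toLinearMap LinearMap.id

/-- The restriction to the hyperplane `xⱼ = 0`. -/
def restrictZero {m : ℕ} (j : Fin m) : G.Polys m →ₗ[k] G.Polys m :=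
  TensorProduct.map (MvPolynomial.aeval
    (Function.update (MvPolynomial.X : Fin m → AffPoly k m) j 0)).toLinearMap LinearMap.id

/-- The value at the point `(1, …, 1)`. -/
def evalOnes {m : ℕ} : G.Polys m →ₗ[k] G.carrier :=
  (TensorProduct.lid k G.carrier).toLinearMap ∘ₗ
    TensorProduct.map (MvPolynomial.aeval (fun _ : Fin m => (1 : k))).toLinearMap LinearMap.id

/-- Let `V ⊆ 𝔤` be a Lie algebra for the bracket `br`. The `V`-valued polynomial `z` is the
logarithm of the solution `u = exp z` of the initial value problem
`(∂u/∂xⱼ) u⁻¹ = a`, `u = 1` for `xⱼ = 0`. Here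
`(∂u/∂xⱼ) u⁻¹ = ((exp(ad z) - 1) / ad z)(∂z/∂xⱼ)`. -/
def IsLogSolution (br : G.carrier →ₗ[k] G.carrier →ₗ[k] G.carrier) (V : Submodule k G.carrier)
    {m : ℕ} (j : Fin m) (a z : G.Polys m) : Prop :=
  z ∈ LinearMap.range (TensorProduct.map (LinearMap.id : AffPoly k m →ₗ[k] AffPoly k m) V.subtype) ∧
  phiAd (polyBracket br m) z (partialDeriv j z) = a ∧
  restrictZero j z = 0

/-- The coefficient of `dxⱼ` in a `𝔤`-valued form. -/
def formsCoeff₁ {m : ℕ} (j : Fin m) : G.Forms m →ₗ[k] G.Polys m :=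
  TensorProduct.map (PolyForm.coeff₁ j) LinearMap.id

/-- The value on `(∂/∂xᵢ, ∂/∂xⱼ)` of the degree two part of a `𝔤`-valued form. -/
def formsCoeff₂ {m : ℕ} (i j : Fin m) : G.Forms m →ₗ[k] G.Polys m :=
  TensorProduct.map (PolyForm.coeff₂ i j) LinearMap.id

/-- The value of a `𝔤`-valued form on a simplex at its `i`-th vertex. -/
def vertex {n : ℕ} (i : Fin (n + 1)) (μ : G.Forms n) : G.carrier :=
  G.value (G.simpForms (a := .mk 0) (b := .mk n) (SimplexCategory.const (.mk 0) (.mk n) i) μ)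

/-- `exp X` is the parallel transport of the connection `d + A` on the one-simplex from the vertex
`1` to the vertex `0`, where `A` is the one-form part of `μ`. The transport `u = exp z` from `0` to
`x` is given by `(∂u/∂x) u⁻¹ + A = 0`, `u(0) = 1`, and `exp X = u(1)⁻¹`. -/
def IsPathHolonomy (μ : G.Forms 1) (X : G.carrier) : Prop :=
  ∃ z : G.Polys 1, IsLogSolution G.bracket (G.deg 0) 0 (-(formsCoeff₁ 0 μ)) z ∧ X = -(evalOnes z)

/-- The parametrization `t₀ = 1 - x₁`, `t₁ = x₁ (1 - x₂)`, `t₂ = x₁ x₂` of the two-simplex by the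
square. -/
def squareParam (k : Type u) [Field k] : Fin 2 → AffPoly k 2 :=
  ![MvPolynomial.X 0 * (1 - MvPolynomial.X 1), MvPolynomial.X 0 * MvPolynomial.X 1]

/-- `exp_γ t` is the two-dimensional holonomy over the two-simplex of the pair `(d + A, β)`, where
`A` and `β` are the one-form and the two-form parts of `μ` and `γ` is the value of `μ` at the vertex
`0`. In the coordinates `(x₁, x₂)` of the square, `exp z` is the parallel transport of `d + A` from
`(0, x₂)` to `(x₁, x₂)`; `Y = ∫₀^{x₁} exp(-ad z)(β(∂/∂x₁, ∂/∂x₂)) dx₁` is the integral of `β` over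
the path, transported back to the vertex `0`; and `u = exp_γ w` is the solution of
`(∂u/∂x₂) u⁻¹ = Y`, `u = 1` for `x₂ = 0`. Then `exp_γ t = u(1, 1)`. -/
def IsSurfaceHolonomy (μ : G.Forms 2) (t : G.carrier) : Prop :=
  ∃ z Y w : G.Polys 2,
    IsLogSolution G.bracket (G.deg 0) 0 (-(formsCoeff₁ 0 (G.pullForms (squareParam k) μ))) z ∧
    partialDeriv 0 Y = expAd (polyBracket G.bracket 2) (-z)
      (formsCoeff₂ 0 1 (G.pullForms (squareParam k) μ)) ∧
    restrictZero 0 Y = 0 ∧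
    IsLogSolution (G.twistedBracket (vertex 0 μ)) (G.deg (-1)) 1 Y w ∧
    t = evalOnes w

/-- The integral over the standard simplex of the part of top degree of a `𝔤`-valued form. -/
def formsIntegral (p : ℕ) : G.Forms p →ₗ[k] G.carrier :=
  (TensorProduct.lid k G.carrier).toLinearMap ∘ₗ TensorProduct.map
    (PolyForm.simplexIntegral p ∘ₗ PolyForm.coeffTop p) LinearMap.id

/-! ## The simplices of the simplicial sets -/

variable (G)

/-- The simplices of `Σ(𝔤)`: the Maurer–Cartan elements of `Ω(Δⁿ) ⊗ 𝔤`. -/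
def SigmaSimplex (a : SimplexCategory) : Type u := {μ : G.Forms a.len // G.IsFormsMC μ}

/-- The `n`-simplices of the simplicial nerve of the Deligne 2-groupoid: objects `μᵢ`, 1-morphisms
`g_{ij} : μⱼ → μᵢ` and 2-morphisms `c_{ijl} : g_{ij} g_{jl} → g_{il}` with
`c_{ijm} c_{jlm} = c_{ilm} c_{ijl}` as 2-morphisms `g_{ij} g_{jl} g_{lm} → g_{im}`. The data `g_{ij}`
and `c_{ijl}` are given for `i < j < l`, and extended to `i ≤ j ≤ l` by identities; the conditions
with repeated indices are then void. Group elements are represented by their logarithms, and the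
entries for all other indices are set to zero. -/
@[ext]
structure NerveSimplex (n : ℕ) : Type u where
  /-- The objects. -/
  obj : Fin (n + 1) → G.carrier
  /-- The 1-morphisms. -/
  one : Fin (n + 1) → Fin (n + 1) → G.carrier
  /-- The 2-morphisms. -/
  two : Fin (n + 1) → Fin (n + 1) → Fin (n + 1) → G.carrier
  obj_mc : ∀ i, G.IsMC (obj i)
  one_eq_zero : ∀ i j, ¬ i < j → one i j = 0
  two_eq_zero : ∀ i j l, ¬ (i < j ∧ j < l) → two i j l = 0
  one_mor : ∀ i j, i ≤ j → G.IsOneMor (one i j) (obj j) (obj i)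
  two_mor : ∀ i j l, i ≤ j → j ≤ l →
    G.IsTwoMor (obj i) (two i j l) (bch G.bracket (one i j) (one j l)) (one i l)
  cocycle : ∀ i j l m, i ≤ j → j ≤ l → l ≤ m →
    bch (G.twistedBracket (obj i)) (two i j m) (expAd G.bracket (one i j) (two j l m)) =
      bch (G.twistedBracket (obj i)) (two i l m) (two i j l)

/-- The degree one cocycles of the total complex of normalized cochains on the simplex `Δ^a` with
values in the complex underlying `𝔤`: the simplices of the simplicial group `K(𝔤[1])`. A cochain
consists of the values `c p σ ∈ 𝔤^{1-p}`, `σ : [p] → a`, and the total differential is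
`(∑ⱼ (-1)ʲ ∂ⱼ^*) + (-1)^p δ`. -/
def emCocycles (a : SimplexCategory) :
    Submodule k (∀ p : ℕ, (SimplexCategory.mk p ⟶ a) → G.carrier) where
  carrier := {c | (∀ (p : ℕ) (σ : SimplexCategory.mk p ⟶ a), c p σ ∈ G.deg (1 - p)) ∧
    (∀ (p : ℕ) (σ : SimplexCategory.mk p ⟶ a),
      ¬ Function.Injective σ.toOrderHom → c p σ = 0) ∧
    (∀ σ : SimplexCategory.mk 0 ⟶ a, G.diff (c 0 σ) = 0) ∧
    ∀ (p : ℕ) (σ : SimplexCategory.mk (p + 1) ⟶ a),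
      ∑ j : Fin (p + 2), (-1 : k) ^ (j : ℕ) • c p (SimplexCategory.δ j ≫ σ) +
        (-1 : k) ^ (p + 1) • G.diff (c (p + 1) σ) = 0}
  add_mem' := by
    rintro c c' ⟨h1, h2, h3, h4⟩ ⟨h1', h2', h3', h4'⟩
    refine ⟨fun p σ => add_mem (h1 p σ) (h1' p σ), fun p σ hσ => ?_, fun σ => ?_, fun p σ => ?_⟩
    · simp [h2 p σ hσ, h2' p σ hσ]
    · simp [h3 σ, h3' σ]
    · have h := congrArg₂ (· + ·) (h4 p σ) (h4' p σ)
      simp only [add_zero] at h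
      simp only [Pi.add_apply, smul_add, map_add, Finset.sum_add_distrib]
      rw [← h]
      abel
  zero_mem' := ⟨fun p σ => zero_mem _, fun p σ _ => rfl, fun σ => by simp, fun p σ => by simp⟩
  smul_mem' := by
    rintro r c ⟨h1, h2, h3, h4⟩
    refine ⟨fun p σ => Submodule.smul_mem _ r (h1 p σ), fun p σ hσ => ?_, fun σ => ?_,
      fun p σ => ?_⟩
    · simp [h2 p σ hσ]
    · simp [h3 σ]
    · have h := congrArg (r • ·) (h4 p σ)
      simp only [smul_zero, smul_add, Finset.smul_sum] at h
      simp only [Pi.smul_apply, map_smul]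
      rw [← h]
      simp only [smul_comm r]

variable {G}

/-- The structure map `f^*` of the nerve: `ν_i = μ_{f i}`, `h_{ij} = g_{f i, f j}`,
`d_{ijl} = c_{f i, f j, f l}`. -/
def NerveSimplex.pull {m n : ℕ} (f : Fin (m + 1) →o Fin (n + 1)) (ν : G.NerveSimplex n) :
    G.NerveSimplex m where
  obj i := ν.obj (f i)
  one i j := ν.one (f i) (f j)
  two i j l := ν.two (f i) (f j) (f l)
  obj_mc i := ν.obj_mc _
  one_eq_zero i j h := ν.one_eq_zero _ _ fun h' => h (f.monotone.reflect_lt h')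
  two_eq_zero i j l h := ν.two_eq_zero _ _ _ fun h' =>
    h ⟨f.monotone.reflect_lt h'.1, f.monotone.reflect_lt h'.2⟩
  one_mor i j h := ν.one_mor _ _ (f.monotone h)
  two_mor i j l h h' := ν.two_mor _ _ _ (f.monotone h) (f.monotone h')
  cocycle i j l m h h' h'' := ν.cocycle _ _ _ _ (f.monotone h) (f.monotone h') (f.monotone h'')

/-- The map of nerves induced by a morphism of nilpotent DGLAs. -/
def NerveSimplex.map {H : DGLA k} (hG : G.IsNilpotent) (f : Hom G H) {n : ℕ}
    (ν : G.NerveSimplex n) : H.NerveSimplex n where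
  obj i := f.toLin (ν.obj i)
  one i j := f.toLin (ν.one i j)
  two i j l := f.toLin (ν.two i j l)
  obj_mc i := f.isMC (ν.obj_mc i)
  one_eq_zero i j h := by rw [ν.one_eq_zero i j h, map_zero]
  two_eq_zero i j l h := by rw [ν.two_eq_zero i j l h, map_zero]
  one_mor i j h := by
    obtain ⟨N, hN⟩ := hG
    refine ⟨f.map_deg _ _ (ν.one_mor i j h).1, ?_⟩
    rw [← (ν.one_mor i j h).2, gauge, gauge, map_sub,
      (nilpBracket hN).map_phiAd f.toLin f.map_bracket, map_add, f.map_diff, f.map_bracket]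
  two_mor i j l h h' := by
    obtain ⟨N, hN⟩ := hG
    refine ⟨f.map_deg _ _ (ν.two_mor i j l h h').1, ?_⟩
    rw [← (ν.two_mor i j l h h').2, (nilpBracket hN).map_bch f.toLin f.map_bracket,
      (nilpBracket hN).map_bch f.toLin f.map_bracket, map_add, f.map_diff, f.map_bracket]
  cocycle i j l m h h' h'' := by
    obtain ⟨N, hN⟩ := hG
    have key := congrArg f.toLin (ν.cocycle i j l m h h' h'')
    rw [(nilpBracket_twisted hN _).map_bch f.toLin (f.map_twisted _),
      (nilpBracket_twisted hN _).map_bch f.toLin (f.map_twisted _),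
      (nilpBracket hN).map_expAd f.toLin f.map_bracket] at key
    exact key

end DGLA

/-! ## The categories and functors -/

/-- Nilpotent DGLAs which vanish in degrees `≤ -2`. -/
structure NilpDGLA (k : Type u) [Field k] where
  /-- The underlying DGLA. -/
  alg : DGLA k
  nilpotent : alg.IsNilpotent
  bounded : ∀ i : ℤ, i ≤ -2 → alg.deg i = ⊥

namespace NilpDGLA

instance (k : Type u) [Field k] : Category (NilpDGLA k) where
  Hom G H := DGLA.Hom G.alg H.alg
  id G := ⟨LinearMap.id, fun _ _ h => h, fun _ _ => rfl, fun _ => rfl⟩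
  comp f g := ⟨g.toLin ∘ₗ f.toLin, fun i x h => g.map_deg i _ (f.map_deg i x h),
    fun x y => by simp [f.map_bracket, g.map_bracket], fun x => by simp [f.map_diff, g.map_diff]⟩

variable (k : Type u) [Field k]

variable {k} in
/-- The linear map underlying a morphism. -/
def lin {G H : NilpDGLA k} (f : G ⟶ H) : G.alg.carrier →ₗ[k] H.alg.carrier := DGLA.Hom.toLin f

variable {k} in
theorem toLin_comp {G H K : NilpDGLA k} (φ : G ⟶ H) (ψ : H ⟶ K) :
    DGLA.Hom.toLin (φ ≫ ψ) = DGLA.Hom.toLin ψ ∘ₗ DGLA.Hom.toLin φ := rfl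

variable {k} in
/-- The map on forms underlying a morphism. -/
def formsMap {G H : NilpDGLA k} (f : G ⟶ H) (n : ℕ) : G.alg.Forms n →ₗ[k] H.alg.Forms n :=
  DGLA.Hom.forms f n

/-- The simplicial set `Σ(𝔤)`, as a functor of `𝔤`. -/
def sigma : NilpDGLA k ⥤ SSet.{u} where
  obj G :=
    { obj := fun a => G.alg.SigmaSimplex a.unop
      map := fun f => TypeCat.ofHom fun μ => ⟨G.alg.simpForms f.unop μ.1, μ.2.pull _⟩
      map_id := fun a => by
        ext μ
        exact Subtype.ext (DGLA.simpForms_id _ _)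
      map_comp := fun f g => by
        ext μ
        exact Subtype.ext (DGLA.simpForms_comp _ _ _) }
  map {G H} φ :=
    { app := fun a => TypeCat.ofHom fun μ => ⟨DGLA.Hom.forms φ _ μ.1, DGLA.Hom.isFormsMC φ μ.2⟩
      naturality := fun a b f => by
        ext μ
        exact Subtype.ext (DGLA.Hom.forms_simp φ f.unop μ.1) }
  map_id G := by
    ext a μ
    exact Subtype.ext (DFunLike.congr_fun (TensorProduct.map_id (R := k)) μ.1)
  map_comp {G H K} φ ψ := by
    ext a μ
    exact Subtype.ext (DGLA.Hom.forms_comp φ ψ (toLin_comp φ ψ) _ μ.1)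

/-- The simplicial nerve of the Deligne 2-groupoid of `𝔤`, as a functor of `𝔤`. -/
def nerve : NilpDGLA k ⥤ SSet.{u} where
  obj G :=
    { obj := fun a => G.alg.NerveSimplex a.unop.len
      map := fun f => TypeCat.ofHom fun ν => ν.pull f.unop.toOrderHom
      map_id := fun a => rfl
      map_comp := fun f g => rfl }
  map {G H} φ :=
    { app := fun a => TypeCat.ofHom fun ν => ν.map G.nilpotent φ
      naturality := fun a b f => rfl }
  map_id G := rfl
  map_comp φ ψ := rfl

/-- The closed elements of degree one of `Ω(Δ^•) ⊗ 𝔤`, as a simplicial abelian group. It depends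
only on the complex underlying `𝔤`; if `𝔤` is abelian its underlying simplicial set is `Σ(𝔤)`. -/
def sigmaAb : NilpDGLA k ⥤ SimplicialObject AddCommGrpCat.{u} where
  obj G :=
    { obj := fun a => AddCommGrpCat.of (G.alg.formsCocycles a.unop.len)
      map := fun f => AddCommGrpCat.ofHom
        { toFun := fun μ => ⟨G.alg.simpForms f.unop μ.1, DGLA.formsCocycles_pull _ μ.2⟩
          map_zero' := Subtype.ext (map_zero _)
          map_add' := fun μ ν => Subtype.ext (map_add _ _ _) }
      map_id := fun a => by
        refine AddCommGrpCat.hom_ext (AddMonoidHom.ext fun μ => Subtype.ext ?_)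
        exact DGLA.simpForms_id _ _
      map_comp := fun f g => by
        refine AddCommGrpCat.hom_ext (AddMonoidHom.ext fun μ => Subtype.ext ?_)
        exact DGLA.simpForms_comp _ _ _ }
  map {G H} φ :=
    { app := fun a => AddCommGrpCat.ofHom
        { toFun := fun μ => ⟨DGLA.Hom.forms φ _ μ.1, DGLA.Hom.mem_formsCocycles φ μ.2⟩
          map_zero' := Subtype.ext (map_zero _)
          map_add' := fun μ ν => Subtype.ext (map_add _ _ _) }
      naturality := fun a b f => by
        refine AddCommGrpCat.hom_ext (AddMonoidHom.ext fun μ => Subtype.ext ?_)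
        exact DGLA.Hom.forms_simp φ f.unop μ.1 }
  map_id G := by
    refine NatTrans.ext (funext fun a => AddCommGrpCat.hom_ext (AddMonoidHom.ext fun μ =>
      Subtype.ext ?_))
    exact DFunLike.congr_fun (TensorProduct.map_id (R := k)) μ.1
  map_comp {G H K} φ ψ := by
    refine NatTrans.ext (funext fun a => AddCommGrpCat.hom_ext (AddMonoidHom.ext fun μ =>
      Subtype.ext ?_))
    exact DGLA.Hom.forms_comp φ ψ (toLin_comp φ ψ) _ μ.1

/-- The simplicial abelian group `K(𝔤[1])` of the complex underlying `𝔤`. -/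
def em : NilpDGLA k ⥤ SimplicialObject AddCommGrpCat.{u} where
  obj G :=
    { obj := fun a => AddCommGrpCat.of (G.alg.emCocycles a.unop)
      map := fun {a b} f => AddCommGrpCat.ofHom
        { toFun := fun c => ⟨fun p σ => c.1 p (σ ≫ f.unop), fun p σ => c.2.1 p _,
            fun p σ hσ => c.2.2.1 p _ fun h => hσ (by
              rw [SimplexCategory.comp_toOrderHom] at h
              exact Function.Injective.of_comp (f := f.unop.toOrderHom) h),
            fun σ => c.2.2.2.1 _, fun p σ => by
              have := c.2.2.2.2 p (σ ≫ f.unop)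
              simpa only [Category.assoc] using this⟩
          map_zero' := rfl
          map_add' := fun _ _ => rfl }
      map_id := fun a => by
        refine AddCommGrpCat.hom_ext (AddMonoidHom.ext fun c => Subtype.ext ?_)
        funext p σ
        exact congrArg (c.1 p) (Category.comp_id σ)
      map_comp := fun f g => by
        refine AddCommGrpCat.hom_ext (AddMonoidHom.ext fun c => Subtype.ext ?_)
        funext p σ
        exact congrArg (c.1 p) (Category.assoc σ g.unop f.unop).symm }
  map {G H} φ :=
    { app := fun a => AddCommGrpCat.ofHom
        { toFun := fun c => ⟨fun p σ => lin φ (c.1 p σ), fun p σ => DGLA.Hom.map_deg φ _ _ (c.2.1 p σ),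
            fun p σ hσ => (congrArg (lin φ) (c.2.2.1 p σ hσ)).trans (map_zero _),
            fun σ => by
              have h := congrArg (lin φ) (c.2.2.2.1 σ)
              rw [map_zero] at h
              exact (DGLA.Hom.map_diff φ _).symm.trans h,
            fun p σ => by
              have h := congrArg (lin φ) (c.2.2.2.2 p σ)
              rw [map_add, map_sum, map_smul, map_zero] at h
              simp only [map_smul] at h
              rw [← h]
              exact congrArg _ (congrArg _ (DGLA.Hom.map_diff φ _).symm)⟩
          map_zero' := Subtype.ext (by funext p σ; exact map_zero (lin φ))
          map_add' := fun c c' => Subtype.ext (by funext p σ; exact map_add (lin φ) _ _) }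
      naturality := fun a b f => rfl }
  map_id G := rfl
  map_comp φ ψ := rfl

end NilpDGLA

/-! ## Principal fibrations -/

/-- An action of a simplicial abelian group on a simplicial set. -/
structure SimplicialAction (A : SimplicialObject AddCommGrpCat.{u}) (E : SSet.{u}) where
  /-- The action in each simplicial degree. -/
  act : ∀ {a : SimplexCategoryᵒᵖ}, A.obj a → E.obj a → E.obj a
  zero_act : ∀ {a : SimplexCategoryᵒᵖ} (e : E.obj a), act (0 : A.obj a) e = e
  add_act : ∀ {a : SimplexCategoryᵒᵖ} (x y : A.obj a) (e : E.obj a),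
    act (x + y) e = act x (act y e)
  map_act : ∀ {a b : SimplexCategoryᵒᵖ} (f : a ⟶ b) (x : A.obj a) (e : E.obj a),
    E.map f (act x e) = act (A.map f x) (E.map f e)

/-- `p : E ⟶ B` is a principal fibration for the action of the simplicial group `A` on `E`: the
action is free and `p` identifies `B` with the quotient of `E` by the action. -/
structure IsPrincipalFibration {A : SimplicialObject AddCommGrpCat.{u}} {E B : SSet.{u}}
    (ρ : SimplicialAction A E) (p : E ⟶ B) : Prop where
  free : ∀ {a : SimplexCategoryᵒᵖ} (x : A.obj a) (e : E.obj a), ρ.act x e = e → x = 0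
  orbit : ∀ {a : SimplexCategoryᵒᵖ} (e e' : E.obj a),
    p.app a e = p.app a e' ↔ ∃ x : A.obj a, ρ.act x e = e'
  surjective : ∀ a : SimplexCategoryᵒᵖ, Function.Surjective (p.app a)

namespace NilpDGLA

variable {k : Type u} [Field k]

/-! ## Evaluation of simplices -/

/-- The Maurer–Cartan element of `Ω(Δⁿ) ⊗ 𝔤` underlying a simplex of `Σ(𝔤)`. -/
def sigmaForm {G : NilpDGLA k} {a : SimplexCategoryᵒᵖ} (μ : ((sigma k).obj G).obj a) :
    G.alg.Forms a.unop.len := Subtype.val (μ : G.alg.SigmaSimplex a.unop)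

/-- The form underlying an element of `sigmaAb`. -/
def sigmaAbForm {G : NilpDGLA k} {a : SimplexCategoryᵒᵖ} (α : ((sigmaAb k).obj G).obj a) :
    G.alg.Forms a.unop.len := Subtype.val (α : G.alg.formsCocycles a.unop.len)

/-- The data `((μᵢ), (g_{ij}), (c_{ijl}))` of a simplex of the nerve. -/
def nerveData {G : NilpDGLA k} {a : SimplexCategoryᵒᵖ} (ν : ((nerve k).obj G).obj a) :
    G.alg.NerveSimplex a.unop.len := ν

/-- The value of a simplex of `K(𝔤[1])` on the simplex `σ : [p] → a`. -/
def emValue {G : NilpDGLA k} {a : SimplexCategoryᵒᵖ} (c : ((em k).obj G).obj a) {p : ℕ}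
    (σ : SimplexCategory.mk p ⟶ a.unop) : G.alg.carrier :=
  Subtype.val (c : G.alg.emCocycles a.unop) p σ

/-- The vertex `i` of a simplex. -/
def vert {a : SimplexCategory} (i : Fin (a.len + 1)) : SimplexCategory.mk 0 ⟶ a :=
  SimplexCategory.const (.mk 0) a i

/-- The edge from `i` to `j` of a simplex. -/
def edge {a : SimplexCategory} (i j : Fin (a.len + 1)) (h : i ≤ j) : SimplexCategory.mk 1 ⟶ a :=
  SimplexCategory.mkOfLe i j h

/-- The face with vertices `i`, `j`, `l` of a simplex. -/
def face {a : SimplexCategory} (i j l : Fin (a.len + 1)) (h : i ≤ j) (h' : j ≤ l) :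
    SimplexCategory.mk 2 ⟶ a :=
  SimplexCategory.mkOfLeComp i j l h h'

/-! ## Holonomy and integration -/

/-- The simplex `ν` of the nerve consists of the values of `μ` at the vertices, the holonomies along
the edges, and the two-dimensional holonomies over the two-dimensional faces; moreover the initial
value problems which define these holonomies are uniquely solvable. -/
def IsHolonomyOf {G : NilpDGLA k} {a : SimplexCategoryᵒᵖ} (μ : ((sigma k).obj G).obj a)
    (ν : ((nerve k).obj G).obj a) : Prop :=
  (∀ i, (nerveData ν).obj i = DGLA.vertex i (sigmaForm μ)) ∧
  (∀ (i j : Fin (a.unop.len + 1)) (h : i < j) (X : G.alg.carrier),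
    DGLA.IsPathHolonomy (G.alg.simpForms (edge i j h.le) (sigmaForm μ)) X ↔
      X = (nerveData ν).one i j) ∧
  ∀ (i j l : Fin (a.unop.len + 1)) (h : i < j) (h' : j < l) (t : G.alg.carrier),
    DGLA.IsSurfaceHolonomy (G.alg.simpForms (face i j l h.le h'.le) (sigmaForm μ)) t ↔
      t = (nerveData ν).two i j l

/-- `c` is the integral of the `𝔤`-valued form `α` over the faces of the simplex. -/
def IsIntegralOf {G : NilpDGLA k} {a : SimplexCategoryᵒᵖ} (α : ((sigmaAb k).obj G).obj a)
    (c : ((em k).obj G).obj a) : Prop :=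
  ∀ (p : ℕ) (σ : SimplexCategory.mk p ⟶ a.unop),
    emValue c σ = DGLA.formsIntegral p (G.alg.simpForms σ (sigmaAbForm α))

/-- The simplicial set underlying a simplicial abelian group. -/
def underlying (A : SimplicialObject AddCommGrpCat.{u}) : SSet.{u} := A ⋙ forget AddCommGrpCat

/-- The map of simplicial sets underlying a homomorphism of simplicial abelian groups. -/
def underlyingMap {A B : SimplicialObject AddCommGrpCat.{u}} (f : A ⟶ B) :
    underlying A ⟶ underlying B := Functor.whiskerRight f (forget AddCommGrpCat)

end NilpDGLA

end

noncomputable section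

/-! ## Power series in nilpotent elements -/

section NilpotentSeries

open PowerSeries

variable {k : Type u} [Field k] {A : Type u} [Ring A] [Algebra k A]

/-- The value `∑ᵢ fᵢ Tⁱ` of a power series at a nilpotent element. -/
def nser (f : k⟦X⟧) (T : A) : A := ∑ᶠ i : ℕ, coeff i f • T ^ i

theorem nser_eq_sum (f : k⟦X⟧) {T : A} {N : ℕ} (h : T ^ N = 0) :
    nser f T = ∑ i ∈ Finset.range N, coeff i f • T ^ i := by
  refine finsum_eq_sum_of_support_subset _ fun i hi => ?_
  by_contra hlt
  simp only [Finset.coe_range, Set.mem_Iio, not_lt] at hlt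
  exact hi (by simp only [pow_eq_zero_of_le hlt h, smul_zero])

theorem nser_add (f g : k⟦X⟧) {T : A} (h : IsNilpotent T) :
    nser (f + g) T = nser f T + nser g T := by
  obtain ⟨N, hN⟩ := h
  simp only [nser_eq_sum _ hN, map_add, add_smul, Finset.sum_add_distrib]

theorem nser_neg (f : k⟦X⟧) {T : A} (h : IsNilpotent T) : nser (-f) T = -nser f T := by
  obtain ⟨N, hN⟩ := h
  simp only [nser_eq_sum _ hN, map_neg, neg_smul, Finset.sum_neg_distrib]

theorem nser_sub (f g : k⟦X⟧) {T : A} (h : IsNilpotent T) :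
    nser (f - g) T = nser f T - nser g T := by
  rw [sub_eq_add_neg, nser_add _ _ h, nser_neg _ h, sub_eq_add_neg]

theorem nser_smul (r : k) (f : k⟦X⟧) {T : A} (h : IsNilpotent T) :
    nser (r • f) T = r • nser f T := by
  obtain ⟨N, hN⟩ := h
  simp only [nser_eq_sum _ hN, Finset.smul_sum, smul_smul, PowerSeries.coeff_smul, smul_eq_mul]

theorem nser_eq_zero_of_dvd {f : k⟦X⟧} {T : A} {N : ℕ} (h : T ^ N = 0)
    (hf : (X : k⟦X⟧) ^ N ∣ f) : nser f T = 0 := by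
  rw [nser_eq_sum f h]
  refine Finset.sum_eq_zero fun i hi => ?_
  rw [X_pow_dvd_iff.1 hf i (Finset.mem_range.1 hi), zero_smul]

theorem nser_coe (p : Polynomial k) {T : A} (h : IsNilpotent T) :
    nser (p : k⟦X⟧) T = Polynomial.aeval T p := by
  obtain ⟨N, hN⟩ := h
  have hM : T ^ (max N (p.natDegree + 1)) = 0 := pow_eq_zero_of_le (le_max_left _ _) hN
  rw [nser_eq_sum _ hM, Polynomial.aeval_eq_sum_range' (n := max N (p.natDegree + 1))
    (lt_of_lt_of_le (Nat.lt_succ_self _) (le_max_right _ _))]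
  simp

theorem nser_eq_aeval (f : k⟦X⟧) {T : A} {N : ℕ} (h : T ^ N = 0) :
    nser f T = Polynomial.aeval T (trunc N f) := by
  rw [← nser_coe _ ⟨N, h⟩, ← sub_eq_zero, ← nser_sub _ _ ⟨N, h⟩]
  refine nser_eq_zero_of_dvd h (X_pow_dvd_iff.2 fun m hm => ?_)
  rw [map_sub, Polynomial.coeff_coe, coeff_trunc, if_pos hm, sub_self]

theorem nser_mul (f g : k⟦X⟧) {T : A} (h : IsNilpotent T) :
    nser (f * g) T = nser f T * nser g T := by
  obtain ⟨N, hN⟩ := h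
  have h1 : nser (f * g) T = nser ((trunc N f * trunc N g : Polynomial k) : k⟦X⟧) T := by
    rw [← sub_eq_zero, ← nser_sub _ _ ⟨N, hN⟩]
    refine nser_eq_zero_of_dvd hN (X_pow_dvd_iff.2 fun m hm => ?_)
    rw [map_sub, Polynomial.coe_mul, coeff_mul_eq_coeff_trunc_mul_trunc f g hm, sub_self]
  rw [h1, nser_coe _ ⟨N, hN⟩, map_mul, nser_eq_aeval _ hN, nser_eq_aeval _ hN]

theorem nser_one {T : A} (h : IsNilpotent T) : nser (1 : k⟦X⟧) T = 1 := by
  have := nser_coe (k := k) 1 h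
  simpa using this

theorem nser_X {T : A} (h : IsNilpotent T) : nser (PowerSeries.X : k⟦X⟧) T = T := by
  have := nser_coe (k := k) Polynomial.X h
  simpa using this

theorem nser_pow (f : k⟦X⟧) {T : A} (h : IsNilpotent T) (n : ℕ) :
    nser (f ^ n) T = nser f T ^ n := by
  induction n with
  | zero => rw [pow_zero, pow_zero, nser_one h]
  | succ n ih => rw [pow_succ, pow_succ, nser_mul _ _ h, ih]

theorem map_nser {B : Type u} [Ring B] [Algebra k B] (F : A →ₗ[k] B) {T : A} {S : B}
    (hF : ∀ i, F (T ^ i) = S ^ i) (h : IsNilpotent T) (f : k⟦X⟧) :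
    F (nser f T) = nser f S := by
  obtain ⟨N, hN⟩ := h
  have hS : S ^ N = 0 := by rw [← hF, hN, map_zero]
  rw [nser_eq_sum f hN, nser_eq_sum f hS, map_sum]
  simp only [map_smul, hF]

/-- The power series `∑ Xⁱ / i!`. -/
def expS (k : Type u) [Field k] : k⟦X⟧ := PowerSeries.mk fun i => ((i.factorial : k))⁻¹

/-- The power series `∑ Xⁱ / (i + 1)!`. -/
def phiS (k : Type u) [Field k] : k⟦X⟧ := PowerSeries.mk fun i => (((i + 1).factorial : k))⁻¹

/-- The polynomial expression `∑_{n < K} (-1)ⁿ eⁿ / (n + 1)`. -/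
def logQuot {B : Type u} [Ring B] [Algebra k B] (K : ℕ) (e : B) : B :=
  ∑ n ∈ Finset.range K, ((-1 : k) ^ n / ((n + 1 : ℕ) : k)) • e ^ n

theorem expS_eq : expS k = 1 + X * phiS k := by
  ext i
  cases i with
  | zero => simp [expS]
  | succ i => simp [expS, phiS, coeff_succ_X_mul, coeff_one]

variable [CharZero k]

theorem derivative_expS : d⁄dX k (expS k) = expS k := by
  ext i
  have h : ((i + 1 : ℕ) : k) ≠ 0 := Nat.cast_ne_zero.2 (Nat.succ_ne_zero i)
  simp only [expS, coeff_derivative, coeff_mk, Nat.factorial_succ]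
  push_cast at h ⊢
  field_simp

theorem X_pow_dvd_phiS_mul_logQuot_sub_one (K : ℕ) :
    (X : k⟦X⟧) ^ K ∣ phiS k * logQuot (k := k) K (X * phiS k) - 1 := by
  set e : k⟦X⟧ := X * phiS k with he
  have hde : d⁄dX k e = 1 + e := by
    have h := derivative_expS (k := k)
    rw [expS_eq, map_add, ← he] at h
    simpa using h
  have hP : d⁄dX k (e * logQuot (k := k) K e - X) = -(-e) ^ K := by
    have h1 : e * logQuot (k := k) K e
        = ∑ n ∈ Finset.range K, ((-1 : k) ^ n / ((n + 1 : ℕ) : k)) • e ^ (n + 1) := by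
      rw [logQuot, Finset.mul_sum]
      exact Finset.sum_congr rfl fun n _ => by rw [mul_smul_comm, pow_succ']
    rw [h1, map_sub, map_sum]
    have h2 : ∀ n ∈ Finset.range K, d⁄dX k (((-1 : k) ^ n / ((n + 1 : ℕ) : k)) • e ^ (n + 1))
        = (-e) ^ n * (1 + e) := by
      intro n _
      have h : ((n + 1 : ℕ) : k) ≠ 0 := Nat.cast_ne_zero.2 (Nat.succ_ne_zero n)
      rw [Derivation.map_smul, Derivation.leibniz_pow, hde, Nat.add_sub_cancel, neg_pow e,
        ← Nat.cast_smul_eq_nsmul k, smul_smul, div_mul_cancel₀ _ h, smul_eq_mul,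
        PowerSeries.smul_eq_C_mul]
      simp [mul_assoc]
    rw [Finset.sum_congr rfl h2, ← Finset.sum_mul]
    have h3 := geom_sum_mul_neg (-e) K
    rw [sub_neg_eq_add] at h3
    rw [h3]
    simp
  have hX : (X : k⟦X⟧) ^ (K + 1) ∣ e * logQuot (k := k) K e - X := by
    refine X_pow_dvd_iff.2 fun m hm => ?_
    cases m with
    | zero => simp [he]
    | succ m =>
      have h4 := congrArg (coeff m) hP
      rw [coeff_derivative] at h4
      have h5 : coeff m (-(-e) ^ K) = 0 := by
        rw [map_neg, neg_eq_zero]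
        refine X_pow_dvd_iff.1 ?_ m (Nat.lt_of_succ_lt_succ hm)
        exact pow_dvd_pow_of_dvd ((dvd_mul_right _ _).neg_right) K
      rw [h5] at h4
      refine (mul_eq_zero.1 h4).resolve_right ?_
      exact_mod_cast Nat.succ_ne_zero m
  have h6 : e * logQuot (k := k) K e - X = X * (phiS k * logQuot (k := k) K e - 1) := by
    rw [he]; ring
  rw [h6, pow_succ'] at hX
  exact (mul_dvd_mul_iff_left X_ne_zero).1 hX

theorem nser_logQuot (K : ℕ) (f : k⟦X⟧) {T : A} (h : IsNilpotent T) :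
    nser (logQuot (k := k) K f) T = logQuot (k := k) K (nser f T) := by
  induction K with
  | zero =>
    have := nser_smul (k := k) 0 1 h
    simpa [logQuot] using this
  | succ K ih =>
    rw [logQuot, Finset.sum_range_succ, nser_add _ _ h, nser_smul _ _ h, nser_pow _ h]
    rw [logQuot] at ih
    rw [ih, logQuot, logQuot, Finset.sum_range_succ]

/-- `log w / (w - 1)` at `w = exp T` is inverse to `(exp T - 1) / T`. -/
theorem logQuot_mul_phi {T : A} {K : ℕ} (h : T ^ K = 0) :
    logQuot (k := k) K (nser (expS k) T - 1) * nser (phiS k) T = 1 := by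
  have hT : IsNilpotent T := ⟨K, h⟩
  have h1 := nser_eq_zero_of_dvd h (X_pow_dvd_phiS_mul_logQuot_sub_one (k := k) K)
  rw [nser_sub _ _ hT, nser_one hT, sub_eq_zero, mul_comm, nser_mul _ _ hT, nser_logQuot _ _ hT] at h1
  rw [expS_eq, nser_add _ _ hT, nser_one hT, add_sub_cancel_left]
  exact h1

theorem nser_expS_add {S T : A} (h : Commute S T) (hS : IsNilpotent S) (hT : IsNilpotent T) :
    nser (expS k) (S + T) = nser (expS k) S * nser (expS k) T := by
  let _ : Module ℚ A := Module.compHom A (algebraMap ℚ k)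
  have key : ∀ U : A, IsNilpotent U → nser (expS k) U = IsNilpotent.exp U := by
    rintro U ⟨N, hN⟩
    rw [nser_eq_sum _ hN, IsNilpotent.exp_eq_sum hN]
    refine Finset.sum_congr rfl fun i _ => ?_
    rw [expS, coeff_mk]
    change _ = (algebraMap ℚ k (i.factorial : ℚ)⁻¹) • U ^ i
    simp
  rw [key _ hS, key _ hT, key _ (h.isNilpotent_add hS hT), IsNilpotent.exp_add_of_commute h hS hT]

theorem nser_expS_neg_mul {T : A} (hT : IsNilpotent T) :
    nser (expS k) (-T) * nser (expS k) T = 1 := by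
  rw [← nser_expS_add (Commute.neg_left (Commute.refl T)) hT.neg hT, neg_add_cancel,
    nser_eq_sum _ (pow_one (0 : A))]
  simp [expS]

theorem nser_expS_mul_neg {T : A} (hT : IsNilpotent T) :
    nser (expS k) T * nser (expS k) (-T) = 1 := by
  simpa using nser_expS_neg_mul (k := k) hT.neg

/-- The commutator with `T` as a linear operator. -/
def commOp (k : Type u) [Field k] {A : Type u} [Ring A] [Algebra k A] (T : A) : Module.End k A :=
  LinearMap.mulLeft k T - LinearMap.mulRight k T

theorem commOp_apply (T S : A) : commOp k T S = T * S - S * T := rfl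

theorem isNilpotent_commOp {T : A} (h : IsNilpotent T) : IsNilpotent (commOp k T) := by
  obtain ⟨N, hN⟩ := h
  refine Commute.isNilpotent_sub (LinearMap.commute_mulLeft_right T T) ⟨N, ?_⟩ ⟨N, ?_⟩
  · rw [LinearMap.pow_mulLeft, hN, LinearMap.mulLeft_zero_eq_zero]
  · rw [LinearMap.pow_mulRight, hN, LinearMap.mulRight_zero_eq_zero]

theorem nser_expS_conj {T : A} (h : IsNilpotent T) (S : A) :
    nser (expS k) T * S * nser (expS k) (-T) = nser (expS k) (commOp k T) S := by
  have hl : IsNilpotent (LinearMap.mulLeft k T) := by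
    obtain ⟨N, hN⟩ := h
    exact ⟨N, by rw [LinearMap.pow_mulLeft, hN, LinearMap.mulLeft_zero_eq_zero]⟩
  have hr : IsNilpotent (LinearMap.mulRight k (-T)) := by
    obtain ⟨N, hN⟩ := h.neg
    exact ⟨N, by rw [LinearMap.pow_mulRight, hN, LinearMap.mulRight_zero_eq_zero]⟩
  have h1 : commOp k T = LinearMap.mulLeft k T + LinearMap.mulRight k (-T) := by
    ext S; simp [commOp, sub_eq_add_neg]
  rw [h1, nser_expS_add (LinearMap.commute_mulLeft_right T (-T)) hl hr]
  have h2 : nser (expS k) (LinearMap.mulLeft k T) = LinearMap.mulLeft k (nser (expS k) T) :=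
    (map_nser (LinearMap.mul k A) (fun i => (LinearMap.pow_mulLeft k A T i).symm) h _).symm
  have h3 : nser (expS k) (LinearMap.mulRight k (-T))
      = LinearMap.mulRight k (nser (expS k) (-T)) :=
    (map_nser (LinearMap.mul k A).flip (fun i => (LinearMap.pow_mulRight k A (-T) i).symm)
      h.neg _).symm
  rw [h2, h3]
  simp [mul_assoc]

end NilpotentSeries

/-! ## Nilpotent Lie algebras and their representations -/

section NilpotentLie

variable {k : Type u} [Field k] {L M W : Type u} [AddCommGroup L] [Module k L] [AddCommGroup M]
  [Module k M] [AddCommGroup W] [Module k W]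

/-- The exponential of a nilpotent operator. -/
def expOp (T : Module.End k M) : Module.End k M := nser (expS k) T

/-- The operator `(exp T - 1) / T` for a nilpotent operator `T`. -/
def phiOp (T : Module.End k M) : Module.End k M := nser (phiS k) T

theorem nser_apply (f : PowerSeries k) {T : Module.End k M} {N : ℕ} (h : T ^ N = 0) (v : M) :
    nser f T v = ∑ i ∈ Finset.range N, PowerSeries.coeff i f • (T ^ i) v := by
  rw [nser_eq_sum f h, LinearMap.sum_apply]
  rfl

theorem nser_intertwine {S : Module.End k M} {T : Module.End k W} (hS : IsNilpotent S)
    (hT : IsNilpotent T) (g : M →ₗ[k] W) (hg : ∀ v, g (S v) = T (g v)) (f : PowerSeries k) (v : M) :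
    g (nser f S v) = nser f T (g v) := by
  obtain ⟨m, hm⟩ := hS
  obtain ⟨n, hn⟩ := hT
  rw [nser_apply f (pow_eq_zero_of_le (le_max_left m n) hm),
    nser_apply f (pow_eq_zero_of_le (le_max_right m n) hn), map_sum]
  have hpow : ∀ (i : ℕ) (v : M), g ((S ^ i) v) = (T ^ i) (g v) := by
    intro i
    induction i with
    | zero => intro v; rfl
    | succ i ih =>
      intro v
      rw [pow_succ, pow_succ, Module.End.mul_apply, Module.End.mul_apply, ih, hg]
  exact Finset.sum_congr rfl fun i _ => by rw [map_smul, hpow]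

theorem expAd_eq {br : L →ₗ[k] L →ₗ[k] L} {x : L} (h : IsNilpotent (br x)) (v : L) :
    expAd br x v = expOp (br x) v := by
  obtain ⟨N, hN⟩ := h
  rw [expOp, nser_apply _ hN, expAd]
  refine (finsum_eq_sum_of_support_subset _ fun i hi => ?_).trans
    (Finset.sum_congr rfl fun i _ => by rw [expS, PowerSeries.coeff_mk])
  by_contra hlt
  simp only [Finset.coe_range, Set.mem_Iio, not_lt] at hlt
  exact hi (by simp [pow_eq_zero_of_le hlt hN])

theorem phiAd_eq {br : L →ₗ[k] L →ₗ[k] L} {x : L} (h : IsNilpotent (br x)) (v : L) :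
    phiAd br x v = phiOp (br x) v := by
  obtain ⟨N, hN⟩ := h
  rw [phiOp, nser_apply _ hN, phiAd]
  refine (finsum_eq_sum_of_support_subset _ fun i hi => ?_).trans
    (Finset.sum_congr rfl fun i _ => by rw [phiS, PowerSeries.coeff_mk])
  by_contra hlt
  simp only [Finset.coe_range, Set.mem_Iio, not_lt] at hlt
  exact hi (by simp [pow_eq_zero_of_le hlt hN])

/-- The operators `a x` raise the finite filtration `F`. -/
structure FiltAct (a : L →ₗ[k] M →ₗ[k] M) (F : ℕ → Submodule k M) (N : ℕ) : Prop where
  act : ∀ x i, ∀ v ∈ F i, a x v ∈ F (i + 1)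
  zero : F 0 = ⊤
  bot : F N = ⊥
  anti : ∀ i, F (i + 1) ≤ F i

/-- A Lie bracket. -/
structure IsLie (br : L →ₗ[k] L →ₗ[k] L) : Prop where
  alt : ∀ x, br x x = 0
  jac : ∀ x y z, br (br x y) z = br x (br y z) - br y (br x z)

/-- A representation of a Lie algebra. -/
def IsRep (br : L →ₗ[k] L →ₗ[k] L) (a : L →ₗ[k] M →ₗ[k] M) : Prop :=
  ∀ x y v, a (br x y) v = a x (a y v) - a y (a x v)

/-- `∂` is a derivation with antiderivative `I` and evaluation `e`, all compatible with the
filtration. -/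
structure Prim (F : ℕ → Submodule k M) (der ev int : M →ₗ[k] M) : Prop where
  der_int : ∀ m, der (int m) = m
  ev_int : ∀ m, ev (int m) = 0
  int_der : ∀ m, int (der m) = m - ev m
  der_mem : ∀ i, ∀ m ∈ F i, der m ∈ F i
  int_mem : ∀ i, ∀ m ∈ F i, int m ∈ F i

theorem FiltAct.pow_eq_zero {a : L →ₗ[k] M →ₗ[k] M} {F : ℕ → Submodule k M} {N : ℕ}
    (h : FiltAct a F N) (x : L) : (a x) ^ N = 0 := by
  have key : ∀ (i : ℕ) (v : M), ((a x) ^ i) v ∈ F i := by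
    intro i
    induction i with
    | zero => intro v; rw [h.zero]; trivial
    | succ i ih => intro v; rw [pow_succ']; exact h.act _ _ _ (ih v)
  ext v
  have := key N v
  rwa [h.bot] at this

theorem FiltAct.nilp {a : L →ₗ[k] M →ₗ[k] M} {F : ℕ → Submodule k M} {N : ℕ}
    (h : FiltAct a F N) (x : L) : IsNilpotent (a x) := ⟨N, h.pow_eq_zero x⟩

theorem FiltAct.nilpBracket {br : L →ₗ[k] L →ₗ[k] L} {F : ℕ → Submodule k L} {N : ℕ}
    (h : FiltAct br F N) : NilpBracket br N := ⟨F, h.act, h.zero, h.bot⟩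

theorem IsLie.skew {br : L →ₗ[k] L →ₗ[k] L} (h : IsLie br) (x y : L) : br x y = -br y x := by
  have := h.alt (x + y)
  simp only [map_add, LinearMap.add_apply, h.alt, zero_add, add_zero] at this
  exact eq_neg_of_add_eq_zero_right this

theorem IsLie.isRep {br : L →ₗ[k] L →ₗ[k] L} (h : IsLie br) : IsRep br br := h.jac

section Exp

variable [CharZero k] {br : L →ₗ[k] L →ₗ[k] L} {a : L →ₗ[k] M →ₗ[k] M}
  {F : ℕ → Submodule k M} {N : ℕ} {FL : ℕ → Submodule k L} {NL : ℕ}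

theorem expOp_neg_apply {T : Module.End k M} (h : IsNilpotent T) (v : M) :
    expOp (-T) (expOp T v) = v := by
  have := congrArg (fun S : Module.End k M => S v) (nser_expS_neg_mul (k := k) h)
  exact this

theorem expOp_apply_neg {T : Module.End k M} (h : IsNilpotent T) (v : M) :
    expOp T (expOp (-T) v) = v := by
  have := congrArg (fun S : Module.End k M => S v) (nser_expS_mul_neg (k := k) h)
  exact this

theorem expOp_eq_add {T : Module.End k M} (h : IsNilpotent T) (v : M) :
    expOp T v = v + phiOp T (T v) := by
  rw [expOp, phiOp, expS_eq, nser_add _ _ h, nser_one h, mul_comm, nser_mul _ _ h, nser_X h]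
  rfl

theorem expOp_zero (v : M) : expOp (0 : Module.End k M) v = v := by
  rw [expOp_eq_add IsNilpotent.zero]; simp

theorem phiOp_neg {T : Module.End k M} (h : IsNilpotent T) (v : M) :
    phiOp (-T) v = expOp (-T) (phiOp T v) := by
  have h1 : PowerSeries.rescale (-1 : k) (phiS k)
      = PowerSeries.rescale (-1 : k) (expS k) * phiS k := by
    have h2 : PowerSeries.rescale (-1 : k) (expS k) * expS k = 1 := by
      have h3 : expS k = PowerSeries.exp k := by
        ext i; simp [expS, PowerSeries.coeff_exp]
      rw [h3, mul_comm]
      exact PowerSeries.exp_mul_exp_neg_eq_one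
    have h4 := congrArg (PowerSeries.rescale (-1 : k)) (expS_eq (k := k))
    rw [map_add, map_one, map_mul, PowerSeries.rescale_X] at h4
    refine mul_left_cancel₀ (PowerSeries.X_ne_zero (R := k)) ?_
    rw [mul_left_comm, ← add_right_inj (PowerSeries.rescale (-1 : k) (expS k)), ← mul_one_add,
      ← expS_eq, h2, h4]
    simp
  have h5 : ∀ f : PowerSeries k, nser f (-T) = nser (PowerSeries.rescale (-1 : k) f) T := by
    obtain ⟨N, hN⟩ := h
    have hN' : (-T) ^ N = 0 := by rw [neg_pow, hN, mul_zero]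
    intro f
    rw [nser_eq_sum _ hN, nser_eq_sum _ hN']
    refine Finset.sum_congr rfl fun i _ => ?_
    rw [PowerSeries.coeff_rescale]
    rcases Nat.even_or_odd i with h' | h' <;> simp [h'.neg_pow]
  rw [phiOp, expOp, h5, h5, h1, nser_mul _ _ h]
  rfl

/-- Conjugation by the exponential of an operator. -/
theorem expOp_conj {T : Module.End k M} (h : IsNilpotent T) (S : Module.End k M) (v : M) :
    expOp T (S v) = nser (expS k) (commOp k T) S (expOp T v) := by
  have h1 := nser_expS_conj (k := k) h S
  have h2 := congrArg (fun U : Module.End k M => U (expOp T v)) h1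
  simp only [Module.End.mul_apply] at h2
  rw [← h2]
  change _ = expOp T (S (expOp (-T) (expOp T v)))
  rw [expOp_neg_apply h]

theorem nser_commOp_rep (ha : IsRep br a) {z : L} (hb : IsNilpotent (br z))
    (hz : IsNilpotent (a z)) (f : PowerSeries k) (w : L) :
    nser f (commOp k (a z)) (a w) = a (nser f (br z) w) := by
  refine (nser_intertwine hb (isNilpotent_commOp hz) a (fun v => ?_) f w).symm
  ext m
  exact ha z v m

theorem expOp_rep (ha : IsRep br a) {z : L} (hb : IsNilpotent (br z))
    (hz : IsNilpotent (a z)) (w : L) (v : M) :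
    expOp (a z) (a w v) = a (expOp (br z) w) (expOp (a z) v) := by
  rw [expOp_conj hz (a w) v, nser_commOp_rep ha hb hz]
  rfl

/-- Conjugation of an operator `S` whose commutator with `a z` is `-a w`. -/
theorem expOp_conj_of_comm (ha : IsRep br a) {z : L} (hb : IsNilpotent (br z))
    (hz : IsNilpotent (a z)) (S : Module.End k M) (w : L)
    (hS : ∀ m, S (a z m) = a w m + a z (S m)) (v : M) :
    S (expOp (a z) v) = expOp (a z) (S v) + a (phiOp (br z) w) (expOp (a z) v) := by
  have h1 : commOp k (a z) S = -a w := by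
    ext m
    rw [commOp_apply, LinearMap.sub_apply, Module.End.mul_apply, Module.End.mul_apply, hS]
    simp
  rw [expOp_conj hz S v]
  have h2 := congrArg (fun U : Module.End k M => U (expOp (a z) v))
    (expOp_eq_add (k := k) (isNilpotent_commOp hz) S)
  simp only [LinearMap.add_apply] at h2
  change _ = expOp (commOp k (a z)) S (expOp (a z) v) + _
  rw [h2, h1, map_neg]
  have h3 := nser_commOp_rep ha hb hz (phiS k) w
  rw [phiOp, h3]
  simp [phiOp]

theorem der_expOp (ha : IsRep br a) (hL : ∀ x, IsNilpotent (br x)) (hM : ∀ x, IsNilpotent (a x))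
    {derL : L →ₗ[k] L} {derM : M →ₗ[k] M}
    (hd : ∀ x m, derM (a x m) = a (derL x) m + a x (derM m)) (z : L) (v : M) :
    derM (expOp (a z) v) = expOp (a z) (derM v) + a (phiOp (br z) (derL z)) (expOp (a z) v) :=
  expOp_conj_of_comm ha (hL z) (hM z) derM (derL z) (hd z) v

/-! ### Affine representations -/

/-- The representation on `M × k` attached to a representation on `M` and a one-cocycle. -/
def affRep (a : L →ₗ[k] M →ₗ[k] M) (c : L →ₗ[k] M) : L →ₗ[k] (M × k) →ₗ[k] (M × k) :=
  LinearMap.mk₂ k (fun x p => (a x p.1 + p.2 • c x, 0))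
    (fun x y p => by simp; abel) (fun r x p => by simp [smul_comm r])
    (fun x p q => by simp [add_smul]; abel) (fun r x p => by simp [mul_smul])

theorem affRep_apply (c : L →ₗ[k] M) (x : L) (p : M × k) :
    affRep a c x p = (a x p.1 + p.2 • c x, 0) := rfl

/-- A one-cocycle of a representation. -/
def IsCocycle (br : L →ₗ[k] L →ₗ[k] L) (a : L →ₗ[k] M →ₗ[k] M) (c : L →ₗ[k] M) : Prop :=
  ∀ x y, c (br x y) = a x (c y) - a y (c x)

theorem isRep_affRep (ha : IsRep br a) {c : L →ₗ[k] M} (hc : IsCocycle br a c) :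
    IsRep br (affRep a c) := by
  intro x y p
  simp only [affRep_apply, ha x y, hc x y, map_add, map_smul, smul_sub, zero_smul, add_zero,
    Prod.mk_sub_mk, sub_zero]
  congr 1
  abel

/-- The filtration of `M × k` for an affine representation. -/
def affFilt (F : ℕ → Submodule k M) : ℕ → Submodule k (M × k)
  | 0 => ⊤
  | i + 1 => (F i).prod ⊥

theorem filtAct_affRep (h : FiltAct a F N) (c : L →ₗ[k] M) :
    FiltAct (affRep a c) (affFilt F) (N + 1) where
  act x i p hp := by
    cases i with
    | zero => exact ⟨by rw [h.zero]; trivial, rfl⟩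
    | succ i =>
      obtain ⟨h1, h2⟩ := hp
      have h3 : p.2 = 0 := h2
      refine ⟨?_, rfl⟩
      change a x p.1 + p.2 • c x ∈ F (i + 1)
      rw [h3, zero_smul, add_zero]
      exact h.act _ _ _ h1
  zero := rfl
  bot := by simp [affFilt, h.bot]
  anti i := by
    cases i with
    | zero => exact le_top
    | succ i => exact Submodule.prod_mono (h.anti i) le_rfl

theorem phiOp_affRep (h : FiltAct a F N) (c : L →ₗ[k] M) (x : L) (v : M) :
    phiOp (affRep a c x) (v, 0) = (phiOp (a x) v, 0) := by
  refine (nser_intertwine (h.nilp x) ((filtAct_affRep h c).nilp x) (LinearMap.inl k M k)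
    (fun v => ?_) (phiS k) v).symm
  simp [affRep_apply]

theorem expOp_affRep (h : FiltAct a F N) (c : L →ₗ[k] M) (x : L) (v : M) (s : k) :
    expOp (affRep a c x) (v, s) = (expOp (a x) v + s • phiOp (a x) (c x), s) := by
  rw [expOp_eq_add ((filtAct_affRep h c).nilp x), affRep_apply, phiOp_affRep h,
    expOp_eq_add (h.nilp x)]
  simp [add_assoc]

/-- The derivative of `phiOp (a z) (c z)` for a cocycle `c` commuting with the derivation. -/
theorem der_phiOp_cocycle (ha : IsRep br a) (hL : ∀ x, IsNilpotent (br x)) (h : FiltAct a F N)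
    {c : L →ₗ[k] M} (hc : IsCocycle br a c) {derL : L →ₗ[k] L} {derM : M →ₗ[k] M}
    (hd : ∀ x m, derM (a x m) = a (derL x) m + a x (derM m))
    (hcd : ∀ x, derM (c x) = c (derL x)) (z : L) :
    derM (phiOp (a z) (c z)) =
      a (phiOp (br z) (derL z)) (phiOp (a z) (c z)) + c (phiOp (br z) (derL z)) := by
  have key := der_expOp (isRep_affRep ha hc) hL (filtAct_affRep h c).nilp
    (derL := derL) (derM := LinearMap.inl k M k ∘ₗ derM ∘ₗ LinearMap.fst k M k)
    (fun x p => by simp [affRep_apply, hd, hcd]; abel) z (0, 1)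
  rw [expOp_affRep h] at key
  simpa [affRep_apply, expOp_affRep h] using congrArg Prod.fst key

end Exp

/-! ### The logarithmic initial value problem -/

section LogDer

variable {br : L →ₗ[k] L →ₗ[k] L} {F : ℕ → Submodule k L} {N : ℕ} {der ev int : L →ₗ[k] L}

theorem FiltAct.phiOp_sub_mem (h : FiltAct br F N) (hl : IsLie br) {z z' u u' : L} {i : ℕ}
    (hz : z - z' ∈ F i) (hu : u - u' ∈ F i) :
    (phiOp (br z) u - u) - (phiOp (br z') u' - u') ∈ F (i + 1) := by
  have hpow : ∀ n, ((br z) ^ n) u - ((br z') ^ n) u' ∈ F i := by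
    intro n
    induction n with
    | zero => exact hu
    | succ n ih =>
      rw [pow_succ', pow_succ', Module.End.mul_apply, Module.End.mul_apply]
      have h1 : (br z) (((br z) ^ n) u) - (br z') (((br z') ^ n) u')
          = br z (((br z) ^ n) u - ((br z') ^ n) u') - br (((br z') ^ n) u') (z - z') := by
        rw [hl.skew _ (z - z')]
        simp only [map_sub, LinearMap.sub_apply]; abel
      rw [h1]
      exact h.anti i (sub_mem (h.act _ _ _ ih) (h.act _ _ _ hz))
  have hpow' : ∀ n, ((br z) ^ (n + 1)) u - ((br z') ^ (n + 1)) u' ∈ F (i + 1) := by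
    intro n
    rw [pow_succ', pow_succ', Module.End.mul_apply, Module.End.mul_apply]
    have h1 : (br z) (((br z) ^ n) u) - (br z') (((br z') ^ n) u')
        = br z (((br z) ^ n) u - ((br z') ^ n) u') - br (((br z') ^ n) u') (z - z') := by
      rw [hl.skew _ (z - z')]
      simp only [map_sub, LinearMap.sub_apply]; abel
    rw [h1]
    exact sub_mem (h.act _ _ _ (hpow n)) (h.act _ _ _ hz)
  have hz0 : ∀ x : L, (br x) ^ (N + 1) = 0 := fun x =>
    pow_eq_zero_of_le (Nat.le_succ N) (h.pow_eq_zero x)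
  have hexp : ∀ x v : L, phiOp (br x) v - v
      = ∑ n ∈ Finset.range N, PowerSeries.coeff (n + 1) (phiS k) • ((br x) ^ (n + 1)) v := by
    intro x v
    rw [phiOp, nser_apply _ (hz0 x), Finset.sum_range_succ']
    simp [phiS]
  rw [hexp, hexp, ← Finset.sum_sub_distrib]
  refine sum_mem fun n _ => ?_
  rw [← smul_sub]
  exact Submodule.smul_mem _ _ (hpow' n)

theorem exists_logDer (h : FiltAct br F N) (hl : IsLie br) (hp : Prim F der ev int) (a : L) :
    ∃ z, phiOp (br z) (der z) = a ∧ ev z = 0 := by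
  set Ψ : L → L := fun z => int (a - (phiOp (br z) (der z) - der z)) with hΨ
  have hcontr : ∀ z z' i, z - z' ∈ F i → Ψ z - Ψ z' ∈ F (i + 1) := by
    intro z z' i hz
    have h1 : Ψ z - Ψ z' = -int ((phiOp (br z) (der z) - der z)
        - (phiOp (br z') (der z') - der z')) := by
      simp only [hΨ, ← map_sub, ← map_neg]; congr 1; abel
    rw [h1]
    refine neg_mem (hp.int_mem _ _ (h.phiOp_sub_mem hl hz ?_))
    rw [← map_sub]
    exact hp.der_mem _ _ hz
  have hit : ∀ n, Ψ^[n + 1] 0 - Ψ^[n] 0 ∈ F n := by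
    intro n
    induction n with
    | zero => rw [h.zero]; trivial
    | succ n ih =>
      have := hcontr _ _ _ ih
      rwa [← Function.iterate_succ_apply' Ψ, ← Function.iterate_succ_apply' Ψ] at this
  have hfix := hit N
  rw [h.bot, Submodule.mem_bot, sub_eq_zero, Function.iterate_succ_apply'] at hfix
  refine ⟨Ψ^[N] 0, ?_, ?_⟩
  · have := congrArg der hfix
    rw [hΨ] at this
    simp only [hp.der_int] at this
    rw [← hΨ] at this
    have h2 : ∀ p q : L, a - (p - q) = q → p = a := fun p q hpq => by
      rw [sub_eq_iff_eq_add] at hpq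
      rw [hpq]; abel
    exact h2 _ _ this
  · rw [← hfix]; exact hp.ev_int _

theorem logDer_unique (h : FiltAct br F N) (hl : IsLie br) (hp : Prim F der ev int) {z z' : L}
    (hd : phiOp (br z) (der z) = phiOp (br z') (der z')) (he : ev z = ev z') : z = z' := by
  have key : ∀ i, z - z' ∈ F i := by
    intro i
    induction i with
    | zero => rw [h.zero]; trivial
    | succ i ih =>
      have h1 : der (z - z') = -((phiOp (br z) (der z) - der z)
          - (phiOp (br z') (der z') - der z')) := by
        rw [hd, map_sub]; abel
      have h2 := hp.int_der (z - z')
      rw [map_sub ev, he, sub_self, sub_zero, h1] at h2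
      rw [← h2]
      refine hp.int_mem _ _ (neg_mem (h.phiOp_sub_mem hl ih ?_))
      rw [← map_sub]
      exact hp.der_mem _ _ ih
  have := key N
  rwa [h.bot, Submodule.mem_bot, sub_eq_zero] at this

/-- Uniqueness for linear initial value problems. -/
theorem linear_unique {a : L →ₗ[k] M →ₗ[k] M} {F : ℕ → Submodule k M} (h : FiltAct a F N)
    {der ev int : M →ₗ[k] M} (hp : Prim F der ev int) (x : L) {m : M} (hd : der m = a x m)
    (he : ev m = 0) : m = 0 := by
  have key : ∀ i, m ∈ F i := by
    intro i
    induction i with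
    | zero => rw [h.zero]; trivial
    | succ i ih =>
      have h2 := hp.int_der m
      rw [he, sub_zero, hd] at h2
      rw [← h2]
      exact hp.int_mem _ _ (h.act _ _ _ ih)
  have := key N
  rwa [h.bot] at this

end LogDer

end NilpotentLie

/-! ## Extension of scalars to polynomials -/

section ScalarExtension

variable {k : Type u} [Field k] {R : Type u} [CommRing R] [Algebra k R]
  {L M : Type u} [AddCommGroup L] [Module k L] [AddCommGroup M] [Module k M]

/-- The extension of scalars of a bilinear map. -/
def extAct (R : Type u) [CommRing R] [Algebra k R] (a : L →ₗ[k] M →ₗ[k] M) :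
    (R ⊗[k] L) →ₗ[k] (R ⊗[k] M) →ₗ[k] (R ⊗[k] M) :=
  TensorProduct.map₂ (LinearMap.mul k R) a

theorem extAct_tmul (a : L →ₗ[k] M →ₗ[k] M) (f g : R) (x : L) (m : M) :
    extAct R a (f ⊗ₜ x) (g ⊗ₜ m) = (f * g) ⊗ₜ a x m := rfl

/-- The elements of `R ⊗ M` with values in the subspace `V`. -/
def extSub (R : Type u) [CommRing R] [Algebra k R] (V : Submodule k M) : Submodule k (R ⊗[k] M) :=
  LinearMap.range (TensorProduct.map (LinearMap.id : R →ₗ[k] R) V.subtype)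

theorem tmul_mem_extSub {V : Submodule k M} (f : R) {m : M} (hm : m ∈ V) :
    f ⊗ₜ[k] m ∈ extSub R V := ⟨f ⊗ₜ ⟨m, hm⟩, by simp⟩

theorem extSub_induction {V : Submodule k M} {P : R ⊗[k] M → Prop} {x : R ⊗[k] M}
    (hx : x ∈ extSub R V) (h0 : P 0) (ht : ∀ f : R, ∀ m ∈ V, P (f ⊗ₜ m))
    (ha : ∀ x y, P x → P y → P (x + y)) : P x := by
  obtain ⟨t, rfl⟩ := hx
  induction t using TensorProduct.induction_on with
  | zero => simpa using h0
  | tmul f m => exact ht f m m.2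
  | add x y hx hy => rw [map_add]; exact ha _ _ hx hy

theorem extSub_mono {V V' : Submodule k M} (h : V ≤ V') : extSub R V ≤ extSub R V' :=
  fun _ hx => extSub_induction (P := fun x => x ∈ extSub R V') hx (zero_mem _)
    (fun f _ hm => tmul_mem_extSub f (h hm)) fun _ _ => add_mem

theorem extSub_top : extSub R (⊤ : Submodule k M) = ⊤ := by
  refine eq_top_iff.2 fun x _ => ?_
  induction x using TensorProduct.induction_on with
  | zero => exact zero_mem _
  | tmul f m => exact tmul_mem_extSub f trivial
  | add x y hx hy => exact add_mem (hx trivial) (hy trivial)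

theorem extSub_bot : extSub R (⊥ : Submodule k M) = ⊥ := by
  refine eq_bot_iff.2 fun x hx => ?_
  refine extSub_induction (P := fun x => x ∈ (⊥ : Submodule k (R ⊗[k] M))) hx (zero_mem _)
    (fun f m hm => ?_) fun _ _ => add_mem
  rw [(Submodule.mem_bot k).1 hm, TensorProduct.tmul_zero]
  exact zero_mem _

theorem map_mem_extSub {R' : Type u} [CommRing R'] [Algebra k R'] {W : Type u} [AddCommGroup W]
    [Module k W] (φ : R →ₗ[k] R') (g : M →ₗ[k] W) {V : Submodule k M} {V' : Submodule k W}
    (hg : ∀ m ∈ V, g m ∈ V') {x : R ⊗[k] M} (hx : x ∈ extSub R V) :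
    TensorProduct.map φ g x ∈ extSub R' V' := by
  refine extSub_induction (P := fun x => TensorProduct.map φ g x ∈ extSub R' V') hx (by simp)
    (fun f m hm => ?_) fun x y hx hy => by rw [map_add]; exact add_mem hx hy
  rw [TensorProduct.map_tmul]
  exact tmul_mem_extSub _ (hg m hm)

theorem extAct_mem {a : L →ₗ[k] M →ₗ[k] M} {U : Submodule k L} {V V' : Submodule k M}
    (h : ∀ x ∈ U, ∀ v ∈ V, a x v ∈ V') {x : R ⊗[k] L} {v : R ⊗[k] M} (hx : x ∈ extSub R U)
    (hv : v ∈ extSub R V) : extAct R a x v ∈ extSub R V' := by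
  refine extSub_induction (P := fun x => extAct R a x v ∈ extSub R V') hx (by simp)
    (fun f l hl => ?_) fun x y hx hy => by
      rw [map_add, LinearMap.add_apply]; exact add_mem hx hy
  refine extSub_induction (P := fun v => extAct R a (f ⊗ₜ l) v ∈ extSub R V') hv (by simp)
    (fun g m hm => ?_) fun x y hx hy => by rw [map_add]; exact add_mem hx hy
  rw [extAct_tmul]
  exact tmul_mem_extSub _ (h l hl m hm)

theorem FiltAct.ext {a : L →ₗ[k] M →ₗ[k] M} {F : ℕ → Submodule k M} {N : ℕ} (h : FiltAct a F N) :
    FiltAct (extAct R a) (fun i => extSub R (F i)) N where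
  act x i v hv := extAct_mem (U := ⊤) (fun x _ v hv => h.act x i v hv)
    (by rw [extSub_top]; trivial) hv
  zero := by rw [h.zero, extSub_top]
  bot := by rw [h.bot, extSub_bot]
  anti i := extSub_mono (h.anti i)

theorem ext_induction₂ {P : R ⊗[k] L → R ⊗[k] M → Prop} (h0 : ∀ y, P 0 y) (h0' : ∀ x, P x 0)
    (ht : ∀ f x g y, P (f ⊗ₜ x) (g ⊗ₜ y)) (ha : ∀ x x' y, P x y → P x' y → P (x + x') y)
    (ha' : ∀ x y y', P x y → P x y' → P x (y + y')) (x : R ⊗[k] L) (y : R ⊗[k] M) : P x y := by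
  induction x using TensorProduct.induction_on with
  | zero => exact h0 y
  | tmul f x =>
    induction y using TensorProduct.induction_on with
    | zero => exact h0' _
    | tmul g y => exact ht f x g y
    | add y y' hy hy' => exact ha' _ _ _ hy hy'
  | add x x' hx hx' => exact ha _ _ _ hx hx'

/-- Extension of scalars preserves identities `c (b x y) = Σ`-type relations: a morphism of
bilinear maps extends. -/
theorem extAct_map {R' : Type u} [CommRing R'] [Algebra k R'] {L' M' : Type u} [AddCommGroup L']
    [Module k L'] [AddCommGroup M'] [Module k M'] {a : L →ₗ[k] M →ₗ[k] M}
    {a' : L' →ₗ[k] M' →ₗ[k] M'} (φ : R →ₐ[k] R') {g : L →ₗ[k] L'} {h : M →ₗ[k] M'}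
    (hgh : ∀ x m, h (a x m) = a' (g x) (h m)) (x : R ⊗[k] L) (m : R ⊗[k] M) :
    TensorProduct.map φ.toLinearMap h (extAct R a x m)
      = extAct R' a' (TensorProduct.map φ.toLinearMap g x) (TensorProduct.map φ.toLinearMap h m) := by
  refine ext_induction₂ (P := fun x m => TensorProduct.map φ.toLinearMap h (extAct R a x m)
      = extAct R' a' (TensorProduct.map φ.toLinearMap g x) (TensorProduct.map φ.toLinearMap h m))
      ?_ ?_ ?_ ?_ ?_ x m
  · simp
  · simp
  · intro f x g y; simp [extAct_tmul, hgh]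
  · intro x x' y hx hx'; simp only [map_add, LinearMap.add_apply, hx, hx']
  · intro x y y' hx hx'; simp only [map_add, hx, hx']

theorem IsRep.ext {br : L →ₗ[k] L →ₗ[k] L} {a : L →ₗ[k] M →ₗ[k] M} (h : IsRep br a) :
    IsRep (extAct R br) (extAct R a) := by
  intro x y v
  refine ext_induction₂ (P := fun x y => extAct R a (extAct R br x y) v
    = extAct R a x (extAct R a y v) - extAct R a y (extAct R a x v)) ?_ ?_ ?_ ?_ ?_ x y
  · simp
  · simp
  · intro f x g y
    induction v using TensorProduct.induction_on with
    | zero => simp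
    | tmul e v =>
      simp only [extAct_tmul, h x y v, TensorProduct.tmul_sub]
      congr 2 <;> ring
    | add v v' hv hv' => simp only [map_add, hv, hv']; abel
  · intro x x' y hx hx'; simp only [map_add, LinearMap.add_apply, hx, hx']; abel
  · intro x y y' hx hx'; simp only [map_add, LinearMap.add_apply, hx, hx']; abel

theorem extAct_swap {br : L →ₗ[k] L →ₗ[k] L} {g : L →ₗ[k] L} {U V : Submodule k L}
    (h : ∀ x ∈ U, ∀ y ∈ V, br x y = g (br y x)) {x y : R ⊗[k] L} (hx : x ∈ extSub R U)
    (hy : y ∈ extSub R V) :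
    extAct R br x y = TensorProduct.map LinearMap.id g (extAct R br y x) := by
  refine extSub_induction (P := fun x => extAct R br x y
      = TensorProduct.map LinearMap.id g (extAct R br y x)) hx (by simp)
    (fun f l hl => ?_) fun x y hx hy => by simp only [map_add, LinearMap.add_apply, hx, hy]
  refine extSub_induction (P := fun y => extAct R br (f ⊗ₜ l) y
      = TensorProduct.map LinearMap.id g (extAct R br y (f ⊗ₜ l))) hy
    (by simp) (fun e m hm => ?_)
    fun x y hx hy => by simp only [map_add, LinearMap.add_apply, hx, hy]
  rw [extAct_tmul, extAct_tmul, h l hl m hm, mul_comm, TensorProduct.map_tmul, LinearMap.id_apply]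

theorem extAct_symm {br : L →ₗ[k] L →ₗ[k] L} {U V : Submodule k L}
    (h : ∀ x ∈ U, ∀ y ∈ V, br x y = br y x) {x y : R ⊗[k] L} (hx : x ∈ extSub R U)
    (hy : y ∈ extSub R V) : extAct R br x y = extAct R br y x := by
  rw [extAct_swap (g := LinearMap.id) h hx hy, TensorProduct.map_id, LinearMap.id_apply]

theorem extAct_antisymm {br : L →ₗ[k] L →ₗ[k] L} {U V : Submodule k L}
    (h : ∀ x ∈ U, ∀ y ∈ V, br x y = -br y x) {x y : R ⊗[k] L} (hx : x ∈ extSub R U)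
    (hy : y ∈ extSub R V) : extAct R br x y = -extAct R br y x := by
  have h1 : TensorProduct.map (LinearMap.id : R →ₗ[k] R) (-LinearMap.id : L →ₗ[k] L)
      = -LinearMap.id := TensorProduct.ext' fun f x => by simp [TensorProduct.tmul_neg]
  rw [extAct_swap (g := -LinearMap.id) h hx hy, h1]
  rfl

theorem IsLie.ext {br : L →ₗ[k] L →ₗ[k] L} (h : IsLie br) : IsLie (extAct R br) where
  alt x := by
    induction x using TensorProduct.induction_on with
    | zero => simp
    | tmul f x => rw [extAct_tmul, h.alt, TensorProduct.tmul_zero]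
    | add x y hx hy =>
      have h1 := extAct_antisymm (R := R) (br := br) (U := ⊤) (V := ⊤)
        (fun x _ y _ => h.skew x y) (x := x) (y := y)
        (by rw [extSub_top]; trivial) (by rw [extSub_top]; trivial)
      simp only [map_add, LinearMap.add_apply, hx, hy, h1]
      abel
  jac := IsRep.ext (R := R) h.isRep

theorem smul_extAct (a : L →ₗ[k] M →ₗ[k] M) (f : R) (x : R ⊗[k] L) (m : R ⊗[k] M) :
    extAct R a x (f • m) = f • extAct R a x m := by
  refine ext_induction₂ (P := fun x m => extAct R a x (f • m) = f • extAct R a x m) ?_ ?_ ?_ ?_ ?_ x m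
  · simp
  · simp
  · intro e x g y
    rw [TensorProduct.smul_tmul', extAct_tmul, extAct_tmul, TensorProduct.smul_tmul']
    congr 1; simp only [smul_eq_mul]; ring
  · intro x x' y hx hx'; simp only [map_add, LinearMap.add_apply, smul_add, hx, hx']
  · intro x y y' hx hx'; simp only [map_add, smul_add, hx, hx']

theorem extAct_smul (a : L →ₗ[k] M →ₗ[k] M) (f : R) (x : R ⊗[k] L) (m : R ⊗[k] M) :
    extAct R a (f • x) m = f • extAct R a x m := by
  refine ext_induction₂ (P := fun x m => extAct R a (f • x) m = f • extAct R a x m) ?_ ?_ ?_ ?_ ?_ x m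
  · simp
  · simp
  · intro e x g y
    rw [TensorProduct.smul_tmul', extAct_tmul, extAct_tmul, TensorProduct.smul_tmul']
    congr 1; simp only [smul_eq_mul]; ring
  · intro x x' y hx hx'; simp only [map_add, LinearMap.add_apply, smul_add, hx, hx']
  · intro x y y' hx hx'; simp only [map_add, smul_add, hx, hx']

theorem extAct_derivation (D : Derivation k R R) (a : L →ₗ[k] M →ₗ[k] M) (x : R ⊗[k] L)
    (m : R ⊗[k] M) :
    TensorProduct.map D.toLinearMap (LinearMap.id : M →ₗ[k] M) (extAct R a x m) =
      extAct R a (TensorProduct.map D.toLinearMap LinearMap.id x) m +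
      extAct R a x (TensorProduct.map D.toLinearMap LinearMap.id m) := by
  refine ext_induction₂ (P := fun x m =>
    TensorProduct.map D.toLinearMap (LinearMap.id : M →ₗ[k] M) (extAct R a x m) =
      extAct R a (TensorProduct.map D.toLinearMap LinearMap.id x) m +
      extAct R a x (TensorProduct.map D.toLinearMap LinearMap.id m)) ?_ ?_ ?_ ?_ ?_ x m
  · simp
  · simp
  · intro f x g y
    simp only [extAct_tmul, TensorProduct.map_tmul, LinearMap.id_apply, 
      Derivation.coeFn_coe, Derivation.leibniz, TensorProduct.add_tmul, smul_eq_mul]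
    rw [add_comm, mul_comm g]
  · intro x x' y hx hx'; simp only [map_add, LinearMap.add_apply, hx, hx']; abel
  · intro x y y' hx hx'; simp only [map_add, hx, hx']; abel

end ScalarExtension

section Antiderivative

variable {k : Type u} [Field k] {m : ℕ}

/-- The antiderivative of a polynomial with respect to `xⱼ` which vanishes for `xⱼ = 0`. -/
def antideriv (j : Fin m) : AffPoly k m →ₗ[k] AffPoly k m :=
  (MvPolynomial.basisMonomials (Fin m) k).constr k fun s =>
    MvPolynomial.monomial (s + Finsupp.single j 1) (((s j + 1 : ℕ) : k)⁻¹)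

/-- The substitution `xⱼ = c`. -/
def setVar (j : Fin m) (c : k) : AffPoly k m →ₐ[k] AffPoly k m :=
  MvPolynomial.aeval (Function.update MvPolynomial.X j (MvPolynomial.C c))

theorem antideriv_monomial (j : Fin m) (s : Fin m →₀ ℕ) (c : k) :
    antideriv j (MvPolynomial.monomial s c)
      = MvPolynomial.monomial (s + Finsupp.single j 1) (c * ((s j + 1 : ℕ) : k)⁻¹) := by
  have h : MvPolynomial.monomial s c = c • MvPolynomial.basisMonomials (Fin m) k s := by
    simp [MvPolynomial.smul_monomial]
  rw [h, map_smul, antideriv, Module.Basis.constr_basis, MvPolynomial.smul_monomial, smul_eq_mul]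

theorem setVar_zero_monomial (j : Fin m) (s : Fin m →₀ ℕ) (c : k) :
    setVar j 0 (MvPolynomial.monomial s c) = if s j = 0 then MvPolynomial.monomial s c else 0 := by
  rw [setVar, MvPolynomial.aeval_monomial]
  split_ifs with h
  · rw [MvPolynomial.monomial_eq, MvPolynomial.algebraMap_eq]
    congr 1
    refine Finsupp.prod_congr fun i hi => ?_
    have hij : i ≠ j := by rintro rfl; exact (Finsupp.mem_support_iff.1 hi) h
    rw [Function.update_of_ne hij]
  · rw [Finsupp.prod, Finset.prod_eq_zero (i := j) (Finsupp.mem_support_iff.2 h) (by simp [h]),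
      mul_zero]

theorem linearMap_ext_monomial {W : Type u} [AddCommGroup W] [Module k W]
    {f g : AffPoly k m →ₗ[k] W}
    (h : ∀ s, f (MvPolynomial.monomial s 1) = g (MvPolynomial.monomial s 1)) : f = g :=
  (MvPolynomial.basisMonomials (Fin m) k).ext fun s => by simpa using h s

variable [CharZero k]

theorem pderiv_antideriv (j : Fin m) (f : AffPoly k m) :
    MvPolynomial.pderiv j (antideriv j f) = f := by
  have : (MvPolynomial.pderiv j).toLinearMap ∘ₗ antideriv (k := k) j = LinearMap.id := by
    refine linearMap_ext_monomial fun s => ?_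
    have h : ((s j : k) + 1) ≠ 0 := by exact_mod_cast Nat.succ_ne_zero (s j)
    simp [antideriv_monomial, MvPolynomial.pderiv_monomial, h]
  exact DFunLike.congr_fun this f

theorem setVar_antideriv (j : Fin m) (f : AffPoly k m) : setVar j 0 (antideriv j f) = 0 := by
  have : (setVar j (0 : k)).toLinearMap ∘ₗ antideriv (k := k) j = 0 := by
    refine linearMap_ext_monomial fun s => ?_
    simp [antideriv_monomial, setVar_zero_monomial]
  exact DFunLike.congr_fun this f

theorem antideriv_pderiv (j : Fin m) (f : AffPoly k m) :
    antideriv j (MvPolynomial.pderiv j f) = f - setVar j 0 f := by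
  have : antideriv (k := k) j ∘ₗ (MvPolynomial.pderiv j).toLinearMap
      = LinearMap.id - (setVar j (0 : k)).toLinearMap := by
    refine linearMap_ext_monomial fun s => ?_
    simp only [LinearMap.comp_apply, Derivation.coeFn_coe,
      MvPolynomial.pderiv_monomial, antideriv_monomial, LinearMap.sub_apply, LinearMap.id_apply,
      AlgHom.toLinearMap_apply, setVar_zero_monomial]
    split_ifs with h
    · simp [h]
    · have h1 : 1 ≤ s j := Nat.one_le_iff_ne_zero.2 h
      have h2 : s - Finsupp.single j 1 + Finsupp.single j 1 = s := by
        refine tsub_add_cancel_of_le ?_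
        simpa using h1
      have h3 : ((s - Finsupp.single j 1 : Fin m →₀ ℕ) j + 1) = s j := by
        simp; omega
      rw [h2, h3, one_mul, mul_inv_cancel₀ (by exact_mod_cast h), sub_zero]
  exact DFunLike.congr_fun this f

theorem prim_ext {M : Type u} [AddCommGroup M] [Module k M] (F : ℕ → Submodule k M) (j : Fin m) :
    Prim (fun i => extSub (AffPoly k m) (F i))
      (TensorProduct.map (MvPolynomial.pderiv j).toLinearMap LinearMap.id)
      (TensorProduct.map (setVar j (0 : k)).toLinearMap LinearMap.id)
      (TensorProduct.map (antideriv j) LinearMap.id) where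
  der_int x := by
    induction x using TensorProduct.induction_on with
    | zero => simp
    | tmul f x => simp [pderiv_antideriv]
    | add x y hx hy => simp only [map_add, hx, hy]
  ev_int x := by
    induction x using TensorProduct.induction_on with
    | zero => simp
    | tmul f x => simp [setVar_antideriv]
    | add x y hx hy => simp only [map_add, hx, hy, add_zero]
  int_der x := by
    induction x using TensorProduct.induction_on with
    | zero => simp
    | tmul f x => simp [antideriv_pderiv, TensorProduct.sub_tmul]
    | add x y hx hy => simp only [map_add, hx, hy]; abel
  der_mem _ _ hx := map_mem_extSub _ _ (fun _ h => h) hx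
  int_mem _ _ hx := map_mem_extSub _ _ (fun _ h => h) hx

end Antiderivative

/-! ## The Baker–Campbell–Hausdorff formula -/

section Dynkin

variable {k : Type u} [Field k] {L : Type u} [AddCommGroup L] [Module k L]

/-- The lists of length `n` with entries in `B`. -/
def listsOf (B : Finset (ℕ × ℕ)) : ℕ → Finset (List (ℕ × ℕ))
  | 0 => {[]}
  | n + 1 => (B ×ˢ listsOf B n).image fun p => p.1 :: p.2

theorem mem_listsOf {B : Finset (ℕ × ℕ)} {n : ℕ} {l : List (ℕ × ℕ)} :
    l ∈ listsOf B n ↔ l.length = n ∧ ∀ p ∈ l, p ∈ B := by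
  induction n generalizing l with
  | zero => simp only [listsOf, Finset.mem_singleton, List.length_eq_zero_iff]; aesop
  | succ n ih =>
    cases l with
    | nil => simp [listsOf]
    | cons p l => simp [listsOf, ih]; tauto

theorem sum_listsOf_succ {W : Type u} [AddCommMonoid W] (B : Finset (ℕ × ℕ)) (n : ℕ)
    (f : List (ℕ × ℕ) → W) :
    ∑ l ∈ listsOf B (n + 1), f l = ∑ p ∈ B, ∑ l ∈ listsOf B n, f (p :: l) := by
  rw [listsOf, Finset.sum_image, Finset.sum_product]
  rintro ⟨p, l⟩ - ⟨p', l'⟩ - h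
  simpa using h

/-- The index pairs `(r, s) ≠ (0, 0)` with entries less than `K`. -/
def pairBox (K : ℕ) : Finset (ℕ × ℕ) := (Finset.range K ×ˢ Finset.range K).erase (0, 0)

theorem pos_of_mem_pairBox {K : ℕ} {p : ℕ × ℕ} (h : p ∈ pairBox K) : 0 < p.1 + p.2 := by
  obtain ⟨h1, -⟩ := Finset.mem_erase.1 h
  by_contra h2
  exact h1 (Prod.ext (by simp; omega) (by simp; omega))

variable {br : L →ₗ[k] L →ₗ[k] L} {F : ℕ → Submodule k L} {N : ℕ}

/-- The factor `∏ 1 / (rᵢ! sᵢ!)` times the nested bracket of `x^{r₁} y^{s₁} ⋯`. -/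
def bchMonomial (br : L →ₗ[k] L →ₗ[k] L) (x y : L) (l : List (ℕ × ℕ)) : L :=
  (l.map fun p => ((p.1.factorial : k) * (p.2.factorial : k))⁻¹).prod •
    nestedBracket br (bchWord x y l)

theorem bchWord_ne_nil (x y : L) {p : ℕ × ℕ} (l : List (ℕ × ℕ)) (hp : 0 < p.1 + p.2) :
    bchWord x y (p :: l) ≠ [] := by
  intro h
  have h1 := congrArg List.length h
  rw [length_bchWord] at h1
  simp at h1
  omega

theorem nestedBracket_replicate_append (x : L) (r : ℕ) {w : List L} (hw : w ≠ []) :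
    nestedBracket br (List.replicate r x ++ w) = ((br x) ^ r) (nestedBracket br w) := by
  induction r with
  | zero => rfl
  | succ r ih =>
    rw [List.replicate_succ, List.cons_append, pow_succ', Module.End.mul_apply, ← ih]
    have h : List.replicate r x ++ w ≠ [] := by simp [hw]
    obtain ⟨y, l, hl⟩ := List.exists_cons_of_ne_nil h
    rw [hl, nestedBracket]

theorem bchMonomial_cons (x y : L) (p : ℕ × ℕ) {l : List (ℕ × ℕ)} (hl : bchWord x y l ≠ []) :
    bchMonomial br x y (p :: l) = ((p.1.factorial : k) * (p.2.factorial : k))⁻¹ •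
      ((br x) ^ p.1) (((br y) ^ p.2) (bchMonomial br x y l)) := by
  have h : bchWord x y (p :: l)
      = List.replicate p.1 x ++ (List.replicate p.2 y ++ bchWord x y l) := by
    simp [bchWord]
  rw [bchMonomial, h, nestedBracket_replicate_append _ _ (by simp [hl]),
    nestedBracket_replicate_append _ _ hl, bchMonomial]
  simp [mul_smul]

theorem nestedBracket_replicate (hl : IsLie br) (x : L) {r : ℕ} (hr : 2 ≤ r) :
    nestedBracket br (List.replicate r x) = 0 := by
  obtain ⟨r, rfl⟩ := Nat.exists_eq_add_of_le' hr
  have : List.replicate (r + 2) x = List.replicate r x ++ [x, x] := by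
    rw [List.replicate_add]; rfl
  rw [this, nestedBracket_replicate_append _ _ (by simp)]
  simp [nestedBracket, hl.alt]

theorem bchMonomial_single (hl : IsLie br) (x y : L) (p : ℕ × ℕ) :
    bchMonomial br x y [p] = (if p.2 = 1 then ((p.1.factorial : k))⁻¹ • ((br x) ^ p.1) y else 0) +
      if p = (1, 0) then x else 0 := by
  obtain ⟨r, s⟩ := p
  have h : bchWord x y [(r, s)] = List.replicate r x ++ List.replicate s y := by simp [bchWord]
  rw [bchMonomial, h]
  rcases s with _ | _ | s
  · rcases r with _ | _ | r
    · simp [nestedBracket]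
    · simp [nestedBracket]
    · have := nestedBracket_replicate hl x (r := r + 2) (by omega)
      simp [this]
  · rw [nestedBracket_replicate_append _ _ (by simp)]
    simp [nestedBracket]
  · rw [nestedBracket_replicate_append _ _ (by simp), nestedBracket_replicate hl _ (by omega)]
    simp

theorem expOp_sum {M : Type u} [AddCommGroup M] [Module k M] {T : Module.End k M} {K : ℕ}
    (h : T ^ K = 0) (v : M) :
    expOp T v = ∑ i ∈ Finset.range K, ((i.factorial : k))⁻¹ • (T ^ i) v := by
  rw [expOp, nser_apply _ h]
  simp [expS]

theorem sum_bchMonomial [CharZero k] (h : FiltAct br F N) (hl : IsLie br) (x y : L) (n : ℕ) :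
    ∑ l ∈ listsOf (pairBox (N + 2)) (n + 1), bchMonomial br x y l =
      ((expOp (br x) * expOp (br y) - 1) ^ n) (x + expOp (br x) y) := by
  have hz : ∀ x : L, (br x) ^ (N + 2) = 0 := fun x =>
    pow_eq_zero_of_le (by omega) (h.pow_eq_zero x)
  induction n with
  | zero =>
    rw [sum_listsOf_succ]
    have h0 : bchMonomial br x y [(0, 0)] = 0 := by simp [bchMonomial, bchWord, nestedBracket]
    simp only [listsOf, Finset.sum_singleton]
    rw [pairBox, Finset.sum_erase (f := fun p => bchMonomial br x y [p]) _ h0, Finset.sum_congr rfl fun p _ => bchMonomial_single hl x y p,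
      Finset.sum_add_distrib, Finset.sum_product]
    simp only [Finset.sum_ite_eq']
    rw [expOp_sum (hz x)]
    simp [add_comm]
  | succ n ih =>
    rw [sum_listsOf_succ, pow_succ', Module.End.mul_apply, ← ih]
    set v := ∑ l ∈ listsOf (pairBox (N + 2)) (n + 1), bchMonomial br x y l with hv
    have h1 : ∀ p ∈ pairBox (N + 2),
        ∑ l ∈ listsOf (pairBox (N + 2)) (n + 1), bchMonomial br x y (p :: l)
        = ((p.1.factorial : k) * (p.2.factorial : k))⁻¹ • ((br x) ^ p.1) (((br y) ^ p.2) v) := by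
      intro p _
      rw [hv, map_sum, map_sum, Finset.smul_sum]
      refine Finset.sum_congr rfl fun l hm => bchMonomial_cons x y p ?_
      obtain ⟨hlen, hmem⟩ := mem_listsOf.1 hm
      obtain ⟨q, l', rfl⟩ := List.exists_cons_of_length_eq_add_one hlen
      exact bchWord_ne_nil x y l' (pos_of_mem_pairBox (hmem q (by simp)))
    rw [Finset.sum_congr rfl h1, pairBox, ← add_left_inj v, LinearMap.sub_apply, Module.End.one_apply,
      sub_add_cancel]
    have h2 := Finset.sum_erase_add (Finset.range (N + 2) ×ˢ Finset.range (N + 2))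
      (fun p : ℕ × ℕ => ((p.1.factorial : k) * (p.2.factorial : k))⁻¹ •
        ((br x) ^ p.1) (((br y) ^ p.2) v)) (a := (0, 0)) (by simp)
    simp only [Nat.factorial_zero, Nat.cast_one, mul_one, inv_one, one_smul, pow_zero,
      Module.End.one_apply] at h2
    rw [h2, Finset.sum_product, Module.End.mul_apply, expOp_sum (hz x)]
    refine Finset.sum_congr rfl fun i _ => ?_
    rw [expOp_sum (hz y), map_sum, Finset.smul_sum]
    refine Finset.sum_congr rfl fun j _ => ?_
    rw [map_smul, smul_smul, mul_inv]

theorem bch_eq_sum (h : FiltAct br F N) (x y : L) :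
    bch br x y = ∑ n ∈ Finset.range (N + 2), ∑ l ∈ listsOf (pairBox (N + 2)) (n + 1),
      bchTerm br x y l := by
  have hdisj : (Finset.range (N + 2) : Set ℕ).PairwiseDisjoint
      fun n => listsOf (pairBox (N + 2)) (n + 1) := by
    intro i _ j _ hij
    refine Finset.disjoint_left.2 fun l hi hj => hij ?_
    have := (mem_listsOf.1 hi).1.symm.trans (mem_listsOf.1 hj).1
    omega
  rw [← Finset.sum_biUnion hdisj, bch]
  refine finsum_eq_sum_of_support_subset _ fun l hl => ?_
  rw [Function.mem_support, bchTerm] at hl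
  split_ifs at hl with hc
  · have hsum : (l.map fun p => p.1 + p.2).sum ≤ N := by
      by_contra hlt
      rw [not_le, ← length_bchWord x y] at hlt
      exact hl (by rw [h.nilpBracket.nested_eq_zero _ hlt, smul_zero])
    have hle : ∀ p ∈ l, p.1 + p.2 ≤ N := fun p hp =>
      (List.single_le_sum (by simp) _ (List.mem_map_of_mem hp)).trans hsum
    have hlen : l.length ≤ N := by
      refine le_trans ?_ hsum
      have := List.length_le_sum_of_one_le (l.map fun p => p.1 + p.2) (by
        intro i hi
        obtain ⟨p, hp, rfl⟩ := List.mem_map.1 hi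
        exact hc.2 p hp)
      simpa using this
    have hpos : 0 < l.length := List.length_pos_iff.2 hc.1
    rw [Finset.coe_biUnion, Set.mem_iUnion₂]
    refine ⟨l.length - 1, by simp; omega, mem_listsOf.2 ⟨by omega, fun p hp => ?_⟩⟩
    have h1 := hle p hp
    have h2 := hc.2 p hp
    refine Finset.mem_erase.2 ⟨fun h0 => by rw [h0] at h2; simp at h2, ?_⟩
    rw [Finset.mem_product, Finset.mem_range, Finset.mem_range]
    omega
  · exact absurd rfl hl

theorem der_nestedBracket {θ : L →ₗ[k] L} (hθ : ∀ u v, θ (br u v) = br (θ u) v + br u (θ v))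
    (w : List L) (hw : ∀ u ∈ w, θ u = u) :
    θ (nestedBracket br w) = (w.length : k) • nestedBracket br w := by
  match w with
  | [] => simp [nestedBracket]
  | [u] => simpa [nestedBracket] using hw u
  | u :: v :: l =>
    have ih := der_nestedBracket hθ (v :: l) fun x hx => hw x (List.mem_cons_of_mem _ hx)
    rw [nestedBracket, hθ, hw u (by simp), ih, map_smul]
    simp only [List.length_cons, Nat.cast_add, Nat.cast_one, add_smul, one_smul]
    abel

/-- Dynkin's formula, differentiated along a derivation `θ` with `θ x = x` and `θ y = y`. -/
theorem der_bch [CharZero k] (h : FiltAct br F N) (hl : IsLie br) {θ : L →ₗ[k] L}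
    (hθ : ∀ u v, θ (br u v) = br (θ u) v + br u (θ v)) {x y : L} (hx : θ x = x) (hy : θ y = y) :
    θ (bch br x y) = logQuot (k := k) (N + 2) (expOp (br x) * expOp (br y) - 1)
      (x + expOp (br x) y) := by
  rw [bch_eq_sum h, map_sum, logQuot, LinearMap.sum_apply]
  refine Finset.sum_congr rfl fun n _ => ?_
  rw [LinearMap.smul_apply, ← sum_bchMonomial h hl, map_sum, Finset.smul_sum]
  refine Finset.sum_congr rfl fun l hm => ?_
  obtain ⟨hlen, hmem⟩ := mem_listsOf.1 hm
  have hc : l ≠ [] ∧ ∀ p ∈ l, 0 < p.1 + p.2 :=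
    ⟨fun h0 => by rw [h0] at hlen; simp at hlen, fun p hp => pos_of_mem_pairBox (hmem p hp)⟩
  rw [bchTerm, if_pos hc, map_smul, der_nestedBracket hθ, length_bchWord, bchMonomial, smul_smul,
    smul_smul, hlen, Nat.add_sub_cancel]
  · congr 1
    have hne : (((l.map fun p => p.1 + p.2).sum : ℕ) : k) ≠ 0 := by
      obtain ⟨p, l, rfl⟩ := List.exists_cons_of_ne_nil hc.1
      have := hc.2 p (by simp)
      rw [List.map_cons, List.sum_cons]
      exact_mod_cast (by omega)
    field_simp
  · intro u hu
    rw [bchWord, List.mem_flatMap] at hu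
    obtain ⟨p, -, hu⟩ := hu
    rcases List.mem_append.1 hu with hu | hu
    · rw [List.eq_of_mem_replicate hu, hx]
    · rw [List.eq_of_mem_replicate hu, hy]

/-- If all brackets of `x` and `y` vanish, the Baker–Campbell–Hausdorff product is the sum. -/
theorem bch_of_comm {x y : L} (hxx : br x x = 0) (hxy : br x y = 0) (hyx : br y x = 0)
    (hyy : br y y = 0) : bch br x y = x + y := by
  have hnest : ∀ w : List L, (∀ u ∈ w, u = x ∨ u = y) → 2 ≤ w.length → nestedBracket br w = 0 := by
    intro w
    induction w with
    | nil => simp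
    | cons u w ih =>
      intro hw hlen
      match w, ih, hw, hlen with
      | [v], ih, hw, hlen =>
        have h1 := hw u (by simp)
        have h2 := hw v (by simp)
        rcases h1 with rfl | rfl <;> rcases h2 with rfl | rfl <;> simpa [nestedBracket]
      | v :: v' :: l, ih, hw, hlen =>
        rw [nestedBracket, ih (fun u hu => hw u (List.mem_cons_of_mem _ hu)) (by simp), map_zero]
  have hmem : ∀ l, ∀ u ∈ bchWord x y l, u = x ∨ u = y := by
    intro l u hu
    rw [bchWord, List.mem_flatMap] at hu
    obtain ⟨p, -, hu⟩ := hu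
    rcases List.mem_append.1 hu with hu | hu
    · exact .inl (List.eq_of_mem_replicate hu)
    · exact .inr (List.eq_of_mem_replicate hu)
  have hsupp : Function.support (bchTerm br x y) ⊆ (({[(1, 0)], [(0, 1)]} : Finset _) : Set _) := by
    intro l hl
    rw [Function.mem_support, bchTerm] at hl
    split_ifs at hl with hc
    · by_contra hne
      refine hl ?_
      rw [hnest _ (hmem l), smul_zero]
      rw [length_bchWord]
      obtain ⟨p, l, rfl⟩ := List.exists_cons_of_ne_nil hc.1
      have hp := hc.2 p (by simp)
      cases l with
      | nil =>
        obtain ⟨r, s⟩ := p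
        simp at hne hp ⊢
        omega
      | cons q l =>
        have hq := hc.2 q (by simp)
        simp
        omega
    · exact absurd rfl hl
  rw [bch, finsum_eq_sum_of_support_subset _ hsupp, Finset.sum_pair (by simp)]
  simp [bchTerm, bchWord, nestedBracket]

end Dynkin

section BCH

variable {k : Type u} [Field k] [CharZero k] {L M : Type u} [AddCommGroup L] [Module k L]
  [AddCommGroup M] [Module k M] {br : L →ₗ[k] L →ₗ[k] L} {a : L →ₗ[k] M →ₗ[k] M}
  {F : ℕ → Submodule k L} {N : ℕ} {FM : ℕ → Submodule k M} {NM : ℕ}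

theorem bch_zero_zero : bch br 0 0 = 0 := by
  rw [bch_of_comm] <;> simp

/-- The variable `t` of the polynomial ring in one variable. -/
def tVar (k : Type u) [Field k] : AffPoly k 1 := MvPolynomial.X 0

/-- The derivative with respect to `t`. -/
def tDer (k : Type u) [Field k] (M : Type u) [AddCommGroup M] [Module k M] :
    AffPoly k 1 ⊗[k] M →ₗ[k] AffPoly k 1 ⊗[k] M :=
  TensorProduct.map (MvPolynomial.pderiv 0).toLinearMap LinearMap.id

/-- The value at `t = c`. -/
def tEval (c : k) (M : Type u) [AddCommGroup M] [Module k M] : AffPoly k 1 ⊗[k] M →ₗ[k] M :=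
  (TensorProduct.lid k M).toLinearMap ∘ₗ
    TensorProduct.map (MvPolynomial.aeval (fun _ : Fin 1 => c)).toLinearMap LinearMap.id

theorem tEval_tmul (c : k) (f : AffPoly k 1) (m : M) :
    tEval c M (f ⊗ₜ m) = MvPolynomial.aeval (fun _ : Fin 1 => c) f • m := by simp [tEval]

theorem tDer_tmul (f : AffPoly k 1) (m : M) :
    tDer k M (f ⊗ₜ m) = MvPolynomial.pderiv 0 f ⊗ₜ m := by simp [tDer]

theorem tEval_act (c : k) (a : L →ₗ[k] M →ₗ[k] M) (x : AffPoly k 1 ⊗[k] L)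
    (m : AffPoly k 1 ⊗[k] M) :
    tEval c M (extAct _ a x m) = a (tEval c L x) (tEval c M m) := by
  refine ext_induction₂ (P := fun x m => tEval c M (extAct _ a x m)
    = a (tEval c L x) (tEval c M m)) ?_ ?_ ?_ ?_ ?_ x m
  · simp
  · simp
  · intro f x g y
    rw [extAct_tmul, tEval_tmul, tEval_tmul, tEval_tmul, map_mul, map_smul, map_smul,
      LinearMap.smul_apply, smul_smul, mul_comm]
  · intro x x' y hx hx'; simp only [map_add, LinearMap.add_apply, hx, hx']
  · intro x y y' hx hx'; simp only [map_add, hx, hx']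

theorem tDer_act (a : L →ₗ[k] M →ₗ[k] M) (x : AffPoly k 1 ⊗[k] L) (m : AffPoly k 1 ⊗[k] M) :
    tDer k M (extAct _ a x m) = extAct _ a (tDer k L x) m + extAct _ a x (tDer k M m) :=
  extAct_derivation (MvPolynomial.pderiv 0) a x m

theorem setVar_fin_one (f : AffPoly k 1) (c : k) :
    setVar 0 c f = algebraMap k _ (MvPolynomial.aeval (fun _ : Fin 1 => c) f) := by
  have : setVar (0 : Fin 1) c
      = (Algebra.ofId k (AffPoly k 1)).comp (MvPolynomial.aeval (fun _ : Fin 1 => c)) := by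
    refine MvPolynomial.algHom_ext fun i => ?_
    obtain rfl : i = 0 := Subsingleton.elim _ _
    simp [setVar, Algebra.ofId_apply, MvPolynomial.algebraMap_eq]
  rw [this]; rfl

theorem tPrim (F : ℕ → Submodule k M) :
    Prim (fun i => extSub (AffPoly k 1) (F i)) (tDer k M)
      ((TensorProduct.mk k (AffPoly k 1) M 1) ∘ₗ tEval 0 M)
      (TensorProduct.map (antideriv 0) LinearMap.id) := by
  have h : TensorProduct.map (setVar (0 : Fin 1) (0 : k)).toLinearMap (LinearMap.id : M →ₗ[k] M)
      = (TensorProduct.mk k (AffPoly k 1) M 1) ∘ₗ tEval 0 M := by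
    refine TensorProduct.ext' fun f m => ?_
    simp only [TensorProduct.map_tmul, AlgHom.toLinearMap_apply, setVar_fin_one, LinearMap.id_apply,
      LinearMap.comp_apply, TensorProduct.mk_apply, tEval_tmul, Algebra.algebraMap_eq_smul_one,
      TensorProduct.smul_tmul]
  rw [← h]
  exact prim_ext F 0

theorem tEval_expOp (ha : FiltAct a FM NM) (c : k) (x : AffPoly k 1 ⊗[k] L)
    (m : AffPoly k 1 ⊗[k] M) :
    tEval c M (expOp (extAct _ a x) m) = expOp (a (tEval c L x)) (tEval c M m) :=
  nser_intertwine (ha.ext.nilp _) (ha.nilp _) (tEval c M) (fun v => tEval_act c a x v) _ m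

theorem expOp_smul (ha : FiltAct a FM NM) (f : AffPoly k 1) (x : AffPoly k 1 ⊗[k] L)
    (m : AffPoly k 1 ⊗[k] M) :
    expOp (extAct _ a x) (f • m) = f • expOp (extAct _ a x) m :=
  (nser_intertwine (ha.ext.nilp x) (ha.ext.nilp x)
    (LinearMap.lsmul (AffPoly k 1) (AffPoly k 1 ⊗[k] M) f |>.restrictScalars k)
    (fun v => (smul_extAct a f x v).symm) _ m).symm

theorem smul_tVar_injective {v : AffPoly k 1 ⊗[k] M} (h : tVar k • v = 0) : v = 0 := by
  have hinj : Function.Injective (LinearMap.mulLeft k (tVar k)) := fun f g hfg =>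
    mul_left_cancel₀ (MvPolynomial.X_ne_zero (R := k) (0 : Fin 1)) hfg
  have h1 := Module.Flat.rTensor_preserves_injective_linearMap (M := M) _ hinj
  refine h1 (a₁ := v) (a₂ := 0) ?_
  rw [map_zero, ← h]
  clear h
  induction v using TensorProduct.induction_on with
  | zero => simp
  | tmul f m => simp [TensorProduct.smul_tmul']
  | add x y hx hy => rw [map_add, smul_add, hx, hy]

theorem phiOp_of_zero {T : Module.End k M} (h : IsNilpotent T) {v : M} (hv : T v = 0) :
    phiOp T v = v := by
  obtain ⟨n, hn⟩ := h
  have hn' : T ^ (n + 1) = 0 := pow_eq_zero_of_le (Nat.le_succ n) hn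
  rw [phiOp, nser_apply _ hn', Finset.sum_range_succ', Finset.sum_eq_zero]
  · simp [phiS]
  · intro i _
    rw [pow_succ, Module.End.mul_apply, hv, map_zero, smul_zero]

/-- The logarithm `ℓ` of `exp (t x) exp (t y)`, before it is identified with the
Baker–Campbell–Hausdorff product. -/
theorem expOp_of_logDer (hb : FiltAct br F N) (hl : IsLie br) (ha : FiltAct a FM NM)
    (hr : IsRep br a) (x y : L) {ℓ : AffPoly k 1 ⊗[k] L}
    (h1 : phiOp (extAct _ br ℓ) (tDer k L ℓ)
      = 1 ⊗ₜ x + expOp (extAct _ br (tVar k ⊗ₜ x)) (1 ⊗ₜ y))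
    (h0 : tEval 0 L ℓ = 0) (m : AffPoly k 1 ⊗[k] M) :
    expOp (extAct _ a ℓ) m =
      expOp (extAct _ a (tVar k ⊗ₜ x)) (expOp (extAct _ a (tVar k ⊗ₜ y)) m) := by
  have hphi : ∀ x : L, phiOp (extAct _ br (tVar k ⊗ₜ x)) (tDer k L (tVar k ⊗ₜ x)) = 1 ⊗ₜ x := by
    intro x
    have hd : tDer k L (tVar k ⊗ₜ x) = 1 ⊗ₜ x := by simp [tDer_tmul, tVar]
    rw [hd, phiOp_of_zero (hb.ext.nilp _)]
    rw [extAct_tmul, hl.alt, TensorProduct.tmul_zero]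
  have hder : ∀ (z : AffPoly k 1 ⊗[k] L) v, tDer k M (expOp (extAct _ a z) v) =
      expOp (extAct _ a z) (tDer k M v) +
        extAct _ a (phiOp (extAct _ br z) (tDer k L z)) (expOp (extAct _ a z) v) := fun z v =>
    der_expOp hr.ext hb.ext.nilp ha.ext.nilp (tDer_act a) z v
  induction m using TensorProduct.induction_on with
  | zero => simp
  | add u v hu hv => simp only [map_add, hu, hv]
  | tmul f m =>
    have hfm : f ⊗ₜ[k] m = f • ((1 : AffPoly k 1) ⊗ₜ[k] m) := by simp [TensorProduct.smul_tmul']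
    rw [hfm, expOp_smul ha, expOp_smul ha, expOp_smul ha]
    congr 1
    have hm : tDer k M ((1 : AffPoly k 1) ⊗ₜ[k] m) = 0 := by simp [tDer_tmul]
    rw [← sub_eq_zero]
    refine linear_unique ha.ext (tPrim FM) (phiOp (extAct _ br ℓ) (tDer k L ℓ)) ?_ ?_
    · rw [map_sub, hder ℓ, hder (tVar k ⊗ₜ x), hder (tVar k ⊗ₜ y), hm, map_zero, map_zero, hphi,
        hphi, zero_add, zero_add, expOp_rep hr.ext (hb.ext.nilp _) (ha.ext.nilp _), h1, map_sub, map_add,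
        LinearMap.add_apply, LinearMap.add_apply]
      abel
    · have h2 : ∀ x : L, tEval 0 L (tVar k ⊗ₜ x) = 0 := fun x => by simp [tEval_tmul, tVar]
      rw [LinearMap.comp_apply, map_sub, tEval_expOp ha, tEval_expOp ha, tEval_expOp ha, h0, h2, h2,
        map_zero, expOp_zero, expOp_zero, sub_self, map_zero]

/-- The Baker–Campbell–Hausdorff formula in a nilpotent representation. -/
theorem expOp_bch (hb : FiltAct br F N) (hl : IsLie br) (ha : FiltAct a FM NM)
    (hr : IsRep br a) (x y : L) (m : M) :
    expOp (a (bch br x y)) m = expOp (a x) (expOp (a y) m) := by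
  set xt := tVar k ⊗ₜ[k] x with hxt
  set yt := tVar k ⊗ₜ[k] y with hyt
  obtain ⟨ℓ, h1, h0⟩ := exists_logDer hb.ext hl.ext (tPrim F)
    (1 ⊗ₜ x + expOp (extAct _ br xt) (1 ⊗ₜ y))
  have h0' : tEval 0 L ℓ = 0 := by
    have := congrArg (tEval 0 L) h0
    simpa [tEval_tmul] using this
  set θ : AffPoly k 1 ⊗[k] L →ₗ[k] AffPoly k 1 ⊗[k] L :=
    (LinearMap.lsmul (AffPoly k 1) (AffPoly k 1 ⊗[k] L) (tVar k) |>.restrictScalars k) ∘ₗ tDer k L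
    with hθ
  have hθapp : ∀ v, θ v = tVar k • tDer k L v := fun v => rfl
  have hθx : ∀ x : L, θ (tVar k ⊗ₜ x) = tVar k ⊗ₜ x := fun x => by
    rw [hθapp, tDer_tmul]; simp [tVar, TensorProduct.smul_tmul']
  have hθd : ∀ u v, θ (extAct _ br u v) = extAct _ br (θ u) v + extAct _ br u (θ v) := fun u v => by
    rw [hθapp, tDer_act, smul_add, hθapp, hθapp, extAct_smul, smul_extAct]
  have hW : expOp (extAct _ br ℓ) = expOp (extAct _ br xt) * expOp (extAct _ br yt) :=
    LinearMap.ext fun v => expOp_of_logDer hb hl hb hl.isRep x y h1 h0' v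
  have hθℓ : phiOp (extAct _ br ℓ) (θ ℓ) = xt + expOp (extAct _ br xt) yt := by
    have h2 : phiOp (extAct _ br ℓ) (θ ℓ) = tVar k • phiOp (extAct _ br ℓ) (tDer k L ℓ) :=
      (nser_intertwine (hb.ext.nilp ℓ) (hb.ext.nilp ℓ)
        (LinearMap.lsmul (AffPoly k 1) (AffPoly k 1 ⊗[k] L) (tVar k) |>.restrictScalars k)
        (fun v => (smul_extAct br _ ℓ v).symm) _ _).symm
    rw [h2, h1, smul_add, ← expOp_smul hb, hxt, hyt, TensorProduct.smul_tmul',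
      TensorProduct.smul_tmul', smul_eq_mul, mul_one]
  have hb' : θ (bch (extAct _ br) xt yt) = θ ℓ := by
    rw [der_bch hb.ext hl.ext hθd (hθx x) (hθx y), ← hW, ← hθℓ]
    have h3 := logQuot_mul_phi (k := k) (K := N + 2) (T := extAct _ br ℓ)
      (pow_eq_zero_of_le (by omega) (hb.ext.pow_eq_zero ℓ))
    exact congrArg (fun S : Module.End k _ => S (θ ℓ)) h3
  have hmap : ∀ c : k, tEval c L (bch (extAct _ br) xt yt) = bch br (c • x) (c • y) := by
    intro c
    rw [hb.ext.nilpBracket.map_bch (tEval c L) (tEval_act c br)]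
    simp [hxt, hyt, tEval_tmul, tVar]
  have hbl : bch (extAct _ br) xt yt = ℓ := by
    rw [← sub_eq_zero]
    have h4 : tDer k L (bch (extAct _ br) xt yt - ℓ) = 0 :=
      smul_tVar_injective (by rw [← hθapp, map_sub, hb', sub_self])
    have h5 := (tPrim F).int_der (bch (extAct _ br) xt yt - ℓ)
    rw [h4, map_zero, LinearMap.comp_apply, map_sub (tEval 0 L), hmap, h0', zero_smul, zero_smul,
      bch_zero_zero, sub_zero, map_zero, sub_zero] at h5
    exact h5.symm
  have h6 := congrArg (tEval 1 M) (expOp_of_logDer hb hl ha hr x y h1 h0' (1 ⊗ₜ m))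
  rw [tEval_expOp ha, tEval_expOp ha, tEval_expOp ha, ← hbl, hmap] at h6
  simpa [tEval_tmul, tVar] using h6

/-- The logarithmic derivative along a cocycle of a Baker–Campbell–Hausdorff product. -/
theorem phiOp_bch (hb : FiltAct br F N) (hl : IsLie br) (ha : FiltAct a FM NM)
    (hr : IsRep br a) {c : L →ₗ[k] M} (hc : IsCocycle br a c) (x y : L) :
    phiOp (a (bch br x y)) (c (bch br x y)) =
      phiOp (a x) (c x) + expOp (a x) (phiOp (a y) (c y)) := by
  have h := expOp_bch hb hl (filtAct_affRep ha c) (isRep_affRep hr hc) x y (0, 1)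
  rw [expOp_affRep ha, expOp_affRep ha, expOp_affRep ha] at h
  have h1 := congrArg Prod.fst h
  simp only [map_zero, zero_add, one_smul] at h1
  rw [h1, add_comm]

/-- The Baker–Campbell–Hausdorff product is associative. -/
theorem bch_assoc (hb : FiltAct br F N) (hl : IsLie br) (x y z : L) :
    bch br (bch br x y) z = bch br x (bch br y z) := by
  set xt := tVar k ⊗ₜ[k] x with hxt
  set yt := tVar k ⊗ₜ[k] y with hyt
  set zt := tVar k ⊗ₜ[k] z with hzt
  have hc : IsCocycle (extAct (AffPoly k 1) br) (extAct _ br) (tDer k L) := fun u v => by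
    rw [tDer_act, hl.ext.skew (tDer k L u) v]; abel
  have hD := fun u v => phiOp_bch hb.ext hl.ext hb.ext hl.ext.isRep hc u v
  have hE := fun u v m => expOp_bch hb.ext (hl.ext (R := AffPoly k 1)) hb.ext hl.ext.isRep u v m
  have hmap : ∀ (c : k) u v, tEval c L (bch (extAct _ br) u v)
      = bch br (tEval c L u) (tEval c L v) := fun c u v =>
    hb.ext.nilpBracket.map_bch (tEval c L) (tEval_act c br) u v
  have key : bch (extAct _ br) (bch (extAct _ br) xt yt) zt
      = bch (extAct _ br) xt (bch (extAct _ br) yt zt) := by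
    refine logDer_unique hb.ext hl.ext (tPrim F) ?_ ?_
    · rw [hD, hD, hD, hD, hE, map_add, add_assoc]
    · rw [LinearMap.comp_apply, LinearMap.comp_apply, hmap, hmap, hmap, hmap]
      simp [hxt, hyt, hzt, tEval_tmul, tVar, bch_zero_zero]
  have h := congrArg (tEval 1 L) key
  rw [hmap, hmap, hmap, hmap] at h
  simpa [hxt, hyt, hzt, tEval_tmul, tVar] using h

end BCH

/-! ## Lie subalgebras given by subspaces -/

section LieOn

variable {k : Type u} [Field k] {V M : Type u} [AddCommGroup V] [Module k V]
  [AddCommGroup M] [Module k M]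

/-- The restriction of a bilinear operation to a subspace closed under it. -/
def restrictBr (br : V →ₗ[k] V →ₗ[k] V) (S : Submodule k V) (h : ∀ x ∈ S, ∀ y ∈ S, br x y ∈ S) :
    S →ₗ[k] S →ₗ[k] S :=
  LinearMap.mk₂ k (fun x y => ⟨br x y, h _ x.2 _ y.2⟩) (fun _ _ _ => Subtype.ext (by simp))
    (fun _ _ _ => Subtype.ext (by simp)) (fun _ _ _ => Subtype.ext (by simp))
    (fun _ _ _ => Subtype.ext (by simp))

/-- The subspace `S` is a Lie algebra under the nilpotent operation `br`. -/
structure LieOn (br : V →ₗ[k] V →ₗ[k] V) (S : Submodule k V) (F : ℕ → Submodule k V) (N : ℕ) :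
    Prop where
  filt : FiltAct br F N
  closed : ∀ x ∈ S, ∀ y ∈ S, br x y ∈ S
  alt : ∀ x ∈ S, br x x = 0
  jac : ∀ x ∈ S, ∀ y ∈ S, ∀ z ∈ S, br (br x y) z = br x (br y z) - br y (br x z)

/-- A representation of the Lie algebra `S`. -/
def RepOn (br : V →ₗ[k] V →ₗ[k] V) (S : Submodule k V) (a : V →ₗ[k] M →ₗ[k] M) : Prop :=
  ∀ x ∈ S, ∀ y ∈ S, ∀ m, a (br x y) m = a x (a y m) - a y (a x m)

/-- A one-cocycle of the Lie algebra `S`. -/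
def CocycleOn (br : V →ₗ[k] V →ₗ[k] V) (S : Submodule k V) (a : V →ₗ[k] M →ₗ[k] M)
    (c : V →ₗ[k] M) : Prop :=
  ∀ x ∈ S, ∀ y ∈ S, c (br x y) = a x (c y) - a y (c x)

variable {br : V →ₗ[k] V →ₗ[k] V} {S : Submodule k V} {F : ℕ → Submodule k V} {N : ℕ}
  {a : V →ₗ[k] M →ₗ[k] M} {FM : ℕ → Submodule k M} {NM : ℕ}

theorem nser_mem {T : Module.End k V} (hT : IsNilpotent T) (h : ∀ v ∈ S, T v ∈ S)
    (f : PowerSeries k) {v : V} (hv : v ∈ S) : nser f T v ∈ S := by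
  obtain ⟨n, hn⟩ := hT
  rw [nser_apply f hn]
  refine sum_mem fun i hi => Submodule.smul_mem _ _ ?_
  clear hi
  induction i with
  | zero => exact hv
  | succ i ih => rw [pow_succ', Module.End.mul_apply]; exact h _ ih

theorem nser_intertwine_on {T : Module.End k V} {T' : Module.End k M} (hT : IsNilpotent T)
    (hT' : IsNilpotent T') (g : V →ₗ[k] M) (h : ∀ v ∈ S, T v ∈ S)
    (hTT' : ∀ v ∈ S, g (T v) = T' (g v)) (f : PowerSeries k) {v : V} (hv : v ∈ S) :
    g (nser f T v) = nser f T' (g v) := by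
  obtain ⟨m, hm⟩ := hT
  obtain ⟨n, hn⟩ := hT'
  rw [nser_apply f (pow_eq_zero_of_le (le_max_left m n) hm),
    nser_apply f (pow_eq_zero_of_le (le_max_right m n) hn), map_sum]
  have key : ∀ i, (T ^ i) v ∈ S ∧ g ((T ^ i) v) = (T' ^ i) (g v) := by
    intro i
    induction i with
    | zero => exact ⟨hv, rfl⟩
    | succ i ih =>
      rw [pow_succ', pow_succ', Module.End.mul_apply, Module.End.mul_apply, ← ih.2]
      exact ⟨h _ ih.1, hTT' _ ih.1⟩
  exact Finset.sum_congr rfl fun i _ => by rw [map_smul, (key i).2]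

theorem nser_congr {T T' : Module.End k V} (hT : IsNilpotent T) (hT' : IsNilpotent T')
    (h : ∀ v ∈ S, T v ∈ S) (hTT' : ∀ v ∈ S, T v = T' v) (f : PowerSeries k) {v : V} (hv : v ∈ S) :
    nser f T v = nser f T' v :=
  nser_intertwine_on hT hT' LinearMap.id h hTT' f hv

namespace LieOn

theorem filtSub (h : LieOn br S F N) :
    FiltAct (restrictBr br S h.closed) (fun i => (F i).comap S.subtype) N where
  act x i v hv := h.filt.act x i v hv
  zero := by rw [h.filt.zero]; rfl
  bot := by rw [h.filt.bot]; simp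
  anti i := Submodule.comap_mono (h.filt.anti i)

theorem isLie (h : LieOn br S F N) : IsLie (restrictBr br S h.closed) where
  alt x := Subtype.ext (h.alt x x.2)
  jac x y z := Subtype.ext (h.jac x x.2 y y.2 z z.2)

theorem isRep (h : LieOn br S F N) (hr : RepOn br S a) :
    IsRep (restrictBr br S h.closed) (a ∘ₗ S.subtype) :=
  fun x y m => hr x x.2 y y.2 m

theorem filtRep (ha : FiltAct a FM NM) : FiltAct (a ∘ₗ S.subtype) FM NM where
  act x i v hv := ha.act x i v hv
  zero := ha.zero
  bot := ha.bot
  anti := ha.anti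

theorem coe_bch (h : LieOn br S F N) (x y : S) :
    ((bch (restrictBr br S h.closed) x y : S) : V) = bch br x y :=
  h.filtSub.nilpBracket.map_bch S.subtype (fun _ _ => rfl) x y

theorem coe_nser (h : LieOn br S F N) (f : PowerSeries k) (x y : S) :
    ((nser f (restrictBr br S h.closed x) y : S) : V) = nser f (br x) y :=
  nser_intertwine (h.filtSub.nilp x) (h.filt.nilp x) S.subtype (fun _ => rfl) f y

theorem bch_mem (h : LieOn br S F N) {x y : V} (hx : x ∈ S) (hy : y ∈ S) : bch br x y ∈ S := by
  rw [← h.coe_bch ⟨x, hx⟩ ⟨y, hy⟩]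
  exact Subtype.mem _

theorem skew (h : LieOn br S F N) {x y : V} (hx : x ∈ S) (hy : y ∈ S) : br x y = -br y x :=
  congrArg Subtype.val (h.isLie.skew ⟨x, hx⟩ ⟨y, hy⟩)

theorem bch_zero_left (h : LieOn br S F N) {x : V} (hx : x ∈ S) : bch br 0 x = x := by
  rw [bch_of_comm] <;> simp [h.alt x hx]

theorem bch_zero_right (h : LieOn br S F N) {x : V} (hx : x ∈ S) : bch br x 0 = x := by
  rw [bch_of_comm] <;> simp [h.alt x hx]

theorem bch_neg_left (h : LieOn br S F N) {x : V} (hx : x ∈ S) : bch br (-x) x = 0 := by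
  rw [bch_of_comm] <;> simp [h.alt x hx]

variable [CharZero k]

theorem bch_assoc (h : LieOn br S F N) {x y z : V} (hx : x ∈ S) (hy : y ∈ S) (hz : z ∈ S) :
    bch br (bch br x y) z = bch br x (bch br y z) := by
  have := congrArg Subtype.val (_root_.bch_assoc h.filtSub h.isLie ⟨x, hx⟩ ⟨y, hy⟩ ⟨z, hz⟩)
  simpa only [h.coe_bch] using this

theorem expOp_bch (h : LieOn br S F N) (hr : RepOn br S a) (ha : FiltAct a FM NM) {x y : V}
    (hx : x ∈ S) (hy : y ∈ S) (m : M) :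
    expOp (a (bch br x y)) m = expOp (a x) (expOp (a y) m) := by
  have := _root_.expOp_bch h.filtSub h.isLie (filtRep ha) (h.isRep hr) ⟨x, hx⟩ ⟨y, hy⟩ m
  simpa only [LinearMap.comp_apply, Submodule.subtype_apply, h.coe_bch] using this

theorem phiOp_bch (h : LieOn br S F N) (hr : RepOn br S a) (ha : FiltAct a FM NM)
    {c : V →ₗ[k] M} (hc : CocycleOn br S a c) {x y : V} (hx : x ∈ S) (hy : y ∈ S) :
    phiOp (a (bch br x y)) (c (bch br x y)) =
      phiOp (a x) (c x) + expOp (a x) (phiOp (a y) (c y)) := by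
  have := _root_.phiOp_bch h.filtSub h.isLie (filtRep ha) (h.isRep hr) (c := c ∘ₗ S.subtype)
    (fun x y => hc x x.2 y y.2) ⟨x, hx⟩ ⟨y, hy⟩
  simpa only [LinearMap.comp_apply, Submodule.subtype_apply, h.coe_bch] using this

theorem expOp_rep (h : LieOn br S F N) (hr : RepOn br S a) (ha : FiltAct a FM NM) {z w : V}
    (hz : z ∈ S) (hw : w ∈ S) (m : M) :
    expOp (a z) (a w m) = a (expOp (br z) w) (expOp (a z) m) := by
  have := _root_.expOp_rep (h.isRep hr) (h.filtSub.nilp ⟨z, hz⟩) (ha.nilp z) ⟨w, hw⟩ m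
  have h2 := h.coe_nser (expS k) ⟨z, hz⟩ ⟨w, hw⟩
  simp only [LinearMap.comp_apply, Submodule.subtype_apply, expOp, h2] at this
  exact this

theorem expOp_conj_of_comm (h : LieOn br S F N) (hr : RepOn br S a) (ha : FiltAct a FM NM) {z w : V}
    (hz : z ∈ S) (hw : w ∈ S) (T : Module.End k M) (hT : ∀ m, T (a z m) = a w m + a z (T m)) (m : M) :
    T (expOp (a z) m) = expOp (a z) (T m) + a (phiOp (br z) w) (expOp (a z) m) := by
  have := _root_.expOp_conj_of_comm (h.isRep hr) (h.filtSub.nilp ⟨z, hz⟩) (ha.nilp z) T ⟨w, hw⟩ hT m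
  have h2 := h.coe_nser (phiS k) ⟨z, hz⟩ ⟨w, hw⟩
  simp only [LinearMap.comp_apply, Submodule.subtype_apply, phiOp, h2] at this
  exact this

theorem der_phiOp_cocycle (h : LieOn br S F N) (hr : RepOn br S a) (ha : FiltAct a FM NM)
    {c : V →ₗ[k] M} (hc : CocycleOn br S a c) {derV : V →ₗ[k] V} (hS : ∀ x ∈ S, derV x ∈ S)
    {derM : M →ₗ[k] M} (hd : ∀ x ∈ S, ∀ m, derM (a x m) = a (derV x) m + a x (derM m))
    (hcd : ∀ x ∈ S, derM (c x) = c (derV x)) {z : V} (hz : z ∈ S) :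
    derM (phiOp (a z) (c z)) =
      a (phiOp (br z) (derV z)) (phiOp (a z) (c z)) + c (phiOp (br z) (derV z)) := by
  have := _root_.der_phiOp_cocycle (h.isRep hr) h.filtSub.nilp (filtRep ha) (c := c ∘ₗ S.subtype)
    (fun x y => hc x x.2 y y.2) (derL := derV.restrict hS) (derM := derM)
    (fun x m => hd x x.2 m) (fun x => hcd x x.2) ⟨z, hz⟩
  have h2 := h.coe_nser (phiS k) ⟨z, hz⟩ ⟨derV z, hS z hz⟩
  simp only [LinearMap.comp_apply, Submodule.subtype_apply, phiOp] at this h2 ⊢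
  rw [← h2]
  exact this

variable {der ev int : V →ₗ[k] V}

theorem primSub (hp : Prim F der ev int) (hder : ∀ x ∈ S, der x ∈ S) (hev : ∀ x ∈ S, ev x ∈ S)
    (hint : ∀ x ∈ S, int x ∈ S) :
    Prim (fun i => (F i).comap S.subtype) (der.restrict hder) (ev.restrict hev)
      (int.restrict hint) where
  der_int m := Subtype.ext (hp.der_int m)
  ev_int m := Subtype.ext (hp.ev_int m)
  int_der m := Subtype.ext (hp.int_der m)
  der_mem i m hm := hp.der_mem i m hm
  int_mem i m hm := hp.int_mem i m hm

theorem exists_logDer (h : LieOn br S F N) (hp : Prim F der ev int) (hder : ∀ x ∈ S, der x ∈ S)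
    (hev : ∀ x ∈ S, ev x ∈ S) (hint : ∀ x ∈ S, int x ∈ S) {b : V} (hb : b ∈ S) :
    ∃ z ∈ S, phiOp (br z) (der z) = b ∧ ev z = 0 := by
  obtain ⟨z, h1, h2⟩ := _root_.exists_logDer h.filtSub h.isLie (primSub hp hder hev hint) ⟨b, hb⟩
  refine ⟨z, z.2, ?_, congrArg Subtype.val h2⟩
  have h3 := h.coe_nser (phiS k) z ⟨der z, hder z z.2⟩
  rw [phiOp, ← h3]
  exact congrArg Subtype.val h1

theorem logDer_unique (h : LieOn br S F N) (hp : Prim F der ev int) (hder : ∀ x ∈ S, der x ∈ S)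
    (hev : ∀ x ∈ S, ev x ∈ S) (hint : ∀ x ∈ S, int x ∈ S) {z z' : V} (hz : z ∈ S) (hz' : z' ∈ S)
    (hd : phiOp (br z) (der z) = phiOp (br z') (der z')) (he : ev z = ev z') : z = z' := by
  refine congrArg Subtype.val (_root_.logDer_unique (z := ⟨z, hz⟩) (z' := ⟨z', hz'⟩) h.filtSub h.isLie
    (primSub hp hder hev hint) (Subtype.ext ?_) (Subtype.ext he))
  have h3 := h.coe_nser (phiS k) ⟨z, hz⟩ ⟨der z, hder z hz⟩
  have h4 := h.coe_nser (phiS k) ⟨z', hz'⟩ ⟨der z', hder z' hz'⟩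
  exact h3.trans (hd.trans h4.symm)

end LieOn

end LieOn

/-! ## Differential graded Lie algebras in degrees `≥ -1` -/

section DG

variable {k : Type u} [Field k] {V : Type u} [AddCommGroup V] [Module k V]

/-- The axioms of a nilpotent differential graded Lie algebra with `deg (-2) = 0` which concern
elements of degrees `-1`, `0` and `1`. -/
structure IsDG (br : V →ₗ[k] V →ₗ[k] V) (deg : ℤ → Submodule k V) (δ : V →ₗ[k] V)
    (F : ℕ → Submodule k V) (N : ℕ) : Prop where
  filt : FiltAct br F N
  filt_diff : ∀ i, ∀ v ∈ F i, δ v ∈ F i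
  bracket_mem : ∀ {i j : ℤ} {x y : V}, x ∈ deg i → y ∈ deg j → br x y ∈ deg (i + j)
  diff_mem : ∀ {i : ℤ} {x : V}, x ∈ deg i → δ x ∈ deg (i + 1)
  bot : deg (-2) = ⊥
  skew0 : ∀ {j : ℤ} {x y : V}, x ∈ deg 0 → y ∈ deg j → br x y = -br y x
  symm1 : ∀ {j : ℤ} {x y : V}, Odd j → x ∈ deg 1 → y ∈ deg j → br x y = br y x
  jac0 : ∀ {j : ℤ} {x y : V} (z : V), x ∈ deg 0 → y ∈ deg j →
    br (br x y) z = br x (br y z) - br y (br x z)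
  jac1 : ∀ {j : ℤ} {x y : V} (z : V), Odd j → x ∈ deg 1 → y ∈ deg j →
    br (br x y) z = br x (br y z) + br y (br x z)
  leib0 : ∀ {x : V} (y : V), x ∈ deg 0 → δ (br x y) = br (δ x) y + br x (δ y)
  leib1 : ∀ {j : ℤ} {x : V} (y : V), Odd j → x ∈ deg j → δ (br x y) = br (δ x) y - br x (δ y)
  diff_diff : ∀ x, δ (δ x) = 0

/-- The operator `δ + [γ, ·]`. -/
def dOp (br : V →ₗ[k] V →ₗ[k] V) (δ : V →ₗ[k] V) (γ : V) : V →ₗ[k] V := δ + br γ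

/-- The bracket `[a, δ b + [γ, b]]`. -/
def twBr (br : V →ₗ[k] V →ₗ[k] V) (δ : V →ₗ[k] V) (γ : V) : V →ₗ[k] V →ₗ[k] V :=
  br.compl₂ (dOp br δ γ)

/-- The gauge action of `exp x`. -/
def gaugeOp (br : V →ₗ[k] V →ₗ[k] V) (δ : V →ₗ[k] V) (x γ : V) : V :=
  γ - phiOp (br x) (δ x + br γ x)

variable {br : V →ₗ[k] V →ₗ[k] V} {deg : ℤ → Submodule k V} {δ : V →ₗ[k] V}
    {F : ℕ → Submodule k V} {N : ℕ} {γ : V}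

theorem dOp_apply (v : V) : dOp br δ γ v = δ v + br γ v := rfl

theorem twBr_apply (x y : V) : twBr br δ γ x y = br x (dOp br δ γ y) := rfl

namespace IsDG

theorem nilp (h : IsDG br deg δ F N) (x : V) : IsNilpotent (br x) := h.filt.nilp x

theorem mem0 (h : IsDG br deg δ F N) {j : ℤ} {x y : V} (hx : x ∈ deg 0) (hy : y ∈ deg j) :
    br x y ∈ deg j := by
  have := h.bracket_mem hx hy
  rwa [zero_add] at this

theorem expOp_mem (h : IsDG br deg δ F N) {j : ℤ} {x y : V} (hx : x ∈ deg 0) (hy : y ∈ deg j) :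
    expOp (br x) y ∈ deg j :=
  nser_mem (h.nilp x) (fun _ hv => h.mem0 hx hv) _ hy

theorem phiOp_mem (h : IsDG br deg δ F N) {j : ℤ} {x y : V} (hx : x ∈ deg 0) (hy : y ∈ deg j) :
    phiOp (br x) y ∈ deg j :=
  nser_mem (h.nilp x) (fun _ hv => h.mem0 hx hv) _ hy

theorem dOp_mem (h : IsDG br deg δ F N) (hγ : γ ∈ deg 1) {j : ℤ} {x : V} (hx : x ∈ deg j) :
    dOp br δ γ x ∈ deg (j + 1) := by
  have := h.bracket_mem hγ hx
  rw [add_comm] at this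
  exact add_mem (h.diff_mem hx) this

theorem dOp_mem0 (h : IsDG br deg δ F N) (hγ : γ ∈ deg 1) {x : V} (hx : x ∈ deg (-1)) :
    dOp br δ γ x ∈ deg 0 := h.dOp_mem hγ hx

theorem br_neg_neg (h : IsDG br deg δ F N) {x y : V} (hx : x ∈ deg (-1)) (hy : y ∈ deg (-1)) :
    br x y = 0 := by
  have := h.bracket_mem hx hy
  rw [show (-1 : ℤ) + -1 = -2 from rfl, h.bot] at this
  exact this

theorem repOn (h : IsDG br deg δ F N) : RepOn br (deg 0) br := fun _ hx _ hy z => h.jac0 z hx hy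

theorem dOp_br0 (h : IsDG br deg δ F N) (hγ : γ ∈ deg 1) {x : V} (hx : x ∈ deg 0) (y : V) :
    dOp br δ γ (br x y) = br (dOp br δ γ x) y + br x (dOp br δ γ y) := by
  have h1 := h.jac0 y hx hγ
  rw [h.skew0 hx hγ, map_neg, LinearMap.neg_apply] at h1
  simp only [dOp_apply, h.leib0 y hx, map_add, LinearMap.add_apply]
  have h2 : br γ (br x y) = br (br γ x) y + br x (br γ y) := by
    rw [eq_comm, ← sub_eq_zero] at h1 ⊢
    rw [← h1]; abel
  rw [h2]; abel

theorem dOp_br_neg (h : IsDG br deg δ F N) (hγ : γ ∈ deg 1) {x : V} (hx : x ∈ deg (-1)) (y : V) :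
    dOp br δ γ (br x y) = br (dOp br δ γ x) y - br x (dOp br δ γ y) := by
  have hodd : Odd (-1 : ℤ) := by decide
  have h1 := h.jac1 y hodd hγ hx
  simp only [dOp_apply, h.leib1 y hodd hx, map_add, LinearMap.add_apply, h1]
  abel

theorem dOp_swap (h : IsDG br deg δ F N) (hγ : γ ∈ deg 1) {x y : V} (hx : x ∈ deg (-1))
    (hy : y ∈ deg (-1)) : br (dOp br δ γ x) y = br x (dOp br δ γ y) := by
  have h1 := h.dOp_br_neg hγ hx y
  rw [h.br_neg_neg hx hy, map_zero] at h1
  exact (sub_eq_zero.1 h1.symm)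

theorem filt_tw (h : IsDG br deg δ F N) (γ : V) : FiltAct (twBr br δ γ) F N where
  act x i v hv := h.filt.act _ _ _ (add_mem (h.filt_diff i v hv) (h.filt.anti _ (h.filt.act _ _ _ hv)))
  zero := h.filt.zero
  bot := h.filt.bot
  anti := h.filt.anti

theorem filt_brD (h : IsDG br deg δ F N) (γ : V) : FiltAct (br ∘ₗ dOp br δ γ) F N where
  act x i v hv := h.filt.act _ _ _ hv
  zero := h.filt.zero
  bot := h.filt.bot
  anti := h.filt.anti

/-- The operator `[γ, ·]` intertwines brackets with a degree `-1` element. -/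
theorem tw_eq (h : IsDG br deg δ F N) (hγ : γ ∈ deg 1) {x y : V} (hx : x ∈ deg (-1))
    (hy : y ∈ deg (-1)) : twBr br δ γ x y = br (dOp br δ γ x) y := (h.dOp_swap hγ hx hy).symm

theorem tw_mem (h : IsDG br deg δ F N) (hγ : γ ∈ deg 1) {x y : V} (hx : x ∈ deg (-1))
    (hy : y ∈ deg (-1)) : twBr br δ γ x y ∈ deg (-1) := by
  rw [h.tw_eq hγ hx hy]
  exact h.mem0 (h.dOp_mem0 hγ hx) hy

theorem nser_tw (h : IsDG br deg δ F N) (hγ : γ ∈ deg 1) (f : PowerSeries k) {x y : V}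
    (hx : x ∈ deg (-1)) (hy : y ∈ deg (-1)) :
    nser f (twBr br δ γ x) y = nser f (br (dOp br δ γ x)) y :=
  nser_congr ((h.filt_tw γ).nilp x) (h.nilp _) (fun _ hv => h.tw_mem hγ hx hv)
    (fun _ hv => h.tw_eq hγ hx hv) f hy

variable [CharZero k]

theorem lieOn (h : IsDG br deg δ F N) : LieOn br (deg 0) F N where
  filt := h.filt
  closed x hx y hy := h.mem0 hx hy
  alt x hx := by
    have h1 := h.skew0 hx hx
    rw [eq_neg_iff_add_eq_zero, ← two_smul k] at h1
    exact (smul_eq_zero.1 h1).resolve_left two_ne_zero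
  jac x hx y hy z _ := h.jac0 z hx hy

/-- The Maurer–Cartan equation. -/
def MC (br : V →ₗ[k] V →ₗ[k] V) (deg : ℤ → Submodule k V) (δ : V →ₗ[k] V) (γ : V) : Prop :=
  IsMaurerCartan (deg 1) δ br γ

theorem dOp_dOp (h : IsDG br deg δ F N) (hγ : MC br deg δ γ) (v : V) :
    dOp br δ γ (dOp br δ γ v) = 0 := by
  obtain ⟨h1, h2⟩ := hγ
  have h3 := h.jac1 v odd_one h1 h1
  rw [← two_smul k] at h3
  have h4 : br γ (br γ v) = -br (δ γ) v := by
    rw [eq_neg_iff_add_eq_zero, ← LinearMap.zero_apply (σ₁₂ := RingHom.id k) (M := V) v,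
      ← map_zero br, ← h2]
    simp only [map_add, LinearMap.add_apply, map_smul, LinearMap.smul_apply, h3, smul_smul]
    rw [inv_mul_cancel₀ two_ne_zero, one_smul, add_comm]
  simp only [dOp_apply, map_add, h.diff_diff, h.leib1 v odd_one h1, h4]
  abel

theorem dOp_tw (h : IsDG br deg δ F N) (hγ : MC br deg δ γ) {x : V} (hx : x ∈ deg (-1)) (y : V) :
    dOp br δ γ (twBr br δ γ x y) = br (dOp br δ γ x) (dOp br δ γ y) := by
  rw [twBr_apply, h.dOp_br_neg hγ.1 hx, h.dOp_dOp hγ, map_zero, sub_zero]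

theorem dOp_brD (h : IsDG br deg δ F N) (hγ : MC br deg δ γ) {x : V} (hx : x ∈ deg (-1)) (y : V) :
    dOp br δ γ (br (dOp br δ γ x) y) = br (dOp br δ γ x) (dOp br δ γ y) := by
  rw [h.dOp_br0 hγ.1 (h.dOp_mem0 hγ.1 hx), h.dOp_dOp hγ, map_zero, LinearMap.zero_apply, zero_add]

theorem repOn_tw (h : IsDG br deg δ F N) (hγ : MC br deg δ γ) :
    RepOn (twBr br δ γ) (deg (-1)) (br ∘ₗ dOp br δ γ) := by
  intro x hx y hy m
  simp only [LinearMap.comp_apply]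
  rw [h.dOp_tw hγ hx]
  exact h.jac0 m (h.dOp_mem0 hγ.1 hx) (h.dOp_mem0 hγ.1 hy)

theorem lieOn_tw (h : IsDG br deg δ F N) (hγ : MC br deg δ γ) :
    LieOn (twBr br δ γ) (deg (-1)) F N where
  filt := h.filt_tw γ
  closed x hx y hy := h.tw_mem hγ.1 hx hy
  alt x hx := by
    have h1 := h.skew0 (h.dOp_mem0 hγ.1 hx) hx
    rw [h.dOp_swap hγ.1 hx hx, eq_neg_iff_add_eq_zero, ← two_smul k] at h1
    exact (smul_eq_zero.1 h1).resolve_left two_ne_zero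
  jac x hx y hy z hz := by
    rw [h.tw_eq hγ.1 (h.tw_mem hγ.1 hx hy) hz, h.tw_eq hγ.1 hx (h.tw_mem hγ.1 hy hz),
      h.tw_eq hγ.1 hy hz, h.tw_eq hγ.1 hy (h.tw_mem hγ.1 hx hz), h.tw_eq hγ.1 hx hz]
    exact h.repOn_tw hγ x hx y hy z

/-! ### Gauge transformations -/

theorem gaugeOp_eq (h : IsDG br deg δ F N) (hγ : γ ∈ deg 1) {x : V} (hx : x ∈ deg 0) :
    gaugeOp br δ x γ = expOp (br x) γ - phiOp (br x) (δ x) := by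
  have h1 : br γ x = -br x γ := by rw [h.skew0 hx hγ, neg_neg]
  rw [gaugeOp, h1, map_add, map_neg, expOp_eq_add (h.nilp x)]
  abel

theorem expOp_dOp (h : IsDG br deg δ F N) (hγ : γ ∈ deg 1) {x : V} (hx : x ∈ deg 0) (v : V) :
    expOp (br x) (dOp br δ γ v) = dOp br δ (gaugeOp br δ x γ) (expOp (br x) v) := by
  have hc : commOp k (br x) (dOp br δ γ) = -br (dOp br δ γ x) := by
    ext v
    rw [commOp_apply, LinearMap.sub_apply, Module.End.mul_apply, Module.End.mul_apply,
      h.dOp_br0 hγ hx]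
    simp
  have h1 : dOp br δ γ x ∈ deg 1 := h.dOp_mem hγ hx
  have h2 := nser_intertwine_on (S := deg 1) (h.nilp x) (isNilpotent_commOp (k := k) (h.nilp x)) br
    (fun v hv => h.mem0 hx hv) (fun v hv => by
      ext w
      exact h.jac0 w hx hv) (phiS k) h1
  rw [expOp_conj (h.nilp x) (dOp br δ γ) v]
  have h3 := expOp_eq_add (k := k) (isNilpotent_commOp (k := k) (h.nilp x)) (dOp br δ γ)
  rw [expOp, phiOp, hc, map_neg, ← h2] at h3
  rw [h3]
  simp only [gaugeOp, dOp_apply, LinearMap.add_apply, LinearMap.neg_apply, map_sub,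
    LinearMap.sub_apply, phiOp]
  abel

end IsDG

/-! ### Derivations -/

/-- A derivation of degree zero commuting with the differential. -/
structure DGDer (br : V →ₗ[k] V →ₗ[k] V) (deg : ℤ → Submodule k V) (δ : V →ₗ[k] V)
    (der : V →ₗ[k] V) : Prop where
  map_br : ∀ x y, der (br x y) = br (der x) y + br x (der y)
  map_diff : ∀ x, der (δ x) = δ (der x)
  mem : ∀ {i x}, x ∈ deg i → der x ∈ deg i

namespace DGDer

variable {der der' : V →ₗ[k] V}

theorem map_dOp (hd : DGDer br deg δ der) (v : V) :
    der (dOp br δ γ v) = dOp br δ γ (der v) + br (der γ) v := by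
  rw [dOp_apply, map_add, hd.map_br, hd.map_diff, dOp_apply]; abel

theorem map_dOp_of_const (hd : DGDer br deg δ der) (hγ : der γ = 0) (v : V) :
    der (dOp br δ γ v) = dOp br δ γ (der v) := by
  rw [hd.map_dOp, hγ, map_zero, LinearMap.zero_apply, add_zero]

theorem cocycle (hd : DGDer br deg δ der) (h : IsDG br deg δ F N) : CocycleOn br (deg 0) br der := by
  intro x hx y hy
  rw [hd.map_br, h.skew0 hy (hd.mem hx)]; abel

theorem cocycle_tw (hd : DGDer br deg δ der) (h : IsDG br deg δ F N) (hγ : γ ∈ deg 1)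
    (hγ' : der γ = 0) : CocycleOn (twBr br δ γ) (deg (-1)) (br ∘ₗ dOp br δ γ) der := by
  intro x hx y hy
  rw [twBr_apply, hd.map_br, hd.map_dOp_of_const hγ', LinearMap.comp_apply, LinearMap.comp_apply,
    h.dOp_swap hγ hx (hd.mem hy), h.skew0 (h.dOp_mem0 hγ hy) (hd.mem hx)]
  abel

variable [CharZero k]

theorem diff_cocycle (h : IsDG br deg δ F N) : CocycleOn br (deg 0) br δ := by
  intro x hx y hy
  rw [h.leib0 y hx, h.skew0 hy (h.diff_mem hx)]; abel

theorem der_expOp (hd : DGDer br deg δ der) (h : IsDG br deg δ F N) {z : V} (hz : z ∈ deg 0) (v : V) :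
    der (expOp (br z) v) = expOp (br z) (der v) + br (phiOp (br z) (der z)) (expOp (br z) v) :=
  h.lieOn.expOp_conj_of_comm h.repOn h.filt hz (hd.mem hz) der (fun m => hd.map_br z m) v

theorem phi_neg (h : IsDG br deg δ F N) (z : V) :
    phiOp (br (-z)) (der (-z)) = -expOp (br (-z)) (phiOp (br z) (der z)) := by
  rw [map_neg br, map_neg der, map_neg, phiOp_neg (h.nilp z)]

/-- The logarithmic derivatives of `exp z` satisfy the zero curvature equation. -/
theorem flat (hd : DGDer br deg δ der) (hd' : DGDer br deg δ der')
    (hcomm : ∀ v, der (der' v) = der' (der v)) (h : IsDG br deg δ F N) {z : V} (hz : z ∈ deg 0) :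
    der (phiOp (br z) (der' z)) =
      br (phiOp (br z) (der z)) (phiOp (br z) (der' z)) + der' (phiOp (br z) (der z)) :=
  h.lieOn.der_phiOp_cocycle h.repOn h.filt (hd'.cocycle h) (fun _ hx => hd.mem hx)
    (fun x _ m => hd.map_br x m) (fun x _ => hcomm x) hz

theorem flat_tw (hd : DGDer br deg δ der) (hd' : DGDer br deg δ der')
    (hcomm : ∀ v, der (der' v) = der' (der v)) (h : IsDG br deg δ F N)
    (hγ : IsDG.MC br deg δ γ) (h0 : der γ = 0) (h0' : der' γ = 0) {z : V} (hz : z ∈ deg (-1)) :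
    der (phiOp (br (dOp br δ γ z)) (der' z)) =
      br (dOp br δ γ (phiOp (br (dOp br δ γ z)) (der z))) (phiOp (br (dOp br δ γ z)) (der' z)) +
        der' (phiOp (br (dOp br δ γ z)) (der z)) := by
  have := (h.lieOn_tw hγ).der_phiOp_cocycle (h.repOn_tw hγ) (h.filt_brD γ)
    (hd'.cocycle_tw h hγ.1 h0') (derV := der) (derM := der) (fun _ hx => hd.mem hx)
    (fun x _ m => by
      simp only [LinearMap.comp_apply]
      rw [hd.map_br, hd.map_dOp_of_const h0]) (fun x _ => hcomm x) hz
  have h1 : phiOp (twBr br δ γ z) (der z) = phiOp (br (dOp br δ γ z)) (der z) :=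
    h.nser_tw hγ.1 _ hz (hd.mem hz)
  rw [h1] at this
  exact this

theorem der_gaugeOp (hd : DGDer br deg δ der) (h : IsDG br deg δ F N) (hγ : γ ∈ deg 1) {z : V}
    (hz : z ∈ deg 0) :
    der (gaugeOp br δ z γ) = expOp (br z) (der γ) -
      dOp br δ (gaugeOp br δ z γ) (phiOp (br z) (der z)) := by
  have h1 := h.lieOn.der_phiOp_cocycle h.repOn h.filt (diff_cocycle h) (fun _ hx => hd.mem hx)
    (fun x _ m => hd.map_br x m) (fun x _ => hd.map_diff x) hz
  rw [h.gaugeOp_eq hγ hz, map_sub, hd.der_expOp h hz, h1, dOp_apply, map_sub, LinearMap.sub_apply,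
    h.skew0 (h.phiOp_mem hz (hd.mem hz)) (h.expOp_mem hz hγ),
    h.skew0 (h.phiOp_mem hz (hd.mem hz)) (h.phiOp_mem hz (h.diff_mem hz))]
  abel

/-- The logarithmic derivative in the twisted group is carried to that in `exp 𝔤⁰`. -/
theorem dOp_phiOp (hd : DGDer br deg δ der) (h : IsDG br deg δ F N) (hγ : IsDG.MC br deg δ γ)
    (h0 : der γ = 0) {w : V} (hw : w ∈ deg (-1)) :
    phiOp (br (dOp br δ γ w)) (der (dOp br δ γ w)) =
      dOp br δ γ (phiOp (br (dOp br δ γ w)) (der w)) := by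
  rw [hd.map_dOp_of_const h0]
  exact (nser_intertwine (h.nilp _) (h.nilp _) (dOp br δ γ) (fun v => h.dOp_brD hγ hw v) _ _).symm

end DGDer

/-- An evaluation `ev` and an antiderivative `int` for the derivation `der`, compatible with all
the structure. -/
structure DGPrim (br : V →ₗ[k] V →ₗ[k] V) (deg : ℤ → Submodule k V) (δ : V →ₗ[k] V)
    (F : ℕ → Submodule k V) (der ev int : V →ₗ[k] V) : Prop where
  isDer : DGDer br deg δ der
  prim : Prim F der ev int
  ev_br : ∀ x y, ev (br x y) = br (ev x) (ev y)
  ev_diff : ∀ x, ev (δ x) = δ (ev x)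
  ev_mem : ∀ {i x}, x ∈ deg i → ev x ∈ deg i
  int_mem : ∀ {i x}, x ∈ deg i → int x ∈ deg i
  der_ev : ∀ x, der (ev x) = 0
  ev_ev : ∀ x, ev (ev x) = ev x

namespace DGPrim

variable {der ev int : V →ₗ[k] V}

theorem ext (hp : DGPrim br deg δ F der ev int) {x y : V} (hd : der x = der y) (he : ev x = ev y) :
    x = y := by
  have h1 := hp.prim.int_der x
  have h2 := hp.prim.int_der y
  rw [hd, he] at h1
  have := h1.symm.trans h2
  exact sub_left_injective this

theorem ev_expOp (hp : DGPrim br deg δ F der ev int) (h : IsDG br deg δ F N) (z v : V) :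
    ev (expOp (br z) v) = expOp (br (ev z)) (ev v) :=
  nser_intertwine (h.nilp _) (h.nilp _) ev (fun v => hp.ev_br z v) _ _

theorem ev_phiOp (hp : DGPrim br deg δ F der ev int) (h : IsDG br deg δ F N) (z v : V) :
    ev (phiOp (br z) v) = phiOp (br (ev z)) (ev v) :=
  nser_intertwine (h.nilp _) (h.nilp _) ev (fun v => hp.ev_br z v) _ _

theorem ev_dOp (hp : DGPrim br deg δ F der ev int) (v : V) :
    ev (dOp br δ γ v) = dOp br δ (ev γ) (ev v) := by
  rw [dOp_apply, map_add, hp.ev_diff, hp.ev_br, dOp_apply]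

theorem ev_bch (hp : DGPrim br deg δ F der ev int) (h : IsDG br deg δ F N) (x y : V) :
    ev (bch br x y) = bch br (ev x) (ev y) :=
  h.filt.nilpBracket.map_bch ev hp.ev_br x y

theorem ev_bch_tw (hp : DGPrim br deg δ F der ev int) (h : IsDG br deg δ F N) (x y : V) :
    ev (bch (twBr br δ γ) x y) = bch (twBr br δ (ev γ)) (ev x) (ev y) :=
  (h.filt_tw γ).nilpBracket.map_bch ev
    (fun x y => by rw [twBr_apply, hp.ev_br, hp.ev_dOp, twBr_apply]) x y

end DGPrim

end DG

/-! ## Radial gauge and the non-abelian Stokes formulas -/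

section Stokes

variable {k : Type u} [Field k] [CharZero k] {V : Type u} [AddCommGroup V] [Module k V]
  {br : V →ₗ[k] V →ₗ[k] V} {deg : ℤ → Submodule k V} {δ : V →ₗ[k] V} {F : ℕ → Submodule k V}
  {N : ℕ} {der ev int der' der'' : V →ₗ[k] V} {γ γ₀ A A' A'' z : V}

/-- Parallel transport gauges `δ + γ` to a constant. -/
theorem gaugeOp_transport (h : IsDG br deg δ F N) (hp : DGPrim br deg δ F der ev int)
    (hγ : γ ∈ deg 1) (hd : der γ = dOp br δ γ A) (hz : z ∈ deg 0)
    (hz1 : phiOp (br z) (der z) = -A) (hz0 : ev z = 0) : gaugeOp br δ (-z) γ = ev γ := by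
  have hz' : -z ∈ deg 0 := neg_mem hz
  refine hp.ext ?_ ?_
  · rw [hp.isDer.der_gaugeOp h hγ hz', DGDer.phi_neg h, hz1, map_neg (expOp (br (-z))), neg_neg, hd,
      h.expOp_dOp hγ hz', hp.der_ev, sub_self]
  · have hz0' : ev (-z) = 0 := by rw [map_neg ev z, hz0, neg_zero]
    rw [gaugeOp, map_sub ev, hp.ev_phiOp h, map_add ev,
      hp.ev_diff, hp.ev_br, hz0', hp.ev_ev]
    simp

theorem expOp_neg_dOp (h : IsDG br deg δ F N) (hp : DGPrim br deg δ F der ev int)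
    (hγ : γ ∈ deg 1) (hd : der γ = dOp br δ γ A) (hz : z ∈ deg 0)
    (hz1 : phiOp (br z) (der z) = -A) (hz0 : ev z = 0) (v : V) :
    expOp (br (-z)) (dOp br δ γ v) = dOp br δ (ev γ) (expOp (br (-z)) v) := by
  rw [h.expOp_dOp hγ (neg_mem hz), gaugeOp_transport h hp hγ hd hz hz1 hz0]

theorem der_expOp_neg (h : IsDG br deg δ F N) (hd : DGDer br deg δ der) (hz : z ∈ deg 0) (v : V) :
    der (expOp (br (-z)) v) = expOp (br (-z)) (der v - br (phiOp (br z) (der z)) v) := by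
  have hz' : -z ∈ deg 0 := neg_mem hz
  rw [hd.der_expOp h hz', DGDer.phi_neg h, map_neg br (expOp (br (-z)) (phiOp (br z) (der z))), LinearMap.neg_apply, map_sub,
    h.lieOn.expOp_rep h.repOn h.filt hz' (h.phiOp_mem hz (hd.mem hz))]
  abel

/-- The remaining component of a connection in radial gauge. -/
theorem radial_connection (h : IsDG br deg δ F N) (hp : DGPrim br deg δ F der ev int)
    (hd' : DGDer br deg δ der') (hcomm : ∀ v, der (der' v) = der' (der v))
    (hev : ∀ v, ev (der' v) = der' (ev v))
    (hγ : γ ∈ deg 1) (hd : der γ = dOp br δ γ A) (hz : z ∈ deg 0)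
    (hz1 : phiOp (br z) (der z) = -A) (hz0 : ev z = 0) {β Y : V}
    (hcurv : der A' - der' A + br A A' + dOp br δ γ β = 0) (hA'0 : ev A' = 0)
    (hY : der Y = expOp (br (-z)) β) (hY0 : ev Y = 0) :
    expOp (br (-z)) (A' + phiOp (br z) (der' z)) = -dOp br δ (ev γ) Y := by
  refine hp.ext ?_ ?_
  · have hflat := hp.isDer.flat hd' hcomm h hz
    rw [hz1, map_neg br, LinearMap.neg_apply, map_neg der'] at hflat
    rw [der_expOp_neg h hp.isDer hz, hz1, map_neg der,
      hp.isDer.map_dOp_of_const (hp.der_ev γ), hY, ← expOp_neg_dOp h hp hγ hd hz hz1 hz0, ← map_neg,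
      map_add, hflat, map_neg br A, LinearMap.neg_apply, map_add]
    congr 1
    rw [← sub_eq_zero, ← hcurv]
    abel
  · rw [hp.ev_expOp h, map_add, hp.ev_phiOp h, hev, hz0, hA'0, map_neg ev z, hz0,
      map_neg ev (dOp br δ (ev γ) Y), hp.ev_dOp, hY0]
    simp

theorem radial_connection' (h : IsDG br deg δ F N) (hz : z ∈ deg 0) {Y : V}
    (hr : expOp (br (-z)) (A' + phiOp (br z) (der' z)) = -dOp br δ γ₀ Y) :
    phiOp (br z) (der' z) = -A' - expOp (br z) (dOp br δ γ₀ Y) := by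
  have h1 := congrArg (expOp (br z)) hr
  rw [map_neg br, expOp_apply_neg (h.nilp z), map_neg] at h1
  rw [← sub_eq_zero] at h1 ⊢
  rw [← h1]; abel

/-- The curvature in radial gauge. -/
theorem radial_curvature (h : IsDG br deg δ F N) (hp : DGPrim br deg δ F der ev int)
    (hd' : DGDer br deg δ der') (hd'' : DGDer br deg δ der'')
    (hcomm' : ∀ v, der (der' v) = der' (der v)) (hcomm'' : ∀ v, der (der'' v) = der'' (der v))
    (hev' : ∀ v, ev (der' v) = der' (ev v)) (hev'' : ∀ v, ev (der'' v) = der'' (ev v))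
    (hγ : γ ∈ deg 1) (hγ' : ev γ = γ₀)
    (hz : z ∈ deg 0) (hz1 : phiOp (br z) (der z) = -A) {β' β'' β Y' Y'' : V}
    (hr' : expOp (br (-z)) (A' + phiOp (br z) (der' z)) = -dOp br δ γ₀ Y')
    (hr'' : expOp (br (-z)) (A'' + phiOp (br z) (der'' z)) = -dOp br δ γ₀ Y'')
    (hA' : A' ∈ deg 0) (hA'' : A'' ∈ deg 0)
    (hbianchi : der β - der' β'' + der'' β' + br A β - br A' β'' + br A'' β' = 0)
    (hβ0 : ev β = 0) (hY'm : Y' ∈ deg (-1)) (hY''m : Y'' ∈ deg (-1))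
    (hY' : der Y' = expOp (br (-z)) β') (hY'' : der Y'' = expOp (br (-z)) β'')
    (hY'0 : ev Y' = 0) (hY''0 : ev Y'' = 0) :
    expOp (br (-z)) β = der' Y'' - der'' Y' - twBr br δ γ₀ Y' Y'' := by
  have hz' : -z ∈ deg 0 := neg_mem hz
  have hγ₀ : γ₀ ∈ deg 1 := hγ' ▸ hp.ev_mem hγ
  have hcov : ∀ {d : V →ₗ[k] V} (hd : DGDer br deg δ d) {B Y b : V} (hB : B ∈ deg 0)
      (hr : expOp (br (-z)) (B + phiOp (br z) (d z)) = -dOp br δ γ₀ Y),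
      expOp (br (-z)) (d b + br B b) =
        d (expOp (br (-z)) b) - br (dOp br δ γ₀ Y) (expOp (br (-z)) b) := by
    intro d hd B Y b hB hr
    have hm := h.phiOp_mem hz (hd.mem hz)
    have h1 := h.lieOn.expOp_rep h.repOn h.filt hz' (add_mem hB hm) b
    rw [hr, map_neg br (dOp br δ γ₀ Y), LinearMap.neg_apply] at h1
    rw [der_expOp_neg h hd hz, sub_eq_add_neg _ (br (dOp br δ γ₀ Y) _), ← h1, ← map_add]
    congr 1
    simp only [map_add, LinearMap.add_apply]
    abel
  refine hp.ext ?_ ?_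
  · have h1 : der β - br (phiOp (br z) (der z)) β =
        (der' β'' + br A' β'') - (der'' β' + br A'' β') := by
      rw [hz1, map_neg br, LinearMap.neg_apply, ← sub_eq_zero, ← hbianchi]; abel
    rw [der_expOp_neg h hp.isDer hz, h1, map_sub, hcov hd' hA' hr', hcov hd'' hA'' hr'', ← hY', ← hY'',
      map_sub, map_sub, hcomm', hcomm'', twBr_apply, hp.isDer.map_br,
      hp.isDer.map_dOp_of_const (by rw [← hγ', hp.der_ev]),
      ← h.dOp_swap hγ₀ hY'm (hp.isDer.mem hY''m),
      h.skew0 (h.dOp_mem0 hγ₀ hY''m) (hp.isDer.mem hY'm)]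
    abel
  · rw [hp.ev_expOp h, hβ0, map_zero, map_sub, map_sub, hev', hev'', twBr_apply, hp.ev_br, hY'0, hY''0]
    simp

/-- The relation between the transports along the boundary of a triangle. -/
theorem boundary_transport (h : IsDG br deg δ F N) (hp : DGPrim br deg δ F der ev int)
    (hγ₀ : IsDG.MC br deg δ γ₀) (hγc : der γ₀ = 0) {u B Y v W : V} (hu : u ∈ deg 0)
    (hu1 : phiOp (br u) (der u) = -B - expOp (br u) (dOp br δ γ₀ Y)) (hv : v ∈ deg 0)
    (hv1 : phiOp (br v) (der v) = -B) (hv0 : ev v = 0) (hW : W ∈ deg (-1))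
    (hW1 : phiOp (twBr br δ γ₀ W) (der W) = Y) (hW0 : ev W = 0) :
    bch br (-u) v = bch br (dOp br δ γ₀ W) (-ev u) := by
  have hu' : -u ∈ deg 0 := neg_mem hu
  have heu : -ev u ∈ deg 0 := neg_mem (hp.ev_mem hu)
  have hDW : dOp br δ γ₀ W ∈ deg 0 := h.dOp_mem0 hγ₀.1 hW
  refine h.lieOn.logDer_unique hp.prim (fun _ => hp.isDer.mem) (fun _ => hp.ev_mem)
    (fun _ => hp.int_mem) (h.lieOn.bch_mem hu' hv) (h.lieOn.bch_mem hDW heu) ?_ ?_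
  · have hc := hp.isDer.cocycle h
    rw [h.lieOn.phiOp_bch h.repOn h.filt hc hu' hv, h.lieOn.phiOp_bch h.repOn h.filt hc hDW heu,
      hp.isDer.dOp_phiOp h hγ₀ hγc hW, map_neg der (ev u), hp.der_ev, neg_zero, map_zero, map_zero,
      add_zero, DGDer.phi_neg h, hu1, hv1]
    have h1 : phiOp (br (dOp br δ γ₀ W)) (der W) = Y := by
      rw [← hW1]; exact (h.nser_tw hγ₀.1 _ hW (hp.isDer.mem hW)).symm
    rw [h1, map_sub, map_neg br, expOp_neg_apply (h.nilp u)]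
    abel
  · rw [hp.ev_bch h, hp.ev_bch h, hv0, hp.ev_dOp, hW0, map_zero, map_neg, map_neg, hp.ev_ev,
      h.lieOn.bch_zero_left heu, h.lieOn.bch_zero_right heu]

theorem boundary_transport_apply (h : IsDG br deg δ F N) (hp : DGPrim br deg δ F der ev int)
    (hγ₀ : IsDG.MC br deg δ γ₀) {u v W : V} (hu : u ∈ deg 0) (hv : v ∈ deg 0) (hW : W ∈ deg (-1))
    (hb : bch br (-u) v = bch br (dOp br δ γ₀ W) (-ev u)) (m : V) :
    expOp (br (-u)) (expOp (br v) m) =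
      expOp (br (dOp br δ γ₀ W)) (expOp (br (-ev u)) m) := by
  rw [← h.lieOn.expOp_bch h.repOn h.filt (neg_mem hu) hv, hb,
    h.lieOn.expOp_bch h.repOn h.filt (h.dOp_mem0 hγ₀.1 hW) (neg_mem (hp.ev_mem hu))]

/-- The non-abelian Stokes formula over a square for a connection with values in the twisted
Lie algebra. -/
theorem stokes_square (h : IsDG br deg δ F N) (hp : DGPrim br deg δ F der ev int)
    (hd' : DGDer br deg δ der') (hcomm : ∀ v, der (der' v) = der' (der v))
    (hev : ∀ v, ev (der' v) = der' (ev v))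
    (hγ₀ : IsDG.MC br deg δ γ₀) (hγc : der γ₀ = 0) (hγc' : der' γ₀ = 0)
    {u b v Y Y' Yf q : V} (hu : u ∈ deg 0) (hv : v ∈ deg 0) (hq : q ∈ deg (-1))
    (hYm : Y ∈ deg (-1)) (hY'm : Y' ∈ deg (-1))
    (hcurv : expOp (br (-u)) b = der Y' - der' Y - twBr br δ γ₀ Y Y')
    (hq1 : phiOp (twBr br δ γ₀ q) (der q) = Y) (hq0 : ev q = 0)
    (hb : bch br (-u) v = bch br (dOp br δ γ₀ q) (-ev u))
    (hY'0 : ev Y' = 0) (hYf : der Yf = expOp (br (-v)) b) (hYf0 : ev Yf = 0) :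
    Y' = phiOp (br (dOp br δ γ₀ q)) (der' q) +
      expOp (br (dOp br δ γ₀ q)) (expOp (br (-ev u)) Yf) := by
  have hDq : dOp br δ γ₀ q ∈ deg 0 := h.dOp_mem0 hγ₀.1 hq
  have hq1' : phiOp (br (dOp br δ γ₀ q)) (der q) = Y := by
    rw [← hq1]; exact (h.nser_tw hγ₀.1 _ hq (hp.isDer.mem hq)).symm
  have key : expOp (br (-dOp br δ γ₀ q)) (Y' - phiOp (br (dOp br δ γ₀ q)) (der' q)) =
      expOp (br (-ev u)) Yf := by
    refine hp.ext ?_ ?_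
    · have hflat := hp.isDer.flat_tw hd' hcomm h hγ₀ hγc hγc' hq
      rw [hq1'] at hflat
      have h1 := boundary_transport_apply h hp hγ₀ hu hv hq hb (expOp (br (-v)) b)
      rw [map_neg br v, expOp_apply_neg (h.nilp v), hcurv] at h1
      have h2 := congrArg (expOp (br (-dOp br δ γ₀ q))) h1
      rw [map_neg br (dOp br δ γ₀ q), expOp_neg_apply (h.nilp _), ← map_neg br v, ← hYf] at h2
      rw [der_expOp_neg h hp.isDer hDq, hp.isDer.dOp_phiOp h hγ₀ hγc hq, hq1', map_sub der, hflat,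
        hp.isDer.der_expOp h (neg_mem (hp.ev_mem hu)), map_neg der (ev u), hp.der_ev, neg_zero,
        map_zero, map_zero, LinearMap.zero_apply, add_zero, ← h2, map_neg br (dOp br δ γ₀ q)]
      congr 1
      rw [h.tw_eq hγ₀.1 hYm hY'm, map_sub]
      abel
    · rw [hp.ev_expOp h, hp.ev_expOp h, hYf0, map_zero, map_sub, hp.ev_phiOp h, hev, hq0, hY'0,
        map_zero, map_zero, sub_zero, map_zero]
  rw [← key, map_neg br (dOp br δ γ₀ q), expOp_apply_neg (h.nilp _)]
  abel

/-- Comparison of the transports along the edges opposite to a vertex. -/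
theorem transport_comparison (h : IsDG br deg δ F N) (hp : DGPrim br deg δ F der ev int)
    (hγ₀ : IsDG.MC br deg δ γ₀) (hγc : der γ₀ = 0) (hγe : ev γ₀ = γ₀) {q r t Y : V}
    (hq : q ∈ deg (-1)) (hr : r ∈ deg (-1)) (ht : t ∈ deg (-1))
    (hY : Y = phiOp (br (dOp br δ γ₀ q)) (der q) +
      expOp (br (dOp br δ γ₀ q)) (phiOp (br (dOp br δ γ₀ r)) (der r)))
    (ht1 : phiOp (twBr br δ γ₀ t) (der t) = Y) (hr0 : ev r = 0) (ht0 : ev t = 0) :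
    bch (twBr br δ γ₀) q r = bch (twBr br δ γ₀) t (ev q) := by
  have hl := h.lieOn_tw hγ₀
  have heq : ev q ∈ deg (-1) := hp.ev_mem hq
  have hc := hp.isDer.cocycle_tw h hγ₀.1 hγc
  have htw : ∀ {x : V}, x ∈ deg (-1) →
      phiOp (twBr br δ γ₀ x) (der x) = phiOp (br (dOp br δ γ₀ x)) (der x) := fun hx =>
    h.nser_tw hγ₀.1 _ hx (hp.isDer.mem hx)
  have hbch := fun {x y : V} (hx : x ∈ deg (-1)) (hy : y ∈ deg (-1)) =>
    hl.phiOp_bch (h.repOn_tw hγ₀) (h.filt_brD γ₀) hc hx hy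
  simp only [LinearMap.comp_apply] at hbch
  refine hl.logDer_unique hp.prim (fun _ => hp.isDer.mem) (fun _ => hp.ev_mem)
    (fun _ => hp.int_mem) (hl.bch_mem hq hr) (hl.bch_mem ht heq) ?_ ?_
  · rw [htw (hl.bch_mem hq hr), htw (hl.bch_mem ht heq), hbch hq hr, hbch ht heq, hp.der_ev, map_zero,
      map_zero, add_zero, ← htw ht, ht1, hY]
  · rw [hp.ev_bch_tw h, hp.ev_bch_tw h, hγe, hr0, ht0, hp.ev_ev, hl.bch_zero_right heq,
      hl.bch_zero_left heq]

/-- Whiskering with a constant one-morphism. -/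
theorem whisker_transport (h : IsDG br deg δ F N) {γ₁ x w : V} (hγ₁ : γ₁ ∈ deg 1) (hx : x ∈ deg 0)
    (hw : w ∈ deg (-1)) (hd : DGDer br deg δ der) (hxc : der x = 0)
    (hg : gaugeOp br δ x γ₁ = γ₀) :
    phiOp (br (dOp br δ γ₀ (expOp (br x) w))) (der (expOp (br x) w)) =
      expOp (br x) (phiOp (twBr br δ γ₁ w) (der w)) := by
  have h1 : phiOp (twBr br δ γ₁ w) (der w) = phiOp (br (dOp br δ γ₁ w)) (der w) :=
    h.nser_tw hγ₁ _ hw (hd.mem hw)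
  rw [hd.der_expOp h hx, hxc, map_zero, map_zero, LinearMap.zero_apply, add_zero, h1]
  refine (nser_intertwine (h.nilp _) (h.nilp _) (expOp (br x)) (fun v => ?_) _ _).symm
  rw [h.lieOn.expOp_rep h.repOn h.filt hx (h.dOp_mem0 hγ₁ hw), h.expOp_dOp hγ₁ hx, hg]

end Stokes

/-! ## Morphisms and extension of scalars -/

section Morphisms

variable {k : Type u} [Field k] {V W : Type u} [AddCommGroup V] [Module k V]
  [AddCommGroup W] [Module k W]

/-- Linear maps compatible with brackets and differentials. -/
structure DGMor (br : V →ₗ[k] V →ₗ[k] V) (δ : V →ₗ[k] V) (br' : W →ₗ[k] W →ₗ[k] W)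
    (δ' : W →ₗ[k] W) (f : V →ₗ[k] W) : Prop where
  map_br : ∀ x y, f (br x y) = br' (f x) (f y)
  map_diff : ∀ x, f (δ x) = δ' (f x)

variable {br : V →ₗ[k] V →ₗ[k] V} {deg : ℤ → Submodule k V} {δ : V →ₗ[k] V}
  {F : ℕ → Submodule k V} {N : ℕ} {br' : W →ₗ[k] W →ₗ[k] W} {deg' : ℤ → Submodule k W}
  {δ' : W →ₗ[k] W} {F' : ℕ → Submodule k W} {N' : ℕ} {f : V →ₗ[k] W}

namespace DGMor

theorem map_expOp (hf : DGMor br δ br' δ' f) (h : IsDG br deg δ F N) (h' : IsDG br' deg' δ' F' N')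
    (x v : V) : f (expOp (br x) v) = expOp (br' (f x)) (f v) :=
  nser_intertwine (h.nilp x) (h'.nilp _) f (fun v => hf.map_br x v) _ _

theorem map_phiOp (hf : DGMor br δ br' δ' f) (h : IsDG br deg δ F N) (h' : IsDG br' deg' δ' F' N')
    (x v : V) : f (phiOp (br x) v) = phiOp (br' (f x)) (f v) :=
  nser_intertwine (h.nilp x) (h'.nilp _) f (fun v => hf.map_br x v) _ _

theorem map_dOp (hf : DGMor br δ br' δ' f) (γ v : V) :
    f (dOp br δ γ v) = dOp br' δ' (f γ) (f v) := by
  rw [dOp_apply, map_add, hf.map_diff, hf.map_br, dOp_apply]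

theorem map_twBr (hf : DGMor br δ br' δ' f) (γ x y : V) :
    f (twBr br δ γ x y) = twBr br' δ' (f γ) (f x) (f y) := by
  rw [twBr_apply, hf.map_br, hf.map_dOp, twBr_apply]

theorem map_bch (hf : DGMor br δ br' δ' f) (h : IsDG br deg δ F N) (x y : V) :
    f (bch br x y) = bch br' (f x) (f y) :=
  h.filt.nilpBracket.map_bch f hf.map_br x y

theorem map_bch_tw (hf : DGMor br δ br' δ' f) (h : IsDG br deg δ F N) (γ x y : V) :
    f (bch (twBr br δ γ) x y) = bch (twBr br' δ' (f γ)) (f x) (f y) :=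
  (h.filt_tw γ).nilpBracket.map_bch f (hf.map_twBr γ) x y

theorem map_phiOp_tw (hf : DGMor br δ br' δ' f) (h : IsDG br deg δ F N)
    (h' : IsDG br' deg' δ' F' N') (γ x v : V) :
    f (phiOp (twBr br δ γ x) v) = phiOp (twBr br' δ' (f γ) (f x)) (f v) :=
  nser_intertwine ((h.filt_tw γ).nilp x) ((h'.filt_tw (f γ)).nilp (f x)) f
    (fun v => hf.map_twBr γ x v) _ _

theorem map_gaugeOp (hf : DGMor br δ br' δ' f) (h : IsDG br deg δ F N)
    (h' : IsDG br' deg' δ' F' N') (x γ : V) :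
    f (gaugeOp br δ x γ) = gaugeOp br' δ' (f x) (f γ) := by
  rw [gaugeOp, map_sub, hf.map_phiOp h h', map_add, hf.map_diff, hf.map_br, gaugeOp]

end DGMor

variable {R : Type u} [CommRing R] [Algebra k R]

theorem extAct_jacobi {br : V →ₗ[k] V →ₗ[k] V} {U U' : Submodule k V} (c : k)
    (h : ∀ x ∈ U, ∀ y ∈ U', ∀ z, br (br x y) z = br x (br y z) + c • br y (br x z))
    {x y : R ⊗[k] V} (z : R ⊗[k] V) (hx : x ∈ extSub R U) (hy : y ∈ extSub R U') :
    extAct R br (extAct R br x y) z =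
      extAct R br x (extAct R br y z) + c • extAct R br y (extAct R br x z) := by
  refine extSub_induction (P := fun x => extAct R br (extAct R br x y) z =
      extAct R br x (extAct R br y z) + c • extAct R br y (extAct R br x z)) hx (by simp)
    (fun f x hx => ?_) fun x x' hx hx' => by
      simp only [map_add, LinearMap.add_apply, hx, hx', smul_add]; abel
  refine extSub_induction (P := fun y => extAct R br (extAct R br (f ⊗ₜ x) y) z =
      extAct R br (f ⊗ₜ x) (extAct R br y z) + c • extAct R br y (extAct R br (f ⊗ₜ x) z)) hy (by simp)
    (fun g y hy => ?_) fun x x' hx hx' => by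
      simp only [map_add, LinearMap.add_apply, hx, hx', smul_add]; abel
  induction z using TensorProduct.induction_on with
  | zero => simp
  | tmul e z =>
    simp only [extAct_tmul, h x hx y hy z, TensorProduct.tmul_add, TensorProduct.tmul_smul]
    rw [← mul_assoc, mul_left_comm, mul_assoc]
  | add z z' hz hz' => simp only [map_add, hz, hz', smul_add]; abel

theorem extAct_leibniz {br : V →ₗ[k] V →ₗ[k] V} {U : Submodule k V} {δ : V →ₗ[k] V} (c : k)
    (h : ∀ x ∈ U, ∀ y, δ (br x y) = br (δ x) y + c • br x (δ y))
    {x : R ⊗[k] V} (y : R ⊗[k] V) (hx : x ∈ extSub R U) :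
    TensorProduct.map LinearMap.id δ (extAct R br x y) =
      extAct R br (TensorProduct.map LinearMap.id δ x) y +
        c • extAct R br x (TensorProduct.map LinearMap.id δ y) := by
  refine extSub_induction (P := fun x => TensorProduct.map LinearMap.id δ (extAct R br x y) =
      extAct R br (TensorProduct.map LinearMap.id δ x) y +
        c • extAct R br x (TensorProduct.map LinearMap.id δ y)) hx (by simp)
    (fun f x hx => ?_) fun x x' hx hx' => by
      simp only [map_add, LinearMap.add_apply, hx, hx', smul_add]; abel
  induction y using TensorProduct.induction_on with
  | zero => simp
  | tmul e y =>
    simp only [extAct_tmul, TensorProduct.map_tmul, LinearMap.id_apply, h x hx y,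
      TensorProduct.tmul_add, TensorProduct.tmul_smul]
  | add z z' hz hz' => simp only [map_add, hz, hz', smul_add]; abel

theorem IsDG.ext (h : IsDG br deg δ F N) (R : Type u) [CommRing R] [Algebra k R] :
    IsDG (extAct R br) (fun i => extSub R (deg i)) (TensorProduct.map LinearMap.id δ)
      (fun i => extSub R (F i)) N where
  filt := h.filt.ext
  filt_diff i _ hv := map_mem_extSub _ _ (h.filt_diff i) hv
  bracket_mem hx hy := extAct_mem (fun _ hx _ hy => h.bracket_mem hx hy) hx hy
  diff_mem hx := map_mem_extSub _ _ (fun _ hx => h.diff_mem hx) hx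
  bot := by rw [h.bot, extSub_bot]
  skew0 hx hy := extAct_antisymm (fun _ hx _ hy => h.skew0 hx hy) hx hy
  symm1 hj hx hy := extAct_symm (fun _ hx _ hy => h.symm1 hj hx hy) hx hy
  jac0 z hx hy := by
    rw [extAct_jacobi (-1) (fun x hx y hy z => by
      rw [h.jac0 z hx hy, neg_smul, one_smul, sub_eq_add_neg]) z hx hy]
    exact (congrArg _ (neg_one_smul k _)).trans (sub_eq_add_neg _ _).symm
  jac1 z hj hx hy := by
    rw [extAct_jacobi 1 (fun x hx y hy z => by rw [h.jac1 z hj hx hy, one_smul]) z hx hy, one_smul]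
  leib0 y hx := by
    rw [extAct_leibniz 1 (fun x hx y => by rw [h.leib0 y hx, one_smul]) y hx, one_smul]
  leib1 y hj hx := by
    rw [extAct_leibniz (-1) (fun x hx y => by
      rw [h.leib1 y hj hx, neg_smul, one_smul, sub_eq_add_neg]) y hx]
    exact (congrArg _ (neg_one_smul k _)).trans (sub_eq_add_neg _ _).symm
  diff_diff x := by
    rw [← LinearMap.comp_apply, ← TensorProduct.map_comp,
      show δ ∘ₗ δ = 0 from LinearMap.ext h.diff_diff, TensorProduct.map_zero_right,
      LinearMap.zero_apply]

theorem map_id_comm {R R' : Type u} [CommRing R] [Algebra k R] [CommRing R'] [Algebra k R']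
    (φ : R →ₗ[k] R') (g : V →ₗ[k] W) (x : R ⊗[k] V) :
    TensorProduct.map φ LinearMap.id (TensorProduct.map LinearMap.id g x) =
      TensorProduct.map LinearMap.id g (TensorProduct.map φ LinearMap.id x) := by
  induction x using TensorProduct.induction_on with
  | zero => simp
  | tmul f x => simp
  | add x y hx hy => simp only [map_add, hx, hy]

theorem map_map_id {R R' R'' : Type u} [CommRing R] [Algebra k R] [CommRing R'] [Algebra k R']
    [CommRing R''] [Algebra k R''] (φ : R →ₗ[k] R') (ψ : R' →ₗ[k] R'') (x : R ⊗[k] V) :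
    TensorProduct.map ψ LinearMap.id (TensorProduct.map φ (LinearMap.id : V →ₗ[k] V) x) =
      TensorProduct.map (ψ ∘ₗ φ) LinearMap.id x := by
  rw [← LinearMap.comp_apply, ← TensorProduct.map_comp, LinearMap.comp_id]

theorem map_id_congr {R R' : Type u} [CommRing R] [Algebra k R] [CommRing R'] [Algebra k R']
    {φ ψ : R →ₗ[k] R'} (h : ∀ f, φ f = ψ f) (x : R ⊗[k] V) :
    TensorProduct.map φ (LinearMap.id : V →ₗ[k] V) x = TensorProduct.map ψ LinearMap.id x := by
  rw [LinearMap.ext h]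

/-- A homomorphism of algebras induces a morphism of extensions of scalars. -/
theorem dgMor_map {R' : Type u} [CommRing R'] [Algebra k R'] (br : V →ₗ[k] V →ₗ[k] V) (δ : V →ₗ[k] V)
    (φ : R →ₐ[k] R') :
    DGMor (extAct R br) (TensorProduct.map LinearMap.id δ) (extAct R' br)
      (TensorProduct.map LinearMap.id δ) (TensorProduct.map φ.toLinearMap LinearMap.id) where
  map_br x y := extAct_map φ (fun _ _ => rfl) x y
  map_diff x := map_id_comm _ _ _

/-- A morphism of coefficients induces a morphism of extensions of scalars. -/
theorem DGMor.ext (hf : DGMor br δ br' δ' f) (R : Type u) [CommRing R] [Algebra k R] :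
    DGMor (extAct R br) (TensorProduct.map LinearMap.id δ) (extAct R br')
      (TensorProduct.map LinearMap.id δ') (TensorProduct.map LinearMap.id f) where
  map_br x y := extAct_map (AlgHom.id k R) (h := f) (g := f) hf.map_br x y
  map_diff x := by
    have : f ∘ₗ δ = δ' ∘ₗ f := LinearMap.ext hf.map_diff
    rw [← LinearMap.comp_apply, ← LinearMap.comp_apply, ← TensorProduct.map_comp,
      ← TensorProduct.map_comp, this]

/-- The value at a point `ε` of an algebra element with values in a vector space. -/
def augmentation (ε : R →ₐ[k] k) : R ⊗[k] V →ₗ[k] V :=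
  (TensorProduct.lid k V).toLinearMap ∘ₗ TensorProduct.map ε.toLinearMap LinearMap.id

theorem augmentation_tmul (ε : R →ₐ[k] k) (f : R) (v : V) : augmentation ε (f ⊗ₜ v) = ε f • v := by
  simp [augmentation]

theorem augmentation_dgMor (br : V →ₗ[k] V →ₗ[k] V) (δ : V →ₗ[k] V) (ε : R →ₐ[k] k) :
    DGMor (extAct R br) (TensorProduct.map LinearMap.id δ) br δ (augmentation ε) where
  map_br x y := by
    refine ext_induction₂ (P := fun x y => augmentation ε (extAct R br x y) =
      br (augmentation ε x) (augmentation ε y)) ?_ ?_ ?_ ?_ ?_ x y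
    · simp
    · simp
    · intro f x g y
      simp only [extAct_tmul, augmentation_tmul, map_smul, LinearMap.smul_apply, map_mul, smul_smul]
      rw [mul_comm]
    · intro x x' y hx hx'; simp only [map_add, LinearMap.add_apply, hx, hx']
    · intro x y y' hx hx'; simp only [map_add, hx, hx']
  map_diff x := by
    induction x using TensorProduct.induction_on with
    | zero => simp
    | tmul f x => simp [augmentation_tmul]
    | add x y hx hy => simp only [map_add, hx, hy]

theorem augmentation_mem {U : Submodule k V} (ε : R →ₐ[k] k) {x : R ⊗[k] V} (hx : x ∈ extSub R U) :
    augmentation ε x ∈ U :=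
  extSub_induction (P := fun x => augmentation ε x ∈ U) hx (by simp)
    (fun f v hv => by rw [augmentation_tmul]; exact U.smul_mem _ hv)
    fun x y hx hy => by rw [map_add]; exact add_mem hx hy

theorem augmentation_one_tmul (ε : R →ₐ[k] k) (v : V) :
    augmentation ε ((1 : R) ⊗ₜ[k] v) = v := by
  rw [augmentation_tmul, map_one, one_smul]

/-- The inclusion of constants is a morphism. -/
theorem const_dgMor (br : V →ₗ[k] V →ₗ[k] V) (δ : V →ₗ[k] V) (R : Type u) [CommRing R]
    [Algebra k R] :
    DGMor br δ (extAct R br) (TensorProduct.map LinearMap.id δ) (TensorProduct.mk k R V 1) where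
  map_br x y := by simp [extAct_tmul]
  map_diff x := by simp

end Morphisms

section PolynomialExtension

variable {k : Type u} [Field k] {V : Type u} [AddCommGroup V] [Module k V]
  {br : V →ₗ[k] V →ₗ[k] V} {deg : ℤ → Submodule k V} {δ : V →ₗ[k] V}
  {F : ℕ → Submodule k V} {N m n : ℕ}

theorem dgDer_pderiv (br : V →ₗ[k] V →ₗ[k] V) (deg : ℤ → Submodule k V) (δ : V →ₗ[k] V) (j : Fin m) :
    DGDer (extAct (AffPoly k m) br) (fun i => extSub (AffPoly k m) (deg i))
      (TensorProduct.map LinearMap.id δ)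
      (TensorProduct.map (MvPolynomial.pderiv j).toLinearMap LinearMap.id) where
  map_br x y := extAct_derivation _ _ _ _
  map_diff x := map_id_comm _ _ _
  mem hx := map_mem_extSub _ _ (fun _ h => h) hx

theorem setVar_X (i j : Fin m) (c : k) :
    setVar j c (MvPolynomial.X i) = if i = j then MvPolynomial.C c else MvPolynomial.X i := by
  simp [setVar, Function.update_apply]

theorem setVar_setVar (j : Fin m) (f : AffPoly k m) : setVar j (0 : k) (setVar j 0 f) = setVar j 0 f := by
  have : (setVar j (0 : k)).comp (setVar j 0) = setVar j 0 := by
    refine MvPolynomial.algHom_ext fun i => ?_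
    rw [AlgHom.comp_apply, setVar_X]
    split_ifs with h
    · simp
    · rw [setVar_X, if_neg h]
  exact DFunLike.congr_fun this f

/-- The chain rule. -/
theorem pderiv_aeval (φ : Fin n → AffPoly k m) (j : Fin m) (f : AffPoly k n) :
    MvPolynomial.pderiv j (MvPolynomial.aeval φ f) =
      ∑ l, MvPolynomial.pderiv j (φ l) * MvPolynomial.aeval φ (MvPolynomial.pderiv l f) := by
  induction f using MvPolynomial.induction_on with
  | C a => simp [MvPolynomial.algebraMap_eq]
  | add p q hp hq => simp only [map_add, hp, hq, mul_add, Finset.sum_add_distrib]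
  | mul_X p i hp =>
    have h : ∀ l, MvPolynomial.pderiv j (φ l) * MvPolynomial.aeval φ
        (MvPolynomial.pderiv l (p * MvPolynomial.X i)) =
        MvPolynomial.pderiv j (φ l) * MvPolynomial.aeval φ (MvPolynomial.pderiv l p) * φ i +
        if l = i then MvPolynomial.pderiv j (φ i) * MvPolynomial.aeval φ p else 0 := by
      intro l
      rw [MvPolynomial.pderiv_mul, MvPolynomial.pderiv_X, map_add, map_mul, MvPolynomial.aeval_X]
      split_ifs with hl
      · subst hl; simp; ring
      · rw [Pi.single_apply, if_neg (Ne.symm hl)]; simp; ring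
    rw [map_mul, MvPolynomial.aeval_X, MvPolynomial.pderiv_mul, hp, Finset.sum_congr rfl fun l _ => h l,
      Finset.sum_add_distrib, Finset.sum_mul, Finset.sum_ite_eq' Finset.univ i, if_pos (Finset.mem_univ _)]
    ring

theorem pderiv_setVar_self (j : Fin m) (c : k) (f : AffPoly k m) :
    MvPolynomial.pderiv j (setVar j c f) = 0 := by
  rw [setVar, pderiv_aeval]
  refine Finset.sum_eq_zero fun l _ => ?_
  rw [Function.update_apply]
  split_ifs with h
  · simp
  · rw [MvPolynomial.pderiv_X_of_ne h, zero_mul]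

theorem pderiv_setVar_of_ne {i j : Fin m} (hij : i ≠ j) (c : k) (f : AffPoly k m) :
    MvPolynomial.pderiv i (setVar j c f) = setVar j c (MvPolynomial.pderiv i f) := by
  rw [setVar, pderiv_aeval, Finset.sum_eq_single i]
  · rw [Function.update_of_ne hij, MvPolynomial.pderiv_X_self, one_mul]
  · intro l _ hl
    rw [Function.update_apply]
    split_ifs with h
    · simp
    · rw [MvPolynomial.pderiv_X_of_ne hl, zero_mul]
  · simp

theorem setVar_comm {i j : Fin m} (hij : i ≠ j) (c d : k) (f : AffPoly k m) :
    setVar i c (setVar j d f) = setVar j d (setVar i c f) := by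
  have : (setVar i c).comp (setVar j d) = (setVar j d).comp (setVar i c) := by
    refine MvPolynomial.algHom_ext fun l => ?_
    rw [AlgHom.comp_apply, AlgHom.comp_apply, setVar_X, setVar_X]
    by_cases h : l = j
    · subst h; rw [if_pos rfl, if_neg hij.symm, setVar_X, if_pos rfl]; simp [← MvPolynomial.algebraMap_eq]
    · rw [if_neg h, setVar_X]
      split_ifs with h2
      · simp [← MvPolynomial.algebraMap_eq]
      · rw [setVar_X, if_neg h]
  exact DFunLike.congr_fun this f

variable [CharZero k]

theorem dgPrim_pderiv (br : V →ₗ[k] V →ₗ[k] V) (deg : ℤ → Submodule k V) (δ : V →ₗ[k] V)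
    (F : ℕ → Submodule k V) (j : Fin m) :
    DGPrim (extAct (AffPoly k m) br) (fun i => extSub (AffPoly k m) (deg i))
      (TensorProduct.map LinearMap.id δ) (fun i => extSub (AffPoly k m) (F i))
      (TensorProduct.map (MvPolynomial.pderiv j).toLinearMap LinearMap.id)
      (TensorProduct.map (setVar j (0 : k)).toLinearMap LinearMap.id)
      (TensorProduct.map (antideriv j) LinearMap.id) where
  isDer := dgDer_pderiv br deg δ j
  prim := prim_ext F j
  ev_br x y := extAct_map (setVar j 0) (fun _ _ => rfl) x y
  ev_diff x := map_id_comm _ _ _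
  ev_mem hx := map_mem_extSub _ _ (fun _ h => h) hx
  int_mem hx := map_mem_extSub _ _ (fun _ h => h) hx
  der_ev x := by
    rw [map_map_id, show (MvPolynomial.pderiv j).toLinearMap ∘ₗ (setVar j (0 : k)).toLinearMap = 0 from
      LinearMap.ext fun f => pderiv_setVar_self j 0 f, TensorProduct.map_zero_left,
      LinearMap.zero_apply]
  ev_ev x := by
    rw [map_map_id]
    exact map_id_congr (fun f => setVar_setVar j f) x

end PolynomialExtension

namespace NilpDGLA

variable {k : Type u} [Field k] (G : NilpDGLA k)

/-- The length of the lower central series. -/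
def order : ℕ := Classical.choose G.nilpotent

theorem lowerCentral_order : G.alg.lowerCentral G.order = ⊥ := Classical.choose_spec G.nilpotent

theorem isDG : IsDG G.alg.bracket G.alg.deg G.alg.diff G.alg.lowerCentral G.order where
  filt := ⟨fun x i v hv => Submodule.apply_mem_map₂ _ (Submodule.mem_top (x := x)) hv, rfl,
    G.lowerCentral_order, fun i => DGLA.lowerCentral_succ_le i⟩
  filt_diff i v hv := DGLA.diff_mem_lowerCentral i hv
  bracket_mem := G.alg.bracket_mem
  diff_mem := G.alg.diff_mem
  bot := G.bounded _ le_rfl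
  skew0 hx hy := by rw [G.alg.skew hx hy, zero_mul, Int.negOnePow_zero, one_smul]
  symm1 hj hx hy := by
    rw [G.alg.skew hx hy, one_mul, Int.negOnePow_odd _ hj]; simp
  jac0 z hx hy := by
    rw [G.alg.jacobi z hx hy, zero_mul, Int.negOnePow_zero, one_smul]; abel
  jac1 z hj hx hy := by
    rw [G.alg.jacobi z hx hy, one_mul, Int.negOnePow_odd _ hj]; simp
  leib0 y hx := by rw [G.alg.leibniz y hx, Int.negOnePow_zero, one_smul]
  leib1 y hj hx := by rw [G.alg.leibniz y hx, Int.negOnePow_odd _ hj]; simp [sub_eq_add_neg]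
  diff_diff := G.alg.diff_diff

/-- The bracket of polynomials with values in `𝔤`. -/
abbrev pBr (m : ℕ) := extAct (AffPoly k m) G.alg.bracket

/-- The polynomials with values in a homogeneous component. -/
abbrev pDeg (m : ℕ) (i : ℤ) : Submodule k (G.alg.Polys m) := extSub (AffPoly k m) (G.alg.deg i)

/-- The differential of `𝔤` on polynomials with values in `𝔤`. -/
abbrev pDiff (m : ℕ) : G.alg.Polys m →ₗ[k] G.alg.Polys m := TensorProduct.map LinearMap.id G.alg.diff

/-- The lower central filtration on polynomials with values in `𝔤`. -/
abbrev pFil (m i : ℕ) : Submodule k (G.alg.Polys m) := extSub (AffPoly k m) (G.alg.lowerCentral i)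

/-- The substitution `xⱼ = c`. -/
abbrev pSet {m : ℕ} (j : Fin m) (c : k) : G.alg.Polys m →ₗ[k] G.alg.Polys m :=
  TensorProduct.map (setVar j c).toLinearMap LinearMap.id

/-- Antiderivatives vanishing for `xⱼ = 0`. -/
abbrev pInt {m : ℕ} (j : Fin m) : G.alg.Polys m →ₗ[k] G.alg.Polys m :=
  TensorProduct.map (antideriv j) LinearMap.id

/-- Substitution of polynomials. -/
abbrev pSub {m n : ℕ} (φ : Fin n → AffPoly k m) : G.alg.Polys n →ₗ[k] G.alg.Polys m :=
  TensorProduct.map (MvPolynomial.aeval φ).toLinearMap LinearMap.id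

/-- Evaluation at a point. -/
abbrev pEval {m : ℕ} (c : Fin m → k) : G.alg.Polys m →ₗ[k] G.alg.carrier :=
  augmentation (MvPolynomial.aeval c)

theorem isDG_polys (m : ℕ) : IsDG (G.pBr m) (G.pDeg m) (G.pDiff m) (G.pFil m) G.order :=
  G.isDG.ext _

theorem dgDer {m : ℕ} (j : Fin m) :
    DGDer (G.pBr m) (G.pDeg m) (G.pDiff m) (DGLA.partialDeriv (G := G.alg) j) :=
  dgDer_pderiv _ _ _ _

theorem dgPrim [CharZero k] {m : ℕ} (j : Fin m) : DGPrim (G.pBr m) (G.pDeg m) (G.pDiff m) (G.pFil m)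
    (DGLA.partialDeriv (G := G.alg) j) (G.pSet j 0) (G.pInt j) :=
  dgPrim_pderiv _ _ _ _ _

theorem restrictZero_eq {m : ℕ} (j : Fin m) : DGLA.restrictZero (G := G.alg) j = G.pSet j 0 := by
  rw [DGLA.restrictZero, pSet, setVar, map_zero]

theorem dgMor_pSet {m : ℕ} (j : Fin m) (c : k) :
    DGMor (G.pBr m) (G.pDiff m) (G.pBr m) (G.pDiff m) (G.pSet j c) := dgMor_map _ _ _

theorem dgMor_pSub {m n : ℕ} (φ : Fin n → AffPoly k m) :
    DGMor (G.pBr n) (G.pDiff n) (G.pBr m) (G.pDiff m) (G.pSub φ) := dgMor_map _ _ _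

theorem dgMor_pEval {m : ℕ} (c : Fin m → k) :
    DGMor (G.pBr m) (G.pDiff m) G.alg.bracket G.alg.diff (G.pEval c) := augmentation_dgMor _ _ _

theorem dgMor_const (m : ℕ) : DGMor G.alg.bracket G.alg.diff (G.pBr m) (G.pDiff m)
    (TensorProduct.mk k (AffPoly k m) G.alg.carrier 1) := const_dgMor _ _ _

theorem partialDeriv_comm {m : ℕ} (i j : Fin m) (x : G.alg.Polys m) :
    DGLA.partialDeriv i (DGLA.partialDeriv j x) = DGLA.partialDeriv j (DGLA.partialDeriv i x) := by
  rw [DGLA.partialDeriv, DGLA.partialDeriv, map_map_id, map_map_id]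
  exact map_id_congr (fun f => PolyForm.pderiv_comm i j f) x

theorem pSet_partialDeriv {m : ℕ} {i j : Fin m} (hij : i ≠ j) (c : k) (x : G.alg.Polys m) :
    G.pSet j c (DGLA.partialDeriv i x) = DGLA.partialDeriv i (G.pSet j c x) := by
  rw [DGLA.partialDeriv, map_map_id, map_map_id]
  exact map_id_congr (fun f => (pderiv_setVar_of_ne hij c f).symm) x

theorem pSet_comm {m : ℕ} {i j : Fin m} (hij : i ≠ j) (c d : k) (x : G.alg.Polys m) :
    G.pSet i c (G.pSet j d x) = G.pSet j d (G.pSet i c x) := by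
  rw [map_map_id, map_map_id]
  exact map_id_congr (fun f => setVar_comm hij c d f) x

theorem pSub_pSub {m n p : ℕ} (ψ : Fin n → AffPoly k m) (φ : Fin p → AffPoly k n)
    (x : G.alg.Polys p) :
    G.pSub ψ (G.pSub φ x) = G.pSub (fun i => MvPolynomial.aeval ψ (φ i)) x := by
  rw [map_map_id]
  have h : (MvPolynomial.aeval ψ).comp (MvPolynomial.aeval φ) =
      MvPolynomial.aeval (R := k) fun i => MvPolynomial.aeval ψ (φ i) :=
    MvPolynomial.algHom_ext fun i => by simp
  exact map_id_congr (fun f => DFunLike.congr_fun h f) x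

theorem pSet_eq_pSub {m : ℕ} (j : Fin m) (c : k) :
    G.pSet j c = G.pSub (Function.update MvPolynomial.X j (MvPolynomial.C c)) := rfl

theorem pEval_pSub {m n : ℕ} (c : Fin m → k) (φ : Fin n → AffPoly k m) (x : G.alg.Polys n) :
    G.pEval c (G.pSub φ x) = G.pEval (fun i => MvPolynomial.aeval c (φ i)) x := by
  induction x using TensorProduct.induction_on with
  | zero => simp
  | tmul f v =>
    have : (MvPolynomial.aeval c).comp (MvPolynomial.aeval φ)
        = MvPolynomial.aeval (R := k) (fun i => MvPolynomial.aeval c (φ i)) :=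
      MvPolynomial.algHom_ext fun i => by simp
    simp only [TensorProduct.map_tmul, augmentation_tmul, LinearMap.id_apply,
      AlgHom.toLinearMap_apply, ← this, AlgHom.comp_apply]
  | add x y hx hy => simp only [map_add, hx, hy]

theorem pEval_pSet {m : ℕ} (c : Fin m → k) (j : Fin m) (d : k) (x : G.alg.Polys m) :
    G.pEval c (G.pSet j d x) = G.pEval (Function.update c j d) x := by
  have h : (fun i => MvPolynomial.aeval c (Function.update (MvPolynomial.X : Fin m → AffPoly k m) j
      (MvPolynomial.C d) i)) = Function.update c j d := by
    funext i
    rw [Function.update_apply, Function.update_apply]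
    split_ifs <;> simp
  rw [pSet_eq_pSub, pEval_pSub, h]

theorem evalOnes_eq {m : ℕ} : DGLA.evalOnes (G := G.alg) (m := m) = G.pEval fun _ => 1 := rfl

theorem partialDeriv_pSub {m n : ℕ} (φ : Fin n → AffPoly k m) (j : Fin m) (x : G.alg.Polys n) :
    DGLA.partialDeriv j (G.pSub φ x) =
      ∑ l, MvPolynomial.pderiv j (φ l) • G.pSub φ (DGLA.partialDeriv l x) := by
  induction x using TensorProduct.induction_on with
  | zero => simp
  | tmul f v =>
    simp only [DGLA.partialDeriv, TensorProduct.map_tmul, LinearMap.id_apply, Derivation.coeFn_coe,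
      AlgHom.toLinearMap_apply, pderiv_aeval, TensorProduct.sum_tmul, TensorProduct.smul_tmul',
      smul_eq_mul]
  | add x y hx hy => simp only [map_add, hx, hy, smul_add, Finset.sum_add_distrib]

end NilpDGLA

/-! ## Coefficients of forms -/

namespace PolyForm

variable {k : Type u} [Field k] {m n p : ℕ}

/-- Contraction of constant forms. -/
abbrev extContract (j : Fin m) : ExteriorAlgebra k (Fin m → k) →ₗ[k] ExteriorAlgebra k (Fin m → k) :=
  CliffordAlgebra.contractLeft (Q := (0 : QuadraticForm k (Fin m → k)))
    (LinearMap.proj j : (Fin m → k) →ₗ[k] k)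

theorem extContract_ι_mul (j : Fin m) (v : Fin m → k) (w : ExteriorAlgebra k (Fin m → k)) :
    extContract j (ExteriorAlgebra.ι k v * w) = v j • w - ExteriorAlgebra.ι k v * extContract j w :=
  CliffordAlgebra.contractLeft_ι_mul _ _ _

theorem extContract_dx_mul (i j : Fin m) (w : ExteriorAlgebra k (Fin m → k)) :
    extContract i (dx j * w) = (if i = j then w else 0) - dx j * extContract i w := by
  rw [dx, extContract_ι_mul, Pi.single_apply, ite_smul, one_smul, zero_smul]

theorem extContract_mul (j : Fin m) (v w : ExteriorAlgebra k (Fin m → k)) :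
    extContract j (v * w) = extContract j v * w + CliffordAlgebra.involute v * extContract j w := by
  induction v using CliffordAlgebra.left_induction with
  | algebraMap r =>
    rw [CliffordAlgebra.contractLeft_algebraMap_mul, CliffordAlgebra.contractLeft_algebraMap,
      AlgHom.commutes, zero_mul, zero_add]
  | add x y hx hy => simp only [add_mul, map_add, hx, hy]; abel
  | ι_mul x v hx =>
    rw [mul_assoc, CliffordAlgebra.contractLeft_ι_mul, hx, CliffordAlgebra.contractLeft_ι_mul, map_mul,
      CliffordAlgebra.involute_ι, sub_mul, smul_mul_assoc, mul_add, neg_mul, neg_mul, mul_assoc, mul_assoc]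
    abel

theorem extContract_involute (j : Fin m) (w : ExteriorAlgebra k (Fin m → k)) :
    extContract j (CliffordAlgebra.involute w) = -CliffordAlgebra.involute (extContract j w) := by
  induction w using CliffordAlgebra.left_induction with
  | algebraMap r => simp
  | add x y hx hy => simp only [map_add, hx, hy]; abel
  | ι_mul x v hx =>
    rw [map_mul, CliffordAlgebra.involute_ι, neg_mul, map_neg, CliffordAlgebra.contractLeft_ι_mul,
      CliffordAlgebra.contractLeft_ι_mul, hx, map_sub, map_smul, map_mul, CliffordAlgebra.involute_ι]
    simp only [mul_neg, neg_mul]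

theorem extContract_mem (j : Fin m) (q : ℕ) {w : ExteriorAlgebra k (Fin m → k)}
    (hw : w ∈ ⋀[k]^(q + 1) (Fin m → k)) : extContract j w ∈ ⋀[k]^q (Fin m → k) := by
  induction q generalizing w with
  | zero =>
    rw [ExteriorAlgebra.exteriorPower, zero_add, pow_one] at hw
    obtain ⟨v, rfl⟩ := hw
    rw [ExteriorAlgebra.exteriorPower, pow_zero, Submodule.mem_one]
    exact ⟨_, (CliffordAlgebra.contractLeft_ι _ _ _).symm⟩
  | succ q ih =>
    rw [ExteriorAlgebra.exteriorPower, pow_succ'] at hw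
    induction hw using Submodule.mul_induction_on' with
    | mem_mul_mem x hx y hy =>
      obtain ⟨v, rfl⟩ := hx
      rw [extContract_ι_mul]
      refine sub_mem (Submodule.smul_mem _ _ hy) ?_
      rw [ExteriorAlgebra.exteriorPower, pow_succ']
      exact Submodule.mul_mem_mul (LinearMap.mem_range_self _ _) (ih hy)
    | add x _ y _ hx hy => rw [map_add]; exact add_mem hx hy

theorem extContract_of_mem_zero (j : Fin m) {w : ExteriorAlgebra k (Fin m → k)}
    (hw : w ∈ ⋀[k]^0 (Fin m → k)) : extContract j w = 0 := by
  rw [ExteriorAlgebra.exteriorPower, pow_zero, Submodule.mem_one] at hw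
  obtain ⟨r, rfl⟩ := hw
  exact CliffordAlgebra.contractLeft_algebraMap _ _ r

theorem algebraMapInv_of_mem_succ (q : ℕ) {w : ExteriorAlgebra k (Fin m → k)}
    (hw : w ∈ ⋀[k]^(q + 1) (Fin m → k)) : ExteriorAlgebra.algebraMapInv w = 0 := by
  rw [ExteriorAlgebra.exteriorPower, pow_succ'] at hw
  induction hw using Submodule.mul_induction_on' with
  | mem_mul_mem x hx y hy =>
    obtain ⟨v, rfl⟩ := hx
    rw [map_mul, ExteriorAlgebra.algebraMapInv, ExteriorAlgebra.lift_ι_apply, LinearMap.zero_apply,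
      zero_mul]
  | add x _ y _ hx hy => rw [map_add, hx, hy, add_zero]

theorem contract_tmul (j : Fin m) (f : AffPoly k m) (w : ExteriorAlgebra k (Fin m → k)) :
    contract j (f ⊗ₜ w) = f ⊗ₜ extContract j w := rfl

theorem funPart_tmul (f : AffPoly k m) (w : ExteriorAlgebra k (Fin m → k)) :
    funPart (f ⊗ₜ w) = ExteriorAlgebra.algebraMapInv w • f := rfl

theorem invol_tmul (f : AffPoly k m) (w : ExteriorAlgebra k (Fin m → k)) :
    invol k m (f ⊗ₜ w) = f ⊗ₜ CliffordAlgebra.involute w := rfl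

theorem funPart_mul (ω η : PolyForm k m) : funPart (ω * η) = funPart ω * funPart η := by
  induction ω using TensorProduct.induction_on with
  | zero => simp
  | tmul f v =>
    induction η using TensorProduct.induction_on with
    | zero => simp
    | tmul g w =>
      rw [Algebra.TensorProduct.tmul_mul_tmul, funPart_tmul, funPart_tmul, funPart_tmul, map_mul,
        smul_mul_smul_comm]
    | add x y hx hy => rw [mul_add, map_add, map_add, mul_add, hx, hy]
  | add x y hx hy => rw [add_mul, map_add, map_add, add_mul, hx, hy]

theorem funPart_ofFun (f : AffPoly k m) : funPart (ofFun k m f) = f := by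
  rw [ofFun, Algebra.TensorProduct.includeLeft_apply, funPart_tmul, map_one, one_smul]

theorem algebraMapInv_dx_mul (j : Fin m) (w : ExteriorAlgebra k (Fin m → k)) :
    ExteriorAlgebra.algebraMapInv (dx j * w) = 0 := by
  rw [map_mul, dx, ExteriorAlgebra.algebraMapInv, ExteriorAlgebra.lift_ι_apply, LinearMap.zero_apply,
    zero_mul]

theorem funPart_d (ω : PolyForm k m) : funPart (d ω) = 0 := by
  induction ω using TensorProduct.induction_on with
  | zero => simp
  | tmul f w =>
    rw [d_tmul, map_sum]
    refine Finset.sum_eq_zero fun j _ => ?_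
    rw [funPart_tmul, algebraMapInv_dx_mul, zero_smul]
  | add x y hx hy => rw [map_add, map_add, hx, hy, add_zero]

theorem algebraMapInv_involute (w : ExteriorAlgebra k (Fin m → k)) :
    ExteriorAlgebra.algebraMapInv (CliffordAlgebra.involute w : ExteriorAlgebra k (Fin m → k)) =
      ExteriorAlgebra.algebraMapInv w := by
  induction w using CliffordAlgebra.left_induction with
  | algebraMap r => rw [AlgHom.commutes]
  | add x y hx hy => rw [map_add, map_add, hx, hy, map_add]
  | ι_mul x v hx =>
    have h : ∀ v : Fin m → k, ExteriorAlgebra.algebraMapInv (R := k) (M := Fin m → k)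
        (CliffordAlgebra.ι 0 v) = 0 := fun v => by
      rw [ExteriorAlgebra.algebraMapInv]
      exact (ExteriorAlgebra.lift_ι_apply _ _ _ _).trans rfl
    rw [map_mul, CliffordAlgebra.involute_ι, map_mul, map_mul, map_neg, h]
    simp

theorem funPart_invol (ω : PolyForm k m) : funPart (invol k m ω) = funPart ω := by
  induction ω using TensorProduct.induction_on with
  | zero => simp
  | tmul f w => rw [invol_tmul, funPart_tmul, algebraMapInv_involute, funPart_tmul]
  | add x y hx hy => simp only [map_add, hx, hy]

theorem contract_invol (j : Fin m) (ω : PolyForm k m) :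
    contract j (invol k m ω) = -invol k m (contract j ω) := by
  induction ω using TensorProduct.induction_on with
  | zero => simp
  | tmul f w => rw [invol_tmul, contract_tmul, extContract_involute, TensorProduct.tmul_neg]; rfl
  | add x y hx hy => simp only [map_add, hx, hy]; abel

theorem contract_mul (j : Fin m) (ω η : PolyForm k m) :
    contract j (ω * η) = contract j ω * η + invol k m ω * contract j η := by
  induction ω using TensorProduct.induction_on with
  | zero => simp
  | tmul f v =>
    induction η using TensorProduct.induction_on with
    | zero => simp
    | tmul g w =>
      rw [Algebra.TensorProduct.tmul_mul_tmul, contract_tmul, contract_tmul, contract_tmul, invol_tmul,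
        extContract_mul, TensorProduct.tmul_add, Algebra.TensorProduct.tmul_mul_tmul,
        Algebra.TensorProduct.tmul_mul_tmul]
    | add x y hx hy => rw [mul_add, map_add, map_add, mul_add, mul_add, hx, hy]; abel
  | add x y hx hy => rw [add_mul, map_add, map_add, map_add, add_mul, add_mul, hx, hy]; abel

theorem contract_ofFun (j : Fin m) (f : AffPoly k m) : contract j (ofFun k m f) = 0 := by
  rw [ofFun, Algebra.TensorProduct.includeLeft_apply, contract_tmul,
    CliffordAlgebra.contractLeft_one, TensorProduct.tmul_zero]

theorem contract_ofFun_mul (j : Fin m) (f : AffPoly k m) (ω : PolyForm k m) :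
    contract j (ofFun k m f * ω) = ofFun k m f * contract j ω := by
  rw [contract_mul, contract_ofFun, invol_ofFun, zero_mul, zero_add]

/-- The derivative of the coefficients of a form. -/
def coeffDeriv (j : Fin m) : PolyForm k m →ₗ[k] PolyForm k m :=
  TensorProduct.map (MvPolynomial.pderiv j).toLinearMap LinearMap.id

theorem coeffDeriv_tmul (j : Fin m) (f : AffPoly k m) (w : ExteriorAlgebra k (Fin m → k)) :
    coeffDeriv j (f ⊗ₜ w) = MvPolynomial.pderiv j f ⊗ₜ w := rfl

/-- Cartan's formula for coordinate vector fields. -/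
theorem contract_d (j : Fin m) (ω : PolyForm k m) :
    contract j (d ω) = coeffDeriv j ω - d (contract j ω) := by
  induction ω using TensorProduct.induction_on with
  | zero => simp
  | tmul f w =>
    rw [d_tmul, map_sum, contract_tmul, d_tmul, coeffDeriv_tmul]
    simp_rw [contract_tmul, extContract_dx_mul, TensorProduct.tmul_sub]
    rw [Finset.sum_sub_distrib]
    congr 1
    rw [Finset.sum_eq_single j]
    · rw [if_pos rfl]
    · intro b _ hb; rw [if_neg hb.symm, TensorProduct.tmul_zero]
    · simp
  | add x y hx hy => simp only [map_add, hx, hy]; abel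

theorem contract_coeffDeriv (i j : Fin m) (ω : PolyForm k m) :
    contract i (coeffDeriv j ω) = coeffDeriv j (contract i ω) := by
  induction ω using TensorProduct.induction_on with
  | zero => simp
  | tmul f w => rfl
  | add x y hx hy => simp only [map_add, hx, hy]

theorem funPart_coeffDeriv (j : Fin m) (ω : PolyForm k m) :
    funPart (coeffDeriv j ω) = MvPolynomial.pderiv j (funPart ω) := by
  induction ω using TensorProduct.induction_on with
  | zero => simp
  | tmul f w => rw [coeffDeriv_tmul, funPart_tmul, funPart_tmul, Derivation.map_smul]
  | add x y hx hy => simp only [map_add, hx, hy]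

theorem contract_contract (i j : Fin m) (ω : PolyForm k m) :
    contract i (contract j ω) = -contract j (contract i ω) := by
  induction ω using TensorProduct.induction_on with
  | zero => simp
  | tmul f w =>
    rw [contract_tmul, contract_tmul, contract_tmul, contract_tmul, CliffordAlgebra.contractLeft_comm,
      TensorProduct.tmul_neg]
  | add x y hx hy => simp only [map_add, hx, hy]; abel

/-- The value on `(∂/∂xᵢ, ∂/∂xⱼ, ∂/∂xₗ)` of the degree three part. -/
def coeff₃ (i j l : Fin m) : PolyForm k m →ₗ[k] AffPoly k m :=
  funPart ∘ₗ contract l ∘ₗ contract j ∘ₗ contract i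

theorem coeff₁_apply (j : Fin m) (ω : PolyForm k m) : coeff₁ j ω = funPart (contract j ω) := rfl

theorem coeff₂_apply (i j : Fin m) (ω : PolyForm k m) :
    coeff₂ i j ω = funPart (contract j (contract i ω)) := rfl

theorem coeff₃_apply (i j l : Fin m) (ω : PolyForm k m) :
    coeff₃ i j l ω = funPart (contract l (contract j (contract i ω))) := rfl

theorem coeff₁_d (i : Fin m) (ω : PolyForm k m) :
    coeff₁ i (d ω) = MvPolynomial.pderiv i (funPart ω) := by
  rw [coeff₁_apply, contract_d, map_sub, funPart_coeffDeriv, funPart_d, sub_zero]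

theorem coeff₂_d (i j : Fin m) (ω : PolyForm k m) :
    coeff₂ i j (d ω) = MvPolynomial.pderiv i (coeff₁ j ω) - MvPolynomial.pderiv j (coeff₁ i ω) := by
  rw [coeff₂_apply, contract_d, map_sub, map_sub, contract_coeffDeriv, funPart_coeffDeriv]
  exact congrArg _ (coeff₁_d j _)

theorem coeff₃_d (i j l : Fin m) (ω : PolyForm k m) :
    coeff₃ i j l (d ω) = MvPolynomial.pderiv i (coeff₂ j l ω) - MvPolynomial.pderiv j (coeff₂ i l ω) +
      MvPolynomial.pderiv l (coeff₂ i j ω) := by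
  rw [coeff₃_apply, contract_d, map_sub, map_sub, map_sub, contract_coeffDeriv, contract_coeffDeriv,
    funPart_coeffDeriv]
  refine (congrArg _ (coeff₂_d j l _)).trans ?_
  rw [coeff₁_apply, coeff₁_apply, coeff₂_apply, coeff₂_apply, coeff₂_apply]
  abel

theorem coeff₁_invol (i : Fin m) (ω : PolyForm k m) : coeff₁ i (invol k m ω) = -coeff₁ i ω := by
  rw [coeff₁_apply, contract_invol, map_neg, funPart_invol, coeff₁_apply]

theorem coeff₂_invol (i j : Fin m) (ω : PolyForm k m) : coeff₂ i j (invol k m ω) = coeff₂ i j ω := by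
  rw [coeff₂_apply, contract_invol, map_neg, map_neg, ← coeff₁_apply, coeff₁_invol, neg_neg]; rfl

theorem coeff₃_invol (i j l : Fin m) (ω : PolyForm k m) :
    coeff₃ i j l (invol k m ω) = -coeff₃ i j l ω := by
  rw [coeff₃_apply, contract_invol, map_neg, map_neg, map_neg]
  exact congrArg _ (coeff₂_invol j l _)

theorem coeff₁_mul (i : Fin m) (ω η : PolyForm k m) :
    coeff₁ i (ω * η) = coeff₁ i ω * funPart η + funPart ω * coeff₁ i η := by
  rw [coeff₁_apply, contract_mul, map_add, funPart_mul, funPart_mul, funPart_invol]; rfl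

theorem coeff₂_mul (i j : Fin m) (ω η : PolyForm k m) :
    coeff₂ i j (ω * η) = coeff₂ i j ω * funPart η + coeff₁ i ω * coeff₁ j η
      - coeff₁ j ω * coeff₁ i η + funPart ω * coeff₂ i j η := by
  rw [coeff₂_apply, contract_mul, map_add, map_add, ← coeff₁_apply, ← coeff₁_apply, coeff₁_mul,
    coeff₁_mul, coeff₁_invol, funPart_invol]
  simp only [← coeff₁_apply, coeff₂_apply]
  ring

theorem coeff₃_mul (i j l : Fin m) (ω η : PolyForm k m) :
    coeff₃ i j l (ω * η) = coeff₃ i j l ω * funPart η + coeff₂ i j ω * coeff₁ l η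
      - coeff₂ i l ω * coeff₁ j η + coeff₂ j l ω * coeff₁ i η + coeff₁ i ω * coeff₂ j l η
      - coeff₁ j ω * coeff₂ i l η + coeff₁ l ω * coeff₂ i j η + funPart ω * coeff₃ i j l η := by
  rw [coeff₃_apply, contract_mul, map_add, map_add, map_add, ← coeff₂_apply, ← coeff₂_apply, coeff₂_mul,
    coeff₂_mul, coeff₁_invol, coeff₁_invol, coeff₂_invol, funPart_invol]
  simp only [coeff₁_apply, coeff₂_apply, coeff₃_apply]
  ring

theorem ofDegree_induction {q : ℕ} {P : PolyForm k m → Prop} {ω : PolyForm k m}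
    (hω : ω ∈ ofDegree k m q) (h0 : P 0)
    (ht : ∀ f : AffPoly k m, ∀ w ∈ ⋀[k]^q (Fin m → k), P (f ⊗ₜ w)) (ha : ∀ x y, P x → P y → P (x + y)) :
    P ω := by
  obtain ⟨t, rfl⟩ := hω
  induction t using TensorProduct.induction_on with
  | zero => simpa using h0
  | tmul f w => exact ht f w w.2
  | add x y hx hy => rw [map_add]; exact ha _ _ hx hy

theorem tmul_mem_ofDegree {q : ℕ} (f : AffPoly k m) {w : ExteriorAlgebra k (Fin m → k)}
    (hw : w ∈ ⋀[k]^q (Fin m → k)) : f ⊗ₜ[k] w ∈ ofDegree k m q := ⟨f ⊗ₜ ⟨w, hw⟩, by simp⟩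

theorem contract_mem (j : Fin m) {q : ℕ} {ω : PolyForm k m} (hω : ω ∈ ofDegree k m (q + 1)) :
    contract j ω ∈ ofDegree k m q :=
  ofDegree_induction (P := fun ω => contract j ω ∈ ofDegree k m q) hω (by simp)
    (fun f w hw => tmul_mem_ofDegree f (extContract_mem j q hw))
    fun x y hx hy => by rw [map_add]; exact add_mem hx hy

theorem contract_of_mem_zero (j : Fin m) {ω : PolyForm k m} (hω : ω ∈ ofDegree k m 0) :
    contract j ω = 0 :=
  ofDegree_induction (P := fun ω => contract j ω = 0) hω (by simp)
    (fun f w hw => by rw [contract_tmul, extContract_of_mem_zero j hw, TensorProduct.tmul_zero])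
    fun x y hx hy => by rw [map_add, hx, hy, add_zero]

theorem funPart_of_mem {q : ℕ} {ω : PolyForm k m} (hω : ω ∈ ofDegree k m q) (hq : q ≠ 0) :
    funPart ω = 0 := by
  obtain ⟨q, rfl⟩ := Nat.exists_eq_succ_of_ne_zero hq
  exact ofDegree_induction (P := fun ω => funPart ω = 0) hω (by simp)
    (fun f w hw => by rw [funPart_tmul, algebraMapInv_of_mem_succ q hw, zero_smul])
    fun x y hx hy => by rw [map_add, hx, hy, add_zero]

theorem coeff₁_of_mem {q : ℕ} {ω : PolyForm k m} (hω : ω ∈ ofDegree k m q) (hq : q ≠ 1) (i : Fin m) :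
    coeff₁ i ω = 0 := by
  rcases q with _ | q
  · rw [coeff₁_apply, contract_of_mem_zero i hω, map_zero]
  · exact funPart_of_mem (contract_mem i hω) (by omega)

theorem coeff₂_of_mem {q : ℕ} {ω : PolyForm k m} (hω : ω ∈ ofDegree k m q) (hq : q ≠ 2)
    (i j : Fin m) : coeff₂ i j ω = 0 := by
  rcases q with _ | q
  · rw [coeff₂_apply, contract_of_mem_zero i hω, map_zero, map_zero]
  · exact coeff₁_of_mem (contract_mem i hω) (by omega) j

theorem coeff₃_of_mem {q : ℕ} {ω : PolyForm k m} (hω : ω ∈ ofDegree k m q) (hq : q ≠ 3)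
    (i j l : Fin m) : coeff₃ i j l ω = 0 := by
  rcases q with _ | q
  · rw [coeff₃_apply, contract_of_mem_zero i hω, map_zero, map_zero, map_zero]
  · exact coeff₂_of_mem (contract_mem i hω) (by omega) j l

/-! ### Pullbacks -/

theorem funPart_d_ofFun_mul (f : AffPoly k m) (ω : PolyForm k m) :
    funPart (d (ofFun k m f) * ω) = 0 := by
  rw [funPart_mul, funPart_d, zero_mul]

theorem pull_ind {P : PolyForm k n → Prop} (ω : PolyForm k n) (h1 : P 1)
    (hf : ∀ f ω, P ω → P (ofFun k n f * ω)) (hd : ∀ v ω, P ω → P (ofExt k n (ExteriorAlgebra.ι k v) * ω))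
    (ha : ∀ x y, P x → P y → P (x + y)) : P ω := by
  have h0 : P 0 := by simpa using hf 0 1 h1
  have hw : ∀ w : ExteriorAlgebra k (Fin n → k), P (ofExt k n w) := by
    intro w
    induction w using CliffordAlgebra.left_induction with
    | algebraMap r =>
      have := hf (algebraMap k _ r) 1 h1
      rwa [mul_one, AlgHom.commutes, ← AlgHom.commutes (ofExt k n)] at this
    | add x y hx hy => rw [map_add]; exact ha _ _ hx hy
    | ι_mul x v hx => rw [map_mul]; exact hd _ _ hx
  induction ω using TensorProduct.induction_on with
  | zero => exact h0
  | tmul f w => rw [tmul_eq]; exact hf _ _ (hw w)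
  | add x y hx hy => exact ha _ _ hx hy

theorem funPart_ofExt_ι_mul (v : Fin n → k) (ω : PolyForm k n) :
    funPart (ofExt k n (ExteriorAlgebra.ι k v) * ω) = 0 := by
  rw [funPart_mul, ofExt, Algebra.TensorProduct.includeRight_apply, funPart_tmul,
    ExteriorAlgebra.algebraMapInv, ExteriorAlgebra.lift_ι_apply]
  simp

theorem funPart_pull (φ : Fin n → AffPoly k m) (ω : PolyForm k n) :
    funPart (pull φ ω) = MvPolynomial.aeval φ (funPart ω) := by
  have h1 : ∀ r, funPart (1 : PolyForm k r) = 1 := fun r => by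
    rw [← map_one (ofFun k r), funPart_ofFun]
  refine pull_ind (P := fun ω => funPart (pull φ ω) = MvPolynomial.aeval φ (funPart ω)) ω ?_ ?_ ?_ ?_
  · rw [map_one, h1, h1, map_one]
  · intro f ω hω
    rw [map_mul, pull_ofFun, funPart_mul, funPart_ofFun, hω, funPart_mul, funPart_ofFun, map_mul]
  · intro v ω _
    rw [map_mul, pull_ofExt_ι, funPart_d_ofFun_mul, funPart_ofExt_ι_mul, map_zero]
  · intro x y hx hy; simp only [map_add, hx, hy]

theorem contract_d_ofFun (j : Fin m) (f : AffPoly k m) :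
    contract j (d (ofFun k m f)) = ofFun k m (MvPolynomial.pderiv j f) := by
  rw [contract_d, contract_ofFun, map_zero, sub_zero]; rfl

theorem contract_ofExt_ι_mul (j : Fin n) (v : Fin n → k) (ω : PolyForm k n) :
    contract j (ofExt k n (ExteriorAlgebra.ι k v) * ω) =
      v j • ω - ofExt k n (ExteriorAlgebra.ι k v) * contract j ω := by
  induction ω using TensorProduct.induction_on with
  | zero => simp
  | tmul f w =>
    rw [ofExt, Algebra.TensorProduct.includeRight_apply, Algebra.TensorProduct.tmul_mul_tmul,
      contract_tmul, contract_tmul, extContract_ι_mul, TensorProduct.tmul_sub,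
      Algebra.TensorProduct.tmul_mul_tmul, one_mul, TensorProduct.tmul_smul]
  | add x y hx hy => simp only [mul_add, map_add, hx, hy, smul_add]; abel

theorem mul_ofFun_left_comm (f : AffPoly k m) (ω η : PolyForm k m) :
    ω * (ofFun k m f * η) = ofFun k m f * (ω * η) := by
  rw [← mul_assoc, ← ofFun_comm, mul_assoc]

/-- The chain rule for contractions of pullbacks. -/
theorem contract_pull (φ : Fin n → AffPoly k m) (j : Fin m) (ω : PolyForm k n) :
    contract j (pull φ ω) =
      ∑ l, ofFun k m (MvPolynomial.pderiv j (φ l)) * pull φ (contract l ω) := by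
  have h1 : ∀ {r} (i : Fin r), contract i (1 : PolyForm k r) = 0 := fun {r} i => by
    rw [← map_one (ofFun k r), contract_ofFun]
  refine pull_ind (P := fun ω => contract j (pull φ ω) =
      ∑ l, ofFun k m (MvPolynomial.pderiv j (φ l)) * pull φ (contract l ω)) ω ?_ ?_ ?_ ?_
  · simp [h1]
  · intro f ω hω
    rw [map_mul, pull_ofFun, contract_ofFun_mul, hω, Finset.mul_sum]
    refine Finset.sum_congr rfl fun l _ => ?_
    rw [contract_ofFun_mul, map_mul, pull_ofFun, mul_ofFun_left_comm]
  · intro v ω hω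
    rw [map_mul, pull_ofExt_ι, contract_mul, contract_d_ofFun, invol_d_ofFun, hω, Finset.mul_sum]
    simp_rw [contract_ofExt_ι_mul, map_sub, map_mul, pull_ofExt_ι, mul_sub, Finset.sum_sub_distrib]
    rw [sub_eq_add_neg, ← Finset.sum_neg_distrib, map_sum, map_sum, Finset.sum_mul]
    congr 1
    · refine Finset.sum_congr rfl fun l _ => ?_
      rw [Derivation.map_smul, map_smul, map_smul, smul_mul_assoc, mul_smul_comm]
    · refine Finset.sum_congr rfl fun l _ => ?_
      rw [← mul_ofFun_left_comm]
      exact map_neg (LinearMap.mulRight k _) _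
  · intro x y hx hy; simp only [map_add, hx, hy, mul_add, Finset.sum_add_distrib]

theorem coeff₁_pull (φ : Fin n → AffPoly k m) (j : Fin m) (ω : PolyForm k n) :
    coeff₁ j (pull φ ω) = ∑ l, MvPolynomial.pderiv j (φ l) * MvPolynomial.aeval φ (coeff₁ l ω) := by
  rw [coeff₁_apply, contract_pull, map_sum]
  refine Finset.sum_congr rfl fun l _ => ?_
  rw [funPart_mul, funPart_ofFun, funPart_pull]; rfl

theorem coeff₂_pull (φ : Fin n → AffPoly k m) (i j : Fin m) (ω : PolyForm k n) :
    coeff₂ i j (pull φ ω) = ∑ l, ∑ l', (MvPolynomial.pderiv i (φ l) * MvPolynomial.pderiv j (φ l')) *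
      MvPolynomial.aeval φ (coeff₂ l l' ω) := by
  rw [coeff₂_apply, contract_pull, map_sum, map_sum]
  refine Finset.sum_congr rfl fun l _ => ?_
  rw [contract_ofFun_mul, funPart_mul, funPart_ofFun, ← coeff₁_apply, coeff₁_pull, Finset.mul_sum]
  exact Finset.sum_congr rfl fun l' _ => (mul_assoc _ _ _).symm

end PolyForm

/-! ## The components of Maurer–Cartan forms -/

namespace DGLA

variable {k : Type u} [Field k] {G : DGLA k} {m n : ℕ}

/-- The degree zero part of a `𝔤`-valued form. -/
def formsFun : G.Forms m →ₗ[k] G.Polys m := TensorProduct.map PolyForm.funPart LinearMap.id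

/-- The values of the degree three part of a `𝔤`-valued form. -/
def formsCoeff₃ (i j l : Fin m) : G.Forms m →ₗ[k] G.Polys m :=
  TensorProduct.map (PolyForm.coeff₃ i j l) LinearMap.id

theorem formsDegOne_induction {P : G.Forms m → Prop} {μ : G.Forms m} (hμ : μ ∈ G.formsDegOne m)
    (h0 : P 0) (ht : ∀ (q : ℕ), ∀ ω ∈ PolyForm.ofDegree k m q, ∀ x ∈ G.deg (1 - q), P (ω ⊗ₜ x))
    (ha : ∀ x y, P x → P y → P (x + y)) : P μ := by
  refine Submodule.iSup_induction _ (motive := P) hμ ?_ h0 ha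
  rintro q _ ⟨t, rfl⟩
  induction t using TensorProduct.induction_on with
  | zero => simpa using h0
  | tmul ω x => exact ht q ω ω.2 x x.2
  | add x y hx hy => rw [map_add]; exact ha _ _ hx hy

theorem mem_extSub_of_degOne (T : PolyForm k m →ₗ[k] AffPoly k m) (q : ℕ)
    (hT : ∀ q', q' ≠ q → ∀ ω ∈ PolyForm.ofDegree k m q', T ω = 0) {μ : G.Forms m}
    (hμ : μ ∈ G.formsDegOne m) :
    TensorProduct.map T LinearMap.id μ ∈ extSub (AffPoly k m) (G.deg (1 - q)) := by
  refine formsDegOne_induction (P := fun μ => TensorProduct.map T LinearMap.id μ ∈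
    extSub (AffPoly k m) (G.deg (1 - q))) hμ (by simp) (fun q' ω hω x hx => ?_)
    fun x y hx hy => by rw [map_add]; exact add_mem hx hy
  rw [TensorProduct.map_tmul]
  by_cases h : q' = q
  · subst h; exact tmul_mem_extSub _ hx
  · rw [hT q' h ω hω, TensorProduct.zero_tmul]; exact zero_mem _

theorem formsFun_mem {μ : G.Forms m} (hμ : μ ∈ G.formsDegOne m) :
    formsFun μ ∈ extSub (AffPoly k m) (G.deg 1) := by
  have := mem_extSub_of_degOne PolyForm.funPart 0 (fun q hq ω hω => PolyForm.funPart_of_mem hω hq) hμ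
  rwa [show (1 : ℤ) - (0 : ℕ) = 1 by norm_num] at this

theorem formsCoeff₁_mem {μ : G.Forms m} (hμ : μ ∈ G.formsDegOne m) (i : Fin m) :
    formsCoeff₁ i μ ∈ extSub (AffPoly k m) (G.deg 0) := by
  have := mem_extSub_of_degOne (PolyForm.coeff₁ i) 1
    (fun q hq ω hω => PolyForm.coeff₁_of_mem hω hq i) hμ
  rwa [show (1 : ℤ) - (1 : ℕ) = 0 by norm_num] at this

theorem formsCoeff₂_mem {μ : G.Forms m} (hμ : μ ∈ G.formsDegOne m) (i j : Fin m) :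
    formsCoeff₂ i j μ ∈ extSub (AffPoly k m) (G.deg (-1)) := by
  have := mem_extSub_of_degOne (PolyForm.coeff₂ i j) 2
    (fun q hq ω hω => PolyForm.coeff₂_of_mem hω hq i j) hμ
  rwa [show (1 : ℤ) - (2 : ℕ) = -1 by norm_num] at this

theorem formsCoeff₃_eq_zero (hG : G.deg (-2) = ⊥) {μ : G.Forms m} (hμ : μ ∈ G.formsDegOne m)
    (i j l : Fin m) : formsCoeff₃ i j l μ = 0 := by
  have := mem_extSub_of_degOne (PolyForm.coeff₃ i j l) 3
    (fun q hq ω hω => PolyForm.coeff₃_of_mem hω hq i j l) hμ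
  rw [show (1 : ℤ) - (3 : ℕ) = -2 by norm_num, hG, extSub_bot] at this
  exact (Submodule.mem_bot k).1 this

theorem formsDiff_tmul (ω : PolyForm k m) (x : G.carrier) :
    G.formsDiff m (ω ⊗ₜ x) = PolyForm.d ω ⊗ₜ x + PolyForm.invol k m ω ⊗ₜ G.diff x := rfl

theorem formsFun_diff (μ : G.Forms m) :
    formsFun (G.formsDiff m μ) = TensorProduct.map LinearMap.id G.diff (formsFun μ) := by
  induction μ using TensorProduct.induction_on with
  | zero => simp
  | tmul ω x =>
    rw [formsDiff_tmul, map_add]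
    simp only [formsFun, TensorProduct.map_tmul, PolyForm.funPart_d, PolyForm.funPart_invol,
      LinearMap.id_apply, TensorProduct.zero_tmul, zero_add]
  | add x y hx hy => simp only [map_add, hx, hy]

theorem formsCoeff₁_diff (i : Fin m) (μ : G.Forms m) :
    formsCoeff₁ i (G.formsDiff m μ) = partialDeriv i (formsFun μ) -
      TensorProduct.map LinearMap.id G.diff (formsCoeff₁ i μ) := by
  induction μ using TensorProduct.induction_on with
  | zero => simp
  | tmul ω x =>
    rw [formsDiff_tmul, map_add]
    simp only [formsFun, formsCoeff₁, partialDeriv, TensorProduct.map_tmul, PolyForm.coeff₁_d,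
      PolyForm.coeff₁_invol, LinearMap.id_apply, TensorProduct.neg_tmul, Derivation.coeFn_coe]
    rw [sub_eq_add_neg]
  | add x y hx hy => simp only [map_add, hx, hy]; abel

theorem formsCoeff₂_diff (i j : Fin m) (μ : G.Forms m) :
    formsCoeff₂ i j (G.formsDiff m μ) = partialDeriv i (formsCoeff₁ j μ) -
      partialDeriv j (formsCoeff₁ i μ) +
      TensorProduct.map LinearMap.id G.diff (formsCoeff₂ i j μ) := by
  induction μ using TensorProduct.induction_on with
  | zero => simp
  | tmul ω x =>
    rw [formsDiff_tmul, map_add]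
    simp only [formsCoeff₂, formsCoeff₁, partialDeriv, TensorProduct.map_tmul, PolyForm.coeff₂_d,
      PolyForm.coeff₂_invol, LinearMap.id_apply, TensorProduct.sub_tmul, Derivation.coeFn_coe]
  | add x y hx hy => simp only [map_add, hx, hy]; abel

theorem formsCoeff₃_diff (i j l : Fin m) (μ : G.Forms m) :
    formsCoeff₃ i j l (G.formsDiff m μ) = partialDeriv i (formsCoeff₂ j l μ) -
      partialDeriv j (formsCoeff₂ i l μ) + partialDeriv l (formsCoeff₂ i j μ) -
      TensorProduct.map LinearMap.id G.diff (formsCoeff₃ i j l μ) := by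
  induction μ using TensorProduct.induction_on with
  | zero => simp
  | tmul ω x =>
    rw [formsDiff_tmul, map_add]
    simp only [formsCoeff₃, formsCoeff₂, partialDeriv, TensorProduct.map_tmul, PolyForm.coeff₃_d,
      PolyForm.coeff₃_invol, LinearMap.id_apply, TensorProduct.sub_tmul, TensorProduct.add_tmul,
      TensorProduct.neg_tmul, Derivation.coeFn_coe]
    rw [sub_eq_add_neg _ (PolyForm.coeff₃ i j l ω ⊗ₜ[k] G.diff x)]
  | add x y hx hy => simp only [map_add, hx, hy]; abel

theorem formsBracket_even {i : ℤ} (hi : Even i) (ω η : PolyForm k m) {x : G.carrier} (hx : x ∈ G.deg i)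
    (y : G.carrier) : G.formsBracket m (ω ⊗ₜ x) (η ⊗ₜ y) = (ω * η) ⊗ₜ G.bracket x y := by
  simp only [formsBracket, LinearMap.add_apply, TensorProduct.map₂_apply_tmul, TensorProduct.map_tmul, LinearMap.comp_apply,
    oddPart, LinearMap.sub_apply, LinearMap.id_apply, evenPart_of_mem hx, if_pos hi, sub_self, map_zero,
    LinearMap.zero_apply, TensorProduct.tmul_zero, add_zero, LinearMap.mul_apply']

theorem formsBracket_odd {i : ℤ} (hi : Odd i) (ω η : PolyForm k m) {x : G.carrier} (hx : x ∈ G.deg i)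
    (y : G.carrier) : G.formsBracket m (ω ⊗ₜ x) (η ⊗ₜ y) =
      (ω * PolyForm.invol k m η) ⊗ₜ G.bracket x y := by
  have hi' : ¬ Even i := Int.not_even_iff_odd.2 hi
  simp only [formsBracket, LinearMap.add_apply, TensorProduct.map₂_apply_tmul, TensorProduct.map_tmul, LinearMap.comp_apply,
    oddPart, LinearMap.sub_apply, LinearMap.id_apply, evenPart_of_mem hx, if_neg hi', sub_zero, map_zero,
    LinearMap.zero_apply, TensorProduct.tmul_zero, zero_add, LinearMap.mul_apply',
    LinearMap.compl₂_apply, AlgHom.toLinearMap_apply]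

/-- A bilinear formula for the components of the bracket of a form of degree one holds if it holds on
pure tensors. -/
theorem formsBracket_induction {μ : G.Forms m} (hμ : μ ∈ G.formsDegOne m) (ν : G.Forms m)
    (T : PolyForm k m →ₗ[k] AffPoly k m)
    (B : G.Forms m →ₗ[k] G.Forms m →ₗ[k] G.Polys m)
    (h : ∀ (q : ℕ), ∀ ω ∈ PolyForm.ofDegree k m q, ∀ (η η' : PolyForm k m) (x y : G.carrier),
      (Odd q → η' = η) → (Even q → η' = PolyForm.invol k m η) →
      T (ω * η') ⊗ₜ G.bracket x y = B (ω ⊗ₜ x) (η ⊗ₜ y)) :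
    TensorProduct.map T LinearMap.id (G.formsBracket m μ ν) = B μ ν := by
  refine formsDegOne_induction (P := fun μ =>
    TensorProduct.map T LinearMap.id (G.formsBracket m μ ν) = B μ ν) hμ (by simp)
    (fun q ω hω x hx => ?_) fun x y hx hy => by simp only [map_add, LinearMap.add_apply, hx, hy]
  induction ν using TensorProduct.induction_on with
  | zero => simp
  | tmul η y =>
    rcases Nat.even_or_odd q with hq | hq
    · have : Odd (1 - q : ℤ) := by
        rw [Int.odd_sub]; simp [hq]
      rw [formsBracket_odd this ω η hx, TensorProduct.map_tmul, LinearMap.id_apply]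
      exact h q ω hω _ _ _ _ (fun h => absurd hq (Nat.not_even_iff_odd.2 h)) fun _ => rfl
    · have : Even (1 - q : ℤ) := by
        rw [Int.even_sub]; simp [hq]
      rw [formsBracket_even this ω η hx, TensorProduct.map_tmul, LinearMap.id_apply]
      exact h q ω hω _ _ _ _ (fun _ => rfl) fun h => absurd h (Nat.not_even_iff_odd.2 hq)
  | add x y hx hy => simp only [map_add, hx, hy]

/-- The pairing `(μ, ν) ↦ c [S μ, T ν]` of forms with values in polynomials. -/
def coeffPairing (c : k) (S T : PolyForm k m →ₗ[k] AffPoly k m) :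
    G.Forms m →ₗ[k] G.Forms m →ₗ[k] G.Polys m :=
  c • (extAct (AffPoly k m) G.bracket).compl₁₂ (TensorProduct.map S LinearMap.id)
    (TensorProduct.map T LinearMap.id)

theorem neg_one_smul_polys (v : G.Polys m) : (-1 : k) • v = -v := neg_one_smul k v

theorem coeffPairing_apply (c : k) (S T : PolyForm k m →ₗ[k] AffPoly k m) (μ ν : G.Forms m) :
    coeffPairing c S T μ ν = c • extAct (AffPoly k m) G.bracket (TensorProduct.map S LinearMap.id μ)
      (TensorProduct.map T LinearMap.id ν) := rfl

theorem coeffPairing_tmul (c : k) (S T : PolyForm k m →ₗ[k] AffPoly k m) (ω η : PolyForm k m)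
    (x y : G.carrier) : coeffPairing c S T (ω ⊗ₜ x) (η ⊗ₜ y) = (c • (S ω * T η)) ⊗ₜ G.bracket x y := rfl

theorem formsFun_bracket {μ : G.Forms m} (hμ : μ ∈ G.formsDegOne m) (ν : G.Forms m) :
    formsFun (G.formsBracket m μ ν) =
      extAct (AffPoly k m) G.bracket (formsFun μ) (formsFun ν) := by
  refine (formsBracket_induction hμ ν _ (coeffPairing (k := k) (G := G) 1 PolyForm.funPart PolyForm.funPart) ?_).trans ?_; rotate_left
  · simp only [LinearMap.add_apply, coeffPairing_apply, one_smul, neg_one_smul_polys, ← sub_eq_add_neg]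
    rfl
  intro q ω hω η η' x y h1 h2
  rw [coeffPairing_tmul, PolyForm.funPart_mul, one_smul]
  rcases Nat.even_or_odd q with hq | hq
  · rw [h2 hq, PolyForm.funPart_invol]
  · rw [h1 hq]

theorem formsCoeff₁_bracket {μ : G.Forms m} (hμ : μ ∈ G.formsDegOne m) (ν : G.Forms m) (i : Fin m) :
    formsCoeff₁ i (G.formsBracket m μ ν) =
      extAct (AffPoly k m) G.bracket (formsCoeff₁ i μ) (formsFun ν) -
      extAct (AffPoly k m) G.bracket (formsFun μ) (formsCoeff₁ i ν) := by
  refine (formsBracket_induction hμ ν _ (coeffPairing (k := k) (G := G) 1 (PolyForm.coeff₁ i) PolyForm.funPart + coeffPairing (-1) PolyForm.funPart (PolyForm.coeff₁ i)) ?_).trans ?_; rotate_left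
  · simp only [LinearMap.add_apply, coeffPairing_apply, one_smul, neg_one_smul_polys, ← sub_eq_add_neg]
    rfl
  intro q ω hω η η' x y h1 h2
  simp only [LinearMap.add_apply, coeffPairing_tmul, ← TensorProduct.add_tmul, PolyForm.coeff₁_mul,
    one_smul, neg_one_smul]
  refine congrArg (· ⊗ₜ[k] G.bracket x y) ?_
  rcases Nat.even_or_odd q with hq | hq
  · rw [h2 hq, PolyForm.coeff₁_of_mem hω (by rintro rfl; exact absurd hq (by decide)), PolyForm.coeff₁_invol]
    ring
  · rw [h1 hq, PolyForm.funPart_of_mem hω (by rintro rfl; exact absurd hq (by decide))]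
    ring

theorem formsCoeff₂_bracket {μ : G.Forms m} (hμ : μ ∈ G.formsDegOne m) (ν : G.Forms m) (i j : Fin m) :
    formsCoeff₂ i j (G.formsBracket m μ ν) =
      extAct (AffPoly k m) G.bracket (formsCoeff₂ i j μ) (formsFun ν) +
      extAct (AffPoly k m) G.bracket (formsCoeff₁ i μ) (formsCoeff₁ j ν) -
      extAct (AffPoly k m) G.bracket (formsCoeff₁ j μ) (formsCoeff₁ i ν) +
      extAct (AffPoly k m) G.bracket (formsFun μ) (formsCoeff₂ i j ν) := by
  refine (formsBracket_induction hμ ν _ (coeffPairing (k := k) (G := G) 1 (PolyForm.coeff₂ i j) PolyForm.funPart +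
    coeffPairing 1 (PolyForm.coeff₁ i) (PolyForm.coeff₁ j) + coeffPairing (-1) (PolyForm.coeff₁ j) (PolyForm.coeff₁ i) +
    coeffPairing 1 PolyForm.funPart (PolyForm.coeff₂ i j)) ?_).trans ?_; rotate_left
  · simp only [LinearMap.add_apply, coeffPairing_apply, one_smul, neg_one_smul_polys, ← sub_eq_add_neg]
    rfl
  intro q ω hω η η' x y h1 h2
  simp only [LinearMap.add_apply, coeffPairing_tmul, one_smul, neg_one_smul, ← TensorProduct.add_tmul, PolyForm.coeff₂_mul]
  refine congrArg (· ⊗ₜ[k] G.bracket x y) ?_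
  rcases Nat.even_or_odd q with hq | hq
  · have h : q ≠ 1 := by rintro rfl; exact absurd hq (by decide)
    rw [h2 hq, PolyForm.coeff₁_of_mem hω h, PolyForm.coeff₁_of_mem hω h, PolyForm.coeff₂_invol,
      PolyForm.funPart_invol]
    ring
  · rw [h1 hq]
    ring

theorem formsCoeff₃_bracket {μ : G.Forms m} (hμ : μ ∈ G.formsDegOne m) (ν : G.Forms m)
    (i j l : Fin m) :
    formsCoeff₃ i j l (G.formsBracket m μ ν) =
      extAct (AffPoly k m) G.bracket (formsCoeff₃ i j l μ) (formsFun ν) -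
      extAct (AffPoly k m) G.bracket (formsCoeff₂ i j μ) (formsCoeff₁ l ν) +
      extAct (AffPoly k m) G.bracket (formsCoeff₂ i l μ) (formsCoeff₁ j ν) -
      extAct (AffPoly k m) G.bracket (formsCoeff₂ j l μ) (formsCoeff₁ i ν) +
      extAct (AffPoly k m) G.bracket (formsCoeff₁ i μ) (formsCoeff₂ j l ν) -
      extAct (AffPoly k m) G.bracket (formsCoeff₁ j μ) (formsCoeff₂ i l ν) +
      extAct (AffPoly k m) G.bracket (formsCoeff₁ l μ) (formsCoeff₂ i j ν) -
      extAct (AffPoly k m) G.bracket (formsFun μ) (formsCoeff₃ i j l ν) := by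
  refine (formsBracket_induction hμ ν _ (coeffPairing (k := k) (G := G) 1 (PolyForm.coeff₃ i j l) PolyForm.funPart + coeffPairing (-1) (PolyForm.coeff₂ i j) (PolyForm.coeff₁ l) +
    coeffPairing 1 (PolyForm.coeff₂ i l) (PolyForm.coeff₁ j) + coeffPairing (-1) (PolyForm.coeff₂ j l) (PolyForm.coeff₁ i) +
    coeffPairing 1 (PolyForm.coeff₁ i) (PolyForm.coeff₂ j l) + coeffPairing (-1) (PolyForm.coeff₁ j) (PolyForm.coeff₂ i l) +
    coeffPairing 1 (PolyForm.coeff₁ l) (PolyForm.coeff₂ i j) + coeffPairing (-1) PolyForm.funPart (PolyForm.coeff₃ i j l)) ?_).trans ?_; rotate_left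
  · simp only [LinearMap.add_apply, coeffPairing_apply, one_smul, neg_one_smul_polys, ← sub_eq_add_neg]
    rfl
  intro q ω hω η η' x y h1 h2
  simp only [LinearMap.add_apply, coeffPairing_tmul, one_smul, neg_one_smul, ← TensorProduct.add_tmul, PolyForm.coeff₃_mul]
  refine congrArg (· ⊗ₜ[k] G.bracket x y) ?_
  rcases Nat.even_or_odd q with hq | hq
  · have h : q ≠ 1 := by rintro rfl; exact absurd hq (by decide)
    have h' : q ≠ 3 := by rintro rfl; exact absurd hq (by decide)
    simp only [h2 hq, PolyForm.coeff₁_of_mem hω h, PolyForm.coeff₃_of_mem hω h', PolyForm.coeff₁_invol,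
      PolyForm.coeff₂_invol, PolyForm.coeff₃_invol]
    ring
  · have h : q ≠ 0 := by rintro rfl; exact absurd hq (by decide)
    have h' : q ≠ 2 := by rintro rfl; exact absurd hq (by decide)
    simp only [h1 hq, PolyForm.funPart_of_mem hω h, PolyForm.coeff₂_of_mem hω h']
    ring

/-! ### Pullbacks -/

theorem pullForms_tmul (φ : Fin n → AffPoly k m) (ω : PolyForm k n) (x : G.carrier) :
    G.pullForms φ (ω ⊗ₜ x) = PolyForm.pull φ ω ⊗ₜ x := rfl

theorem pullForms_pullForms {p : ℕ} (ψ : Fin n → AffPoly k m) (φ : Fin p → AffPoly k n)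
    (μ : G.Forms p) : G.pullForms ψ (G.pullForms φ μ) =
      G.pullForms (fun i => MvPolynomial.aeval ψ (φ i)) μ := by
  induction μ using TensorProduct.induction_on with
  | zero => simp
  | tmul ω x =>
    rw [pullForms_tmul, pullForms_tmul, pullForms_tmul, ← PolyForm.pull_comp, AlgHom.comp_apply]
  | add x y hx hy => simp only [map_add, hx, hy]

theorem formsFun_pull (φ : Fin n → AffPoly k m) (μ : G.Forms n) :
    formsFun (G.pullForms φ μ) =
      TensorProduct.map (MvPolynomial.aeval φ).toLinearMap LinearMap.id (formsFun μ) := by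
  induction μ using TensorProduct.induction_on with
  | zero => simp
  | tmul ω x =>
    simp only [pullForms_tmul, formsFun, TensorProduct.map_tmul, PolyForm.funPart_pull,
      LinearMap.id_apply, AlgHom.toLinearMap_apply]
  | add x y hx hy => simp only [map_add, hx, hy]

theorem formsCoeff₁_pull (φ : Fin n → AffPoly k m) (j : Fin m) (μ : G.Forms n) :
    formsCoeff₁ j (G.pullForms φ μ) = ∑ l, MvPolynomial.pderiv j (φ l) •
      TensorProduct.map (MvPolynomial.aeval φ).toLinearMap LinearMap.id (formsCoeff₁ l μ) := by
  induction μ using TensorProduct.induction_on with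
  | zero => simp
  | tmul ω x =>
    simp only [pullForms_tmul, formsCoeff₁, TensorProduct.map_tmul, PolyForm.coeff₁_pull,
      LinearMap.id_apply, AlgHom.toLinearMap_apply, TensorProduct.sum_tmul, TensorProduct.smul_tmul',
      smul_eq_mul]
  | add x y hx hy => simp only [map_add, hx, hy, smul_add, Finset.sum_add_distrib]

theorem formsCoeff₂_pull (φ : Fin n → AffPoly k m) (i j : Fin m) (μ : G.Forms n) :
    formsCoeff₂ i j (G.pullForms φ μ) =
      ∑ l, ∑ l', (MvPolynomial.pderiv i (φ l) * MvPolynomial.pderiv j (φ l')) •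
        TensorProduct.map (MvPolynomial.aeval φ).toLinearMap LinearMap.id (formsCoeff₂ l l' μ) := by
  induction μ using TensorProduct.induction_on with
  | zero => simp
  | tmul ω x =>
    simp only [pullForms_tmul, formsCoeff₂, TensorProduct.map_tmul, PolyForm.coeff₂_pull,
      LinearMap.id_apply, AlgHom.toLinearMap_apply, TensorProduct.sum_tmul, TensorProduct.smul_tmul',
      smul_eq_mul]
  | add x y hx hy => simp only [map_add, hx, hy, smul_add, Finset.sum_add_distrib]

end DGLA

namespace NilpDGLA

open DGLA

variable {k : Type u} [Field k] [CharZero k] {G : NilpDGLA k} {m : ℕ} {μ : G.alg.Forms m}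

theorem half_add_self {W : Type u} [AddCommGroup W] [Module k W] (w : W) :
    (2 : k)⁻¹ • (w + w) = w := by
  rw [← two_smul k w, smul_smul, inv_mul_cancel₀ two_ne_zero, one_smul]

theorem mc_fun (h : G.alg.IsFormsMC μ) :
    IsDG.MC (G.pBr m) (G.pDeg m) (G.pDiff m) (formsFun μ) := by
  refine ⟨formsFun_mem h.1, ?_⟩
  have h2 := congrArg formsFun h.2
  rwa [map_add, map_smul, formsFun_diff, formsFun_bracket h.1, map_zero] at h2

theorem mc_one (h : G.alg.IsFormsMC μ) (i : Fin m) :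
    partialDeriv i (formsFun μ) = dOp (G.pBr m) (G.pDiff m) (formsFun μ) (formsCoeff₁ i μ) := by
  have h2 := congrArg (formsCoeff₁ i) h.2
  have hs := (G.isDG_polys m).skew0 (formsCoeff₁_mem h.1 i) (formsFun_mem h.1)
  rw [map_add, map_smul, formsCoeff₁_diff, formsCoeff₁_bracket h.1, map_zero, hs, ← neg_add', smul_neg,
    half_add_self] at h2
  rw [dOp_apply, ← sub_eq_zero, ← h2]
  abel

theorem mc_two (h : G.alg.IsFormsMC μ) (i j : Fin m) :
    partialDeriv i (formsCoeff₁ j μ) - partialDeriv j (formsCoeff₁ i μ) +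
      G.pBr m (formsCoeff₁ i μ) (formsCoeff₁ j μ) +
      dOp (G.pBr m) (G.pDiff m) (formsFun μ) (formsCoeff₂ i j μ) = 0 := by
  have h2 := congrArg (formsCoeff₂ i j) h.2
  have hs := (G.isDG_polys m).skew0 (formsCoeff₁_mem h.1 j) (formsCoeff₁_mem h.1 i)
  have hs' := (G.isDG_polys m).symm1 (j := -1) (by decide) (formsFun_mem h.1) (formsCoeff₂_mem h.1 i j)
  have h3 : ∀ a b : G.alg.Polys m, a + b - -b + a = (a + b) + (a + b) := fun a b => by abel
  rw [map_add, map_smul, formsCoeff₂_diff, formsCoeff₂_bracket h.1, map_zero, hs, hs', h3,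
    half_add_self] at h2
  rw [dOp_apply, ← h2, hs']
  abel

theorem mc_three (h : G.alg.IsFormsMC μ) (i j l : Fin m) :
    partialDeriv i (formsCoeff₂ j l μ) - partialDeriv j (formsCoeff₂ i l μ) +
      partialDeriv l (formsCoeff₂ i j μ) + G.pBr m (formsCoeff₁ i μ) (formsCoeff₂ j l μ) -
      G.pBr m (formsCoeff₁ j μ) (formsCoeff₂ i l μ) +
      G.pBr m (formsCoeff₁ l μ) (formsCoeff₂ i j μ) = 0 := by
  have h2 := congrArg (formsCoeff₃ i j l) h.2
  have hs := fun a b c => (G.isDG_polys m).skew0 (formsCoeff₁_mem h.1 a) (formsCoeff₂_mem h.1 b c)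
  have hz := formsCoeff₃_eq_zero (G.bounded _ le_rfl) h.1 i j l
  have h3 : ∀ a b c : G.alg.Polys m, 0 - -c + -b - -a + a - b + c - 0 =
    (a - b + c) + (a - b + c) := fun a b c => by abel
  rw [map_add, map_smul, formsCoeff₃_diff, formsCoeff₃_bracket h.1, hz, map_zero, map_zero, map_zero,
    LinearMap.zero_apply, map_zero, hs i, hs j, hs l] at h2
  have h4 := h3 (-G.pBr m (formsCoeff₂ j l μ) (formsCoeff₁ i μ))
    (-G.pBr m (formsCoeff₂ i l μ) (formsCoeff₁ j μ)) (-G.pBr m (formsCoeff₂ i j μ) (formsCoeff₁ l μ))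
  simp only [neg_neg] at h4
  rw [h4, half_add_self] at h2
  rw [hs i, hs j, hs l, ← h2]
  abel

end NilpDGLA

/-! ## Logarithms of solutions -/

namespace NilpDGLA

open DGLA

variable {k : Type u} [Field k] (G : NilpDGLA k) {m n : ℕ}

/-- The polynomial with constant value. -/
abbrev pConst (m : ℕ) (x : G.alg.carrier) : G.alg.Polys m := (1 : AffPoly k m) ⊗ₜ[k] x

variable {G}

theorem pConst_mem {i : ℤ} {x : G.alg.carrier} (hx : x ∈ G.alg.deg i) : G.pConst m x ∈ G.pDeg m i :=
  tmul_mem_extSub _ hx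

theorem pSub_pConst (φ : Fin n → AffPoly k m) (x : G.alg.carrier) :
    G.pSub φ (G.pConst n x) = G.pConst m x := by
  rw [TensorProduct.map_tmul, AlgHom.toLinearMap_apply, map_one, LinearMap.id_apply]

theorem pSet_pConst (j : Fin m) (c : k) (x : G.alg.carrier) :
    G.pSet j c (G.pConst m x) = G.pConst m x := pSub_pConst _ x

theorem partialDeriv_pConst (j : Fin m) (x : G.alg.carrier) :
    partialDeriv j (G.pConst m x) = 0 := by
  rw [partialDeriv, TensorProduct.map_tmul, Derivation.coeFn_coe, Derivation.map_one_eq_zero,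
    TensorProduct.zero_tmul]

theorem pEval_pConst (c : Fin m → k) (x : G.alg.carrier) : G.pEval c (G.pConst m x) = x :=
  augmentation_one_tmul _ x

theorem pSub_C (c : Fin n → k) (x : G.alg.Polys n) :
    G.pSub (fun i => (MvPolynomial.C (c i) : AffPoly k m)) x = G.pConst m (G.pEval c x) := by
  induction x using TensorProduct.induction_on with
  | zero => simp
  | tmul f v =>
    have h : MvPolynomial.aeval (fun i => (MvPolynomial.C (c i) : AffPoly k m)) f =
        MvPolynomial.C (MvPolynomial.aeval c f) := by
      have : MvPolynomial.aeval (fun i => (MvPolynomial.C (c i) : AffPoly k m)) =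
          (Algebra.ofId k (AffPoly k m)).comp (MvPolynomial.aeval c) :=
        MvPolynomial.algHom_ext fun i => by simp [Algebra.ofId_apply, MvPolynomial.algebraMap_eq]
      rw [this]; rfl
    rw [TensorProduct.map_tmul, AlgHom.toLinearMap_apply, h, LinearMap.id_apply, augmentation_tmul,
      pConst, TensorProduct.tmul_smul, TensorProduct.smul_tmul', MvPolynomial.C_eq_smul_one]
  | add x y hx hy => rw [map_add, map_add, hx, hy, pConst, pConst, pConst, TensorProduct.tmul_add]

theorem pSub_smul (φ : Fin n → AffPoly k m) (f : AffPoly k n) (x : G.alg.Polys n) :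
    G.pSub φ (f • x) = MvPolynomial.aeval φ f • G.pSub φ x := by
  induction x using TensorProduct.induction_on with
  | zero => simp
  | tmul g v => simp [TensorProduct.smul_tmul']
  | add x y hx hy => simp only [smul_add, map_add, hx, hy]

theorem pSet_smul (j : Fin m) (c : k) (f : AffPoly k m) (x : G.alg.Polys m) :
    G.pSet j c (f • x) = setVar j c f • G.pSet j c x := pSub_smul _ f x

/-- Substituting after setting `xᵢ = c` is the same as substituting if the substitution has
`xᵢ = c`. -/
theorem pSub_pSet (φ : Fin n → AffPoly k m) {i : Fin n} {c : k} (h : φ i = MvPolynomial.C c)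
    (x : G.alg.Polys n) : G.pSub φ (G.pSet i c x) = G.pSub φ x := by
  rw [pSet_eq_pSub, pSub_pSub]
  have : (fun l => MvPolynomial.aeval φ (Function.update (MvPolynomial.X : Fin n → AffPoly k n) i
      (MvPolynomial.C c) l)) = φ := by
    funext l
    rw [Function.update_apply]
    split_ifs with hl
    · rw [hl, h, ← MvPolynomial.algebraMap_eq, AlgHom.commutes]; rfl
    · rw [MvPolynomial.aeval_X]
  rw [this]

theorem pSub_mem (φ : Fin n → AffPoly k m) {i : ℤ} {x : G.alg.Polys n} (hx : x ∈ G.pDeg n i) :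
    G.pSub φ x ∈ G.pDeg m i := map_mem_extSub _ _ (fun _ h => h) hx

theorem pSet_mem (j : Fin m) (c : k) {i : ℤ} {x : G.alg.Polys m} (hx : x ∈ G.pDeg m i) :
    G.pSet j c x ∈ G.pDeg m i := map_mem_extSub _ _ (fun _ h => h) hx

theorem pEval_mem (c : Fin m → k) {i : ℤ} {x : G.alg.Polys m} (hx : x ∈ G.pDeg m i) :
    G.pEval c x ∈ G.alg.deg i := augmentation_mem _ hx

/-- The substitution `φ` is a line in the direction of `xᵢ` with parameter `xⱼ`. -/
def IsLine (φ : Fin n → AffPoly k m) (j : Fin m) (i : Fin n) : Prop :=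
  ∀ l, MvPolynomial.pderiv j (φ l) = if l = i then 1 else 0

theorem IsLine.partialDeriv {φ : Fin n → AffPoly k m} {j : Fin m} {i : Fin n} (h : IsLine φ j i)
    (x : G.alg.Polys n) :
    DGLA.partialDeriv j (G.pSub φ x) = G.pSub φ (DGLA.partialDeriv i x) := by
  rw [partialDeriv_pSub, Finset.sum_eq_single i]
  · rw [h i, if_pos rfl, one_smul]
  · intro l _ hl; rw [h l, if_neg hl, zero_smul]
  · simp

theorem IsLine.formsCoeff₁ {φ : Fin n → AffPoly k m} {j : Fin m} {i : Fin n} (h : IsLine φ j i)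
    (μ : G.alg.Forms n) :
    DGLA.formsCoeff₁ j (G.alg.pullForms φ μ) = G.pSub φ (DGLA.formsCoeff₁ i μ) := by
  rw [formsCoeff₁_pull, Finset.sum_eq_single i]
  · rw [h i, if_pos rfl, one_smul]
  · intro l _ hl; rw [h l, if_neg hl, zero_smul]
  · simp

theorem IsLine.formsCoeff₂ {φ : Fin n → AffPoly k m} {j j' : Fin m} {i i' : Fin n} (h : IsLine φ j i)
    (h' : IsLine φ j' i') (μ : G.alg.Forms n) :
    DGLA.formsCoeff₂ j j' (G.alg.pullForms φ μ) = G.pSub φ (DGLA.formsCoeff₂ i i' μ) := by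
  rw [formsCoeff₂_pull, Finset.sum_eq_single i, Finset.sum_eq_single i']
  · rw [h i, h' i', if_pos rfl, if_pos rfl, one_mul, one_smul]
  · intro l _ hl; rw [h' l, if_neg hl, mul_zero, zero_smul]
  · simp
  · intro l _ hl
    refine Finset.sum_eq_zero fun l' _ => ?_
    rw [h l, if_neg hl, zero_mul, zero_smul]
  · simp

theorem pSet_formsCoeff₁_eq_zero {φ : Fin n → AffPoly k m} {i j : Fin m} {c : k}
    (h : ∀ l, setVar j c (MvPolynomial.pderiv i (φ l)) = 0) (μ : G.alg.Forms n) :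
    G.pSet j c (formsCoeff₁ i (G.alg.pullForms φ μ)) = 0 := by
  rw [formsCoeff₁_pull, map_sum]
  exact Finset.sum_eq_zero fun l _ => by rw [pSet_smul, h, zero_smul]

theorem pSet_formsCoeff₂_eq_zero {φ : Fin n → AffPoly k m} {i i' j : Fin m} {c : k}
    (h : ∀ l, setVar j c (MvPolynomial.pderiv i' (φ l)) = 0) (μ : G.alg.Forms n) :
    G.pSet j c (formsCoeff₂ i i' (G.alg.pullForms φ μ)) = 0 := by
  rw [formsCoeff₂_pull, map_sum]
  refine Finset.sum_eq_zero fun l _ => ?_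
  rw [map_sum]
  exact Finset.sum_eq_zero fun l' _ => by rw [pSet_smul, map_mul, h, mul_zero, zero_smul]

variable (G) in
/-- `z` is the logarithm of the solution of `(∂ⱼ u) u⁻¹ = a`, `u = 1` for `xⱼ = 0`. -/
def IsLog {m : ℕ} (j : Fin m) (a z : G.alg.Polys m) : Prop :=
  z ∈ G.pDeg m 0 ∧ phiOp (G.pBr m z) (partialDeriv j z) = a ∧ G.pSet j 0 z = 0

variable (G) in
/-- The analogue of `IsLog` for the Lie algebra `𝔤⁻¹` with the bracket twisted by `γ`. -/
def IsLogTw {m : ℕ} (γ : G.alg.carrier) (j : Fin m) (a w : G.alg.Polys m) : Prop :=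
  w ∈ G.pDeg m (-1) ∧
    phiOp (twBr (G.pBr m) (G.pDiff m) (G.pConst m γ) w) (partialDeriv j w) = a ∧ G.pSet j 0 w = 0

theorem isLogSolution_iff {j : Fin m} {a z : G.alg.Polys m} :
    IsLogSolution G.alg.bracket (G.alg.deg 0) j a z ↔ G.IsLog j a z := by
  have h := phiAd_eq ((G.isDG_polys m).nilp z) (partialDeriv j z)
  rw [IsLogSolution, restrictZero_eq, show phiAd (polyBracket G.alg.bracket m) z (partialDeriv j z) = _
    from h]
  rfl

theorem polyBracket_twisted (γ : G.alg.carrier) :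
    polyBracket (G.alg.twistedBracket γ) m = twBr (G.pBr m) (G.pDiff m) (G.pConst m γ) := by
  refine LinearMap.ext fun x => LinearMap.ext fun y => ?_
  refine ext_induction₂ (P := fun x y => polyBracket (G.alg.twistedBracket γ) m x y =
    twBr (G.pBr m) (G.pDiff m) (G.pConst m γ) x y) ?_ ?_ ?_ ?_ ?_ x y
  · simp
  · simp
  · intro f x g y
    rw [twBr_apply, dOp_apply, extAct_tmul, TensorProduct.map_tmul, one_mul, LinearMap.id_apply,
      ← TensorProduct.tmul_add, extAct_tmul]
    rfl
  · intro x x' y hx hx'; simp only [map_add, LinearMap.add_apply, hx, hx']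
  · intro x y y' hx hx'; simp only [map_add, hx, hx']

theorem isLogSolution_twisted_iff {γ : G.alg.carrier} {j : Fin m} {a w : G.alg.Polys m} :
    IsLogSolution (G.alg.twistedBracket γ) (G.alg.deg (-1)) j a w ↔ G.IsLogTw γ j a w := by
  rw [IsLogSolution, polyBracket_twisted, phiAd_eq (((G.isDG_polys m).filt_tw _).nilp w),
    restrictZero_eq]
  rfl

/-- The Lie algebra structure at a constant Maurer–Cartan element. -/
theorem mc_pConst {γ : G.alg.carrier} (h : G.alg.IsMC γ) (m : ℕ) :
    IsDG.MC (G.pBr m) (G.pDeg m) (G.pDiff m) (G.pConst m γ) := by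
  refine ⟨pConst_mem h.1, ?_⟩
  rw [extAct_tmul, TensorProduct.map_tmul, one_mul, LinearMap.id_apply, ← TensorProduct.tmul_smul,
    ← TensorProduct.tmul_add, h.2, TensorProduct.tmul_zero]

theorem pSub_of_pSet_eq_zero {φ : Fin n → AffPoly k m} {i : Fin n} (h : φ i = 0) {x : G.alg.Polys n}
    (hx : G.pSet i 0 x = 0) : G.pSub φ x = 0 := by
  rw [← pSub_pSet φ (i := i) (c := 0) (by rw [h, map_zero]), hx, map_zero]

theorem IsLine.pSet {φ : Fin n → AffPoly k m} {j : Fin m} {i : Fin n} (h0 : setVar j (0 : k) (φ i) = 0)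
    {x : G.alg.Polys n} (hx : G.pSet i 0 x = 0) : G.pSet j 0 (G.pSub φ x) = 0 := by
  rw [pSet_eq_pSub, pSub_pSub]
  exact pSub_of_pSet_eq_zero h0 hx

theorem IsLog.pSub {φ : Fin n → AffPoly k m} {j : Fin m} {i : Fin n} (h : IsLine φ j i)
    (h0 : setVar j (0 : k) (φ i) = 0) {a z : G.alg.Polys n} (hz : G.IsLog i a z) :
    G.IsLog j (G.pSub φ a) (G.pSub φ z) := by
  refine ⟨pSub_mem _ hz.1, ?_, IsLine.pSet h0 hz.2.2⟩
  rw [h.partialDeriv, ← (G.dgMor_pSub φ).map_phiOp (G.isDG_polys n) (G.isDG_polys m), hz.2.1]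

theorem IsLogTw.pSub {γ : G.alg.carrier} {φ : Fin n → AffPoly k m} {j : Fin m} {i : Fin n}
    (h : IsLine φ j i) (h0 : setVar j (0 : k) (φ i) = 0) {a w : G.alg.Polys n} (hw : G.IsLogTw γ i a w) :
    G.IsLogTw γ j (G.pSub φ a) (G.pSub φ w) := by
  refine ⟨pSub_mem _ hw.1, ?_, IsLine.pSet h0 hw.2.2⟩
  have := (G.dgMor_pSub φ).map_phiOp_tw (G.isDG_polys n) (G.isDG_polys m) (G.pConst n γ) w
    (DGLA.partialDeriv i w)
  rw [pSub_pConst, hw.2.1] at this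
  rw [h.partialDeriv, ← this]

theorem isLine_update {i j : Fin m} (hij : i ≠ j) (c : k) :
    IsLine (Function.update (MvPolynomial.X : Fin m → AffPoly k m) j (MvPolynomial.C c)) i i := by
  intro l
  rw [Function.update_apply]
  by_cases h : l = j
  · rw [if_pos h, if_neg (by rintro rfl; exact hij h), MvPolynomial.pderiv_C]
  · rw [if_neg h, MvPolynomial.pderiv_X, Pi.single_apply]

theorem setVar_update {i j : Fin m} (hij : i ≠ j) (c : k) :
    setVar i (0 : k) (Function.update (MvPolynomial.X : Fin m → AffPoly k m) j (MvPolynomial.C c) i) = 0 := by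
  rw [Function.update_of_ne hij, setVar_X, if_pos rfl, map_zero]

theorem IsLog.pSet {i j : Fin m} (hij : i ≠ j) (c : k) {a z : G.alg.Polys m} (hz : G.IsLog i a z) :
    G.IsLog i (G.pSet j c a) (G.pSet j c z) :=
  hz.pSub (isLine_update hij c) (setVar_update hij c)

theorem IsLogTw.pSet {γ : G.alg.carrier} {i j : Fin m} (hij : i ≠ j) (c : k) {a w : G.alg.Polys m}
    (hw : G.IsLogTw γ i a w) : G.IsLogTw γ i (G.pSet j c a) (G.pSet j c w) :=
  hw.pSub (isLine_update hij c) (setVar_update hij c)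

section CharZero

variable [CharZero k]

theorem exists_isLog (j : Fin m) {a : G.alg.Polys m} (ha : a ∈ G.pDeg m 0) : ∃ z, G.IsLog j a z := by
  have hp := G.dgPrim j
  obtain ⟨z, h1, h2, h3⟩ := (G.isDG_polys m).lieOn.exists_logDer hp.prim (fun _ => hp.isDer.mem)
    (fun _ => hp.ev_mem) (fun _ => hp.int_mem) ha
  exact ⟨z, h1, h2, h3⟩

theorem IsLog.unique {j : Fin m} {a z z' : G.alg.Polys m} (h : G.IsLog j a z) (h' : G.IsLog j a z') :
    z = z' := by
  have hp := G.dgPrim j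
  exact (G.isDG_polys m).lieOn.logDer_unique hp.prim (fun _ => hp.isDer.mem)
    (fun _ => hp.ev_mem) (fun _ => hp.int_mem) h.1 h'.1 (h.2.1.trans h'.2.1.symm)
    (h.2.2.trans h'.2.2.symm)

theorem exists_isLogTw {γ : G.alg.carrier} (hγ : G.alg.IsMC γ) (j : Fin m) {a : G.alg.Polys m}
    (ha : a ∈ G.pDeg m (-1)) : ∃ w, G.IsLogTw γ j a w := by
  have hp := G.dgPrim j
  obtain ⟨z, h1, h2, h3⟩ := ((G.isDG_polys m).lieOn_tw (mc_pConst hγ m)).exists_logDer hp.prim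
    (fun _ => hp.isDer.mem) (fun _ => hp.ev_mem) (fun _ => hp.int_mem) ha
  exact ⟨z, h1, h2, h3⟩

theorem IsLogTw.unique {γ : G.alg.carrier} (hγ : G.alg.IsMC γ) {j : Fin m} {a w w' : G.alg.Polys m}
    (h : G.IsLogTw γ j a w) (h' : G.IsLogTw γ j a w') : w = w' := by
  have hp := G.dgPrim j
  exact ((G.isDG_polys m).lieOn_tw (mc_pConst hγ m)).logDer_unique hp.prim (fun _ => hp.isDer.mem)
    (fun _ => hp.ev_mem) (fun _ => hp.int_mem) h.1 h'.1 (h.2.1.trans h'.2.1.symm)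
    (h.2.2.trans h'.2.2.symm)

theorem isLog_zero (j : Fin m) : G.IsLog j 0 0 := by
  refine ⟨zero_mem _, ?_, map_zero _⟩
  rw [map_zero (partialDeriv j), map_zero]

theorem isLogTw_zero (γ : G.alg.carrier) (j : Fin m) : G.IsLogTw γ j 0 0 := by
  refine ⟨zero_mem _, ?_, map_zero _⟩
  rw [map_zero (partialDeriv j), map_zero]

/-! ## Existence and uniqueness of holonomies -/

theorem isPathHolonomy_iff {μ : G.alg.Forms 1} {X : G.alg.carrier} :
    IsPathHolonomy μ X ↔ ∃ z, G.IsLog 0 (-(formsCoeff₁ 0 μ)) z ∧ X = -(G.pEval (fun _ => 1) z) := by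
  simp only [IsPathHolonomy, isLogSolution_iff, evalOnes_eq]

theorem isSurfaceHolonomy_iff {μ : G.alg.Forms 2} {t : G.alg.carrier} :
    IsSurfaceHolonomy μ t ↔ ∃ z Y w : G.alg.Polys 2,
      G.IsLog 0 (-(formsCoeff₁ 0 (G.alg.pullForms (squareParam k) μ))) z ∧
      partialDeriv 0 Y = expOp (G.pBr 2 (-z)) (formsCoeff₂ 0 1 (G.alg.pullForms (squareParam k) μ)) ∧
      G.pSet 0 0 Y = 0 ∧ G.IsLogTw (vertex 0 μ) 1 Y w ∧ t = G.pEval (fun _ => 1) w := by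
  have h : ∀ z v : G.alg.Polys 2, expAd (polyBracket G.alg.bracket 2) z v = expOp (G.pBr 2 z) v :=
    fun z v => expAd_eq ((G.isDG_polys 2).nilp z) v
  simp only [IsSurfaceHolonomy, isLogSolution_iff, isLogSolution_twisted_iff, evalOnes_eq, h,
    restrictZero_eq]

theorem exists_pathHolonomy {μ : G.alg.Forms 1} (hμ : μ ∈ G.alg.formsDegOne 1) :
    ∃ X, IsPathHolonomy μ X := by
  obtain ⟨z, hz⟩ := exists_isLog (G := G) 0 (neg_mem (formsCoeff₁_mem hμ 0))
  exact ⟨_, isPathHolonomy_iff.2 ⟨z, hz, rfl⟩⟩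

theorem pathHolonomy_unique {μ : G.alg.Forms 1} {X X' : G.alg.carrier} (h : IsPathHolonomy μ X)
    (h' : IsPathHolonomy μ X') : X = X' := by
  obtain ⟨z, hz, rfl⟩ := isPathHolonomy_iff.1 h
  obtain ⟨z', hz', rfl⟩ := isPathHolonomy_iff.1 h'
  rw [hz.unique hz']

theorem pathHolonomy_mem {μ : G.alg.Forms 1} {X : G.alg.carrier} (h : IsPathHolonomy μ X) :
    X ∈ G.alg.deg 0 := by
  obtain ⟨z, hz, rfl⟩ := isPathHolonomy_iff.1 h
  exact neg_mem (pEval_mem _ hz.1)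

/-- The antiderivative of a polynomial along a coordinate. -/
theorem exists_primitive (j : Fin m) {i : ℤ} {b : G.alg.Polys m} (hb : b ∈ G.pDeg m i) :
    ∃ Y ∈ G.pDeg m i, partialDeriv j Y = b ∧ G.pSet j 0 Y = 0 :=
  ⟨G.pInt j b, (G.dgPrim j).int_mem hb, (G.dgPrim j).prim.der_int b, (G.dgPrim j).prim.ev_int b⟩

theorem exists_surfaceHolonomy {μ : G.alg.Forms 2} (hμ : μ ∈ G.alg.formsDegOne 2)
    (hγ : G.alg.IsMC (vertex 0 μ)) : ∃ t, IsSurfaceHolonomy μ t := by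
  have h := pull_mem_degOne (squareParam k) hμ
  obtain ⟨z, hz⟩ := exists_isLog (G := G) 0 (neg_mem (formsCoeff₁_mem h 0))
  obtain ⟨Y, hYm, hY1, hY0⟩ := exists_primitive (G := G) 0
    ((G.isDG_polys 2).expOp_mem (neg_mem hz.1) (formsCoeff₂_mem h 0 1))
  obtain ⟨w, hw⟩ := exists_isLogTw hγ 1 hYm
  exact ⟨_, isSurfaceHolonomy_iff.2 ⟨z, Y, w, hz, hY1, hY0, hw, rfl⟩⟩

theorem surfaceHolonomy_unique {μ : G.alg.Forms 2} (hγ : G.alg.IsMC (vertex 0 μ))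
    {t t' : G.alg.carrier} (h : IsSurfaceHolonomy μ t) (h' : IsSurfaceHolonomy μ t') : t = t' := by
  obtain ⟨z, Y, w, hz, hY1, hY0, hw, rfl⟩ := isSurfaceHolonomy_iff.1 h
  obtain ⟨z', Y', w', hz', hY1', hY0', hw', rfl⟩ := isSurfaceHolonomy_iff.1 h'
  obtain rfl := hz.unique hz'
  obtain rfl := (G.dgPrim 0).ext (hY1.trans hY1'.symm) (hY0.trans hY0'.symm)
  rw [hw.unique hγ hw']

theorem surfaceHolonomy_mem {μ : G.alg.Forms 2} {t : G.alg.carrier} (h : IsSurfaceHolonomy μ t) :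
    t ∈ G.alg.deg (-1) := by
  obtain ⟨z, Y, w, hz, hY1, hY0, hw, rfl⟩ := isSurfaceHolonomy_iff.1 h
  exact pEval_mem _ hw.1

/-! ### Vertices -/

theorem vertex_eq (i : Fin (n + 1)) (μ : G.alg.Forms n) :
    vertex i μ = G.pEval (fun j => if j.succ = i then 1 else 0) (formsFun μ) := by
  have h : ∀ ν : G.alg.Forms 0, G.alg.value ν = G.pEval Fin.elim0 (formsFun ν) := by
    intro ν
    induction ν using TensorProduct.induction_on with
    | zero => simp
    | tmul ω x => rfl
    | add x y hx hy => simp only [map_add, hx, hy]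
  rw [vertex, h, simpForms, formsFun_pull, pEval_pSub]
  congr 3
  funext j
  rw [PolyForm.simplexMap]
  by_cases hj : j.succ = i
  · subst hj
    rw [if_pos rfl]
    refine (congrArg _ ((Finset.sum_congr (Finset.filter_true_of_mem fun _ _ => rfl)
      fun _ _ => rfl).trans PolyForm.sum_bary)).trans (map_one _)
  · rw [if_neg hj]
    exact (congrArg _ (Finset.sum_congr (Finset.filter_false_of_mem fun _ _ h => hj h.symm)
      fun _ _ => rfl)).trans (map_zero _)

theorem vertex_mc {μ : G.alg.Forms n} (h : G.alg.IsFormsMC μ) (i : Fin (n + 1)) :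
    G.alg.IsMC (vertex i μ) := by
  obtain ⟨h1, h2⟩ := mc_fun h
  rw [vertex_eq]
  refine ⟨pEval_mem _ h1, ?_⟩
  have h3 := congrArg (G.pEval fun j => if j.succ = i then 1 else 0) h2
  rwa [map_add, map_smul, (G.dgMor_pEval _).map_diff, (G.dgMor_pEval _).map_br, map_zero] at h3

theorem vertex_simpForms {a b : ℕ} (f : SimplexCategory.mk a ⟶ SimplexCategory.mk b) (i : Fin (a + 1))
    (μ : G.alg.Forms b) :
    vertex i (G.alg.simpForms f μ) = vertex (f.toOrderHom i) μ := by
  rw [vertex, vertex, ← simpForms_comp]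
  rfl

/-- The holonomy of a path is a morphism between the values at its end points. -/
theorem isOneMor_of_isPathHolonomy {μ : G.alg.Forms 1} (hμ : G.alg.IsFormsMC μ) {X : G.alg.carrier}
    (h : IsPathHolonomy μ X) : G.alg.IsOneMor X (vertex 1 μ) (vertex 0 μ) := by
  refine ⟨pathHolonomy_mem h, ?_⟩
  obtain ⟨z, hz, rfl⟩ := isPathHolonomy_iff.1 h
  have h1 := gaugeOp_transport (G.isDG_polys 1) (G.dgPrim 0) (formsFun_mem hμ.1) (mc_one hμ 0) hz.1
    hz.2.1 hz.2.2
  have h2 := congrArg (G.pEval fun _ => 1) h1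
  rw [(G.dgMor_pEval _).map_gaugeOp (G.isDG_polys 1) G.isDG, map_neg, pEval_pSet] at h2
  rw [DGLA.gauge, phiAd_eq (G.isDG.nilp _), vertex_eq, vertex_eq]
  refine Eq.trans ?_ (h2.trans ?_)
  · have : (fun j : Fin 1 => if j.succ = (1 : Fin 2) then (1 : k) else 0) = fun _ => 1 := by
      funext j; fin_cases j; rfl
    rw [this]; rfl
  · congr 3
    funext j; fin_cases j; simp

end CharZero

end NilpDGLA

/-! ## The two-dimensional holonomy as a morphism -/

namespace NilpDGLA

open DGLA

variable {k : Type u} [Field k] {G : NilpDGLA k} {m n : ℕ}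

theorem simplexMap_edge {a b : Fin (n + 1)} (h : a ≤ b) (i : Fin n) :
    PolyForm.simplexMap k (edge (a := .mk n) a b h).toOrderHom i =
      (if a = i.succ then 1 - MvPolynomial.X 0 else 0) + if b = i.succ then MvPolynomial.X 0 else 0 := by
  refine (Finset.sum_filter _ _).trans ((Fin.sum_univ_two _).trans ?_)
  refine congrArg₂ _ (if_congr Iff.rfl ?_ rfl) (if_congr Iff.rfl ?_ rfl)
  · simp [PolyForm.bary]
  · rfl

theorem simplexMap_face {a b c : Fin (n + 1)} (h : a ≤ b) (h' : b ≤ c) (i : Fin n) :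
    PolyForm.simplexMap k (face (a := .mk n) a b c h h').toOrderHom i =
      ((if a = i.succ then 1 - (MvPolynomial.X 0 + MvPolynomial.X 1) else 0) +
        if b = i.succ then MvPolynomial.X 0 else 0) + if c = i.succ then MvPolynomial.X 1 else 0 := by
  refine (Finset.sum_filter _ _).trans ((Fin.sum_univ_three _).trans ?_)
  refine congrArg₂ _ (congrArg₂ _ (if_congr Iff.rfl ?_ rfl) (if_congr Iff.rfl ?_ rfl))
    (if_congr Iff.rfl ?_ rfl)
  · simp [PolyForm.bary, Fin.sum_univ_two]
  · rfl
  · rfl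

theorem pull_edge {a b : Fin (n + 1)} (h : a ≤ b) (φ : Fin n → AffPoly k 1) (μ : G.alg.Forms n)
    (hφ : ∀ i, φ i = (if a = i.succ then 1 - MvPolynomial.X 0 else 0) +
      if b = i.succ then MvPolynomial.X 0 else 0) :
    G.alg.pullForms φ μ = G.alg.simpForms (edge (a := .mk n) a b h) μ := by
  have : φ = PolyForm.simplexMap k (edge (a := .mk n) a b h).toOrderHom :=
    funext fun i => (hφ i).trans (simplexMap_edge h i).symm
  rw [this]; rfl

theorem aeval_squareParam (p q r : Prop) [Decidable p] [Decidable q] [Decidable r] :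
    MvPolynomial.aeval (squareParam k) (((if p then 1 - (MvPolynomial.X 0 + MvPolynomial.X 1) else 0) +
        if q then MvPolynomial.X 0 else 0) + if r then MvPolynomial.X 1 else 0 : AffPoly k 2) =
      ((if p then 1 - MvPolynomial.X 0 else 0) +
        if q then MvPolynomial.X 0 * (1 - MvPolynomial.X 1) else 0) +
        if r then MvPolynomial.X 0 * MvPolynomial.X 1 else 0 := by
  rw [map_add, map_add]
  refine congrArg₂ _ (congrArg₂ _ ?_ ?_) ?_
  · split_ifs
    · simp only [map_sub, map_one, map_add, MvPolynomial.aeval_X, squareParam, Matrix.cons_val_zero,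
        Matrix.cons_val_one]
      ring
    · exact map_zero _
  · split_ifs
    · simp [squareParam]
    · exact map_zero _
  · split_ifs
    · simp [squareParam]
    · exact map_zero _

theorem pull_face {a b c : Fin (n + 1)} (h : a ≤ b) (h' : b ≤ c) (φ : Fin n → AffPoly k 2)
    (μ : G.alg.Forms n)
    (hφ : ∀ i, φ i = ((if a = i.succ then 1 - MvPolynomial.X 0 else 0) +
        if b = i.succ then MvPolynomial.X 0 * (1 - MvPolynomial.X 1) else 0) +
        if c = i.succ then MvPolynomial.X 0 * MvPolynomial.X 1 else 0) :
    G.alg.pullForms φ μ =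
      G.alg.pullForms (squareParam k) (G.alg.simpForms (face (a := .mk n) a b c h h') μ) := by
  have : φ = fun i => MvPolynomial.aeval (squareParam k)
      (PolyForm.simplexMap k (face (a := .mk n) a b c h h').toOrderHom i) := by
    funext i
    exact (hφ i).trans ((aeval_squareParam _ _ _).symm.trans
      (congrArg (MvPolynomial.aeval (squareParam k)) (simplexMap_face h h' i).symm))
  rw [this, simpForms, pullForms_pullForms]

variable [CharZero k]

theorem isPathHolonomy_of {μ : G.alg.Forms 1} {ν : G.alg.Forms m} (φ : Fin m → AffPoly k 1) {i : Fin m}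
    (c : Fin m → k) (hν : G.alg.pullForms φ ν = μ) (h : IsLine φ 0 i)
    (h0 : setVar 0 (0 : k) (φ i) = 0) (hc : ∀ l, MvPolynomial.aeval (fun _ => (1 : k)) (φ l) = c l)
    {a z : G.alg.Polys m} (hz : G.IsLog i a z) (ha : G.pSub φ a = -G.pSub φ (formsCoeff₁ i ν)) :
    IsPathHolonomy μ (-(G.pEval c z)) := by
  refine isPathHolonomy_iff.2 ⟨G.pSub φ z, ?_, ?_⟩
  · rw [← hν, h.formsCoeff₁, ← ha]
    exact hz.pSub h h0
  · rw [pEval_pSub, show (fun i => MvPolynomial.aeval (fun _ => (1 : k)) (φ i)) = c from funext hc]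

theorem isSurfaceHolonomy_of {μ : G.alg.Forms 2} {ν : G.alg.Forms m} (φ : Fin m → AffPoly k 2)
    {i j : Fin m} (c : Fin m → k) (hν : G.alg.pullForms φ ν = G.alg.pullForms (squareParam k) μ)
    (h : IsLine φ 0 i) (h0 : setVar 0 (0 : k) (φ i) = 0) (h' : IsLine φ 1 j)
    (h0' : setVar 1 (0 : k) (φ j) = 0) (hc : ∀ l, MvPolynomial.aeval (fun _ => (1 : k)) (φ l) = c l)
    {a b z Y w : G.alg.Polys m} (hz : G.IsLog i a z) (ha : G.pSub φ a = -G.pSub φ (formsCoeff₁ i ν))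
    (hY : partialDeriv i Y = expOp (G.pBr m (-z)) b) (hb : G.pSub φ b = G.pSub φ (formsCoeff₂ i j ν))
    (hY0 : G.pSet i 0 Y = 0) {γ : G.alg.carrier} (hγ : vertex 0 μ = γ) (hw : G.IsLogTw γ j Y w) :
    IsSurfaceHolonomy μ (G.pEval c w) := by
  refine isSurfaceHolonomy_iff.2 ⟨G.pSub φ z, G.pSub φ Y, G.pSub φ w, ?_, ?_, ?_, ?_, ?_⟩
  · rw [← hν, h.formsCoeff₁, ← ha]
    exact hz.pSub h h0
  · rw [← hν, h.formsCoeff₂ h', ← hb, h.partialDeriv, hY,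
      (G.dgMor_pSub φ).map_expOp (G.isDG_polys m) (G.isDG_polys 2), map_neg (G.pSub φ)]
  · exact IsLine.pSet h0 hY0
  · rw [hγ]; exact hw.pSub h' h0'
  · rw [pEval_pSub, show (fun i => MvPolynomial.aeval (fun _ => (1 : k)) (φ i)) = c from funext hc]

/-- Transport along the rays in direction `xₒ`. -/
theorem exists_radial {ν : G.alg.Forms m} (hν : G.alg.IsFormsMC ν) (o : Fin m) {γ₀ : G.alg.carrier}
    (hγ₀ : G.pSet o 0 (formsFun ν) = G.pConst m γ₀)
    (h0 : ∀ i, i ≠ o → G.pSet o 0 (formsCoeff₁ i ν) = 0) :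
    ∃ (z : G.alg.Polys m) (Y : Fin m → G.alg.Polys m), G.IsLog o (-(formsCoeff₁ o ν)) z ∧
      ∀ i, Y i ∈ G.pDeg m (-1) ∧ partialDeriv o (Y i) = expOp (G.pBr m (-z)) (formsCoeff₂ o i ν) ∧
        G.pSet o 0 (Y i) = 0 ∧ (i ≠ o → expOp (G.pBr m (-z)) (formsCoeff₁ i ν +
          phiOp (G.pBr m z) (partialDeriv i z)) =
            -dOp (G.pBr m) (G.pDiff m) (G.pConst m γ₀) (Y i)) := by
  obtain ⟨z, hz⟩ := exists_isLog (G := G) o (neg_mem (formsCoeff₁_mem hν.1 o))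
  choose Y hYm hY1 hY0 using fun i => exists_primitive (G := G) o
    ((G.isDG_polys m).expOp_mem (neg_mem hz.1) (formsCoeff₂_mem hν.1 o i))
  refine ⟨z, Y, hz, fun i => ⟨hYm i, hY1 i, hY0 i, fun hi => ?_⟩⟩
  have := radial_connection (G.isDG_polys m) (G.dgPrim o) (G.dgDer i) (fun v => G.partialDeriv_comm _ _ v)
    (fun v => G.pSet_partialDeriv hi 0 v) (formsFun_mem hν.1) (mc_one hν o) hz.1 hz.2.1 hz.2.2
    (mc_two hν o i) (h0 i hi) (hY1 i) (hY0 i)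
  rw [this, hγ₀]

theorem pSet_formsFun_eq_vertex (φ : Fin n → AffPoly k m) (j : Fin m) (c : k) (i : Fin (n + 1))
    (h : ∀ l : Fin n, setVar j c (φ l) = MvPolynomial.C (if l.succ = i then 1 else 0))
    (μ : G.alg.Forms n) :
    G.pSet j c (formsFun (G.alg.pullForms φ μ)) = G.pConst m (vertex i μ) := by
  rw [formsFun_pull, pSet_eq_pSub, pSub_pSub, vertex_eq, ← pSub_C]
  have : (fun l => MvPolynomial.aeval (Function.update (MvPolynomial.X : Fin m → AffPoly k m) j
      (MvPolynomial.C c)) (φ l)) = fun l => MvPolynomial.C (if l.succ = i then 1 else 0) := funext h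
  rw [this]

/-- The two-dimensional holonomy is a two-morphism between the holonomies along the boundary. -/
theorem isTwoMor_of_isSurfaceHolonomy {μ : G.alg.Forms 2} (hμ : G.alg.IsFormsMC μ)
    {X₀₁ X₁₂ X₀₂ t : G.alg.carrier}
    (h₀₁ : IsPathHolonomy (G.alg.simpForms (edge (a := .mk 2) 0 1 (by decide)) μ) X₀₁)
    (h₁₂ : IsPathHolonomy (G.alg.simpForms (edge (a := .mk 2) 1 2 (by decide)) μ) X₁₂)
    (h₀₂ : IsPathHolonomy (G.alg.simpForms (edge (a := .mk 2) 0 2 (by decide)) μ) X₀₂)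
    (ht : IsSurfaceHolonomy μ t) :
    G.alg.IsTwoMor (vertex 0 μ) t (bch G.alg.bracket X₀₁ X₁₂) X₀₂ := by
  refine ⟨surfaceHolonomy_mem ht, ?_⟩
  have hγm := vertex_mc hμ 0
  have hX := fun {ν : G.alg.Forms 1} {X} (h : IsPathHolonomy ν X) => pathHolonomy_mem h
  set ν := G.alg.pullForms (squareParam k) μ with hνd
  have hν : G.alg.IsFormsMC ν := hμ.pull _
  have hγ : G.pSet 0 0 (formsFun ν) = G.pConst 2 (vertex 0 μ) :=
    pSet_formsFun_eq_vertex _ _ _ _ (fun l => by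
      fin_cases l <;> simp [squareParam, setVar_X]) μ
  have hA0 : G.pSet 0 0 (formsCoeff₁ 1 ν) = 0 := pSet_formsCoeff₁_eq_zero (fun l => by
    fin_cases l <;> simp [squareParam, setVar_X, MvPolynomial.pderiv_X]) μ
  obtain ⟨z, Y, hz, hY⟩ := exists_radial hν 0 hγ (fun i hi => by
    obtain rfl : i = 1 := by omega
    exact hA0)
  obtain ⟨hYm, hY1, hY0, hYr⟩ := hY 1
  obtain ⟨w, hw⟩ := exists_isLogTw hγm 1 hYm
  obtain ⟨v, hv⟩ := exists_isLog (G := G) 1 (pSet_mem 0 1 (neg_mem (formsCoeff₁_mem hν.1 1)))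
  have e₀₁ : X₀₁ = -G.pEval ![1, 0] z := pathHolonomy_unique h₀₁ (isPathHolonomy_of
    ![MvPolynomial.X 0, 0] _ (by
      rw [pullForms_pullForms]
      exact pull_edge _ _ _ fun i => by fin_cases i <;> simp [squareParam])
    (fun l => by fin_cases l <;> simp [MvPolynomial.pderiv_X]) (by simp [setVar_X])
    (fun l => by fin_cases l <;> simp) hz (map_neg _ _))
  have e₀₂ : X₀₂ = -G.pEval ![1, 1] z := pathHolonomy_unique h₀₂ (isPathHolonomy_of
    ![MvPolynomial.X 0, 1] _ (by
      rw [pullForms_pullForms]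
      exact pull_edge _ _ _ fun i => by fin_cases i <;> simp [squareParam])
    (fun l => by fin_cases l <;> simp [MvPolynomial.pderiv_X]) (by simp [setVar_X])
    (fun l => by fin_cases l <;> simp) hz (map_neg _ _))
  have e₁₂ : X₁₂ = -G.pEval ![1, 1] v := pathHolonomy_unique h₁₂ (isPathHolonomy_of (ν := ν)
    ![1, MvPolynomial.X 0] _ (by
      rw [pullForms_pullForms]
      exact pull_edge _ _ _ fun i => by fin_cases i <;> simp [squareParam])
    (fun l => by fin_cases l <;> simp [MvPolynomial.pderiv_X]) (by simp [setVar_X])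
    (fun l => by fin_cases l <;> simp) hv (by
      rw [pSub_pSet _ (by simp), map_neg]))
  have et : t = G.pEval ![1, 1] w := surfaceHolonomy_unique hγm ht (isSurfaceHolonomy_of
    ![MvPolynomial.X 0, MvPolynomial.X 1] _ (by
      rw [pullForms_pullForms]
      refine congrArg (G.alg.pullForms · μ) (funext fun l => ?_)
      fin_cases l <;> simp [squareParam])
    (fun l => by fin_cases l <;> simp [MvPolynomial.pderiv_X]) (by simp [setVar_X])
    (fun l => by fin_cases l <;> simp [MvPolynomial.pderiv_X]) (by simp [setVar_X])
    (fun l => by fin_cases l <;> simp) hz (map_neg _ _) hY1 rfl hY0 rfl hw)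
  have hD := G.isDG_polys 2
  have hr := congrArg (G.pSet 0 1) (radial_connection' hD hz.1 (hYr (by decide)))
  have hm := G.dgMor_pSet (m := 2) 0 1
  rw [hm.map_phiOp hD hD, G.pSet_partialDeriv (by decide), map_sub, map_neg, hm.map_expOp hD hD, hm.map_dOp,
    pSet_pConst] at hr
  have hv1 := hv.2.1
  rw [map_neg] at hv1
  have hw' := hw.pSet (j := 0) (by decide) 1
  have hb := boundary_transport hD (G.dgPrim 1) (mc_pConst hγm 2) (partialDeriv_pConst _ _)
    (pSet_mem 0 1 hz.1) hr hv.1 hv1 hv.2.2 hw'.1 hw'.2.1 hw'.2.2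
  have he := G.dgMor_pEval (m := 2) ![1, 1]
  have hb' := congrArg (G.pEval ![1, 1]) hb
  rw [he.map_bch hD, he.map_bch hD, map_neg, map_neg, he.map_dOp, pEval_pConst, pEval_pSet, pEval_pSet,
    pEval_pSet, pEval_pSet] at hb'
  have p1 : Function.update ![(1 : k), 1] 0 1 = ![1, 1] := by
    funext i; fin_cases i <;> simp
  have p2 : Function.update (Function.update ![(1 : k), 1] 1 0) 0 1 = ![1, 0] := by
    funext i; fin_cases i <;> simp
  rw [p1, p2, ← et, ← e₀₁, ← e₀₂, show G.pEval ![1, 1] v = -X₁₂ by rw [e₁₂, neg_neg]] at hb'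
  have hL := G.isDG.lieOn
  have hDt : dOp G.alg.bracket G.alg.diff (vertex 0 μ) t ∈ G.alg.deg 0 :=
    G.isDG.dOp_mem0 hγm.1 (surfaceHolonomy_mem ht)
  change bch G.alg.bracket (dOp G.alg.bracket G.alg.diff (vertex 0 μ) t) _ = _
  rw [← hL.bch_assoc hDt (hX h₀₁) (hX h₁₂), ← hb', hL.bch_assoc (hX h₀₂) (neg_mem (hX h₁₂)) (hX h₁₂),
    hL.bch_neg_left (hX h₁₂), hL.bch_zero_right (hX h₀₂)]

end NilpDGLA

/-! ## The cocycle condition over a tetrahedron -/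

namespace NilpDGLA

open DGLA

variable {k : Type u} [Field k] [CharZero k] {G : NilpDGLA k} {m n : ℕ}

/-- The parametrization `t₁ = x₁(1 - x₂)`, `t₂ = x₁x₂(1 - x₃)`, `t₃ = x₁x₂x₃` of the three-dimensional
simplex by the cube. -/
def cubeParam (k : Type u) [Field k] : Fin 3 → AffPoly k 3 :=
  ![MvPolynomial.X 0 * (1 - MvPolynomial.X 1),
    MvPolynomial.X 0 * MvPolynomial.X 1 * (1 - MvPolynomial.X 2),
    MvPolynomial.X 0 * MvPolynomial.X 1 * MvPolynomial.X 2]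

/-- The logarithm of the transport along the edge `01` does not depend on the other coordinates. -/
theorem pSet_isLog_cubeParam {μ : G.alg.Forms 3} {z : G.alg.Polys 3}
    (hz : G.IsLog 0 (-(formsCoeff₁ 0 (G.alg.pullForms (cubeParam k) μ))) z) :
    G.pSet 1 0 (G.pSet 0 1 z) = G.pConst 3 (G.pEval ![1, 0, 0] z) := by
  have h1 := hz.pSet (j := 1) (by decide) 0
  have h2 := h1.pSet (j := 2) (by decide) 0
  have hl : IsLine (Function.update (MvPolynomial.X : Fin 3 → AffPoly k 3) 1 (MvPolynomial.C 0)) 0 0 :=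
    isLine_update (by decide) 0
  have hl' : IsLine (Function.update (MvPolynomial.X : Fin 3 → AffPoly k 3) 2 (MvPolynomial.C 0)) 0 0 :=
    isLine_update (by decide) 0
  have e : G.pSet 2 0 (G.pSet 1 0 (-(formsCoeff₁ 0 (G.alg.pullForms (cubeParam k) μ)))) =
      G.pSet 1 0 (-(formsCoeff₁ 0 (G.alg.pullForms (cubeParam k) μ))) := by
    rw [map_neg (G.pSet 1 0), map_neg (G.pSet 2 0), pSet_eq_pSub, pSet_eq_pSub, ← hl.formsCoeff₁,
      ← hl'.formsCoeff₁, pullForms_pullForms _ (cubeParam k) μ,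
      pullForms_pullForms _ _ μ]
    have : (fun i => MvPolynomial.aeval (Function.update (MvPolynomial.X : Fin 3 → AffPoly k 3) 2
        (MvPolynomial.C 0)) (MvPolynomial.aeval (Function.update (MvPolynomial.X : Fin 3 → AffPoly k 3) 1
        (MvPolynomial.C 0)) (cubeParam k i))) = fun i => MvPolynomial.aeval
        (Function.update (MvPolynomial.X : Fin 3 → AffPoly k 3) 1 (MvPolynomial.C 0)) (cubeParam k i) := by
      funext i
      fin_cases i <;> simp [cubeParam, Function.update]
    rw [this]
  rw [e] at h2
  have h3 := h1.unique h2
  have h4 : ∀ x : G.alg.Polys 3, G.pSet 0 1 (G.pSet 2 0 (G.pSet 1 0 x)) = G.pConst 3 (G.pEval ![1, 0, 0] x) := by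
    intro x
    rw [pSet_eq_pSub, pSet_eq_pSub, pSet_eq_pSub, pSub_pSub, pSub_pSub, ← pSub_C]
    have : (fun i => MvPolynomial.aeval (fun i => MvPolynomial.aeval (Function.update
        (MvPolynomial.X : Fin 3 → AffPoly k 3) 0 (MvPolynomial.C 1)) (Function.update
        (MvPolynomial.X : Fin 3 → AffPoly k 3) 2 (MvPolynomial.C 0) i)) (Function.update
        (MvPolynomial.X : Fin 3 → AffPoly k 3) 1 (MvPolynomial.C 0) i)) =
        fun i => MvPolynomial.C (![(1 : k), 0, 0] i) := by
      funext i
      fin_cases i <;> simp [Function.update]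
    rw [this]
  rw [G.pSet_comm (show (1 : Fin 3) ≠ 0 by decide), h3, h4]

/-- The two-dimensional holonomies over the faces of a tetrahedron satisfy the cocycle condition. -/
theorem cocycle_of_isSurfaceHolonomy {μ : G.alg.Forms 3} (hμ : G.alg.IsFormsMC μ)
    {X t₀₁₂ t₀₁₃ t₀₂₃ t₁₂₃ : G.alg.carrier}
    (hX : IsPathHolonomy (G.alg.simpForms (edge (a := .mk 3) 0 1 (by decide)) μ) X)
    (h₀₁₂ : IsSurfaceHolonomy (G.alg.simpForms (face (a := .mk 3) 0 1 2 (by decide) (by decide)) μ) t₀₁₂)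
    (h₀₁₃ : IsSurfaceHolonomy (G.alg.simpForms (face (a := .mk 3) 0 1 3 (by decide) (by decide)) μ) t₀₁₃)
    (h₀₂₃ : IsSurfaceHolonomy (G.alg.simpForms (face (a := .mk 3) 0 2 3 (by decide) (by decide)) μ) t₀₂₃)
    (h₁₂₃ : IsSurfaceHolonomy (G.alg.simpForms (face (a := .mk 3) 1 2 3 (by decide) (by decide)) μ) t₁₂₃) :
    bch (G.alg.twistedBracket (vertex 0 μ)) t₀₁₃ (expAd G.alg.bracket X t₁₂₃) =
      bch (G.alg.twistedBracket (vertex 0 μ)) t₀₂₃ t₀₁₂ := by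
  have hγm := vertex_mc hμ 0
  have hγm' := vertex_mc hμ 1
  have hXm := pathHolonomy_mem hX
  set ν := G.alg.pullForms (cubeParam k) μ with hνd
  have hν : G.alg.IsFormsMC ν := hμ.pull _
  have hγ : G.pSet 0 0 (formsFun ν) = G.pConst 3 (vertex 0 μ) :=
    pSet_formsFun_eq_vertex _ _ _ _ (fun l => by
      fin_cases l <;> simp [cubeParam, setVar_X]) μ
  obtain ⟨z, Y, hz, hY⟩ := exists_radial hν 0 hγ (fun i hi => by
    refine pSet_formsCoeff₁_eq_zero (fun l => ?_) μ
    fin_cases i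
    · exact absurd rfl hi
    · fin_cases l <;> simp [cubeParam, setVar_X, MvPolynomial.pderiv_X]
    · fin_cases l <;> simp [cubeParam, setVar_X, MvPolynomial.pderiv_X])
  obtain ⟨hY1m, hY1, hY10, hY1r⟩ := hY 1
  obtain ⟨hY2m, hY2, hY20, hY2r⟩ := hY 2
  replace hY1r := hY1r (by decide)
  replace hY2r := hY2r (by decide)
  obtain ⟨q, hq⟩ := exists_isLogTw hγm 1 hY1m
  obtain ⟨T, hT⟩ := exists_isLogTw hγm 2 hY2m
  obtain ⟨v, hv⟩ := exists_isLog (G := G) 1 (pSet_mem 0 1 (neg_mem (formsCoeff₁_mem hν.1 1)))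
  obtain ⟨Yf, hYfm, hYf1, hYf0⟩ := exists_primitive (G := G) 1
    ((G.isDG_polys 3).expOp_mem (neg_mem hv.1) (pSet_mem 0 1 (formsCoeff₂_mem hν.1 1 2)))
  obtain ⟨W, hW⟩ := exists_isLogTw hγm' 2 hYfm
  have eX : X = -G.pEval ![1, 0, 0] z := pathHolonomy_unique hX (isPathHolonomy_of
    ![MvPolynomial.X 0, 0, 0] _ (by
      rw [pullForms_pullForms]
      exact pull_edge _ _ _ fun i => by fin_cases i <;> simp [cubeParam])
    (fun l => by fin_cases l <;> simp [MvPolynomial.pderiv_X]) (by simp [setVar_X])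
    (fun l => by fin_cases l <;> simp) hz (map_neg _ _))
  have e₀₁₃ : t₀₁₃ = G.pEval ![1, 1, 1] q := surfaceHolonomy_unique
    (by rw [vertex_simpForms]; exact hγm) h₀₁₃ (isSurfaceHolonomy_of (ν := ν)
    ![MvPolynomial.X 0, MvPolynomial.X 1, 1] _ (by
      rw [pullForms_pullForms]
      exact pull_face _ _ _ _ fun i => by fin_cases i <;> simp [cubeParam])
    (fun l => by fin_cases l <;> simp [MvPolynomial.pderiv_X]) (by simp [setVar_X])
    (fun l => by fin_cases l <;> simp [MvPolynomial.pderiv_X]) (by simp [setVar_X])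
    (fun l => by fin_cases l <;> simp) hz (map_neg _ _) hY1 rfl hY10 (vertex_simpForms _ _ _) hq)
  have e₀₁₂ : t₀₁₂ = G.pEval ![1, 1, 0] q := surfaceHolonomy_unique
    (by rw [vertex_simpForms]; exact hγm) h₀₁₂ (isSurfaceHolonomy_of (ν := ν)
    ![MvPolynomial.X 0, MvPolynomial.X 1, 0] _ (by
      rw [pullForms_pullForms]
      exact pull_face _ _ _ _ fun i => by fin_cases i <;> simp [cubeParam])
    (fun l => by fin_cases l <;> simp [MvPolynomial.pderiv_X]) (by simp [setVar_X])
    (fun l => by fin_cases l <;> simp [MvPolynomial.pderiv_X]) (by simp [setVar_X])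
    (fun l => by fin_cases l <;> simp) hz (map_neg _ _) hY1 rfl hY10 (vertex_simpForms _ _ _) hq)
  have e₀₂₃ : t₀₂₃ = G.pEval ![1, 1, 1] T := surfaceHolonomy_unique
    (by rw [vertex_simpForms]; exact hγm) h₀₂₃ (isSurfaceHolonomy_of (ν := ν)
    ![MvPolynomial.X 0, 1, MvPolynomial.X 1] _ (by
      rw [pullForms_pullForms]
      exact pull_face _ _ _ _ fun i => by fin_cases i <;> simp [cubeParam])
    (fun l => by fin_cases l <;> simp [MvPolynomial.pderiv_X]) (by simp [setVar_X])
    (fun l => by fin_cases l <;> simp [MvPolynomial.pderiv_X]) (by simp [setVar_X])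
    (fun l => by fin_cases l <;> simp) hz (map_neg _ _) hY2 rfl hY20 (vertex_simpForms _ _ _) hT)
  have e₁₂₃ : t₁₂₃ = G.pEval ![1, 1, 1] W := surfaceHolonomy_unique
    (by rw [vertex_simpForms]; exact hγm') h₁₂₃ (isSurfaceHolonomy_of (ν := ν)
    ![1, MvPolynomial.X 0, MvPolynomial.X 1] _ (by
      rw [pullForms_pullForms]
      exact pull_face _ _ _ _ fun i => by fin_cases i <;> simp [cubeParam])
    (fun l => by fin_cases l <;> simp [MvPolynomial.pderiv_X]) (by simp [setVar_X])
    (fun l => by fin_cases l <;> simp [MvPolynomial.pderiv_X]) (by simp [setVar_X])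
    (fun l => by fin_cases l <;> simp) hv (by rw [pSub_pSet _ (by simp), map_neg]) hYf1
    (pSub_pSet _ (by simp) _) hYf0 (vertex_simpForms _ _ _) hW)
  have hD := G.isDG_polys 3
  have hβ0 : G.pSet 0 0 (formsCoeff₂ 1 2 ν) = 0 := pSet_formsCoeff₂_eq_zero (fun l => by
    fin_cases l <;> simp [cubeParam, setVar_X, MvPolynomial.pderiv_X]) μ
  have hβ0' : G.pSet 1 0 (formsCoeff₂ 0 2 ν) = 0 := pSet_formsCoeff₂_eq_zero (fun l => by
    fin_cases l <;> simp [cubeParam, setVar_X, MvPolynomial.pderiv_X]) μ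
  have hcurv := radial_curvature hD (G.dgPrim 0) (G.dgDer 1) (G.dgDer 2)
    (fun v => G.partialDeriv_comm _ _ v) (fun v => G.partialDeriv_comm _ _ v)
    (fun v => G.pSet_partialDeriv (by decide) 0 v) (fun v => G.pSet_partialDeriv (by decide) 0 v)
    (formsFun_mem hν.1) hγ hz.1 hz.2.1 hY1r hY2r (formsCoeff₁_mem hν.1 1) (formsCoeff₁_mem hν.1 2)
    (mc_three hν 0 1 2) hβ0 hY1m hY2m hY1 hY2 hY10 hY20
  have hS := G.dgMor_pSet (m := 3) 0 1
  have hr := congrArg (G.pSet 0 1) (radial_connection' hD hz.1 hY1r)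
  rw [hS.map_phiOp hD hD, G.pSet_partialDeriv (by decide), map_sub, map_neg (G.pSet 0 1),
    hS.map_expOp hD hD, hS.map_dOp, pSet_pConst] at hr
  have hv1 := hv.2.1
  rw [map_neg (G.pSet 0 1)] at hv1
  have hq' := hq.pSet (j := 0) (by decide) 1
  have hb := boundary_transport hD (G.dgPrim 1) (mc_pConst hγm 3) (partialDeriv_pConst _ _)
    (pSet_mem 0 1 hz.1) hr hv.1 hv1 hv.2.2 hq'.1 hq'.2.1 hq'.2.2
  have hc := congrArg (G.pSet 0 1) hcurv
  rw [hS.map_expOp hD hD, map_neg (G.pSet 0 1), map_sub, map_sub, G.pSet_partialDeriv (by decide),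
    G.pSet_partialDeriv (by decide), hS.map_twBr, pSet_pConst] at hc
  have hY21 : G.pSet 1 0 (Y 2) = 0 := by
    refine (G.dgPrim 0).ext ?_ ?_
    · rw [← G.pSet_partialDeriv (by decide), hY2, (G.dgMor_pSet 1 0).map_expOp hD hD, hβ0', map_zero,
        map_zero (partialDeriv 0)]
    · rw [G.pSet_comm (by decide), hY20, map_zero, map_zero]
  have hst := stokes_square hD (G.dgPrim 1) (G.dgDer 2) (fun v => G.partialDeriv_comm _ _ v)
    (fun v => G.pSet_partialDeriv (by decide) 0 v) (mc_pConst hγm 3) (partialDeriv_pConst _ _)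
    (partialDeriv_pConst _ _) (pSet_mem 0 1 hz.1) hv.1 hq'.1 (pSet_mem 0 1 hY1m) (pSet_mem 0 1 hY2m) hc
    hq'.2.1 hq'.2.2 hb (by rw [G.pSet_comm (by decide), hY21, map_zero]) hYf1 hYf0
  rw [pSet_isLog_cubeParam hz, ← TensorProduct.tmul_neg, ← eX] at hst
  have hR := G.dgMor_pSet (m := 3) 1 1
  have hst' := congrArg (G.pSet 1 1) hst
  rw [map_add, hR.map_phiOp hD hD, hR.map_expOp hD hD, hR.map_expOp hD hD, hR.map_dOp, pSet_pConst,
    pSet_pConst, G.pSet_partialDeriv (by decide)] at hst'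
  have hW' := hW.pSet (j := 1) (by decide) 1
  have hT' := (hT.pSet (j := 0) (by decide) 1).pSet (j := 1) (by decide) 1
  have hq'' := pSet_mem 1 1 hq'.1
  have hXc : G.pConst 3 X ∈ G.pDeg 3 0 := pConst_mem hXm
  have hg : gaugeOp (G.pBr 3) (G.pDiff 3) (G.pConst 3 X) (G.pConst 3 (vertex 1 μ)) =
      G.pConst 3 (vertex 0 μ) := by
    have h1 := (isOneMor_of_isPathHolonomy (hμ.pull _) hX).2
    change G.alg.gauge X (vertex 1 (G.alg.simpForms _ μ)) = vertex 0 (G.alg.simpForms _ μ) at h1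
    rw [vertex_simpForms, vertex_simpForms, DGLA.gauge, phiAd_eq (G.isDG.nilp _)] at h1
    have h2 := (G.dgMor_const 3).map_gaugeOp G.isDG hD X (vertex 1 μ)
    exact h2.symm.trans (congrArg (G.pConst 3) h1)
  have hwh := whisker_transport hD (pConst_mem hγm'.1) hXc hW'.1 (G.dgDer 2) (partialDeriv_pConst _ _) hg
  rw [hW'.2.1] at hwh
  rw [← hwh] at hst'
  have htc := transport_comparison hD (G.dgPrim 2) (mc_pConst hγm 3) (partialDeriv_pConst _ _)
    (pSet_pConst _ _ _) hq'' (hD.expOp_mem hXc hW'.1) hT'.1 hst' hT'.2.1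
    (by rw [(G.dgPrim 2).ev_expOp hD, hW'.2.2, map_zero]) hT'.2.2
  have he := G.dgMor_pEval (m := 3) ![1, 1, 1]
  have hf := congrArg (G.pEval ![1, 1, 1]) htc
  rw [he.map_bch_tw hD, he.map_bch_tw hD, he.map_expOp hD G.isDG, pEval_pConst, pEval_pConst] at hf
  simp only [pEval_pSet] at hf
  have p1 : Function.update ![(1 : k), 1, 1] 1 1 = ![1, 1, 1] := by
    funext i; fin_cases i <;> simp
  have p2 : Function.update ![(1 : k), 1, 1] 0 1 = ![1, 1, 1] := by
    funext i; fin_cases i <;> simp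
  have p3 : Function.update (Function.update (Function.update ![(1 : k), 1, 1] 2 0) 1 1) 0 1 = ![1, 1, 0] := by
    funext i; fin_cases i <;> simp
  rw [p3, p1, p2, ← e₀₁₂, ← e₀₁₃, ← e₀₂₃, ← e₁₂₃] at hf
  rw [expAd_eq (G.isDG.nilp _)]
  exact hf

end NilpDGLA

/-! ## Functoriality of holonomies -/

namespace NilpDGLA

open DGLA CategoryTheory

variable {k : Type u} [Field k] {G H : NilpDGLA k} {m n : ℕ}

/-- The map on polynomials induced by a morphism. -/
abbrev pMap (f : G ⟶ H) (m : ℕ) : G.alg.Polys m →ₗ[k] H.alg.Polys m :=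
  TensorProduct.map LinearMap.id (lin f)

theorem dgMor_lin (f : G ⟶ H) : DGMor G.alg.bracket G.alg.diff H.alg.bracket H.alg.diff (lin f) :=
  ⟨DGLA.Hom.map_bracket f, DGLA.Hom.map_diff f⟩

theorem dgMor_pMap (f : G ⟶ H) (m : ℕ) : DGMor (G.pBr m) (G.pDiff m) (H.pBr m) (H.pDiff m) (pMap f m) :=
  (dgMor_lin f).ext _

theorem lin_mem (f : G ⟶ H) {i : ℤ} {x : G.alg.carrier} (hx : x ∈ G.alg.deg i) :
    lin f x ∈ H.alg.deg i := DGLA.Hom.map_deg f i x hx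

theorem pMap_mem (f : G ⟶ H) {i : ℤ} {x : G.alg.Polys m} (hx : x ∈ G.pDeg m i) :
    pMap f m x ∈ H.pDeg m i := map_mem_extSub _ _ (fun _ h => lin_mem f h) hx

theorem partialDeriv_pMap (f : G ⟶ H) (j : Fin m) (x : G.alg.Polys m) :
    partialDeriv j (pMap f m x) = pMap f m (partialDeriv j x) := map_id_comm _ _ _

theorem pSet_pMap (f : G ⟶ H) (j : Fin m) (c : k) (x : G.alg.Polys m) :
    H.pSet j c (pMap f m x) = pMap f m (G.pSet j c x) := map_id_comm _ _ _

theorem pMap_pConst (f : G ⟶ H) (x : G.alg.carrier) :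
    pMap f m (G.pConst m x) = H.pConst m (lin f x) := TensorProduct.map_tmul _ _ _ _

theorem pEval_pMap (f : G ⟶ H) (c : Fin m → k) (x : G.alg.Polys m) :
    H.pEval c (pMap f m x) = lin f (G.pEval c x) := by
  induction x using TensorProduct.induction_on with
  | zero => simp
  | tmul g v => rw [TensorProduct.map_tmul, augmentation_tmul, augmentation_tmul, map_smul]; rfl
  | add x y hx hy => simp only [map_add, hx, hy]

theorem map_id_formsMap {V : Type u} [AddCommGroup V] [Module k V] (f : G ⟶ H) (φ : PolyForm k m →ₗ[k] V)
    (μ : G.alg.Forms m) : TensorProduct.map φ LinearMap.id (formsMap f m μ) =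
      TensorProduct.map LinearMap.id (lin f) (TensorProduct.map φ LinearMap.id μ) := by
  induction μ using TensorProduct.induction_on with
  | zero => simp
  | tmul g v => rfl
  | add x y hx hy => simp only [map_add, hx, hy]

theorem formsCoeff₁_formsMap (f : G ⟶ H) (j : Fin m) (μ : G.alg.Forms m) :
    formsCoeff₁ j (formsMap f m μ) = pMap f m (formsCoeff₁ j μ) := map_id_formsMap _ _ _

theorem formsCoeff₂_formsMap (f : G ⟶ H) (i j : Fin m) (μ : G.alg.Forms m) :
    formsCoeff₂ i j (formsMap f m μ) = pMap f m (formsCoeff₂ i j μ) := map_id_formsMap _ _ _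

theorem formsFun_formsMap (f : G ⟶ H) (μ : G.alg.Forms m) :
    formsFun (formsMap f m μ) = pMap f m (formsFun μ) := map_id_formsMap _ _ _

theorem pullForms_formsMap (f : G ⟶ H) (φ : Fin n → AffPoly k m) (μ : G.alg.Forms n) :
    H.alg.pullForms φ (formsMap f n μ) = formsMap f m (G.alg.pullForms φ μ) := map_id_formsMap _ _ _

theorem IsLog.map (f : G ⟶ H) {j : Fin m} {a z : G.alg.Polys m} (h : G.IsLog j a z) :
    H.IsLog j (pMap f m a) (pMap f m z) := by
  refine ⟨pMap_mem f h.1, ?_, ?_⟩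
  · rw [partialDeriv_pMap, ← (dgMor_pMap f m).map_phiOp (G.isDG_polys m) (H.isDG_polys m), h.2.1]
  · rw [pSet_pMap, h.2.2, map_zero]

theorem IsLogTw.map (f : G ⟶ H) {γ : G.alg.carrier} {j : Fin m} {a w : G.alg.Polys m}
    (h : G.IsLogTw γ j a w) : H.IsLogTw (lin f γ) j (pMap f m a) (pMap f m w) := by
  refine ⟨pMap_mem f h.1, ?_, ?_⟩
  · rw [partialDeriv_pMap, ← pMap_pConst,
      ← (dgMor_pMap f m).map_phiOp_tw (G.isDG_polys m) (H.isDG_polys m), h.2.1]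
  · rw [pSet_pMap, h.2.2, map_zero]

variable [CharZero k]

theorem vertex_formsMap (f : G ⟶ H) (i : Fin (n + 1)) (μ : G.alg.Forms n) :
    vertex i (formsMap f n μ) = lin f (vertex i μ) := by
  rw [vertex_eq, vertex_eq, formsFun_formsMap, pEval_pMap]

theorem isPathHolonomy_formsMap (f : G ⟶ H) {μ : G.alg.Forms 1} {X : G.alg.carrier}
    (h : IsPathHolonomy μ X) : IsPathHolonomy (formsMap f 1 μ) (lin f X) := by
  obtain ⟨z, hz, rfl⟩ := isPathHolonomy_iff.1 h
  refine isPathHolonomy_iff.2 ⟨pMap f 1 z, ?_, ?_⟩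
  · rw [formsCoeff₁_formsMap, ← map_neg (pMap f 1)]
    exact hz.map f
  · rw [pEval_pMap, map_neg]

theorem isSurfaceHolonomy_formsMap (f : G ⟶ H) {μ : G.alg.Forms 2} {t : G.alg.carrier}
    (h : IsSurfaceHolonomy μ t) : IsSurfaceHolonomy (formsMap f 2 μ) (lin f t) := by
  obtain ⟨z, Y, w, hz, hY1, hY0, hw, rfl⟩ := isSurfaceHolonomy_iff.1 h
  refine isSurfaceHolonomy_iff.2 ⟨pMap f 2 z, pMap f 2 Y, pMap f 2 w, ?_, ?_, ?_, ?_, ?_⟩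
  · rw [pullForms_formsMap, formsCoeff₁_formsMap, ← map_neg (pMap f 2)]
    exact hz.map f
  · rw [pullForms_formsMap, formsCoeff₂_formsMap, partialDeriv_pMap, hY1,
      (dgMor_pMap f 2).map_expOp (G.isDG_polys 2) (H.isDG_polys 2), map_neg (pMap f 2)]
  · rw [pSet_pMap, hY0, map_zero]
  · rw [vertex_formsMap]
    exact hw.map f
  · rw [pEval_pMap]

/-! ## Degenerate simplices -/

theorem coeff₂_self (j : Fin m) (ω : PolyForm k m) : PolyForm.coeff₂ j j ω = 0 := by
  have h := PolyForm.contract_contract j j ω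
  have h2 : (2 : k) • PolyForm.contract j (PolyForm.contract j ω) = 0 := by
    rw [two_smul]; nth_rewrite 1 [h]; exact neg_add_cancel _
  rw [PolyForm.coeff₂_apply, (smul_eq_zero.1 h2).resolve_left two_ne_zero, map_zero]

theorem formsCoeff₂_self (j : Fin m) (μ : G.alg.Forms m) : formsCoeff₂ j j μ = 0 := by
  have : PolyForm.coeff₂ j j = (0 : PolyForm k m →ₗ[k] AffPoly k m) := LinearMap.ext (coeff₂_self j)
  rw [formsCoeff₂, this, TensorProduct.map_zero_left, LinearMap.zero_apply]

theorem isPathHolonomy_degenerate (φ : Fin 0 → AffPoly k 1) (ν : G.alg.Forms 0) :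
    IsPathHolonomy (G.alg.pullForms φ ν) 0 := by
  refine isPathHolonomy_iff.2 ⟨0, ?_, by simp⟩
  have h : formsCoeff₁ 0 (G.alg.pullForms φ ν) = 0 := by
    rw [formsCoeff₁_pull, Finset.univ_eq_empty, Finset.sum_empty]
  rw [h, neg_zero]
  exact isLog_zero 0

theorem isSurfaceHolonomy_degenerate (φ : Fin 1 → AffPoly k 2) {ν : G.alg.Forms 1}
    (hν : ν ∈ G.alg.formsDegOne 1) : IsSurfaceHolonomy (G.alg.pullForms φ ν) 0 := by
  have hm := pull_mem_degOne (squareParam k) (pull_mem_degOne φ hν)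
  obtain ⟨z, hz⟩ := exists_isLog (G := G) 0 (neg_mem (formsCoeff₁_mem hm 0))
  refine isSurfaceHolonomy_iff.2 ⟨z, 0, 0, hz, ?_, map_zero _, isLogTw_zero _ _, by simp⟩
  have h : formsCoeff₂ 0 1 (G.alg.pullForms (squareParam k) (G.alg.pullForms φ ν)) = 0 := by
    rw [pullForms_pullForms, formsCoeff₂_pull]
    refine Finset.sum_eq_zero fun l _ => Finset.sum_eq_zero fun l' _ => ?_
    rw [Subsingleton.elim l l', formsCoeff₂_self, map_zero, smul_zero]
  rw [h, map_zero, map_zero]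

/-! ## The holonomies as functions -/

open Classical in
/-- The holonomy along the one-simplex. -/
def hol₁ (μ : G.alg.Forms 1) : G.alg.carrier :=
  if h : ∃ X, IsPathHolonomy μ X then h.choose else 0

open Classical in
/-- The two-dimensional holonomy over the two-simplex. -/
def hol₂ (μ : G.alg.Forms 2) : G.alg.carrier :=
  if h : ∃ t, IsSurfaceHolonomy μ t then h.choose else 0

theorem hol₁_spec {μ : G.alg.Forms 1} (hμ : G.alg.IsFormsMC μ) : IsPathHolonomy μ (hol₁ μ) := by
  have h' := exists_pathHolonomy hμ.1
  rw [hol₁, dif_pos h']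
  exact h'.choose_spec

theorem hol₂_spec {μ : G.alg.Forms 2} (hμ : G.alg.IsFormsMC μ) : IsSurfaceHolonomy μ (hol₂ μ) := by
  have h' := exists_surfaceHolonomy hμ.1 (vertex_mc hμ 0)
  rw [hol₂, dif_pos h']
  exact h'.choose_spec

theorem edge_comp {a b : ℕ} (f : SimplexCategory.mk a ⟶ SimplexCategory.mk b) {i j : Fin (a + 1)}
    (h : i ≤ j) : edge (a := .mk a) i j h ≫ f =
      edge (a := .mk b) (f.toOrderHom i) (f.toOrderHom j) (f.toOrderHom.monotone h) := by
  refine SimplexCategory.Hom.ext _ _ (OrderHom.ext _ _ (funext fun x => ?_))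
  match x with
  | 0 => rfl
  | 1 => rfl

theorem face_comp {a b : ℕ} (f : SimplexCategory.mk a ⟶ SimplexCategory.mk b) {i j l : Fin (a + 1)}
    (h : i ≤ j) (h' : j ≤ l) : face (a := .mk a) i j l h h' ≫ f =
      face (a := .mk b) (f.toOrderHom i) (f.toOrderHom j) (f.toOrderHom l) (f.toOrderHom.monotone h)
        (f.toOrderHom.monotone h') := by
  refine SimplexCategory.Hom.ext _ _ (OrderHom.ext _ _ (funext fun x => ?_))
  match x with
  | 0 => rfl
  | 1 => rfl
  | 2 => rfl

/-- The holonomy along the edge from `i` to `j`. -/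
def holOne {n : ℕ} (μ : G.alg.Forms n) (i j : Fin (n + 1)) : G.alg.carrier :=
  if h : i < j then hol₁ (G.alg.simpForms (edge (a := .mk n) i j h.le) μ) else 0

/-- The two-dimensional holonomy over the face with vertices `i`, `j`, `l`. -/
def holTwo {n : ℕ} (μ : G.alg.Forms n) (i j l : Fin (n + 1)) : G.alg.carrier :=
  if h : i < j ∧ j < l then hol₂ (G.alg.simpForms (face (a := .mk n) i j l h.1.le h.2.le) μ) else 0

theorem holOne_spec {μ : G.alg.Forms n} (hμ : G.alg.IsFormsMC μ) {i j : Fin (n + 1)} (h : i ≤ j) :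
    IsPathHolonomy (G.alg.simpForms (edge (a := .mk n) i j h) μ) (holOne μ i j) := by
  rcases h.lt_or_eq with h' | rfl
  · rw [holOne, dif_pos h']
    exact hol₁_spec (hμ.pull _)
  · rw [holOne, dif_neg (lt_irrefl _)]
    have : edge (a := .mk n) i i h = SimplexCategory.const (.mk 1) (.mk 0) 0 ≫
        SimplexCategory.const (.mk 0) (.mk n) i := by
      refine SimplexCategory.Hom.ext _ _ (OrderHom.ext _ _ (funext fun x => ?_))
      match x with
      | 0 => rfl
      | 1 => rfl
    rw [this, simpForms_comp]
    exact isPathHolonomy_degenerate _ _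

theorem holTwo_spec {μ : G.alg.Forms n} (hμ : G.alg.IsFormsMC μ) {i j l : Fin (n + 1)} (h : i ≤ j) (h' : j ≤ l) :
    IsSurfaceHolonomy (G.alg.simpForms (face (a := .mk n) i j l h h') μ) (holTwo μ i j l) := by
  by_cases hc : i < j ∧ j < l
  · rw [holTwo, dif_pos hc]
    exact hol₂_spec (hμ.pull _)
  · rw [holTwo, dif_neg hc]
    have : ∃ s : SimplexCategory.mk 2 ⟶ SimplexCategory.mk 1, face (a := .mk n) i j l h h' =
        s ≫ edge (a := .mk n) i l (h.trans h') := by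
      rcases h.lt_or_eq with h1 | rfl
      · obtain rfl : j = l := h'.lt_or_eq.resolve_left fun h2 => hc ⟨h1, h2⟩
        refine ⟨SimplexCategory.σ 1, SimplexCategory.Hom.ext _ _ (OrderHom.ext _ _ (funext fun x => ?_))⟩
        match x with
        | 0 => rfl
        | 1 => rfl
        | 2 => rfl
      · refine ⟨SimplexCategory.σ 0, SimplexCategory.Hom.ext _ _ (OrderHom.ext _ _ (funext fun x => ?_))⟩
        match x with
        | 0 => rfl
        | 1 => rfl
        | 2 => rfl
    obtain ⟨s, hs⟩ := this
    rw [hs, simpForms_comp]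
    exact isSurfaceHolonomy_degenerate _ (hμ.pull _).1

theorem holOne_eq {μ : G.alg.Forms n} (hμ : G.alg.IsFormsMC μ) {i j : Fin (n + 1)} (h : i ≤ j)
    {X : G.alg.carrier} (hX : IsPathHolonomy (G.alg.simpForms (edge (a := .mk n) i j h) μ) X) :
    holOne μ i j = X := pathHolonomy_unique (holOne_spec hμ h) hX

theorem holTwo_eq {μ : G.alg.Forms n} (hμ : G.alg.IsFormsMC μ) {i j l : Fin (n + 1)} (h : i ≤ j)
    (h' : j ≤ l) {t : G.alg.carrier}
    (ht : IsSurfaceHolonomy (G.alg.simpForms (face (a := .mk n) i j l h h') μ) t) :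
    holTwo μ i j l = t := surfaceHolonomy_unique (vertex_mc (hμ.pull _) 0) (holTwo_spec hμ h h') ht

/-- The holonomies of a simplex form a simplex of the nerve. -/
def holNerve {n : ℕ} (μ : G.alg.Forms n) (hμ : G.alg.IsFormsMC μ) : G.alg.NerveSimplex n where
  obj i := vertex i μ
  one := holOne μ
  two := holTwo μ
  obj_mc i := vertex_mc hμ i
  one_eq_zero i j h := dif_neg h
  two_eq_zero i j l h := dif_neg h
  one_mor i j h := by
    have h1 := isOneMor_of_isPathHolonomy (hμ.pull _) (holOne_spec hμ h)
    change G.alg.IsOneMor _ (vertex 1 (G.alg.simpForms _ μ)) (vertex 0 (G.alg.simpForms _ μ)) at h1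
    rw [vertex_simpForms, vertex_simpForms] at h1
    exact h1
  two_mor i j l h h' := by
    have h1 := isTwoMor_of_isSurfaceHolonomy (μ := G.alg.simpForms (face (a := .mk n) i j l h h') μ)
      (hμ.pull _) (X₀₁ := holOne μ i j) (X₁₂ := holOne μ j l) (X₀₂ := holOne μ i l) (t := holTwo μ i j l)
      (by rw [← simpForms_comp, edge_comp]; exact holOne_spec hμ h)
      (by rw [← simpForms_comp, edge_comp]; exact holOne_spec hμ h')
      (by rw [← simpForms_comp, edge_comp]; exact holOne_spec hμ (h.trans h'))
      (holTwo_spec hμ h h')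
    rw [vertex_simpForms] at h1
    exact h1
  cocycle i j l m h h' h'' := by
    let s : SimplexCategory.mk 3 ⟶ SimplexCategory.mk n := SimplexCategory.mkHom
      ⟨![i, j, l, m], by
        refine Fin.monotone_iff_le_succ.2 fun x => ?_
        fin_cases x
        exacts [h, h', h'']⟩
    have h1 := cocycle_of_isSurfaceHolonomy (μ := G.alg.simpForms s μ) (hμ.pull _) (X := holOne μ i j)
      (t₀₁₂ := holTwo μ i j l) (t₀₁₃ := holTwo μ i j m) (t₀₂₃ := holTwo μ i l m) (t₁₂₃ := holTwo μ j l m)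
      (by rw [← simpForms_comp, edge_comp]; exact holOne_spec hμ h)
      (by rw [← simpForms_comp, face_comp]; exact holTwo_spec hμ h h')
      (by rw [← simpForms_comp, face_comp]; exact holTwo_spec hμ h (h'.trans h''))
      (by rw [← simpForms_comp, face_comp]; exact holTwo_spec hμ (h.trans h') h'')
      (by rw [← simpForms_comp, face_comp]; exact holTwo_spec hμ h' h'')
    rw [vertex_simpForms] at h1
    exact h1

theorem holNerve_simpForms {a b : ℕ} (f : SimplexCategory.mk a ⟶ SimplexCategory.mk b) {μ : G.alg.Forms b}
    (hμ : G.alg.IsFormsMC μ) :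
    holNerve (n := a) (G.alg.simpForms f μ) (hμ.pull _) = (holNerve μ hμ).pull f.toOrderHom := by
  refine NerveSimplex.ext ?_ ?_ ?_
  · funext i
    exact vertex_simpForms f i μ
  · funext i j
    by_cases h : i < j
    · refine holOne_eq (hμ.pull _) h.le ?_
      change IsPathHolonomy (G.alg.simpForms (edge (a := .mk a) i j h.le) (G.alg.simpForms f μ)) _
      rw [← simpForms_comp, edge_comp]
      exact holOne_spec hμ (f.toOrderHom.monotone h.le)
    · exact ((holNerve _ _).one_eq_zero i j h).trans (((holNerve μ hμ).pull f.toOrderHom).one_eq_zero i j h).symm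
  · funext i j l
    by_cases h : i < j ∧ j < l
    · refine holTwo_eq (hμ.pull _) h.1.le h.2.le ?_
      change IsSurfaceHolonomy (G.alg.simpForms (face (a := .mk a) i j l h.1.le h.2.le) (G.alg.simpForms f μ)) _
      rw [← simpForms_comp, face_comp]
      exact holTwo_spec hμ (f.toOrderHom.monotone h.1.le) (f.toOrderHom.monotone h.2.le)
    · exact ((holNerve _ _).two_eq_zero i j l h).trans
        (((holNerve μ hμ).pull f.toOrderHom).two_eq_zero i j l h).symm

theorem holNerve_formsMap (f : G ⟶ H) {μ : G.alg.Forms n} (hμ : G.alg.IsFormsMC μ)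
    (hμ' : H.alg.IsFormsMC (formsMap f n μ)) :
    holNerve (formsMap f n μ) hμ' = (holNerve μ hμ).map G.nilpotent f := by
  refine NerveSimplex.ext ?_ ?_ ?_
  · funext i
    exact vertex_formsMap f i μ
  · funext i j
    by_cases h : i < j
    · refine holOne_eq hμ' h.le ?_
      exact (congrArg (fun ν => IsPathHolonomy ν (lin f (holOne μ i j))) (pullForms_formsMap f _ μ)).mpr
        (isPathHolonomy_formsMap f (holOne_spec hμ h.le))
    · exact ((holNerve _ _).one_eq_zero i j h).trans
        (((holNerve μ hμ).map G.nilpotent f).one_eq_zero i j h).symm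
  · funext i j l
    by_cases h : i < j ∧ j < l
    · refine holTwo_eq hμ' h.1.le h.2.le ?_
      exact (congrArg (fun ν => IsSurfaceHolonomy ν (lin f (holTwo μ i j l)))
        (pullForms_formsMap f _ μ)).mpr (isSurfaceHolonomy_formsMap f (holTwo_spec hμ h.1.le h.2.le))
    · exact ((holNerve _ _).two_eq_zero i j l h).trans
        (((holNerve μ hμ).map G.nilpotent f).two_eq_zero i j l h).symm

variable (k) in
/-- The holonomy map. -/
def holMap : sigma k ⟶ nerve k where
  app G :=
    { app := fun a => TypeCat.ofHom fun μ => holNerve (n := a.unop.len) (sigmaForm μ) μ.2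
      naturality := fun a b f => by
        ext μ
        exact holNerve_simpForms f.unop μ.2 }
  naturality G H f := by
    ext a μ
    exact holNerve_formsMap f μ.2 (DGLA.Hom.isFormsMC f μ.2)

theorem isHolonomyOf_holMap {a : SimplexCategoryᵒᵖ} (μ : ((sigma k).obj G).obj a) :
    IsHolonomyOf μ (((holMap k).app G).app a μ) := by
  have hμ : G.alg.IsFormsMC (sigmaForm μ) := μ.2
  refine ⟨fun i => rfl, fun i j h X => ⟨fun hX => ?_, ?_⟩, fun i j l h h' t => ⟨fun ht => ?_, ?_⟩⟩
  · exact (holOne_eq (n := a.unop.len) hμ h.le hX).symm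
  · rintro rfl
    exact holOne_spec (n := a.unop.len) hμ h.le
  · exact (holTwo_eq (n := a.unop.len) hμ h.le h'.le ht).symm
  · rintro rfl
    exact holTwo_spec (n := a.unop.len) hμ h.le h'.le

end NilpDGLA

/-! ## Integrals -/

section

variable {k : Type u} [Field k] [CharZero k] {M : Type u} [AddCommGroup M] [Module k M]

theorem phiOp_of_apply_eq_zero {T : Module.End k M} (h : IsNilpotent T) {v : M} (hv : T v = 0) :
    phiOp T v = v := by
  obtain ⟨N, hN⟩ := h
  rw [phiOp, nser_apply _ (pow_eq_zero_of_le (Nat.le_succ N) hN), Finset.sum_range_succ',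
    Finset.sum_eq_zero fun i _ => ?_]
  · simp [phiS]
  · rw [pow_succ, Module.End.mul_apply, hv, map_zero, smul_zero]

theorem expOp_of_apply_eq_zero {T : Module.End k M} (h : IsNilpotent T) {v : M} (hv : T v = 0) :
    expOp T v = v := by
  rw [expOp_eq_add h, hv, map_zero, add_zero]

end

namespace PolyForm

variable {k : Type u} [Field k] {m : ℕ}

theorem foldl_contract_of_eq_zero (l : List (Fin m)) (T : PolyForm k m →ₗ[k] PolyForm k m)
    {ω : PolyForm k m} (h : T ω = 0) : (l.foldl (fun T j => contract j ∘ₗ T) T) ω = 0 := by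
  induction l generalizing T with
  | nil => exact h
  | cons j l ih => exact ih _ (by rw [LinearMap.comp_apply, h, map_zero])

theorem contract_contract_contract_of_mem {q : ℕ} (hq : q ≤ 2) {ω : PolyForm k m}
    (hω : ω ∈ ofDegree k m q) (i j l : Fin m) : contract l (contract j (contract i ω)) = 0 := by
  rcases q with _ | _ | _ | q
  · rw [contract_of_mem_zero i hω, map_zero, map_zero]
  · rw [contract_of_mem_zero j (contract_mem i hω), map_zero]
  · rw [contract_of_mem_zero l (contract_mem j (contract_mem i hω))]
  · omega

theorem coeffTop_of_mem {p q : ℕ} (hq : q ≤ 2) {ω : PolyForm k (p + 3)}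
    (hω : ω ∈ ofDegree k (p + 3) q) : coeffTop (p + 3) ω = 0 := by
  obtain ⟨l, hl⟩ : ∃ l, List.finRange (p + 3) = 0 :: 1 :: 2 :: l := by
    simp only [List.finRange_succ, List.map_cons]
    exact ⟨_, rfl⟩
  rw [coeffTop, LinearMap.comp_apply, hl, List.foldl_cons, List.foldl_cons, List.foldl_cons,
    foldl_contract_of_eq_zero l (contract 2 ∘ₗ contract 1 ∘ₗ contract 0 ∘ₗ LinearMap.id)
      (contract_contract_contract_of_mem hq hω 0 1 2), map_zero]

theorem coeff₂_swap (i j : Fin m) (ω : PolyForm k m) : coeff₂ i j ω = -coeff₂ j i ω := by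
  rw [coeff₂_apply, coeff₂_apply, contract_contract, map_neg]

theorem simplexIntegral_monomial (s : Fin m →₀ ℕ) : simplexIntegral m (MvPolynomial.monomial s (1 : k)) =
    (∏ i, ((s i).factorial : k)) / ((m + ∑ i, s i).factorial : k) := by
  have h := (MvPolynomial.basisMonomials (Fin m) k).constr_basis k (fun a : Fin m →₀ ℕ =>
    (∏ i, ((a i).factorial : k)) / ((m + ∑ i, a i).factorial : k)) s
  rwa [MvPolynomial.coe_basisMonomials] at h

variable [CharZero k]

theorem simplexIntegral_zero (f : AffPoly k 0) :
    simplexIntegral 0 f = MvPolynomial.aeval (Fin.elim0 : Fin 0 → k) f := by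
  have : simplexIntegral (k := k) 0 = (MvPolynomial.aeval (Fin.elim0 : Fin 0 → k)).toLinearMap := by
    refine linearMap_ext_monomial fun s => ?_
    rw [simplexIntegral_monomial]
    simp [MvPolynomial.aeval_monomial]
  rw [this]; rfl

theorem simplexIntegral_one (f : AffPoly k 1) :
    simplexIntegral 1 f = MvPolynomial.aeval (fun _ => (1 : k)) (antideriv 0 f) := by
  have : simplexIntegral (k := k) 1 = (MvPolynomial.aeval (fun _ => (1 : k))).toLinearMap ∘ₗ
      antideriv 0 := by
    refine linearMap_ext_monomial fun s => ?_
    rw [simplexIntegral_monomial, LinearMap.comp_apply, antideriv_monomial]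
    simp only [Finset.univ_unique, Fin.default_eq_zero, Fin.isValue, Finset.prod_singleton,
      Finset.sum_singleton, one_mul, AlgHom.toLinearMap_apply, MvPolynomial.aeval_monomial, one_pow,
      Finsupp.prod, Finset.prod_const_one, mul_one]
    rw [add_comm 1, Nat.factorial_succ, Nat.cast_mul]
    have := Nat.cast_ne_zero (R := k).2 (Nat.factorial_ne_zero (s 0))
    simp only [Algebra.algebraMap_self, RingHom.id_apply]
    rw [mul_comm, ← div_div, div_self this, one_div]
  rw [this]; rfl

/-- The integral over the unit interval of the variable `xⱼ`, evaluated at `1` in the other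
variables. -/
theorem aeval_antideriv_one_sub_mul (n a b : ℕ) :
    MvPolynomial.aeval (fun _ => (1 : k)) (antideriv 1 (antideriv 0
      ((MvPolynomial.X 0) ^ n * (1 - MvPolynomial.X 1) ^ a * MvPolynomial.X 1 ^ b : AffPoly k 2))) =
      (n + 1 : k)⁻¹ * (a.factorial * b.factorial / ((a + b + 1).factorial : k)) := by
  induction a generalizing b with
  | zero =>
    have h : ((MvPolynomial.X 0) ^ n * (1 - MvPolynomial.X 1) ^ 0 * MvPolynomial.X 1 ^ b : AffPoly k 2) =
        MvPolynomial.monomial (Finsupp.single 0 n + Finsupp.single 1 b) 1 := by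
      rw [pow_zero, mul_one, MvPolynomial.X_pow_eq_monomial, MvPolynomial.X_pow_eq_monomial,
        MvPolynomial.monomial_mul, one_mul]
    rw [h, antideriv_monomial, antideriv_monomial, MvPolynomial.aeval_monomial]
    simp only [Finsupp.prod, one_pow, Finset.prod_const_one, mul_one, one_mul,
      Algebra.algebraMap_self, RingHom.id_apply]
    have hb := Nat.cast_ne_zero (R := k).2 (Nat.factorial_ne_zero b)
    have e : (0 + b + 1).factorial = (b + 1) * b.factorial := by rw [zero_add, Nat.factorial_succ]
    rw [e]
    simp
    field_simp
    exact Or.inl trivial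
  | succ a ih =>
    have h : ((MvPolynomial.X 0) ^ n * (1 - MvPolynomial.X 1) ^ (a + 1) * MvPolynomial.X 1 ^ b : AffPoly k 2) =
        (MvPolynomial.X 0) ^ n * (1 - MvPolynomial.X 1) ^ a * MvPolynomial.X 1 ^ b -
        (MvPolynomial.X 0) ^ n * (1 - MvPolynomial.X 1) ^ a * MvPolynomial.X 1 ^ (b + 1) := by
      ring
    rw [h, map_sub, map_sub, map_sub, ih, ih, ← mul_sub]
    congr 1
    have h1 := Nat.cast_ne_zero (R := k).2 (Nat.factorial_ne_zero (a + b + 1))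
    have h2 : ((a + b + 1 + 1 : ℕ) : k) ≠ 0 := Nat.cast_ne_zero.2 (Nat.succ_ne_zero _)
    rw [show a + (b + 1) + 1 = (a + b + 1) + 1 by ring, show a + 1 + b + 1 = (a + b + 1) + 1 by ring,
      Nat.factorial_succ (a + b + 1), Nat.factorial_succ a, Nat.factorial_succ b]
    push_cast at h2 ⊢
    field_simp
    ring

theorem simplexIntegral_two (f : AffPoly k 2) :
    simplexIntegral 2 f = MvPolynomial.aeval (fun _ => (1 : k)) (antideriv 1 (antideriv 0
      (MvPolynomial.X 0 * MvPolynomial.aeval (DGLA.squareParam k) f))) := by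
  have : simplexIntegral (k := k) 2 = (MvPolynomial.aeval (fun _ => (1 : k))).toLinearMap ∘ₗ
      antideriv 1 ∘ₗ antideriv 0 ∘ₗ LinearMap.mulLeft k (MvPolynomial.X 0) ∘ₗ
        (MvPolynomial.aeval (DGLA.squareParam k)).toLinearMap := by
    refine linearMap_ext_monomial fun s => ?_
    have h : MvPolynomial.X 0 * MvPolynomial.aeval (DGLA.squareParam k) (MvPolynomial.monomial s (1 : k)) =
        (MvPolynomial.X 0) ^ (s 0 + s 1 + 1) * (1 - MvPolynomial.X 1) ^ (s 0) * MvPolynomial.X 1 ^ (s 1) := by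
      rw [MvPolynomial.aeval_monomial, map_one, one_mul, Finsupp.prod_fintype _ _ (by simp),
        Fin.prod_univ_two]
      simp only [DGLA.squareParam, Matrix.cons_val_zero, Matrix.cons_val_one, mul_pow]
      ring
    simp only [LinearMap.comp_apply, LinearMap.mulLeft_apply, AlgHom.toLinearMap_apply]
    rw [h, aeval_antideriv_one_sub_mul, simplexIntegral_monomial, Fin.prod_univ_two, Fin.sum_univ_two,
      show 2 + (s 0 + s 1) = (s 0 + s 1 + 1) + 1 by ring, Nat.factorial_succ (s 0 + s 1 + 1)]
    push_cast
    rw [inv_mul_eq_div, div_div, mul_comm ((s 0 + s 1 + 1).factorial : k)]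
  rw [this]; rfl

end PolyForm

namespace NilpDGLA

open DGLA

variable {k : Type u} [Field k] {G A : NilpDGLA k} {m n : ℕ}

theorem formsCoeff₂_swap (i j : Fin m) (μ : G.alg.Forms m) : formsCoeff₂ i j μ = -formsCoeff₂ j i μ := by
  induction μ using TensorProduct.induction_on with
  | zero => simp
  | tmul ω x =>
    refine (TensorProduct.map_tmul _ _ _ _).trans ?_
    rw [PolyForm.coeff₂_swap, TensorProduct.neg_tmul]
    rfl
  | add x y hx hy => rw [map_add, map_add, hx, hy, neg_add]

theorem formsCoeff₂_squareParam [CharZero k] (μ : G.alg.Forms 2) :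
    formsCoeff₂ 0 1 (G.alg.pullForms (squareParam k) μ) =
      (MvPolynomial.X 0 : AffPoly k 2) • G.pSub (squareParam k) (formsCoeff₂ 0 1 μ) := by
  rw [formsCoeff₂_pull, Fin.sum_univ_two, Fin.sum_univ_two, Fin.sum_univ_two, formsCoeff₂_self,
    formsCoeff₂_self, formsCoeff₂_swap 1 0, map_zero, smul_zero, smul_zero, zero_add, add_zero,
    map_neg (G.pSub (squareParam k)), smul_neg, ← neg_smul, ← add_smul]
  congr 1
  simp only [squareParam, Matrix.cons_val_zero, Matrix.cons_val_one, MvPolynomial.pderiv_mul, map_sub,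
    MvPolynomial.pderiv_X, Derivation.map_one_eq_zero]
  simp
  ring

variable [CharZero k]

theorem formsIntegral_zero (μ : G.alg.Forms 0) : formsIntegral 0 μ = vertex 0 μ := by
  rw [vertex_eq]
  induction μ using TensorProduct.induction_on with
  | zero => simp
  | tmul ω x =>
    have h : formsIntegral 0 (ω ⊗ₜ x : G.alg.Forms 0) =
      PolyForm.simplexIntegral 0 (PolyForm.funPart ω) • x := rfl
    rw [h, PolyForm.simplexIntegral_zero]
    refine Eq.trans ?_ (augmentation_tmul _ _ _).symm
    congr 3
    funext i; exact i.elim0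
  | add x y hx hy => simp only [map_add, hx, hy]

theorem formsIntegral_one (μ : G.alg.Forms 1) :
    formsIntegral 1 μ = G.pEval (fun _ => 1) (G.pInt 0 (formsCoeff₁ 0 μ)) := by
  induction μ using TensorProduct.induction_on with
  | zero => simp
  | tmul ω x =>
    have h : formsIntegral 1 (ω ⊗ₜ x : G.alg.Forms 1) =
      PolyForm.simplexIntegral 1 (PolyForm.coeff₁ 0 ω) • x := rfl
    rw [h, PolyForm.simplexIntegral_one]
    exact (augmentation_tmul _ _ _).symm
  | add x y hx hy => simp only [map_add, hx, hy]

theorem formsIntegral_two (μ : G.alg.Forms 2) :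
    formsIntegral 2 μ = G.pEval (fun _ => 1) (G.pInt 1 (G.pInt 0
      (formsCoeff₂ 0 1 (G.alg.pullForms (squareParam k) μ)))) := by
  rw [formsCoeff₂_squareParam]
  induction μ using TensorProduct.induction_on with
  | zero => simp
  | tmul ω x =>
    have h : formsIntegral 2 (ω ⊗ₜ x : G.alg.Forms 2) =
      PolyForm.simplexIntegral 2 (PolyForm.coeff₂ 0 1 ω) • x := rfl
    rw [h, PolyForm.simplexIntegral_two]
    exact (augmentation_tmul _ _ _).symm
  | add x y hx hy => simp only [map_add, smul_add, hx, hy]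

theorem formsIntegral_eq_zero {p : ℕ} {μ : G.alg.Forms (p + 3)} (hμ : μ ∈ G.alg.formsDegOne (p + 3)) :
    formsIntegral (p + 3) μ = 0 := by
  refine formsDegOne_induction (P := fun μ => formsIntegral (p + 3) μ = 0) hμ (map_zero _)
    (fun q ω hω x hx => ?_) fun x y hx hy => by rw [map_add, hx, hy, add_zero]
  have h : formsIntegral (p + 3) (ω ⊗ₜ x : G.alg.Forms (p + 3)) =
      PolyForm.simplexIntegral (p + 3) (PolyForm.coeffTop (p + 3) ω) • x := rfl
  rw [h]
  rcases le_or_gt q 2 with hq | hq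
  · rw [PolyForm.coeffTop_of_mem hq hω, map_zero, zero_smul]
  · rw [G.bounded _ (by omega), Submodule.mem_bot] at hx
    rw [hx, smul_zero]

end NilpDGLA

/-! ## Central extensions: forms and holonomies -/

namespace NilpDGLA

open DGLA

variable {k : Type u} [Field k] {A G : NilpDGLA k} {m n : ℕ}

/-- The image of `ι` is central. -/
def IsCentral (ι : A ⟶ G) : Prop := ∀ x y, G.alg.bracket (lin ι x) y = 0

theorem vertex_add [CharZero k] (i : Fin (n + 1)) (μ ν : G.alg.Forms n) :
    vertex i (μ + ν) = vertex i μ + vertex i ν := by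
  rw [vertex_eq, vertex_eq, vertex_eq, map_add, map_add]

namespace IsCentral

variable {ι : A ⟶ G}

theorem right (h : IsCentral ι) (x : G.alg.carrier) (a : A.alg.carrier) : G.alg.bracket x (lin ι a) = 0 := by
  refine hom_induction (P := fun a => G.alg.bracket x (lin ι a) = 0) a (by simp)
    (fun a b ha hb => by rw [map_add, map_add, ha, hb, add_zero]) fun i a ha => ?_
  refine hom_induction (P := fun x => G.alg.bracket x (lin ι a) = 0) x (by simp)
    (fun a b ha hb => by rw [map_add, LinearMap.add_apply, ha, hb, add_zero]) fun j x hx => ?_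
  rw [G.alg.skew hx (lin_mem ι ha), h, smul_zero, neg_zero]

theorem pBr_left (h : IsCentral ι) (x : A.alg.Polys m) (y : G.alg.Polys m) : G.pBr m (pMap ι m x) y = 0 := by
  induction x using TensorProduct.induction_on with
  | zero => simp
  | add x x' hx hx' => rw [map_add, map_add, LinearMap.add_apply, hx, hx', add_zero]
  | tmul f x =>
    induction y using TensorProduct.induction_on with
    | zero => simp
    | add y y' hy hy' => rw [map_add, hy, hy', add_zero]
    | tmul g y => rw [TensorProduct.map_tmul, extAct_tmul, h, TensorProduct.tmul_zero]

theorem pBr_right (h : IsCentral ι) (y : G.alg.Polys m) (x : A.alg.Polys m) : G.pBr m y (pMap ι m x) = 0 := by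
  induction x using TensorProduct.induction_on with
  | zero => simp
  | add x x' hx hx' => rw [map_add, map_add, hx, hx', add_zero]
  | tmul f x =>
    induction y using TensorProduct.induction_on with
    | zero => simp
    | add y y' hy hy' => rw [map_add, LinearMap.add_apply, hy, hy', add_zero]
    | tmul g y => rw [TensorProduct.map_tmul, extAct_tmul, h.right, TensorProduct.tmul_zero]

theorem formsBracket_left (h : IsCentral ι) (α : A.alg.Forms m) (μ : G.alg.Forms m) :
    G.alg.formsBracket m (formsMap ι m α) μ = 0 := by
  induction α using TensorProduct.induction_on with
  | zero => simp
  | add x x' hx hx' => rw [map_add, map_add, LinearMap.add_apply, hx, hx', add_zero]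
  | tmul ω x =>
    induction μ using TensorProduct.induction_on with
    | zero => simp
    | add y y' hy hy' => rw [map_add, hy, hy', add_zero]
    | tmul η y =>
      have e := DGLA.Hom.map_evenPart ι x
      have o := DGLA.Hom.map_oddPart ι x
      change (ω * η) ⊗ₜ[k] G.alg.bracket (G.alg.evenPart (DGLA.Hom.toLin ι x)) y +
        (ω * PolyForm.invol k m η) ⊗ₜ[k] G.alg.bracket (G.alg.oddPart (DGLA.Hom.toLin ι x)) y = 0
      rw [← e, ← o]
      have h1 := h (A.alg.evenPart x) y
      have h2 := h (A.alg.oddPart x) y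
      rw [lin] at h1 h2
      rw [h1, h2, TensorProduct.tmul_zero, TensorProduct.tmul_zero, add_zero]

theorem formsBracket_right (h : IsCentral ι) (μ : G.alg.Forms m) (α : A.alg.Forms m) :
    G.alg.formsBracket m μ (formsMap ι m α) = 0 := by
  induction α using TensorProduct.induction_on with
  | zero => simp
  | add x x' hx hx' => rw [map_add, map_add, hx, hx', add_zero]
  | tmul ω x =>
    induction μ using TensorProduct.induction_on with
    | zero => simp
    | add y y' hy hy' => rw [map_add, LinearMap.add_apply, hy, hy', add_zero]
    | tmul η y =>
      change (η * ω) ⊗ₜ[k] G.alg.bracket (G.alg.evenPart y) (lin ι x) +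
        (η * PolyForm.invol k m ω) ⊗ₜ[k] G.alg.bracket (G.alg.oddPart y) (lin ι x) = 0
      rw [h.right, h.right, TensorProduct.tmul_zero, TensorProduct.tmul_zero, add_zero]

theorem formsBracket_add (h : IsCentral ι) (μ : G.alg.Forms m) (α : A.alg.Forms m) :
    G.alg.formsBracket m (μ + formsMap ι m α) (μ + formsMap ι m α) = G.alg.formsBracket m μ μ := by
  rw [map_add (G.alg.formsBracket m), LinearMap.add_apply, map_add, h.formsBracket_left,
    h.formsBracket_right, add_zero, add_zero]

theorem isFormsMC_add (h : IsCentral ι) {μ : G.alg.Forms m} (hμ : G.alg.IsFormsMC μ) {α : A.alg.Forms m}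
    (hα : α ∈ A.alg.formsCocycles m) : G.alg.IsFormsMC (μ + formsMap ι m α) := by
  have h' := DGLA.Hom.mem_formsCocycles ι hα
  refine ⟨add_mem hμ.1 h'.1, ?_⟩
  have h2 : G.alg.formsDiff m (formsMap ι m α) = 0 := h'.2
  rw [h.formsBracket_add, map_add, h2, add_zero]
  exact hμ.2

theorem pBr_add (h : IsCentral ι) (z : G.alg.Polys m) (x : A.alg.Polys m) :
    G.pBr m (z + pMap ι m x) = G.pBr m z :=
  LinearMap.ext fun y => by rw [map_add, LinearMap.add_apply, h.pBr_left, add_zero]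

theorem twBr_add (h : IsCentral ι) (γ : G.alg.carrier) (c : A.alg.carrier) (w : G.alg.Polys m) (x : A.alg.Polys m) :
    twBr (G.pBr m) (G.pDiff m) (G.pConst m (γ + lin ι c)) (w + pMap ι m x) =
      twBr (G.pBr m) (G.pDiff m) (G.pConst m γ) w := by
  refine LinearMap.ext fun y => ?_
  rw [twBr_apply, twBr_apply, h.pBr_add, dOp_apply, dOp_apply, pConst, TensorProduct.tmul_add,
    ← pConst, ← pConst, ← pMap_pConst, h.pBr_add]

variable [CharZero k]

theorem isLog_add (h : IsCentral ι) {j : Fin m} {a z : G.alg.Polys m} (hz : G.IsLog j a z) {a' : A.alg.Polys m}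
    (ha' : a' ∈ A.pDeg m 0) : G.IsLog j (a + pMap ι m a') (z + pMap ι m (A.pInt j a')) := by
  have hp := (A.dgPrim j).prim
  refine ⟨add_mem hz.1 (pMap_mem ι ((A.dgPrim j).int_mem ha')), ?_, ?_⟩
  · rw [h.pBr_add, map_add (partialDeriv j), partialDeriv_pMap, map_add, hz.2.1]
    congr 1
    rw [phiOp_of_apply_eq_zero ((G.isDG_polys m).nilp z) (h.pBr_right _ _)]
    exact congrArg (pMap ι m) (hp.der_int a')
  · rw [map_add (G.pSet j 0), hz.2.2, zero_add, pSet_pMap]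
    exact (congrArg (pMap ι m) (hp.ev_int a')).trans (map_zero _)

theorem isLogTw_add (h : IsCentral ι) {γ : G.alg.carrier} (c : A.alg.carrier) {j : Fin m} {a w : G.alg.Polys m}
    (hw : G.IsLogTw γ j a w) {a' : A.alg.Polys m} (ha' : a' ∈ A.pDeg m (-1)) :
    G.IsLogTw (γ + lin ι c) j (a + pMap ι m a') (w + pMap ι m (A.pInt j a')) := by
  have hp := (A.dgPrim j).prim
  refine ⟨add_mem hw.1 (pMap_mem ι ((A.dgPrim j).int_mem ha')), ?_, ?_⟩
  · rw [h.twBr_add, map_add (partialDeriv j), partialDeriv_pMap, map_add, hw.2.1]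
    congr 1
    rw [phiOp_of_apply_eq_zero (((G.isDG_polys m).filt_tw _).nilp w)]
    · exact congrArg (pMap ι m) (hp.der_int a')
    · rw [twBr_apply, dOp_apply, h.pBr_right, add_zero, ← (dgMor_pMap ι m).map_diff, h.pBr_right]
  · rw [map_add (G.pSet j 0), hw.2.2, zero_add, pSet_pMap]
    exact (congrArg (pMap ι m) (hp.ev_int a')).trans (map_zero _)

theorem isPathHolonomy_add (h : IsCentral ι) {μ : G.alg.Forms 1} {X : G.alg.carrier} (hX : IsPathHolonomy μ X)
    {α : A.alg.Forms 1} (hα : α ∈ A.alg.formsDegOne 1) :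
    IsPathHolonomy (μ + formsMap ι 1 α) (X + lin ι (formsIntegral 1 α)) := by
  obtain ⟨z, hz, rfl⟩ := isPathHolonomy_iff.1 hX
  refine isPathHolonomy_iff.2 ⟨z + pMap ι 1 (A.pInt 0 (-(formsCoeff₁ 0 α))), ?_, ?_⟩
  · rw [map_add (formsCoeff₁ 0), formsCoeff₁_formsMap, neg_add, ← map_neg (pMap ι 1)]
    exact h.isLog_add hz (neg_mem (formsCoeff₁_mem hα 0))
  · rw [map_add, pEval_pMap, formsIntegral_one, map_neg (A.pInt 0), map_neg, map_neg, neg_add, neg_neg]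

theorem isSurfaceHolonomy_add (h : IsCentral ι) {μ : G.alg.Forms 2} {t : G.alg.carrier} (ht : IsSurfaceHolonomy μ t)
    {α : A.alg.Forms 2} (hα : α ∈ A.alg.formsDegOne 2) :
    IsSurfaceHolonomy (μ + formsMap ι 2 α) (t + lin ι (formsIntegral 2 α)) := by
  obtain ⟨z, Y, w, hz, hY1, hY0, hw, rfl⟩ := isSurfaceHolonomy_iff.1 ht
  have hα' := pull_mem_degOne (squareParam k) hα
  have hβ := formsCoeff₂_mem hα' 0 1
  have hp := (A.dgPrim (m := 2) 0).prim
  refine isSurfaceHolonomy_iff.2 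
    ⟨z + pMap ι 2 (A.pInt 0 (-(formsCoeff₁ 0 (A.alg.pullForms (squareParam k) α)))),
      Y + pMap ι 2 (A.pInt 0 (formsCoeff₂ 0 1 (A.alg.pullForms (squareParam k) α))),
      w + pMap ι 2 (A.pInt 1 (A.pInt 0 (formsCoeff₂ 0 1 (A.alg.pullForms (squareParam k) α)))),
      ?_, ?_, ?_, ?_, ?_⟩
  · rw [map_add (G.alg.pullForms (squareParam k)), pullForms_formsMap, map_add (formsCoeff₁ 0),
      formsCoeff₁_formsMap, neg_add, ← map_neg (pMap ι 2)]
    exact h.isLog_add hz (neg_mem (formsCoeff₁_mem hα' 0))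
  · rw [map_add (G.alg.pullForms (squareParam k)), pullForms_formsMap, map_add (formsCoeff₂ 0 1),
      formsCoeff₂_formsMap, map_add (partialDeriv 0), hY1, partialDeriv_pMap, neg_add,
      ← map_neg (pMap ι 2), h.pBr_add, map_add]
    congr 1
    rw [expOp_of_apply_eq_zero ((G.isDG_polys 2).nilp _) (h.pBr_right _ _)]
    exact congrArg (pMap ι 2) (hp.der_int _)
  · rw [map_add (G.pSet 0 0), hY0, zero_add, pSet_pMap]
    exact (congrArg (pMap ι 2) (hp.ev_int _)).trans (map_zero _)
  · rw [vertex_add, vertex_formsMap]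
    exact h.isLogTw_add _ hw ((A.dgPrim 0).int_mem hβ)
  · rw [map_add, pEval_pMap, formsIntegral_two]

end IsCentral

end NilpDGLA

/-! ## Central extensions: the nerve -/

section

variable {k : Type u} [Field k] [CharZero k] {V : Type u} [AddCommGroup V] [Module k V]
  {br : V →ₗ[k] V →ₗ[k] V} {S : Submodule k V} {F : ℕ → Submodule k V} {N : ℕ}

/-- The Baker–Campbell–Hausdorff product is compatible with addition of central elements. -/
theorem LieOn.bch_add_central (h : LieOn br S F N) {x y a b : V} (hx : x ∈ S) (hy : y ∈ S)
    (ha : a ∈ S) (hb : b ∈ S) (hca : ∀ v, br a v = 0) (hcb : ∀ v, br b v = 0) :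
    bch br (x + a) (y + b) = bch br x y + (a + b) := by
  have hr : ∀ {u c : V}, u ∈ S → c ∈ S → (∀ v, br c v = 0) → bch br u c = u + c := fun hu hc hcc =>
    bch_of_comm (h.alt _ hu) (by rw [h.skew hu hc, hcc, neg_zero]) (hcc _) (hcc _)
  have hl : ∀ {u c : V}, u ∈ S → c ∈ S → (∀ v, br c v = 0) → bch br c u = c + u := fun hu hc hcc =>
    bch_of_comm (hcc _) (hcc _) (by rw [h.skew hu hc, hcc, neg_zero]) (h.alt _ hu)
  have hcab : ∀ v, br (a + b) v = 0 := fun v => by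
    rw [map_add, LinearMap.add_apply, hca, hcb, add_zero]
  have hyb : y + b ∈ S := add_mem hy hb
  rw [← hr hx ha hca, h.bch_assoc hx ha hyb, hl hyb ha hca, show a + (y + b) = y + (a + b) by abel,
    ← hr hy (add_mem ha hb) hcab, ← h.bch_assoc hx hy (add_mem ha hb),
    hr (h.bch_mem hx hy) (add_mem ha hb) hcab]

end

namespace NilpDGLA

open DGLA

variable {k : Type u} [Field k] {A G : NilpDGLA k} {n : ℕ}

namespace IsCentral

variable {ι : A ⟶ G}

theorem bracket_add (h : IsCentral ι) (x : G.alg.carrier) (a : A.alg.carrier) :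
    G.alg.bracket (x + lin ι a) = G.alg.bracket x :=
  LinearMap.ext fun y => by rw [map_add, LinearMap.add_apply, h, add_zero]

theorem dOp_add (h : IsCentral ι) (γ t : G.alg.carrier) (c b : A.alg.carrier) :
    G.alg.diff (t + lin ι b) + G.alg.bracket (γ + lin ι c) (t + lin ι b) =
      (G.alg.diff t + G.alg.bracket γ t) + lin ι (A.alg.diff b) := by
  rw [h.bracket_add, map_add, map_add, h.right, (dgMor_lin ι).map_diff]
  abel

theorem twistedBracket_add (h : IsCentral ι) (γ : G.alg.carrier) (c : A.alg.carrier) :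
    G.alg.twistedBracket (γ + lin ι c) = G.alg.twistedBracket γ := by
  rw [twistedBracket, h.bracket_add, twistedBracket]

theorem isMC_add_iff (h : IsCentral ι) {γ : G.alg.carrier} (hγ : G.alg.IsMC γ) {c : A.alg.carrier}
    (hc : c ∈ A.alg.deg 1) : G.alg.IsMC (γ + lin ι c) ↔ lin ι (A.alg.diff c) = 0 := by
  have e : G.alg.diff (γ + lin ι c) + (2 : k)⁻¹ • G.alg.bracket (γ + lin ι c) (γ + lin ι c) =
      (G.alg.diff γ + (2 : k)⁻¹ • G.alg.bracket γ γ) + lin ι (A.alg.diff c) := by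
    rw [h.bracket_add, map_add, map_add, h.right, (dgMor_lin ι).map_diff, add_zero]
    abel
  rw [hγ.2, zero_add] at e
  exact ⟨fun h' => e.symm.trans h'.2, fun h' => ⟨add_mem hγ.1 (lin_mem ι hc), e.trans h'⟩⟩

variable [CharZero k]

theorem gauge_add (h : IsCentral ι) (X γ : G.alg.carrier) (a c : A.alg.carrier) :
    G.alg.gauge (X + lin ι a) (γ + lin ι c) = G.alg.gauge X γ + lin ι (c - A.alg.diff a) := by
  have hT := G.isDG.nilp (X + lin ι a)
  rw [DGLA.gauge, DGLA.gauge, h.dOp_add, phiAd_eq hT, phiAd_eq (G.isDG.nilp X), h.bracket_add, map_add,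
    phiOp_of_apply_eq_zero (G.isDG.nilp X) (h.right _ _), map_sub]
  abel

theorem expAd_add (h : IsCentral ι) (X t : G.alg.carrier) (a b : A.alg.carrier) :
    expAd G.alg.bracket (X + lin ι a) (t + lin ι b) = expAd G.alg.bracket X t + lin ι b := by
  rw [expAd_eq (G.isDG.nilp _), expAd_eq (G.isDG.nilp X), h.bracket_add, map_add,
    expOp_of_apply_eq_zero (G.isDG.nilp X) (h.right _ _)]

theorem bch_add (h : IsCentral ι) {X Y : G.alg.carrier} (hX : X ∈ G.alg.deg 0) (hY : Y ∈ G.alg.deg 0)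
    {a b : A.alg.carrier} (ha : a ∈ A.alg.deg 0) (hb : b ∈ A.alg.deg 0) :
    bch G.alg.bracket (X + lin ι a) (Y + lin ι b) = bch G.alg.bracket X Y + lin ι (a + b) := by
  rw [G.isDG.lieOn.bch_add_central hX hY (lin_mem ι ha) (lin_mem ι hb) (h a) (h b), map_add]

theorem bch_twisted_add (h : IsCentral ι) {γ : G.alg.carrier} (hγ : G.alg.IsMC γ) (c : A.alg.carrier)
    {X Y : G.alg.carrier} (hX : X ∈ G.alg.deg (-1)) (hY : Y ∈ G.alg.deg (-1))
    {a b : A.alg.carrier} (ha : a ∈ A.alg.deg (-1)) (hb : b ∈ A.alg.deg (-1)) :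
    bch (G.alg.twistedBracket (γ + lin ι c)) (X + lin ι a) (Y + lin ι b) =
      bch (G.alg.twistedBracket γ) X Y + lin ι (a + b) := by
  rw [h.twistedBracket_add, map_add]
  exact (G.isDG.lieOn_tw hγ).bch_add_central hX hY (lin_mem ι ha) (lin_mem ι hb) (fun v => h a _)
    fun v => h b _

end IsCentral

/-- The simplices of `K(𝔞[1])` in terms of the values on vertices, edges and triangles. -/
@[ext]
structure EmData (A : NilpDGLA k) (n : ℕ) where
  /-- The values on vertices. -/
  obj : Fin (n + 1) → A.alg.carrier
  /-- The values on edges. -/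
  one : Fin (n + 1) → Fin (n + 1) → A.alg.carrier
  /-- The values on triangles. -/
  two : Fin (n + 1) → Fin (n + 1) → Fin (n + 1) → A.alg.carrier
  obj_mem : ∀ i, obj i ∈ A.alg.deg 1
  one_mem : ∀ i j, one i j ∈ A.alg.deg 0
  two_mem : ∀ i j l, two i j l ∈ A.alg.deg (-1)
  one_eq_zero : ∀ i j, ¬ i < j → one i j = 0
  two_eq_zero : ∀ i j l, ¬ (i < j ∧ j < l) → two i j l = 0
  diff_obj : ∀ i, A.alg.diff (obj i) = 0
  diff_one : ∀ i j, i ≤ j → obj j - A.alg.diff (one i j) = obj i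
  diff_two : ∀ i j l, i ≤ j → j ≤ l → A.alg.diff (two i j l) + (one i j + one j l) = one i l
  cocycle : ∀ i j l m, i ≤ j → j ≤ l → l ≤ m → two i j m + two j l m = two i l m + two i j l

/-- The cochain with given values on vertices, edges and triangles. -/
def EmData.cochain (e : EmData A n) : ∀ p : ℕ, (SimplexCategory.mk p ⟶ SimplexCategory.mk n) → A.alg.carrier
  | 0, σ => e.obj (σ.toOrderHom 0)
  | 1, σ => e.one (σ.toOrderHom 0) (σ.toOrderHom 1)
  | 2, σ => e.two (σ.toOrderHom 0) (σ.toOrderHom 1) (σ.toOrderHom 2)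
  | _ + 3, _ => 0

theorem EmData.cochain_mem (e : EmData A n) : e.cochain ∈ A.alg.emCocycles (.mk n) := by
  refine ⟨fun p σ => ?_, fun p σ hσ => ?_, fun σ => e.diff_obj _, fun p σ => ?_⟩
  · match p with
    | 0 => exact e.obj_mem _
    | 1 => exact e.one_mem _ _
    | 2 => exact e.two_mem _ _ _
    | p + 3 => exact zero_mem _
  · match p with
    | 0 => exact absurd (fun x y _ => Subsingleton.elim (α := Fin 1) x y) hσ
    | 1 =>
      refine e.one_eq_zero _ _ fun h => hσ ?_
      exact (Fin.strictMono_iff_lt_succ (f := σ.toOrderHom)).2 (fun x => by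
        fin_cases x; exact h) |>.injective
    | 2 =>
      refine e.two_eq_zero _ _ _ fun h => hσ ?_
      exact (Fin.strictMono_iff_lt_succ (f := σ.toOrderHom)).2 (fun x => by
        fin_cases x
        exacts [h.1, h.2]) |>.injective
    | p + 3 => rfl
  · match p with
    | 0 =>
      have h := e.diff_one _ _ (σ.toOrderHom.monotone (show (0 : Fin 2) ≤ 1 by decide))
      refine (congrArg₂ _ (Fin.sum_univ_two _) rfl).trans ?_
      have h1 : e.cochain 0 (SimplexCategory.δ 0 ≫ σ) = e.obj (σ.toOrderHom 1) := rfl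
      have h2 : e.cochain 0 (SimplexCategory.δ 1 ≫ σ) = e.obj (σ.toOrderHom 0) := rfl
      have h3 : e.cochain 1 σ = e.one (σ.toOrderHom 0) (σ.toOrderHom 1) := rfl
      rw [h1, h2, h3, ← h]
      simp
    | 1 =>
      have h := e.diff_two _ _ _ (σ.toOrderHom.monotone (show (0 : Fin 3) ≤ 1 by decide))
        (σ.toOrderHom.monotone (show (1 : Fin 3) ≤ 2 by decide))
      refine (congrArg₂ _ (Fin.sum_univ_three _) rfl).trans ?_
      have h1 : e.cochain 1 (SimplexCategory.δ 0 ≫ σ) = e.one (σ.toOrderHom 1) (σ.toOrderHom 2) := rfl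
      have h2 : e.cochain 1 (SimplexCategory.δ 1 ≫ σ) = e.one (σ.toOrderHom 0) (σ.toOrderHom 2) := rfl
      have h3 : e.cochain 1 (SimplexCategory.δ 2 ≫ σ) = e.one (σ.toOrderHom 0) (σ.toOrderHom 1) := rfl
      have h4 : e.cochain 2 σ = e.two (σ.toOrderHom 0) (σ.toOrderHom 1) (σ.toOrderHom 2) := rfl
      rw [h1, h2, h3, h4, ← h]
      simp
      abel
    | 2 =>
      have h := e.cocycle _ _ _ _ (σ.toOrderHom.monotone (show (0 : Fin 4) ≤ 1 by decide))
        (σ.toOrderHom.monotone (show (1 : Fin 4) ≤ 2 by decide))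
        (σ.toOrderHom.monotone (show (2 : Fin 4) ≤ 3 by decide))
      refine (congrArg₂ _ (Fin.sum_univ_four _) rfl).trans ?_
      have h1 : e.cochain 2 (SimplexCategory.δ 0 ≫ σ) =
        e.two (σ.toOrderHom 1) (σ.toOrderHom 2) (σ.toOrderHom 3) := rfl
      have h2 : e.cochain 2 (SimplexCategory.δ 1 ≫ σ) =
        e.two (σ.toOrderHom 0) (σ.toOrderHom 2) (σ.toOrderHom 3) := rfl
      have h3 : e.cochain 2 (SimplexCategory.δ 2 ≫ σ) =
        e.two (σ.toOrderHom 0) (σ.toOrderHom 1) (σ.toOrderHom 3) := rfl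
      have h4 : e.cochain 2 (SimplexCategory.δ 3 ≫ σ) =
        e.two (σ.toOrderHom 0) (σ.toOrderHom 1) (σ.toOrderHom 2) := rfl
      have h5 : e.cochain 3 σ = 0 := rfl
      rw [h1, h2, h3, h4, h5, map_zero A.alg.diff, smul_zero, add_zero]
      refine Eq.trans ?_ (sub_eq_zero.2 h)
      simp [pow_succ]
      abel
    | p + 3 =>
      have h1 : ∀ τ, e.cochain (p + 3) τ = 0 := fun _ => rfl
      have h2 : e.cochain (p + 3 + 1) σ = 0 := rfl
      simp [h1, h2]

section Values

variable {c : ∀ p : ℕ, (SimplexCategory.mk p ⟶ SimplexCategory.mk n) → A.alg.carrier}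

theorem hom_mk_zero (σ : SimplexCategory.mk 0 ⟶ SimplexCategory.mk n) :
    σ = vert (a := .mk n) (σ.toOrderHom 0) := by
  refine SimplexCategory.Hom.ext _ _ (OrderHom.ext _ _ (funext fun x => ?_))
  obtain rfl : x = 0 := Subsingleton.elim (α := Fin 1) _ _
  rfl

theorem hom_mk_one (σ : SimplexCategory.mk 1 ⟶ SimplexCategory.mk n) :
    σ = edge (a := .mk n) (σ.toOrderHom 0) (σ.toOrderHom 1)
      (σ.toOrderHom.monotone (show (0 : Fin 2) ≤ 1 by decide)) := by
  refine SimplexCategory.Hom.ext _ _ (OrderHom.ext _ _ (funext fun x => ?_))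
  match x with
  | 0 => rfl
  | 1 => rfl

theorem hom_mk_two (σ : SimplexCategory.mk 2 ⟶ SimplexCategory.mk n) :
    σ = face (a := .mk n) (σ.toOrderHom 0) (σ.toOrderHom 1) (σ.toOrderHom 2)
      (σ.toOrderHom.monotone (show (0 : Fin 3) ≤ 1 by decide))
      (σ.toOrderHom.monotone (show (1 : Fin 3) ≤ 2 by decide)) := by
  refine SimplexCategory.Hom.ext _ _ (OrderHom.ext _ _ (funext fun x => ?_))
  match x with
  | 0 => rfl
  | 1 => rfl
  | 2 => rfl

/-- A cocycle is determined by its values on vertices, edges and triangles. -/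
theorem em_ext (hc : c ∈ A.alg.emCocycles (.mk n))
    {c' : ∀ p : ℕ, (SimplexCategory.mk p ⟶ SimplexCategory.mk n) → A.alg.carrier}
    (hc' : c' ∈ A.alg.emCocycles (.mk n)) (h0 : ∀ i, c 0 (vert (a := .mk n) i) = c' 0 (vert (a := .mk n) i))
    (h1 : ∀ i j h, c 1 (edge (a := .mk n) i j h) = c' 1 (edge (a := .mk n) i j h))
    (h2 : ∀ i j l h h', c 2 (face (a := .mk n) i j l h h') = c' 2 (face (a := .mk n) i j l h h')) :
    c = c' := by
  funext p σ
  match p with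
  | 0 => rw [hom_mk_zero σ]; exact h0 _
  | 1 => rw [hom_mk_one σ]; exact h1 _ _ _
  | 2 => rw [hom_mk_two σ]; exact h2 _ _ _ _ _
  | p + 3 =>
    have hb := A.bounded (1 - ((p + 3 : ℕ) : ℤ)) (by push_cast; omega)
    have e := hc.1 (p + 3) σ
    have e' := hc'.1 (p + 3) σ
    rw [hb, Submodule.mem_bot] at e e'
    rw [e, e']

theorem em_edge_self (hc : c ∈ A.alg.emCocycles (.mk n)) (i : Fin (n + 1)) (h : i ≤ i) :
    c 1 (edge (a := .mk n) i i h) = 0 :=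
  hc.2.1 1 _ fun hi => absurd (@hi (0 : Fin 2) (1 : Fin 2) rfl) (by decide)

theorem em_face_left (hc : c ∈ A.alg.emCocycles (.mk n)) (i j : Fin (n + 1)) (h : i ≤ i) (h' : i ≤ j) :
    c 2 (face (a := .mk n) i i j h h') = 0 :=
  hc.2.1 2 _ fun hi => absurd (@hi (0 : Fin 3) (1 : Fin 3) rfl) (by decide)

theorem em_face_right (hc : c ∈ A.alg.emCocycles (.mk n)) (i j : Fin (n + 1)) (h : i ≤ j) (h' : j ≤ j) :
    c 2 (face (a := .mk n) i j j h h') = 0 :=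
  hc.2.1 2 _ fun hi => absurd (@hi (1 : Fin 3) (2 : Fin 3) rfl) (by decide)

variable (c) in
/-- The value on the edge from `i` to `j`. -/
def emOne (i j : Fin (n + 1)) : A.alg.carrier :=
  if h : i < j then c 1 (edge (a := .mk n) i j h.le) else 0

variable (c) in
/-- The value on the triangle `i`, `j`, `l`. -/
def emTwo (i j l : Fin (n + 1)) : A.alg.carrier :=
  if h : i < j ∧ j < l then c 2 (face (a := .mk n) i j l h.1.le h.2.le) else 0

theorem emOne_eq (hc : c ∈ A.alg.emCocycles (.mk n)) {i j : Fin (n + 1)} (h : i ≤ j) :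
    emOne c i j = c 1 (edge (a := .mk n) i j h) := by
  rcases h.lt_or_eq with h' | rfl
  · rw [emOne, dif_pos h']
  · rw [emOne, dif_neg (lt_irrefl _), em_edge_self hc]

theorem emTwo_eq (hc : c ∈ A.alg.emCocycles (.mk n)) {i j l : Fin (n + 1)} (h : i ≤ j) (h' : j ≤ l) :
    emTwo c i j l = c 2 (face (a := .mk n) i j l h h') := by
  by_cases hs : i < j ∧ j < l
  · rw [emTwo, dif_pos hs]
  · rw [emTwo, dif_neg hs]
    rcases h.lt_or_eq with h1 | rfl
    · obtain rfl : j = l := h'.lt_or_eq.resolve_left fun h2 => hs ⟨h1, h2⟩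
      rw [em_face_right hc]
    · rw [em_face_left hc]

/-- The values of a cocycle on vertices, edges and triangles. -/
def emData (hc : c ∈ A.alg.emCocycles (.mk n)) : EmData A n where
  obj i := c 0 (vert (a := .mk n) i)
  one := emOne c
  two := emTwo c
  obj_mem i := hc.1 0 _
  one_mem i j := by
    by_cases h : i < j
    · rw [emOne_eq hc h.le]; exact hc.1 1 _
    · rw [emOne, dif_neg h]; exact zero_mem _
  two_mem i j l := by
    by_cases h : i < j ∧ j < l
    · rw [emTwo_eq hc h.1.le h.2.le]; exact hc.1 2 _
    · rw [emTwo, dif_neg h]; exact zero_mem _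
  one_eq_zero i j h := dif_neg h
  two_eq_zero i j l h := dif_neg h
  diff_obj i := hc.2.2.1 _
  diff_one i j h := by
    have h1 := (congrArg (· + _) (Fin.sum_univ_two _)).symm.trans
      (hc.2.2.2 0 (edge (a := .mk n) i j h))
    rw [hom_mk_zero (SimplexCategory.δ 0 ≫ edge (a := .mk n) i j h),
      hom_mk_zero (SimplexCategory.δ 1 ≫ edge (a := .mk n) i j h)] at h1
    have h2 : (-1 : k) ^ 0 • c 0 (vert (a := .mk n) j) + (-1 : k) ^ 1 • c 0 (vert (a := .mk n) i) +
      (-1 : k) ^ (0 + 1) • A.alg.diff (c 1 (edge (a := .mk n) i j h)) = 0 := h1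
    rw [emOne_eq hc h, ← sub_eq_zero, ← h2]
    simp
    abel
  diff_two i j l h h' := by
    have h1 := (congrArg (· + _) (Fin.sum_univ_three _)).symm.trans
      (hc.2.2.2 1 (face (a := .mk n) i j l h h'))
    rw [hom_mk_one (SimplexCategory.δ 0 ≫ face (a := .mk n) i j l h h'),
      hom_mk_one (SimplexCategory.δ 1 ≫ face (a := .mk n) i j l h h'),
      hom_mk_one (SimplexCategory.δ 2 ≫ face (a := .mk n) i j l h h')] at h1
    have h2 : (-1 : k) ^ 0 • c 1 (edge (a := .mk n) j l h') +
      (-1 : k) ^ 1 • c 1 (edge (a := .mk n) i l (h.trans h')) +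
      (-1 : k) ^ 2 • c 1 (edge (a := .mk n) i j h) +
      (-1 : k) ^ (1 + 1) • A.alg.diff (c 2 (face (a := .mk n) i j l h h')) = 0 := h1
    rw [emOne_eq hc h, emOne_eq hc h', emOne_eq hc (h.trans h'), emTwo_eq hc h h', ← sub_eq_zero,
      ← h2]
    simp
    abel
  cocycle i j l m h h' h'' := by
    let σ : SimplexCategory.mk 3 ⟶ SimplexCategory.mk n := SimplexCategory.mkHom ⟨![i, j, l, m],
      Fin.monotone_iff_le_succ.2 fun x => by
        fin_cases x
        exacts [h, h', h'']⟩
    have h1 := (congrArg (· + _) (Fin.sum_univ_four _)).symm.trans (hc.2.2.2 2 σ)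
    rw [hom_mk_two (SimplexCategory.δ 0 ≫ σ), hom_mk_two (SimplexCategory.δ 1 ≫ σ),
      hom_mk_two (SimplexCategory.δ 2 ≫ σ), hom_mk_two (SimplexCategory.δ 3 ≫ σ)] at h1
    have h2 : (-1 : k) ^ 0 • c 2 (face (a := .mk n) j l m h' h'') +
      (-1 : k) ^ 1 • c 2 (face (a := .mk n) i l m (h.trans h') h'') +
      (-1 : k) ^ 2 • c 2 (face (a := .mk n) i j m h (h'.trans h'')) +
      (-1 : k) ^ 3 • c 2 (face (a := .mk n) i j l h h') +
      (-1 : k) ^ (2 + 1) • A.alg.diff (c 3 σ) = 0 := h1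
    have h3 := hc.1 3 σ
    rw [A.bounded _ (by norm_num), Submodule.mem_bot] at h3
    rw [h3, map_zero A.alg.diff, smul_zero, add_zero] at h2
    rw [emTwo_eq hc h (h'.trans h''), emTwo_eq hc h' h'', emTwo_eq hc (h.trans h') h'',
      emTwo_eq hc h h', ← sub_eq_zero, ← h2]
    simp [pow_succ]
    abel

end Values

end NilpDGLA

/-! ## Central extensions: the action on the nerve -/

namespace NilpDGLA

open DGLA

variable {k : Type u} [Field k] {A G : NilpDGLA k} {m n : ℕ} {ι : A ⟶ G}

/-- An injective morphism has a left inverse which preserves degrees. -/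
theorem exists_retraction (hι : Function.Injective (lin ι)) :
    ∃ r : G.alg.carrier →ₗ[k] A.alg.carrier,
      (∀ i, ∀ x ∈ G.alg.deg i, r x ∈ A.alg.deg i) ∧ ∀ a, r (lin ι a) = a := by
  have hr : ∀ i, ∃ r : G.alg.deg i →ₗ[k] A.alg.deg i,
      r ∘ₗ (lin ι).restrict (p := A.alg.deg i) (q := G.alg.deg i) (fun a ha => lin_mem ι ha) = LinearMap.id :=
    fun i => LinearMap.exists_leftInverse_of_injective _ (LinearMap.ker_eq_bot.2 fun a b hab =>
      Subtype.ext (hι (congrArg Subtype.val hab)))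
  choose r hr using hr
  let R : G.alg.carrier →ₗ[k] A.alg.carrier :=
    DirectSum.toModule k ℤ A.alg.carrier (fun i => (A.alg.deg i).subtype ∘ₗ r i) ∘ₗ
      (LinearEquiv.ofBijective (DirectSum.coeLinearMap G.alg.deg) G.alg.isInternal).symm.toLinearMap
  have hR : ∀ i x (hx : x ∈ G.alg.deg i), R x = r i ⟨x, hx⟩ := fun i x hx => by
    have h : (LinearEquiv.ofBijective (DirectSum.coeLinearMap G.alg.deg) G.alg.isInternal).symm x
        = DirectSum.lof k ℤ (fun i => G.alg.deg i) i ⟨x, hx⟩ := by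
      rw [LinearEquiv.symm_apply_eq]
      exact (DirectSum.coeLinearMap_lof G.alg.deg i ⟨x, hx⟩).symm
    simp only [R, LinearMap.comp_apply, LinearEquiv.coe_coe, h, DirectSum.toModule_lof]
    rfl
  refine ⟨R, fun i x hx => ?_, fun a => ?_⟩
  · rw [hR i x hx]
    exact (r i ⟨x, hx⟩).2
  · refine hom_induction (P := fun a => R (lin ι a) = a) a (by simp)
      (fun a b ha hb => by rw [map_add, map_add, ha, hb]) fun i a ha => ?_
    rw [hR i _ (lin_mem ι ha)]
    exact congrArg Subtype.val (LinearMap.congr_fun (hr i) ⟨a, ha⟩)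

theorem mem_deg_of_lin_mem (hι : Function.Injective (lin ι)) {i : ℤ} {a : A.alg.carrier}
    (ha : lin ι a ∈ G.alg.deg i) : a ∈ A.alg.deg i := by
  obtain ⟨r, hr, hr'⟩ := exists_retraction hι
  exact hr' a ▸ hr i _ ha

theorem formsMap_injective (hι : Function.Injective (lin ι)) : Function.Injective (formsMap ι m) := by
  obtain ⟨r, -, hr'⟩ := exists_retraction hι
  refine Function.LeftInverse.injective (g := TensorProduct.map LinearMap.id r) fun α => ?_
  induction α using TensorProduct.induction_on with
  | zero => simp
  | add x y hx hy => rw [map_add, map_add, hx, hy]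
  | tmul ω x => exact congrArg (ω ⊗ₜ[k] ·) (hr' x)

theorem mem_formsDegOne_of_formsMap (hι : Function.Injective (lin ι)) {α : A.alg.Forms m}
    (hα : formsMap ι m α ∈ G.alg.formsDegOne m) : α ∈ A.alg.formsDegOne m := by
  obtain ⟨r, hr, hr'⟩ := exists_retraction hι
  have e : TensorProduct.map LinearMap.id r (formsMap ι m α) = α := by
    clear hα
    induction α using TensorProduct.induction_on with
    | zero => simp
    | add x y hx hy => rw [map_add, map_add, hx, hy]
    | tmul ω x => exact congrArg (ω ⊗ₜ[k] ·) (hr' x)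
  rw [← e]
  refine Submodule.iSup_induction _
    (motive := fun μ => TensorProduct.map LinearMap.id r μ ∈ A.alg.formsDegOne m) hα
    ?_ (by simp) (fun x y hx hy => by rw [map_add]; exact add_mem hx hy)
  rintro q _ ⟨t, rfl⟩
  refine Submodule.mem_iSup_of_mem q ?_
  induction t using TensorProduct.induction_on with
  | zero => simp
  | tmul ω x => exact ⟨ω ⊗ₜ (⟨_, hr _ _ x.2⟩ : A.alg.deg (1 - q)), by simp⟩
  | add x y hx hy => rw [map_add, map_add]; exact add_mem hx hy

namespace IsCentral

/-- Elements of `Ω ⊗ 𝔞` whose sum with a Maurer–Cartan element satisfies the Maurer–Cartan equation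
are cocycles. -/
theorem mem_formsCocycles (h : IsCentral ι) (hι : Function.Injective (lin ι)) {μ : G.alg.Forms m}
    (hμ : G.alg.IsFormsMC μ) {α : A.alg.Forms m} (hα : G.alg.IsFormsMC (μ + formsMap ι m α)) :
    α ∈ A.alg.formsCocycles m := by
  refine ⟨mem_formsDegOne_of_formsMap hι ?_, formsMap_injective hι ?_⟩
  · have e : formsMap ι m α = (μ + formsMap ι m α) + (-1 : k) • μ := by module
    rw [e]
    exact add_mem hα.1 (Submodule.smul_mem _ (-1 : k) hμ.1)
  have h1 := hα.2
  rw [h.formsBracket_add, map_add, add_right_comm, hμ.2, zero_add] at h1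
  rw [map_zero]
  exact (DGLA.Hom.formsDiff ι m α).trans h1

variable [CharZero k]

theorem bch_dOp_add (h : IsCentral ι) {γ t X Y : G.alg.carrier} (hγ : G.alg.IsMC γ) (ht : t ∈ G.alg.deg (-1))
    (hX : X ∈ G.alg.deg 0) (hY : Y ∈ G.alg.deg 0) (c : A.alg.carrier) {b x y : A.alg.carrier}
    (hb : b ∈ A.alg.deg (-1)) (hx : x ∈ A.alg.deg 0) (hy : y ∈ A.alg.deg 0) :
    bch G.alg.bracket (G.alg.diff (t + lin ι b) + G.alg.bracket (γ + lin ι c) (t + lin ι b))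
      (bch G.alg.bracket (X + lin ι x) (Y + lin ι y)) =
      bch G.alg.bracket (G.alg.diff t + G.alg.bracket γ t) (bch G.alg.bracket X Y) +
        lin ι (A.alg.diff b + (x + y)) := by
  have h1 : G.alg.diff t + G.alg.bracket γ t ∈ G.alg.deg 0 := G.isDG.dOp_mem0 hγ.1 ht
  have h2 : A.alg.diff b ∈ A.alg.deg 0 := by simpa using A.alg.diff_mem hb
  rw [h.dOp_add, h.bch_add hX hY hx hy, h.bch_add h1 (G.isDG.lieOn.bch_mem hX hY) h2 (add_mem hx hy)]

/-- Addition of the values of a cocycle to the data of a simplex of the nerve. -/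
def shift (h : IsCentral ι) (ν : G.alg.NerveSimplex n) (e : EmData A n) : G.alg.NerveSimplex n where
  obj i := ν.obj i + lin ι (e.obj i)
  one i j := ν.one i j + lin ι (e.one i j)
  two i j l := ν.two i j l + lin ι (e.two i j l)
  obj_mc i := (h.isMC_add_iff (ν.obj_mc i) (e.obj_mem i)).2 (by rw [e.diff_obj, map_zero])
  one_eq_zero i j hij := by rw [ν.one_eq_zero i j hij, e.one_eq_zero i j hij, map_zero, add_zero]
  two_eq_zero i j l hs := by rw [ν.two_eq_zero i j l hs, e.two_eq_zero i j l hs, map_zero, add_zero]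
  one_mor i j hij := ⟨add_mem (ν.one_mor i j hij).1 (lin_mem ι (e.one_mem i j)), by
    rw [h.gauge_add, (ν.one_mor i j hij).2, e.diff_one i j hij]⟩
  two_mor i j l hij hjl := ⟨add_mem (ν.two_mor i j l hij hjl).1 (lin_mem ι (e.two_mem i j l)), by
    have ho := (ν.one_mor i j hij).1
    have ho' := (ν.one_mor j l hjl).1
    have ht := (ν.two_mor i j l hij hjl).1
    rw [h.bch_dOp_add (ν.obj_mc i) ht ho ho' _ (e.two_mem i j l) (e.one_mem i j) (e.one_mem j l),
      (ν.two_mor i j l hij hjl).2, e.diff_two i j l hij hjl]⟩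
  cocycle i j l m hij hjl hlm := by
    have h1 := (ν.two_mor i j m hij (hjl.trans hlm)).1
    have h2 := (ν.two_mor j l m hjl hlm).1
    have h3 := (ν.two_mor i l m (hij.trans hjl) hlm).1
    have h4 := (ν.two_mor i j l hij hjl).1
    have h5 : expAd G.alg.bracket (ν.one i j) (ν.two j l m) ∈ G.alg.deg (-1) := by
      rw [expAd_eq (G.isDG.nilp _)]
      exact G.isDG.expOp_mem (ν.one_mor i j hij).1 h2
    rw [h.expAd_add, h.bch_twisted_add (ν.obj_mc i) _ h1 h5 (e.two_mem _ _ _) (e.two_mem _ _ _),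
      h.bch_twisted_add (ν.obj_mc i) _ h3 h4 (e.two_mem _ _ _) (e.two_mem _ _ _),
      ν.cocycle i j l m hij hjl hlm, e.cocycle i j l m hij hjl hlm]

/-- Simplices of the nerve whose data differ by elements of a central subalgebra differ by a
cocycle. -/
theorem exists_shift_eq (h : IsCentral ι) (hι : Function.Injective (lin ι)) (ν ν' : G.alg.NerveSimplex n)
    {o : Fin (n + 1) → A.alg.carrier} {x : Fin (n + 1) → Fin (n + 1) → A.alg.carrier}
    {t : Fin (n + 1) → Fin (n + 1) → Fin (n + 1) → A.alg.carrier}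
    (ho : ∀ i, ν'.obj i = ν.obj i + lin ι (o i)) (hx : ∀ i j, ν'.one i j = ν.one i j + lin ι (x i j))
    (ht : ∀ i j l, ν'.two i j l = ν.two i j l + lin ι (t i j l)) :
    ∃ e : EmData A n, h.shift ν e = ν' := by
  have hx0 : ∀ i j, ¬ i < j → x i j = 0 := fun i j hij => by
    have := hx i j
    rw [ν.one_eq_zero i j hij, ν'.one_eq_zero i j hij, zero_add] at this
    exact hι (this.symm.trans (map_zero _).symm)
  have ht0 : ∀ i j l, ¬ (i < j ∧ j < l) → t i j l = 0 := fun i j l hs => by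
    have := ht i j l
    rw [ν.two_eq_zero i j l hs, ν'.two_eq_zero i j l hs, zero_add] at this
    exact hι (this.symm.trans (map_zero _).symm)
  have om : ∀ i, o i ∈ A.alg.deg 1 := fun i => mem_deg_of_lin_mem hι (by
    have := sub_mem (ν'.obj_mc i).1 (ν.obj_mc i).1
    rwa [ho, add_sub_cancel_left] at this)
  have xm : ∀ i j, x i j ∈ A.alg.deg 0 := fun i j => by
    by_cases hij : i < j
    · refine mem_deg_of_lin_mem hι ?_
      have := sub_mem (ν'.one_mor i j hij.le).1 (ν.one_mor i j hij.le).1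
      rwa [hx, add_sub_cancel_left] at this
    · rw [hx0 i j hij]; exact zero_mem _
  have tm : ∀ i j l, t i j l ∈ A.alg.deg (-1) := fun i j l => by
    by_cases hs : i < j ∧ j < l
    · refine mem_deg_of_lin_mem hι ?_
      have := sub_mem (ν'.two_mor i j l hs.1.le hs.2.le).1 (ν.two_mor i j l hs.1.le hs.2.le).1
      rwa [ht, add_sub_cancel_left] at this
    · rw [ht0 i j l hs]; exact zero_mem _
  refine ⟨
    { obj := o
      one := x
      two := t
      obj_mem := om
      one_mem := xm
      two_mem := tm
      one_eq_zero := hx0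
      two_eq_zero := ht0
      diff_obj := fun i => hι ?_
      diff_one := fun i j hij => hι ?_
      diff_two := fun i j l hij hjl => hι ?_
      cocycle := fun i j l m hij hjl hlm => hι ?_ }, NerveSimplex.ext ?_ ?_ ?_⟩
  · rw [(h.isMC_add_iff (ν.obj_mc i) (om i)).1 (ho i ▸ ν'.obj_mc i), map_zero]
  · have h1 := (ν'.one_mor i j hij).2
    rw [hx, ho, ho, h.gauge_add, (ν.one_mor i j hij).2] at h1
    exact add_left_cancel h1
  · have h1 := (ν'.two_mor i j l hij hjl).2
    rw [hx, hx, hx, ho, ht, h.bch_dOp_add (ν.obj_mc i) (ν.two_mor i j l hij hjl).1 (ν.one_mor i j hij).1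
      (ν.one_mor j l hjl).1 _ (tm i j l) (xm i j) (xm j l), (ν.two_mor i j l hij hjl).2] at h1
    exact add_left_cancel h1
  · have h1 := ν'.cocycle i j l m hij hjl hlm
    have h2 := (ν.two_mor j l m hjl hlm).1
    have h5 : expAd G.alg.bracket (ν.one i j) (ν.two j l m) ∈ G.alg.deg (-1) := by
      rw [expAd_eq (G.isDG.nilp _)]
      exact G.isDG.expOp_mem (ν.one_mor i j hij).1 h2
    rw [hx, ho, ht, ht, ht, ht, h.expAd_add, h.bch_twisted_add (ν.obj_mc i) _
        (ν.two_mor i j m hij (hjl.trans hlm)).1 h5 (tm _ _ _) (tm _ _ _),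
      h.bch_twisted_add (ν.obj_mc i) _ (ν.two_mor i l m (hij.trans hjl) hlm).1
        (ν.two_mor i j l hij hjl).1 (tm _ _ _) (tm _ _ _), ν.cocycle i j l m hij hjl hlm] at h1
    exact add_left_cancel h1
  · exact funext fun i => (ho i).symm
  · exact funext fun i => funext fun j => (hx i j).symm
  · exact funext fun i => funext fun j => funext fun l => (ht i j l).symm

end IsCentral

end NilpDGLA

/-! ## Integration -/

namespace NilpDGLA

open DGLA

variable {k : Type u} [Field k] [CharZero k] {A G H : NilpDGLA k} {n : ℕ} {ι : A ⟶ G}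

theorem isPathHolonomy_zero : IsPathHolonomy (0 : G.alg.Forms 1) 0 := by
  have := isPathHolonomy_degenerate (G := G) (fun i => i.elim0) 0
  rwa [map_zero] at this

theorem isSurfaceHolonomy_zero : IsSurfaceHolonomy (0 : G.alg.Forms 2) 0 := by
  have := isSurfaceHolonomy_degenerate (G := G) (fun _ => 0) (zero_mem (G.alg.formsDegOne 1))
  rwa [map_zero] at this

theorem isFormsMC_zero : G.alg.IsFormsMC (0 : G.alg.Forms n) :=
  ⟨zero_mem _, by rw [map_zero, map_zero, smul_zero, add_zero]⟩

/-- The integrals of a form over the faces of the simplex. -/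
def integralCochain (α : G.alg.Forms n) (p : ℕ) (σ : SimplexCategory.mk p ⟶ SimplexCategory.mk n) :
    G.alg.carrier := formsIntegral p (G.alg.simpForms σ α)

namespace IsCentral

theorem holOne_add (h : IsCentral ι) {μ : G.alg.Forms n} (hμ : G.alg.IsFormsMC μ) {α : A.alg.Forms n}
    (hα : α ∈ A.alg.formsCocycles n) {i j : Fin (n + 1)} (hij : i ≤ j) :
    holOne (μ + formsMap ι n α) i j =
      holOne μ i j + lin ι (integralCochain α 1 (edge (a := .mk n) i j hij)) := by
  refine holOne_eq (h.isFormsMC_add hμ hα) hij ?_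
  have h1 := h.isPathHolonomy_add (holOne_spec hμ hij)
    (pull_mem_degOne (PolyForm.simplexMap k (edge (a := .mk n) i j hij).toOrderHom) hα.1)
  rw [← pullForms_formsMap] at h1
  exact (congrArg (fun ν => IsPathHolonomy ν _) (map_add (G.alg.simpForms _) _ _)).mpr h1

theorem holTwo_add (h : IsCentral ι) {μ : G.alg.Forms n} (hμ : G.alg.IsFormsMC μ) {α : A.alg.Forms n}
    (hα : α ∈ A.alg.formsCocycles n) {i j l : Fin (n + 1)} (hij : i ≤ j) (hjl : j ≤ l) :
    holTwo (μ + formsMap ι n α) i j l =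
      holTwo μ i j l + lin ι (integralCochain α 2 (face (a := .mk n) i j l hij hjl)) := by
  refine holTwo_eq (h.isFormsMC_add hμ hα) hij hjl ?_
  have h1 := h.isSurfaceHolonomy_add (holTwo_spec hμ hij hjl)
    (pull_mem_degOne (PolyForm.simplexMap k (face (a := .mk n) i j l hij hjl).toOrderHom) hα.1)
  rw [← pullForms_formsMap] at h1
  exact (congrArg (fun ν => IsSurfaceHolonomy ν _) (map_add (G.alg.simpForms _) _ _)).mpr h1

end IsCentral

theorem formsMap_id (μ : G.alg.Forms n) : formsMap (𝟙 G) n μ = μ :=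
  DFunLike.congr_fun (TensorProduct.map_id (R := k)) μ

theorem holOne_zero (i j : Fin (n + 1)) : holOne (0 : G.alg.Forms n) i j = 0 := by
  by_cases h : i < j
  · refine holOne_eq isFormsMC_zero h.le ?_
    rw [map_zero]
    exact isPathHolonomy_zero
  · exact dif_neg h

theorem holTwo_zero (i j l : Fin (n + 1)) : holTwo (0 : G.alg.Forms n) i j l = 0 := by
  by_cases h : i < j ∧ j < l
  · refine holTwo_eq isFormsMC_zero h.1.le h.2.le ?_
    rw [map_zero]
    exact isSurfaceHolonomy_zero
  · exact dif_neg h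

theorem vertex_zero (i : Fin (n + 1)) : vertex i (0 : G.alg.Forms n) = 0 := by
  rw [vertex_eq, map_zero, map_zero]

theorem integralCochain_zero (α : G.alg.Forms n) (σ : SimplexCategory.mk 0 ⟶ SimplexCategory.mk n) :
    integralCochain α 0 σ = vertex (σ.toOrderHom 0) α := by
  rw [integralCochain, ← vertex_simpForms σ 0 α]
  exact formsIntegral_zero _

variable (A) in
/-- The simplex of the nerve with trivial entries. -/
def zeroNerve (n : ℕ) : A.alg.NerveSimplex n := holNerve 0 isFormsMC_zero

section Abelian

variable {α : A.alg.Forms n}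

theorem integralCochain_one (hA : IsCentral (𝟙 A)) (hα : α ∈ A.alg.formsCocycles n)
    (σ : SimplexCategory.mk 1 ⟶ SimplexCategory.mk n) :
    integralCochain α 1 σ = holOne α (σ.toOrderHom 0) (σ.toOrderHom 1) := by
  have h1 := hA.holOne_add isFormsMC_zero hα (σ.toOrderHom.monotone (show (0 : Fin 2) ≤ 1 by decide))
  rw [holOne_zero, zero_add, zero_add, formsMap_id, ← hom_mk_one σ] at h1
  exact h1.symm

theorem integralCochain_two (hA : IsCentral (𝟙 A)) (hα : α ∈ A.alg.formsCocycles n)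
    (σ : SimplexCategory.mk 2 ⟶ SimplexCategory.mk n) :
    integralCochain α 2 σ = holTwo α (σ.toOrderHom 0) (σ.toOrderHom 1) (σ.toOrderHom 2) := by
  have h1 := hA.holTwo_add isFormsMC_zero hα (σ.toOrderHom.monotone (show (0 : Fin 3) ≤ 1 by decide))
    (σ.toOrderHom.monotone (show (1 : Fin 3) ≤ 2 by decide))
  rw [holTwo_zero, zero_add, zero_add, formsMap_id, ← hom_mk_two σ] at h1
  exact h1.symm

theorem shift_zeroNerve_obj (hA : IsCentral (𝟙 A)) (e : EmData A n) (i : Fin (n + 1)) :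
    (hA.shift (zeroNerve A n) e).obj i = e.obj i :=
  (congrArg (· + e.obj i) (vertex_zero i)).trans (zero_add _)

theorem shift_zeroNerve_one (hA : IsCentral (𝟙 A)) (e : EmData A n) (i j : Fin (n + 1)) :
    (hA.shift (zeroNerve A n) e).one i j = e.one i j :=
  (congrArg (· + e.one i j) (holOne_zero i j)).trans (zero_add _)

theorem shift_zeroNerve_two (hA : IsCentral (𝟙 A)) (e : EmData A n) (i j l : Fin (n + 1)) :
    (hA.shift (zeroNerve A n) e).two i j l = e.two i j l :=
  (congrArg (· + e.two i j l) (holTwo_zero i j l)).trans (zero_add _)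

/-- Simplices of the nerve of an abelian algebra are cocycles. -/
theorem exists_shift_zeroNerve_eq (hA : IsCentral (𝟙 A)) (ν : A.alg.NerveSimplex n) :
    ∃ e : EmData A n, hA.shift (zeroNerve A n) e = ν :=
  hA.exists_shift_eq (fun _ _ h => h) (zeroNerve A n) ν (o := ν.obj) (x := ν.one) (t := ν.two)
    (fun i => ((congrArg (· + ν.obj i) (vertex_zero i)).trans (zero_add _)).symm)
    (fun i j => ((congrArg (· + ν.one i j) (holOne_zero i j)).trans (zero_add _)).symm)
    (fun i j l => ((congrArg (· + ν.two i j l) (holTwo_zero i j l)).trans (zero_add _)).symm)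

theorem integralCochain_mem_of_isCentral (hA : IsCentral (𝟙 A)) (hα : α ∈ A.alg.formsCocycles n) :
    integralCochain α ∈ A.alg.emCocycles (.mk n) := by
  have hμ : A.alg.IsFormsMC α := by
    have := hA.isFormsMC_add isFormsMC_zero hα
    rwa [formsMap_id, zero_add] at this
  obtain ⟨e, he⟩ := exists_shift_zeroNerve_eq hA (holNerve α hμ)
  have h0 : ∀ i, vertex i α = e.obj i := fun i =>
    (congrArg (fun ν => NerveSimplex.obj ν i) he).symm.trans (shift_zeroNerve_obj hA e i)
  have h1 : ∀ i j, holOne α i j = e.one i j := fun i j =>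
    (congrArg (fun ν => NerveSimplex.one ν i j) he).symm.trans (shift_zeroNerve_one hA e i j)
  have h2 : ∀ i j l, holTwo α i j l = e.two i j l := fun i j l =>
    (congrArg (fun ν => NerveSimplex.two ν i j l) he).symm.trans (shift_zeroNerve_two hA e i j l)
  have : integralCochain α = e.cochain := by
    funext p σ
    match p with
    | 0 => exact (integralCochain_zero α σ).trans (h0 _)
    | 1 => exact (integralCochain_one hA hα σ).trans (h1 _ _)
    | 2 => exact (integralCochain_two hA hα σ).trans (h2 _ _ _)
    | p + 3 => exact formsIntegral_eq_zero (pull_mem_degOne _ hα.1)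
  rw [this]
  exact e.cochain_mem

end Abelian

/-- The complex underlying `𝔤`, as an abelian DGLA. -/
def toAbelian (G : NilpDGLA k) : NilpDGLA k where
  alg :=
    { carrier := G.alg.carrier
      deg := G.alg.deg
      isInternal := G.alg.isInternal
      bracket := 0
      diff := G.alg.diff
      bracket_mem := fun _ _ => zero_mem _
      diff_mem := G.alg.diff_mem
      skew := fun _ _ => by simp
      jacobi := fun _ _ _ => by simp
      leibniz := fun _ _ => by simp
      diff_diff := G.alg.diff_diff }
  nilpotent := ⟨1, eq_bot_iff.2 (Submodule.map₂_le.2 fun _ _ _ _ => zero_mem _)⟩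
  bounded := G.bounded

/-- The integrals of a closed form of degree one form a cocycle. -/
theorem integralCochain_mem {α : G.alg.Forms n} (hα : α ∈ G.alg.formsCocycles n) :
    integralCochain α ∈ G.alg.emCocycles (.mk n) :=
  integralCochain_mem_of_isCentral (A := G.toAbelian) (α := α) (fun _ _ => rfl) hα

theorem formsIntegral_formsMap (f : G ⟶ H) (p : ℕ) (μ : G.alg.Forms p) :
    formsIntegral p (formsMap f p μ) = lin f (formsIntegral p μ) := by
  induction μ using TensorProduct.induction_on with
  | zero => simp
  | add x y hx hy => simp only [map_add, hx, hy]
  | tmul ω x => exact (map_smul (lin f) _ _).symm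

variable (k) in
/-- The integration map. -/
def integralMap : sigmaAb k ⟶ em k where
  app G :=
    { app := fun a => AddCommGrpCat.ofHom
        { toFun := fun α => ⟨integralCochain (n := a.unop.len) (sigmaAbForm α), integralCochain_mem α.2⟩
          map_zero' := Subtype.ext (funext fun p => funext fun σ =>
            (congrArg (formsIntegral p) (map_zero (G.alg.simpForms σ))).trans (map_zero _))
          map_add' := fun α β => Subtype.ext (funext fun p => funext fun σ =>
            (congrArg (formsIntegral p) (map_add (G.alg.simpForms σ) _ _)).trans (map_add _ _ _)) }
      naturality := fun a b f => by
        refine AddCommGrpCat.hom_ext (AddMonoidHom.ext fun α => Subtype.ext ?_)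
        funext p σ
        exact congrArg (formsIntegral p) (G.alg.simpForms_comp σ f.unop (sigmaAbForm α)).symm }
  naturality G H f := by
    refine NatTrans.ext (funext fun a => AddCommGrpCat.hom_ext (AddMonoidHom.ext fun α =>
      Subtype.ext ?_))
    funext p σ
    exact (congrArg (formsIntegral p) (pullForms_formsMap f _ (sigmaAbForm α))).trans
      (formsIntegral_formsMap f p _)

theorem isIntegralOf_integralMap {a : SimplexCategoryᵒᵖ} (α : ((sigmaAb k).obj G).obj a) :
    IsIntegralOf α (((integralMap k).app G).app a α) := fun _ _ => rfl

/-- The holonomy map is equivariant relative to the integration map. -/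
theorem IsCentral.holNerve_add (h : IsCentral ι) {μ : G.alg.Forms n} (hμ : G.alg.IsFormsMC μ)
    {α : A.alg.Forms n} (hα : α ∈ A.alg.formsCocycles n) :
    holNerve (μ + formsMap ι n α) (h.isFormsMC_add hμ hα) =
      h.shift (holNerve μ hμ) (emData (integralCochain_mem hα)) := by
  refine NerveSimplex.ext (funext fun i => ?_) (funext fun i => funext fun j => ?_)
    (funext fun i => funext fun j => funext fun l => ?_)
  · refine (vertex_add i _ _).trans (congrArg (vertex i μ + ·) ?_)
    exact (vertex_formsMap ι i α).trans (congrArg (lin ι) (integralCochain_zero α (vert (a := .mk n) i)).symm)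
  · by_cases hij : i < j
    · refine (h.holOne_add hμ hα hij.le).trans (congrArg (fun x => holOne μ i j + lin ι x) ?_)
      exact (emOne_eq (integralCochain_mem hα) hij.le).symm
    · exact ((holNerve _ _).one_eq_zero i j hij).trans (NerveSimplex.one_eq_zero _ i j hij).symm
  · by_cases hs : i < j ∧ j < l
    · refine (h.holTwo_add hμ hα hs.1.le hs.2.le).trans (congrArg (fun x => holTwo μ i j l + lin ι x) ?_)
      exact (emTwo_eq (integralCochain_mem hα) hs.1.le hs.2.le).symm
    · exact ((holNerve _ _).two_eq_zero i j l hs).trans (NerveSimplex.two_eq_zero _ i j l hs).symm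

end NilpDGLA

/-! ## Simplices of dimension zero -/

theorem PolyForm.exists_eq_algebraMap {k : Type u} [Field k] (ω : PolyForm k 0) :
    ∃ c : k, ω = algebraMap k (PolyForm k 0) c := by
  induction ω using TensorProduct.induction_on with
  | zero => exact ⟨0, (map_zero _).symm⟩
  | add x y hx hy =>
    obtain ⟨a, rfl⟩ := hx
    obtain ⟨b, rfl⟩ := hy
    exact ⟨a + b, (map_add _ _ _).symm⟩
  | tmul f w =>
    have hw : ∃ c : k, w = algebraMap k _ c := by
      induction w using CliffordAlgebra.left_induction with
      | algebraMap r => exact ⟨r, rfl⟩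
      | add x y hx hy =>
        obtain ⟨a, rfl⟩ := hx
        obtain ⟨b, rfl⟩ := hy
        exact ⟨a + b, (map_add _ _ _).symm⟩
      | ι_mul x v hx => exact ⟨0, by rw [Subsingleton.elim v 0, map_zero, zero_mul, map_zero]⟩
    obtain ⟨b, rfl⟩ := hw
    obtain ⟨a, rfl⟩ := MvPolynomial.C_surjective (Fin 0) f
    refine ⟨a * b, ?_⟩
    rw [tmul_eq, map_mul, AlgHom.commutes, ← MvPolynomial.algebraMap_eq, AlgHom.commutes]

namespace NilpDGLA

open DGLA

variable {k : Type u} [Field k] {A G Q : NilpDGLA k} {n : ℕ}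

theorem isFormsMC_one_tmul {γ : G.alg.carrier} (hγ : G.alg.IsMC γ) :
    G.alg.IsFormsMC ((1 : PolyForm k n) ⊗ₜ[k] γ : G.alg.Forms n) := by
  have h1 : (1 : PolyForm k n) = (1 : AffPoly k n) ⊗ₜ[k] (1 : ExteriorAlgebra k (Fin n → k)) := rfl
  refine ⟨Submodule.mem_iSup_of_mem 0 ⟨(⟨1, ?_⟩ : PolyForm.ofDegree k n 0) ⊗ₜ (⟨γ, ?_⟩ : G.alg.deg (1 - (0 : ℕ))), rfl⟩, ?_⟩
  · exact ⟨1 ⊗ₜ ⟨1, by rw [ExteriorAlgebra.exteriorPower, pow_zero]; exact Submodule.one_le.mp le_rfl⟩, rfl⟩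
  · simpa using hγ.1
  · have hd : PolyForm.d (1 : PolyForm k n) = 0 := by rw [h1, PolyForm.d_tmul]; simp
    have e : G.alg.formsDiff n ((1 : PolyForm k n) ⊗ₜ[k] γ) = 1 ⊗ₜ[k] G.alg.diff γ := by
      have : G.alg.formsDiff n ((1 : PolyForm k n) ⊗ₜ[k] γ) =
        PolyForm.d (1 : PolyForm k n) ⊗ₜ[k] γ + PolyForm.invol k n 1 ⊗ₜ[k] G.alg.diff γ := rfl
      rw [this, hd, map_one, TensorProduct.zero_tmul, zero_add]
    have e' : G.alg.formsBracket n ((1 : PolyForm k n) ⊗ₜ[k] γ) ((1 : PolyForm k n) ⊗ₜ[k] γ) =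
        1 ⊗ₜ[k] G.alg.bracket γ γ := by
      have : G.alg.formsBracket n ((1 : PolyForm k n) ⊗ₜ[k] γ) ((1 : PolyForm k n) ⊗ₜ[k] γ) =
        ((1 : PolyForm k n) * 1) ⊗ₜ[k] G.alg.bracket (G.alg.evenPart γ) γ +
          ((1 : PolyForm k n) * PolyForm.invol k n 1) ⊗ₜ[k] G.alg.bracket (G.alg.oddPart γ) γ := rfl
      rw [this, map_one, mul_one, ← TensorProduct.tmul_add, ← LinearMap.add_apply, ← map_add, oddPart,
        LinearMap.sub_apply, add_sub_cancel]
      rfl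
    rw [e, e', ← TensorProduct.tmul_smul, ← TensorProduct.tmul_add, hγ.2, TensorProduct.tmul_zero]

theorem exists_eq_one_tmul (μ : G.alg.Forms 0) : ∃ x : G.alg.carrier, μ = (1 : PolyForm k 0) ⊗ₜ[k] x := by
  induction μ using TensorProduct.induction_on with
  | zero => exact ⟨0, (TensorProduct.tmul_zero _ _).symm⟩
  | add x y hx hy =>
    obtain ⟨a, rfl⟩ := hx
    obtain ⟨b, rfl⟩ := hy
    exact ⟨a + b, (TensorProduct.tmul_add _ _ _).symm⟩
  | tmul ω x =>
    obtain ⟨c, rfl⟩ := PolyForm.exists_eq_algebraMap ω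
    exact ⟨c • x, by rw [Algebra.algebraMap_eq_smul_one, TensorProduct.smul_tmul]⟩

theorem vertex_one_tmul (x : G.alg.carrier) : vertex 0 ((1 : PolyForm k 0) ⊗ₜ[k] x : G.alg.Forms 0) = x := by
  refine (congrArg (G.alg.value) (G.alg.simpForms_id (.mk 0) (1 ⊗ₜ[k] x))).trans ?_
  have : G.alg.value ((1 : PolyForm k 0) ⊗ₜ[k] x) =
    MvPolynomial.aeval (Fin.elim0 : Fin 0 → k) (PolyForm.funPart (1 : PolyForm k 0)) • x := rfl
  have h1 : (1 : PolyForm k 0) = (1 : AffPoly k 0) ⊗ₜ[k] (1 : ExteriorAlgebra k (Fin 0 → k)) := rfl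
  rw [this, h1, PolyForm.funPart]
  simp

variable [CharZero k]

variable (G) in
/-- The zero-simplices of `Σ(𝔤)` are the Maurer–Cartan elements. -/
def sigmaZeroEquiv : {γ // G.alg.IsMC γ} ≃ ((sigma k).obj G).obj (.op (.mk 0)) where
  toFun γ := ⟨1 ⊗ₜ[k] γ.1, isFormsMC_one_tmul γ.2⟩
  invFun μ := ⟨vertex (n := 0) 0 (sigmaForm μ), vertex_mc μ.2 0⟩
  left_inv γ := Subtype.ext (vertex_one_tmul γ.1)
  right_inv μ := Subtype.ext (by
    obtain ⟨x, hx⟩ := exists_eq_one_tmul (sigmaForm μ)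
    change (1 : PolyForm k 0) ⊗ₜ[k] vertex (n := 0) 0 (sigmaForm μ) = sigmaForm μ
    rw [hx, vertex_one_tmul])

/-- The zero-simplices of the nerve are its objects. -/
theorem holMap_zero_bijective : Function.Bijective fun γ : {γ // G.alg.IsMC γ} =>
    ((holMap k).app G).app (.op (.mk 0)) (sigmaZeroEquiv G γ) := by
  have hv : ∀ γ : {γ // G.alg.IsMC γ},
      (nerveData (((holMap k).app G).app (.op (.mk 0)) (sigmaZeroEquiv G γ))).obj 0 = γ.1 :=
    fun γ => vertex_one_tmul γ.1
  refine ⟨fun γ γ' h => Subtype.ext ?_, fun ν => ⟨⟨(nerveData ν).obj 0, (nerveData ν).obj_mc 0⟩, ?_⟩⟩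
  · rw [← hv γ, ← hv γ']
    exact congrArg (fun ν => (nerveData ν).obj 0) h
  · have h0 : ∀ i j : Fin 1, ¬ i < j := fun i j h => by omega
    refine NerveSimplex.ext (funext fun i => ?_) (funext fun i => funext fun j => ?_)
      (funext fun i => funext fun j => funext fun l => ?_)
    · obtain rfl : i = 0 := Subsingleton.elim (α := Fin 1) _ _
      exact hv _
    · exact (NerveSimplex.one_eq_zero _ i j (h0 i j)).trans (NerveSimplex.one_eq_zero (nerveData ν) i j (h0 i j)).symm
    · exact (NerveSimplex.two_eq_zero _ i j l fun h => h0 i j h.1).trans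
        (NerveSimplex.two_eq_zero (nerveData ν) i j l fun h => h0 i j h.1).symm

/-! ## Actions -/

variable {ι : A ⟶ G} {π : G ⟶ Q}

/-- The action of the cocycles of `Ω ⊗ 𝔞` on `Σ(𝔤)`. -/
def IsCentral.sigmaAction (h : IsCentral ι) :
    SimplicialAction ((sigmaAb k).obj A) ((sigma k).obj G) where
  act {a} α μ := ⟨sigmaForm μ + formsMap ι _ (sigmaAbForm α), h.isFormsMC_add μ.2 α.2⟩
  zero_act μ := Subtype.ext ((congrArg (sigmaForm μ + ·) (map_zero (formsMap ι _))).trans (add_zero _))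
  add_act α β μ := Subtype.ext (by
    change sigmaForm μ + formsMap ι _ (sigmaAbForm α + sigmaAbForm β) =
      (sigmaForm μ + formsMap ι _ (sigmaAbForm β)) + formsMap ι _ (sigmaAbForm α)
    rw [map_add, add_assoc, add_comm (formsMap ι _ (sigmaAbForm α))])
  map_act f α μ := Subtype.ext ((map_add (G.alg.simpForms f.unop) _ _).trans
    (congrArg (G.alg.simpForms f.unop (sigmaForm μ) + ·) (pullForms_formsMap ι _ (sigmaAbForm α))))

theorem emOne_comp {a b : ℕ} (f : SimplexCategory.mk a ⟶ SimplexCategory.mk b)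
    {c : ∀ p : ℕ, (SimplexCategory.mk p ⟶ SimplexCategory.mk b) → A.alg.carrier}
    (hc : c ∈ A.alg.emCocycles (.mk b)) (i j : Fin (a + 1)) :
    emOne c (f.toOrderHom i) (f.toOrderHom j) = emOne (fun p σ => c p (σ ≫ f)) i j := by
  by_cases h : i < j
  · rw [emOne_eq hc (f.toOrderHom.monotone h.le), ← edge_comp f h.le, emOne, dif_pos h]
  · rw [emOne, dif_neg (fun h' => h (f.toOrderHom.monotone.reflect_lt h')), emOne, dif_neg h]

theorem emTwo_comp {a b : ℕ} (f : SimplexCategory.mk a ⟶ SimplexCategory.mk b)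
    {c : ∀ p : ℕ, (SimplexCategory.mk p ⟶ SimplexCategory.mk b) → A.alg.carrier}
    (hc : c ∈ A.alg.emCocycles (.mk b)) (i j l : Fin (a + 1)) :
    emTwo c (f.toOrderHom i) (f.toOrderHom j) (f.toOrderHom l) = emTwo (fun p σ => c p (σ ≫ f)) i j l := by
  by_cases h : i < j ∧ j < l
  · rw [emTwo_eq hc (f.toOrderHom.monotone h.1.le) (f.toOrderHom.monotone h.2.le),
      ← face_comp f h.1.le h.2.le, emTwo, dif_pos h]
  · rw [emTwo, dif_neg (fun h' => h ⟨f.toOrderHom.monotone.reflect_lt h'.1,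
      f.toOrderHom.monotone.reflect_lt h'.2⟩), emTwo, dif_neg h]

/-- The action of `K(𝔞[1])` on the nerve. -/
def IsCentral.nerveAction (h : IsCentral ι) : SimplicialAction ((em k).obj A) ((nerve k).obj G) where
  act {a} c ν := h.shift (n := a.unop.len) (nerveData ν) (emData (Subtype.property (c : A.alg.emCocycles a.unop)))
  zero_act {a} ν := by
    refine NerveSimplex.ext (funext fun i => ?_) (funext fun i => funext fun j => ?_)
      (funext fun i => funext fun j => funext fun l => ?_)
    · exact (congrArg ((nerveData ν).obj i + ·) (map_zero (lin ι))).trans (add_zero _)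
    · refine (congrArg (fun x => (nerveData ν).one i j + lin ι x) ?_).trans
        ((congrArg ((nerveData ν).one i j + ·) (map_zero (lin ι))).trans (add_zero _))
      exact dite_eq_right_iff.2 fun _ => rfl
    · refine (congrArg (fun x => (nerveData ν).two i j l + lin ι x) ?_).trans
        ((congrArg ((nerveData ν).two i j l + ·) (map_zero (lin ι))).trans (add_zero _))
      exact dite_eq_right_iff.2 fun _ => rfl
  add_act {a} c c' ν := by
    have e : ∀ (u : G.alg.carrier) (x y z : A.alg.carrier), z = x + y →
        u + lin ι z = (u + lin ι y) + lin ι x := fun u x y z hz => by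
      rw [hz, map_add, add_assoc, add_comm (lin ι x)]
    refine NerveSimplex.ext (funext fun i => ?_) (funext fun i => funext fun j => ?_)
      (funext fun i => funext fun j => funext fun l => ?_)
    · exact e _ _ _ _ rfl
    · refine e _ _ _ _ ?_
      change emOne _ i j = emOne _ i j + emOne _ i j
      by_cases hij : i < j
      · rw [emOne, emOne, emOne, dif_pos hij, dif_pos hij, dif_pos hij]; rfl
      · rw [emOne, emOne, emOne, dif_neg hij, dif_neg hij, dif_neg hij, add_zero]
    · refine e _ _ _ _ ?_
      change emTwo _ i j l = emTwo _ i j l + emTwo _ i j l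
      by_cases hs : i < j ∧ j < l
      · rw [emTwo, emTwo, emTwo, dif_pos hs, dif_pos hs, dif_pos hs]; rfl
      · rw [emTwo, emTwo, emTwo, dif_neg hs, dif_neg hs, dif_neg hs, add_zero]
  map_act {a b} f c ν := by
    refine NerveSimplex.ext (funext fun i => ?_) (funext fun i => funext fun j => ?_)
      (funext fun i => funext fun j => funext fun l => ?_)
    · exact congrArg (fun σ => (nerveData ν).obj (f.unop.toOrderHom i) +
        lin ι ((c : A.alg.emCocycles a.unop).1 0 σ)) (hom_mk_zero (n := a.unop.len)
          (vert (a := b.unop) i ≫ f.unop)).symm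
    · exact congrArg (fun x => (nerveData ν).one (f.unop.toOrderHom i) (f.unop.toOrderHom j) + lin ι x)
        (emOne_comp f.unop (Subtype.property (c : A.alg.emCocycles a.unop)) i j)
    · exact congrArg (fun x => (nerveData ν).two (f.unop.toOrderHom i) (f.unop.toOrderHom j)
        (f.unop.toOrderHom l) + lin ι x)
        (emTwo_comp f.unop (Subtype.property (c : A.alg.emCocycles a.unop)) i j l)

end NilpDGLA

/-! ## Principal fibrations and abelian algebras -/

namespace NilpDGLA

open DGLA

variable {k : Type u} [Field k] [CharZero k] {A G Q : NilpDGLA k} {n : ℕ} {ι : A ⟶ G} {π : G ⟶ Q}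

theorem IsCentral.sigmaAction_free (h : IsCentral ι) (hι : Function.Injective (lin ι)) {a : SimplexCategoryᵒᵖ}
    (α : ((sigmaAb k).obj A).obj a) (μ : ((sigma k).obj G).obj a) (e : h.sigmaAction.act α μ = μ) :
    α = 0 := by
  have e1 : sigmaForm μ + formsMap ι _ (sigmaAbForm α) = sigmaForm μ + 0 :=
    (congrArg sigmaForm e).trans (add_zero _).symm
  have e2 : formsMap ι _ (sigmaAbForm α) =
    (sigmaForm μ + formsMap ι _ (sigmaAbForm α)) + (-1 : k) • sigmaForm μ := by module
  refine Subtype.ext (formsMap_injective hι (e2.trans (Eq.trans ?_ (map_zero _).symm)))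
  rw [e1]
  module

theorem emData_injective {c c' : ∀ p : ℕ, (SimplexCategory.mk p ⟶ SimplexCategory.mk n) → A.alg.carrier}
    (hc : c ∈ A.alg.emCocycles (.mk n)) (hc' : c' ∈ A.alg.emCocycles (.mk n))
    (h0 : ∀ i, (emData hc).obj i = (emData hc').obj i)
    (h1 : ∀ i j, (emData hc).one i j = (emData hc').one i j)
    (h2 : ∀ i j l, (emData hc).two i j l = (emData hc').two i j l) : c = c' :=
  em_ext hc hc' h0
    (fun i j h => (emOne_eq hc h).symm.trans ((h1 i j).trans (emOne_eq hc' h)))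
    fun i j l h h' => (emTwo_eq hc h h').symm.trans ((h2 i j l).trans (emTwo_eq hc' h h'))

theorem emData_cochain (e : EmData A n) : emData e.cochain_mem = e := by
  refine EmData.ext rfl (funext fun i => funext fun j => ?_)
    (funext fun i => funext fun j => funext fun l => ?_)
  · by_cases h : i < j
    · exact dif_pos h
    · rw [EmData.one_eq_zero _ i j h, EmData.one_eq_zero _ i j h]
  · by_cases h : i < j ∧ j < l
    · exact dif_pos h
    · rw [EmData.two_eq_zero _ i j l h, EmData.two_eq_zero _ i j l h]

theorem IsCentral.shift_injective (h : IsCentral ι) (hι : Function.Injective (lin ι)) (ν : G.alg.NerveSimplex n)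
    {c c' : ∀ p : ℕ, (SimplexCategory.mk p ⟶ SimplexCategory.mk n) → A.alg.carrier}
    (hc : c ∈ A.alg.emCocycles (.mk n)) (hc' : c' ∈ A.alg.emCocycles (.mk n))
    (e : h.shift ν (emData hc) = h.shift ν (emData hc')) : c = c' :=
  emData_injective hc hc' (fun i => hι (add_left_cancel (congrArg (fun ν => NerveSimplex.obj ν i) e)))
    (fun i j => hι (add_left_cancel (congrArg (fun ν => NerveSimplex.one ν i j) e)))
    fun i j l => hι (add_left_cancel (congrArg (fun ν => NerveSimplex.two ν i j l) e))

theorem IsCentral.nerveAction_free (h : IsCentral ι) (hι : Function.Injective (lin ι)) {a : SimplexCategoryᵒᵖ}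
    (c : ((em k).obj A).obj a) (ν : ((nerve k).obj G).obj a) (e : h.nerveAction.act c ν = ν) :
    c = 0 :=
  Subtype.ext (h.shift_injective hι (n := a.unop.len) (nerveData ν)
    (Subtype.property (c : A.alg.emCocycles a.unop))
    (Subtype.property (0 : A.alg.emCocycles a.unop)) (e.trans (h.nerveAction.zero_act ν).symm))

theorem formsMap_eq_iff (hπ : Function.Surjective (lin π)) (hex : LinearMap.ker (lin π) = LinearMap.range (lin ι))
    (μ μ' : G.alg.Forms n) : formsMap π n μ = formsMap π n μ' ↔ ∃ α, μ + formsMap ι n α = μ' := by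
  have he : Function.Exact (formsMap ι n) (formsMap π n) :=
    lTensor_exact (PolyForm k n) (LinearMap.exact_iff.2 hex) hπ
  constructor
  · intro e
    obtain ⟨α, hα⟩ := (he (μ' - μ)).1 (by rw [map_sub, e, sub_self])
    exact ⟨α, by rw [hα]; abel⟩
  · rintro ⟨α, rfl⟩
    rw [map_add, he.apply_apply_eq_zero, add_zero]

theorem IsCentral.sigma_orbit (h : IsCentral ι) (hι : Function.Injective (lin ι))
    (hπ : Function.Surjective (lin π)) (hex : LinearMap.ker (lin π) = LinearMap.range (lin ι))
    {a : SimplexCategoryᵒᵖ} (μ μ' : ((sigma k).obj G).obj a) :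
    ((sigma k).map π).app a μ = ((sigma k).map π).app a μ' ↔
      ∃ α : ((sigmaAb k).obj A).obj a, h.sigmaAction.act α μ = μ' := by
  have key := formsMap_eq_iff hπ hex (sigmaForm μ) (sigmaForm μ')
  constructor
  · intro e
    obtain ⟨α, hα⟩ := key.1 (congrArg sigmaForm e)
    exact ⟨⟨α, h.mem_formsCocycles hι (Subtype.property μ) (hα ▸ Subtype.property μ')⟩, Subtype.ext hα⟩
  · rintro ⟨α, rfl⟩
    exact Subtype.ext ((formsMap_eq_iff hπ hex (sigmaForm μ) _).2 ⟨sigmaAbForm α, rfl⟩)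

theorem lin_eq_iff (hex : LinearMap.ker (lin π) = LinearMap.range (lin ι)) (x x' : G.alg.carrier) :
    lin π x = lin π x' ↔ ∃ a, x' = x + lin ι a := by
  have he := LinearMap.exact_iff.2 hex
  constructor
  · intro e
    obtain ⟨a, ha⟩ := (he (x' - x)).1 (by rw [map_sub, e, sub_self])
    exact ⟨a, by rw [ha]; abel⟩
  · rintro ⟨a, rfl⟩
    rw [map_add, he.apply_apply_eq_zero, add_zero]

theorem IsCentral.nerve_orbit (h : IsCentral ι) (hι : Function.Injective (lin ι))
    (hex : LinearMap.ker (lin π) = LinearMap.range (lin ι))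
    {a : SimplexCategoryᵒᵖ} (ν ν' : ((nerve k).obj G).obj a) :
    ((nerve k).map π).app a ν = ((nerve k).map π).app a ν' ↔
      ∃ c : ((em k).obj A).obj a, h.nerveAction.act c ν = ν' := by
  constructor
  · intro e
    have ho : ∀ i, ∃ x, (nerveData ν').obj i = (nerveData ν).obj i + lin ι x := fun i =>
      (lin_eq_iff hex _ _).1 (congrArg (fun ν => (nerveData ν).obj i) e)
    have hx : ∀ i j, ∃ x, (nerveData ν').one i j = (nerveData ν).one i j + lin ι x := fun i j =>
      (lin_eq_iff hex _ _).1 (congrArg (fun ν => (nerveData ν).one i j) e)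
    have ht : ∀ i j l, ∃ x, (nerveData ν').two i j l = (nerveData ν).two i j l + lin ι x := fun i j l =>
      (lin_eq_iff hex _ _).1 (congrArg (fun ν => (nerveData ν).two i j l) e)
    choose o ho using ho
    choose x hx using hx
    choose t ht using ht
    obtain ⟨d, hd⟩ := h.exists_shift_eq hι (nerveData ν) (nerveData ν') ho hx ht
    refine ⟨⟨d.cochain, d.cochain_mem⟩, Eq.trans ?_ hd⟩
    exact congrArg (h.shift (nerveData ν)) (emData_cochain d)
  · rintro ⟨c, rfl⟩
    exact NerveSimplex.ext (funext fun i => (lin_eq_iff hex _ _).2 ⟨_, rfl⟩)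
      (funext fun i => funext fun j => (lin_eq_iff hex _ _).2 ⟨_, rfl⟩)
      (funext fun i => funext fun j => funext fun l => (lin_eq_iff hex _ _).2 ⟨_, rfl⟩)

theorem isPrincipalFibration_toRange {B : SimplicialObject AddCommGrpCat.{u}} {E X : SSet.{u}}
    (ρ : SimplicialAction B E) (p : E ⟶ X)
    (hfree : ∀ {a : SimplexCategoryᵒᵖ} (x : B.obj a) (e : E.obj a), ρ.act x e = e → x = 0)
    (horbit : ∀ {a : SimplexCategoryᵒᵖ} (e e' : E.obj a),
      p.app a e = p.app a e' ↔ ∃ x : B.obj a, ρ.act x e = e') :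
    IsPrincipalFibration ρ (SSet.Subcomplex.toRange p) where
  free := hfree
  orbit e e' := Subtype.ext_iff.trans (horbit e e')
  surjective a := by
    rintro ⟨_, e, rfl⟩
    exact ⟨e, rfl⟩

/-- The map of images induced by a natural transformation. -/
theorem exists_range_map {F F' : NilpDGLA k ⥤ SSet.{u}} (I : F ⟶ F') (π : G ⟶ Q) :
    ∃ I₀ : (SSet.Subcomplex.range (F.map π) : SSet) ⟶ (SSet.Subcomplex.range (F'.map π) : SSet),
      SSet.Subcomplex.toRange (F.map π) ≫ I₀ = I.app G ≫ SSet.Subcomplex.toRange (F'.map π) ∧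
      I₀ ≫ (SSet.Subcomplex.range (F'.map π)).ι = (SSet.Subcomplex.range (F.map π)).ι ≫ I.app Q := by
  have hle : SSet.Subcomplex.range ((SSet.Subcomplex.range (F.map π)).ι ≫ I.app Q) ≤
      SSet.Subcomplex.range (F'.map π) := by
    rintro a _ ⟨⟨_, e, rfl⟩, rfl⟩
    exact ⟨(I.app G).app a e, (ConcreteCategory.congr_hom (NatTrans.congr_app (I.naturality π) a) e).symm⟩
  refine ⟨SSet.Subcomplex.lift _ hle, ?_, rfl⟩
  rw [← cancel_mono (SSet.Subcomplex.range (F'.map π)).ι]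
  exact I.naturality π

section Abelian

/-- For an abelian algebra the Maurer–Cartan elements are the cocycles. -/
def sigmaIso (hA : IsCentral (𝟙 A)) : underlying ((sigmaAb k).obj A) ≅ (sigma k).obj A :=
  NatIso.ofComponents (fun a => Equiv.toIso
    { toFun := fun α => ⟨sigmaAbForm α, by
        have := hA.isFormsMC_add isFormsMC_zero (Subtype.property (α : A.alg.formsCocycles a.unop.len))
        rwa [formsMap_id, zero_add] at this⟩
      invFun := fun μ => (⟨sigmaForm μ, hA.mem_formsCocycles (fun _ _ h => h) isFormsMC_zero (by
        rw [formsMap_id, zero_add]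
        exact Subtype.property μ)⟩ : A.alg.formsCocycles a.unop.len)
      left_inv := fun _ => rfl
      right_inv := fun _ => rfl })
    fun f => by
      ext α
      rfl

theorem zeroNerve_pull {a b : ℕ} (f : SimplexCategory.mk a ⟶ SimplexCategory.mk b) :
    (zeroNerve A b).pull f.toOrderHom = zeroNerve A a :=
  NerveSimplex.ext (funext fun i => (vertex_zero _).trans (vertex_zero i).symm)
    (funext fun i => funext fun j => (holOne_zero _ _).trans (holOne_zero i j).symm)
    (funext fun i => funext fun j => funext fun l => (holTwo_zero _ _ _).trans (holTwo_zero i j l).symm)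

theorem nerveAction_zeroNerve_bijective (hA : IsCentral (𝟙 A)) (a : SimplexCategoryᵒᵖ) :
    Function.Bijective fun c : ((em k).obj A).obj a =>
      hA.nerveAction.act c (zeroNerve A a.unop.len : ((nerve k).obj A).obj a) := by
  refine ⟨fun c c' e => Subtype.ext ?_, fun ν => ?_⟩
  · exact hA.shift_injective (fun _ _ h => h) (zeroNerve A a.unop.len)
      (Subtype.property (c : A.alg.emCocycles a.unop)) (Subtype.property (c' : A.alg.emCocycles a.unop)) e
  · obtain ⟨e, he⟩ := exists_shift_zeroNerve_eq hA (nerveData ν)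
    exact ⟨(⟨e.cochain, e.cochain_mem⟩ : A.alg.emCocycles a.unop),
      (congrArg (hA.shift (zeroNerve A a.unop.len)) (emData_cochain e)).trans he⟩

/-- For an abelian algebra the simplices of the nerve are the simplices of `K(𝔞[1])`. -/
def nerveIso (hA : IsCentral (𝟙 A)) : underlying ((em k).obj A) ≅ (nerve k).obj A :=
  NatIso.ofComponents (fun a => Equiv.toIso (Equiv.ofBijective _ (nerveAction_zeroNerve_bijective hA a)))
    fun {a b} f => by
      ext c
      exact ((hA.nerveAction.map_act f c (zeroNerve A a.unop.len)).trans
        (congrArg (hA.nerveAction.act (((em k).obj A).map f c)) (zeroNerve_pull f.unop))).symm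

theorem holMap_abelian (hA : IsCentral (𝟙 A)) :
    (sigmaIso hA).hom ≫ (holMap k).app A = underlyingMap ((integralMap k).app A) ≫ (nerveIso hA).hom := by
  ext a α
  have hα : sigmaAbForm α ∈ A.alg.formsCocycles a.unop.len := Subtype.property (α : A.alg.formsCocycles _)
  have h1 := hA.holNerve_add isFormsMC_zero hα
  have h2 : (0 : A.alg.Forms a.unop.len) + formsMap (𝟙 A) _ (sigmaAbForm α) = sigmaAbForm α := by
    rw [formsMap_id, zero_add]
  have h3 : ∀ {μ μ' : A.alg.Forms a.unop.len} (hμ : A.alg.IsFormsMC μ) (e : μ = μ'),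
      holNerve μ' (e ▸ hμ) = holNerve μ hμ := fun _ e => by subst e; rfl
  exact (h3 (hA.isFormsMC_add isFormsMC_zero hα) h2).trans h1

end Abelian

end NilpDGLA

end

theorem mainTheorem1 (k : Type u) [Field k] [CharZero k] :
    ∃ (I : NilpDGLA.sigma k ⟶ NilpDGLA.nerve k) (J : NilpDGLA.sigmaAb k ⟶ NilpDGLA.em k),
      -- the components of `I` are given by one- and two-dimensional holonomy
      (∀ (G : NilpDGLA k) (a : SimplexCategoryᵒᵖ) (μ : ((NilpDGLA.sigma k).obj G).obj a),
        NilpDGLA.IsHolonomyOf μ ((I.app G).app a μ)) ∧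
      -- the components of `J` are given by integration
      (∀ (G : NilpDGLA k) (a : SimplexCategoryᵒᵖ) (α : ((NilpDGLA.sigmaAb k).obj G).obj a),
        NilpDGLA.IsIntegralOf α ((J.app G).app a α)) ∧
      -- `I` is the identity on simplices of dimension zero
      (∀ G : NilpDGLA k,
        ∃ (s : {γ // G.alg.IsMC γ} ≃ ((NilpDGLA.sigma k).obj G).obj (.op (.mk 0)))
          (t : {γ // G.alg.IsMC γ} ≃ ((NilpDGLA.nerve k).obj G).obj (.op (.mk 0))),
          (∀ γ, NilpDGLA.sigmaForm (s γ) = 1 ⊗ₜ[k] γ.1) ∧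
          (∀ γ, (NilpDGLA.nerveData (t γ)).obj 0 = γ.1) ∧
          ∀ γ, (I.app G).app (.op (.mk 0)) (s γ) = t γ) ∧
      -- for abelian algebras `I` is the integration map
      (∀ A : NilpDGLA k, (∀ x y, A.alg.bracket x y = 0) →
        ∃ (s : NilpDGLA.underlying ((NilpDGLA.sigmaAb k).obj A) ≅ (NilpDGLA.sigma k).obj A)
          (t : NilpDGLA.underlying ((NilpDGLA.em k).obj A) ≅ (NilpDGLA.nerve k).obj A),
          (∀ (a : SimplexCategoryᵒᵖ) (α : ((NilpDGLA.sigmaAb k).obj A).obj a),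
            NilpDGLA.sigmaForm (s.hom.app a α) = NilpDGLA.sigmaAbForm α) ∧
          (∀ (a : SimplexCategoryᵒᵖ) (c : ((NilpDGLA.em k).obj A).obj a),
            (∀ i, (NilpDGLA.nerveData (t.hom.app a c)).obj i =
              NilpDGLA.emValue c (NilpDGLA.vert i)) ∧
            (∀ i j h, (NilpDGLA.nerveData (t.hom.app a c)).one i j =
              NilpDGLA.emValue c (NilpDGLA.edge i j h)) ∧
            (∀ i j l h h', (NilpDGLA.nerveData (t.hom.app a c)).two i j l =
              NilpDGLA.emValue c (NilpDGLA.face i j l h h'))) ∧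
          s.hom ≫ I.app A = NilpDGLA.underlyingMap (J.app A) ≫ t.hom) ∧
      -- for a central subalgebra `I` is a morphism of principal fibrations relative to `J`
      (∀ (A G Q : NilpDGLA k) (ι : A ⟶ G) (π : G ⟶ Q),
        Function.Injective (NilpDGLA.lin ι) →
        (∀ x y, G.alg.bracket (NilpDGLA.lin ι x) y = 0) →
        Function.Surjective (NilpDGLA.lin π) →
        LinearMap.ker (NilpDGLA.lin π) = LinearMap.range (NilpDGLA.lin ι) →
        ∃ (ρ : SimplicialAction ((NilpDGLA.sigmaAb k).obj A) ((NilpDGLA.sigma k).obj G))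
          (τ : SimplicialAction ((NilpDGLA.em k).obj A) ((NilpDGLA.nerve k).obj G))
          (I₀ : (SSet.Subcomplex.range ((NilpDGLA.sigma k).map π) : SSet) ⟶
            (SSet.Subcomplex.range ((NilpDGLA.nerve k).map π) : SSet)),
          (∀ (a : SimplexCategoryᵒᵖ) (α : ((NilpDGLA.sigmaAb k).obj A).obj a)
            (μ : ((NilpDGLA.sigma k).obj G).obj a),
            NilpDGLA.sigmaForm (ρ.act α μ) =
              NilpDGLA.sigmaForm μ + NilpDGLA.formsMap ι _ (NilpDGLA.sigmaAbForm α)) ∧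
          (∀ (a : SimplexCategoryᵒᵖ) (c : ((NilpDGLA.em k).obj A).obj a)
            (ν : ((NilpDGLA.nerve k).obj G).obj a),
            (∀ i, (NilpDGLA.nerveData (τ.act c ν)).obj i = (NilpDGLA.nerveData ν).obj i +
              NilpDGLA.lin ι (NilpDGLA.emValue c (NilpDGLA.vert i))) ∧
            (∀ i j h, (NilpDGLA.nerveData (τ.act c ν)).one i j = (NilpDGLA.nerveData ν).one i j +
              NilpDGLA.lin ι (NilpDGLA.emValue c (NilpDGLA.edge i j h))) ∧
            (∀ i j l h h', (NilpDGLA.nerveData (τ.act c ν)).two i j l =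
              (NilpDGLA.nerveData ν).two i j l +
                NilpDGLA.lin ι (NilpDGLA.emValue c (NilpDGLA.face i j l h h')))) ∧
          IsPrincipalFibration ρ (SSet.Subcomplex.toRange ((NilpDGLA.sigma k).map π)) ∧
          IsPrincipalFibration τ (SSet.Subcomplex.toRange ((NilpDGLA.nerve k).map π)) ∧
          SSet.Subcomplex.toRange ((NilpDGLA.sigma k).map π) ≫ I₀ =
            I.app G ≫ SSet.Subcomplex.toRange ((NilpDGLA.nerve k).map π) ∧
          I₀ ≫ (SSet.Subcomplex.range ((NilpDGLA.nerve k).map π)).ι =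
            (SSet.Subcomplex.range ((NilpDGLA.sigma k).map π)).ι ≫ I.app Q ∧
          ∀ (a : SimplexCategoryᵒᵖ) (α : ((NilpDGLA.sigmaAb k).obj A).obj a)
            (μ : ((NilpDGLA.sigma k).obj G).obj a),
            (I.app G).app a (ρ.act α μ) = τ.act ((J.app A).app a α) ((I.app G).app a μ)) := by
  refine ⟨NilpDGLA.holMap k, NilpDGLA.integralMap k, fun G a μ => NilpDGLA.isHolonomyOf_holMap μ,
    fun G a α => NilpDGLA.isIntegralOf_integralMap α, fun G => ?_, fun A hA => ?_,
    fun A G Q ι π hι hc hπ hex => ?_⟩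
  · exact ⟨NilpDGLA.sigmaZeroEquiv G, Equiv.ofBijective _ NilpDGLA.holMap_zero_bijective,
      fun γ => rfl, fun γ => NilpDGLA.vertex_one_tmul γ.1, fun γ => rfl⟩
  · have hA' : NilpDGLA.IsCentral (𝟙 A) := fun x y => hA x y
    have hc : ∀ {a : SimplexCategoryᵒᵖ} (c : ((NilpDGLA.em k).obj A).obj a),
        Subtype.val (c : A.alg.emCocycles a.unop) ∈ A.alg.emCocycles a.unop :=
      fun {a} c => Subtype.property (c : A.alg.emCocycles a.unop)
    refine ⟨NilpDGLA.sigmaIso hA', NilpDGLA.nerveIso hA', fun a α => rfl, fun a c => ⟨fun i => ?_,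
      fun i j h => ?_, fun i j l h h' => ?_⟩, NilpDGLA.holMap_abelian hA'⟩
    · exact NilpDGLA.shift_zeroNerve_obj hA' (NilpDGLA.emData (n := a.unop.len) (hc c)) i
    · exact (NilpDGLA.shift_zeroNerve_one hA' (NilpDGLA.emData (n := a.unop.len) (hc c)) i j).trans
        (NilpDGLA.emOne_eq (n := a.unop.len) (hc c) h)
    · exact (NilpDGLA.shift_zeroNerve_two hA' (NilpDGLA.emData (n := a.unop.len) (hc c)) i j l).trans
        (NilpDGLA.emTwo_eq (n := a.unop.len) (hc c) h h')
  · have h : NilpDGLA.IsCentral ι := hc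
    obtain ⟨I₀, hI, hI'⟩ := NilpDGLA.exists_range_map (NilpDGLA.holMap k) π
    refine ⟨h.sigmaAction, h.nerveAction, I₀, fun a α μ => rfl, fun a c ν => ⟨fun i => rfl,
      fun i j hij => ?_, fun i j l hij hjl => ?_⟩,
      NilpDGLA.isPrincipalFibration_toRange _ _ (h.sigmaAction_free hι) (h.sigma_orbit hι hπ hex),
      NilpDGLA.isPrincipalFibration_toRange _ _ (h.nerveAction_free hι) (h.nerve_orbit hι hex), hI, hI',
      fun a α μ => h.holNerve_add (Subtype.property μ)
        (Subtype.property (α : A.alg.formsCocycles a.unop.len))⟩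
    · exact congrArg (fun x => (NilpDGLA.nerveData ν).one i j + NilpDGLA.lin ι x)
        (NilpDGLA.emOne_eq (n := a.unop.len) (Subtype.property (c : A.alg.emCocycles a.unop)) hij)
    · exact congrArg (fun x => (NilpDGLA.nerveData ν).two i j l + NilpDGLA.lin ι x)
        (NilpDGLA.emTwo_eq (n := a.unop.len) (Subtype.property (c : A.alg.emCocycles a.unop)) hij hjl)
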